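/- Let $k$ be a field of characteristic zero and $W=k\langle z,d/dz\rangle$. For a $W$-module $M$, let $\mathcal F(M)$ be the same $k$-space on which $z$ acts as $-d/dz$ and $d/dz$ acts as $z$. For a closed point $x\in\mathbb A^1$ with residue field $k_x$ put $A_x=k_x[[t]]$, $K_x=k_x((t))$ with $t=z-x$, and put $K_\infty=k((\zeta))$ with $\zeta=1/z$; let $-x$ be the image of $x$ under $z\mapsto -z$. Let $\mathrm{Hol}(K)$ be the category of finite-dimensional $K$-vector spaces with a connection, and $\mathrm{Hol}(\mathbb A^1)$ the category of finitely generated $W$-modules of finite generic rank. Let $\jmath_{\infty*}$ denote restriction of scalars to $W$ from $\mathcal D_{K_\infty}$, $j_{x*}$ restriction of scalars to $W$ from $\mathcal D_{A_x}$, $\jmath_!$ the $!$-extension from the punctured formal disk to the formal disk, $\Psi_\infty(M)=K_\infty\otimes_{k[z]}M$ (the left adjoint of $\jmath_{\infty*}$), and $\Phi_x$ the formal vanishing cycles functor (the left adjoint of $j_{x*}\jmath_!$ on holonomic modules). Let $\mathrm{Hol}(K_\infty)^{>1}$ be the full subcategory of modules with all slopes $>1$. Let $\mathrm{Hol}(K_\infty)^{\le1,(x)}$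 be the full subcategory of those $N$ for which $\overline k((\zeta))\otimes N$ is a direct sum, over the geometric points $\beta$ of $x$, of modules $\ell_\beta\otimes N_\beta$, where $N_\beta$ has all slopes $<1$ and $\ell_\beta=(\overline k((\zeta)),\ \partial_\zeta=d/d\zeta+\beta\zeta^{-2})$. Every $N\in\mathrm{Hol}(K_\infty)$ decomposes functorially as $N=N^{>1}\oplus\bigoplus_{x\in\mathbb A^1}N^{\le1,(x)}$ with components in these subcategories. There exist equivalences (the local Fourier transforms), for every closed point $x\in\mathbb A^1$, $$\mathcal F(x,\infty):\mathrm{Hol}(K_x)\to\mathrm{Hol}(K_\infty)^{\le1,(-x)},\quad \mathcal F(\infty,x):\mathrm{Hol}(K_\infty)^{\le1,(x)}\to\mathrm{Hol}(K_x),\quad \mathcal F(\infty,\infty):\mathrm{Hol}(K_\infty)^{>1}\to\mathrm{Hol}(K_\infty)^{>1},$$ with functorial isomorphisms of $W$-modules $$\mathcal F(j_{x*}\jmath_!N)\cong\jmath_{\infty*}\mathcal F(x,\infty)N,\quad \mathcal F(\jmath_{\infty*}N)\cong j_{x*}\jmath_!\mathcal F(\infty,x)N,\quad \mathcal F(\jmath_{\infty*}N)\cong\jmath_{\infty*}\mathcal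 F(\infty,\infty)N$$ that are homeomorphisms for the $t$-adic and $\zeta$-adic topologies. The functors $\mathcal F$ and $\Psi_\infty$, $\Phi_x$ send holonomic modules to holonomic modules, and for any such choice of local Fourier transforms there are isomorphisms, natural in $M\in\mathrm{Hol}(\mathbb A^1)$: 1. for every closed point $x\in\mathbb A^1$, $$\Phi_x(\mathcal F(M))\cong\mathcal F(\infty,x)\bigl(\Psi_\infty(M)^{\le1,(x)}\bigr),\qquad \Psi_\infty(\mathcal F(M))^{\le1,(-x)}\cong\mathcal F(x,\infty)\Phi_x(M);$$ 2. $$\Psi_\infty(\mathcal F(M))^{>1}\cong\mathcal F(\infty,\infty)\bigl(\Psi_\infty(M)^{>1}\bigr);$$ 3. consequently $$\Psi_\infty(\mathcal F(M))\cong\mathcal F(\infty,\infty)\bigl(\Psi_\infty(M)^{>1}\bigr)\oplus\bigoplus_{x\in\mathbb A^1}\mathcal F(x,\infty)\Phi_x(M).$$ -/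

import Mathlib

open CategoryTheory Polynomial
open scoped Differential PowerSeries LaurentSeries TensorProduct

universe u

noncomputable section

namespace LocalFourier

/-! ## Modules with a derivation -/

/-- A left `D_R`-module over a differential ring `R`: an `R`-module with an additive operator
`∂` that satisfies the Leibniz rule over the derivation of `R`. -/
structure DMod (R : Type u) [CommRing R] [Differential R] where
  /-- the underlying module -/
  carrier : Type u
  [addCommGroup : AddCommGroup carrier]
  [module : Module R carrier]
  /-- the action of the derivation -/
  del : carrier →+ carrier
  leibniz : ∀ (r : R) (m : carrier), del (r • m) = r′ • m + r • del m

namespace DMod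

attribute [instance] DMod.addCommGroup DMod.module

variable {R : Type u} [CommRing R] [Differential R]

/-- Morphisms of `D_R`-modules. -/
@[ext]
structure Hom (M N : DMod R) where
  /-- the underlying linear map -/
  toLin : M.carrier →ₗ[R] N.carrier
  comm : ∀ m, toLin (M.del m) = N.del (toLin m)

instance : Category (DMod R) where
  Hom M N := Hom M N
  id M := ⟨LinearMap.id, fun _ => rfl⟩
  comp f g := ⟨g.toLin ∘ₗ f.toLin, fun m => by simp [f.comm, g.comm]⟩

@[simp] lemma id_toLin (M : DMod R) : Hom.toLin (𝟙 M) = LinearMap.id := rfl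

@[simp] lemma comp_toLin {M N P : DMod R} (f : M ⟶ N) (g : N ⟶ P) :
    Hom.toLin (f ≫ g) = g.toLin ∘ₗ f.toLin := rfl

lemma hom_ext {M N : DMod R} {f g : M ⟶ N} (h : ∀ m, f.toLin m = g.toLin m) : f = g :=
  Hom.ext (LinearMap.ext h)

/-- A submodule that is stable under `∂`. -/
def Stable (M : DMod R) (N : Submodule R M.carrier) : Prop := ∀ m ∈ N, M.del m ∈ N

/-- The `D_R`-submodule given by a stable submodule. -/
def sub (M : DMod R) (N : Submodule R M.carrier) (h : M.Stable N) : DMod R where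
  carrier := N
  del := (M.del.comp N.subtype.toAddMonoidHom).codRestrict N.toAddSubgroup
    (fun m => h m.1 m.2)
  leibniz r m := Subtype.ext (M.leibniz r m.1)

/-- The quotient by a stable submodule. -/
def quot (M : DMod R) (N : Submodule R M.carrier) (h : M.Stable N) : DMod R where
  carrier := M.carrier ⧸ N
  del := (QuotientAddGroup.lift N.toAddSubgroup (N.mkQ.toAddMonoidHom.comp M.del)
    (fun m hm => (Submodule.Quotient.mk_eq_zero N).2 (h m hm)) : M.carrier ⧸ N →+ M.carrier ⧸ N)
  leibniz r m := by
    obtain ⟨m, rfl⟩ := Submodule.Quotient.mk_surjective N m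
    exact congrArg N.mkQ (M.leibniz r m)

/-- A non-zero `D_R`-module without proper non-zero `D_R`-submodules. -/
def IsIrreducible (M : DMod R) : Prop :=
  Nontrivial M.carrier ∧ ∀ N : Submodule R M.carrier, M.Stable N → N = ⊥ ∨ N = ⊤

/-- `X` is an irreducible component (irreducible subquotient) of `M`. -/
def IsComponent (X M : DMod R) : Prop :=
  X.IsIrreducible ∧ ∃ (Y : DMod R) (i : Y ⟶ M) (q : Y ⟶ X),
    Function.Injective i.toLin ∧ Function.Surjective q.toLin

open Classical in
/-- The morphisms `f i : N i ⟶ M` identify `M` with the direct sum of the `N i`. -/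
def IsDirectSum {ι : Type*} (N : ι → DMod R) (M : DMod R) (f : ∀ i, N i ⟶ M) : Prop :=
  Function.Bijective (DirectSum.toModule R ι M.carrier (fun i => (f i).toLin))

/-- `M` is finitely generated over the ring `D_R`. -/
def FinitelyGenerated (M : DMod R) : Prop :=
  ∃ S : Finset M.carrier, ∀ N : Submodule R M.carrier, M.Stable N → (∀ s ∈ S, s ∈ N) → N = ⊤

/-- The largest `D_R`-submodule of `N` that is a sum of images of modules in the class `P`. -/
def partSub (P : ObjectProperty (DMod R)) (N : DMod R) : Submodule R N.carrier :=
  ⨆ f : (Σ X : P.FullSubcategory, (X.obj ⟶ N)), LinearMap.range f.2.toLin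

lemma partSub_stable (P : ObjectProperty (DMod R)) (N : DMod R) : N.Stable (partSub P N) := by
  intro m hm
  refine Submodule.iSup_induction' _ (motive := fun m _ => N.del m ∈ partSub P N) ?_ ?_ ?_ hm
  · rintro f _ ⟨y, rfl⟩
    rw [← f.2.comm]
    exact Submodule.mem_iSup_of_mem f ⟨_, rfl⟩
  · simp
  · intro x y _ _ hx hy
    rw [map_add]
    exact add_mem hx hy

lemma partSub_map (P : ObjectProperty (DMod R)) {N N' : DMod R} (g : N ⟶ N') :
    ∀ m ∈ partSub P N, g.toLin m ∈ partSub P N' := by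
  intro m hm
  refine Submodule.iSup_induction' _
    (motive := fun m _ => g.toLin m ∈ partSub P N') ?_ ?_ ?_ hm
  · rintro f _ ⟨y, rfl⟩
    exact Submodule.mem_iSup_of_mem
      (⟨f.1, f.2 ≫ g⟩ : (Σ X : P.FullSubcategory, (X.obj ⟶ N'))) ⟨y, rfl⟩
  · simp
  · intro x y _ _ hx hy
    rw [map_add]
    exact add_mem hx hy

/-- The component `N ↦ N^P` of a module in a class `P`, as a functor. -/
def part (P : ObjectProperty (DMod R)) : DMod R ⥤ DMod R where
  obj N := N.sub (partSub P N) (partSub_stable P N)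
  map g := ⟨g.toLin.restrict (partSub_map P g), fun m => Subtype.ext (g.comm m.1)⟩

/-- The inclusion of `N^P` into `N`. -/
def partInc (P : ObjectProperty (DMod R)) (N : DMod R) : (part P).obj N ⟶ N :=
  ⟨(partSub P N).subtype, fun _ => rfl⟩

end DMod

/-! ## Direct and inverse images -/

/-- A ring map `φ : R → S` together with a unit `u` such that `d_S ∘ φ = u • φ ∘ d_R`; then
`∂_S` acts on `S`-modules as `u ∂_R` (for a change of coordinate, `u` is the Jacobian). -/
structure DiffMap (R S : Type u) [CommRing R] [Differential R] [CommRing S]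
    [Differential S] where
  /-- the ring map -/
  toRingHom : R →+* S
  /-- the Jacobian -/
  jac : Sˣ
  deriv_map : ∀ r, (toRingHom r)′ = jac * toRingHom (r′)

namespace DiffMap

variable {R S : Type u} [CommRing R] [Differential R] [CommRing S] [Differential S]

/-- Direct image: a `D_S`-module regarded as a `D_R`-module. -/
def pushforward (φ : DiffMap R S) : DMod S ⥤ DMod R where
  obj M :=
    letI : Module R M.carrier := Module.compHom M.carrier φ.toRingHom
    { carrier := M.carrier
      del := (DistribSMul.toAddMonoidHom M.carrier ((φ.jac⁻¹ : Sˣ) : S)).comp M.del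
      leibniz := fun r m => by
        change ((φ.jac⁻¹ : Sˣ) : S) • M.del (φ.toRingHom r • m)
          = φ.toRingHom (r′) • m + φ.toRingHom r • (((φ.jac⁻¹ : Sˣ) : S) • M.del m)
        rw [M.leibniz, φ.deriv_map, smul_add, smul_smul, ← mul_assoc, Units.inv_mul, one_mul,
          smul_comm] }
  map {M N} f :=
    letI : Module R M.carrier := Module.compHom M.carrier φ.toRingHom
    letI : Module R N.carrier := Module.compHom N.carrier φ.toRingHom
    { toLin :=
        { toFun := f.toLin
          map_add' := map_add _
          map_smul' := fun r m => f.toLin.map_smul (φ.toRingHom r) m }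
      comm := fun m => by
        change f.toLin (((φ.jac⁻¹ : Sˣ) : S) • M.del m) = ((φ.jac⁻¹ : Sˣ) : S) • N.del (f.toLin m)
        rw [map_smul, f.comm] }

section Tensor

variable [Algebra R S] (u : S)
  (hu : ∀ r : R, (algebraMap R S r)′ = u * algebraMap R S (r′))

/-- The operator `s ⊗ m ↦ s′ ⊗ m + u s ⊗ ∂ m` on `S ⊗ M`. -/
def tensorDel (M : DMod R) : S ⊗[R] M.carrier →+ S ⊗[R] M.carrier :=
  TensorProduct.liftAddHom
    (AddMonoidHom.mk' (fun s => AddMonoidHom.mk' (fun m => s′ ⊗ₜ[R] m + (u * s) ⊗ₜ[R] M.del m)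
        (fun a b => by simp only [map_add, TensorProduct.tmul_add]; abel))
      (fun a b => by
        ext m
        simp only [map_add, mul_add, TensorProduct.add_tmul, AddMonoidHom.mk'_apply,
          AddMonoidHom.add_apply]
        abel))
    (fun r s m => by
      have key : (r • s)′ = r′ • (u * s) + r • s′ := by
        rw [Algebra.smul_def, Algebra.smul_def, Algebra.smul_def, Derivation.leibniz, hu,
          smul_eq_mul, smul_eq_mul]
        ring
      change (r • s)′ ⊗ₜ[R] m + (u * r • s) ⊗ₜ[R] M.del m
        = s′ ⊗ₜ[R] (r • m) + (u * s) ⊗ₜ[R] M.del (r • m)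
      rw [M.leibniz, TensorProduct.tmul_add, ← TensorProduct.smul_tmul, ← TensorProduct.smul_tmul,
        ← TensorProduct.smul_tmul, key, TensorProduct.add_tmul, mul_smul_comm]
      abel)

@[simp] lemma tensorDel_tmul (M : DMod R) (s : S) (m : M.carrier) :
    tensorDel u hu M (s ⊗ₜ m) = s′ ⊗ₜ[R] m + (u * s) ⊗ₜ[R] M.del m := rfl

/-- The module `S ⊗ M` with the derivation `tensorDel`. -/
def tensorObj (M : DMod R) : DMod S where
  carrier := S ⊗[R] M.carrier
  del := tensorDel u hu M
  leibniz r x := by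
    induction x using TensorProduct.induction_on with
    | zero => simp
    | tmul s m =>
      simp only [TensorProduct.smul_tmul', tensorDel_tmul, smul_add, smul_eq_mul,
        Derivation.leibniz, TensorProduct.add_tmul]
      rw [show u * (r * s) = r * (u * s) by ring, mul_comm s (r′)]
      abel
    | add x y hx hy =>
      simp only [smul_add, map_add, hx, hy]
      abel

/-- Functoriality of `tensorObj`. -/
def tensorMap {M N : DMod R} (f : M ⟶ N) : tensorObj u hu M ⟶ tensorObj u hu N where
  toLin := f.toLin.baseChange S
  comm x := by
    change S ⊗[R] M.carrier at x
    change f.toLin.baseChange S (tensorDel u hu M x) = tensorDel u hu N (f.toLin.baseChange S x)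
    induction x using TensorProduct.induction_on with
    | zero => simp
    | tmul s m => simp [f.comm]
    | add x y hx hy => simp only [map_add, hx, hy]

/-- Base change as a functor. -/
def tensorFunctor : DMod R ⥤ DMod S where
  obj M := tensorObj u hu M
  map f := tensorMap u hu f
  map_id _ := DMod.Hom.ext (LinearMap.baseChange_id)
  map_comp _ _ := DMod.Hom.ext (LinearMap.baseChange_comp _ _)

end Tensor

/-- Inverse image `M ↦ S ⊗_R M` along `φ`. -/
def pullback (φ : DiffMap R S) : DMod R ⥤ DMod S :=
  letI : Algebra R S := φ.toRingHom.toAlgebra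
  tensorFunctor (φ.jac : S) φ.deriv_map

end DiffMap

/-! ## The differential rings -/

section Rings

/-- A differential ring from an additive map that satisfies the Leibniz rule. -/
@[reducible]
def mkDifferential {R : Type u} [CommRing R] (D : R →+ R)
    (h : ∀ a b, D (a * b) = a * D b + b * D a) : Differential R :=
  ⟨Derivation.mk' D.toIntLinearMap h⟩

/-- `k[z]` with `d/dz`. -/
instance instDifferentialPolynomial (k : Type u) [CommRing k] : Differential k[X] :=
  mkDifferential (Polynomial.derivative' (R := k)).toLinearMap.toAddMonoidHom
    (fun f g => (Polynomial.derivative' (R := k)).leibniz f g)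

lemma deriv_polynomial {k : Type u} [CommRing k] {S : Type u} [CommRing S] [Differential S]
    (φ : k[X] →+* S) (hC : ∀ a : k, (φ (Polynomial.C a))′ = 0) (f : k[X]) :
    (φ f)′ = (φ Polynomial.X)′ * φ (f′) := by
  have hd : ∀ f : k[X], f′ = Polynomial.derivative f := fun _ => rfl
  induction f using Polynomial.induction_on' with
  | add p q hp hq => simp only [map_add, hp, hq, mul_add]
  | monomial n a =>
    rw [hd, Polynomial.derivative_monomial, ← Polynomial.C_mul_X_pow_eq_monomial,
      ← Polynomial.C_mul_X_pow_eq_monomial]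
    simp only [map_mul, map_pow, Derivation.leibniz, Derivation.leibniz_pow, hC, map_natCast,
      smul_eq_mul, nsmul_eq_mul]
    ring

/-- `L[[t]]` with `d/dt`. -/
instance instDifferentialPowerSeries (L : Type u) [CommRing L] : Differential L⟦X⟧ :=
  mkDifferential (PowerSeries.derivative L).toLinearMap.toAddMonoidHom
    (fun f g => (PowerSeries.derivative L).leibniz f g)

lemma laurent_single_mul_derivative {L : Type u} [CommRing L] (f : L⸨X⸩) (n : ℤ) :
    (HahnSeries.single (1 : ℤ) (1 : L) * LaurentSeries.derivative L f).coeff n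
      = n • f.coeff n := by
  have h := HahnSeries.coeff_single_mul_add (r := (1 : L)) (x := LaurentSeries.derivative L f)
    (a := n - 1) (b := 1)
  rw [sub_add_cancel, one_mul] at h
  rw [h, LaurentSeries.derivative_apply, LaurentSeries.hasseDeriv_coeff]
  simp

lemma laurent_leibniz {L : Type u} [CommRing L] (f g : L⸨X⸩) :
    LaurentSeries.derivative L (f * g)
      = f * LaurentSeries.derivative L g + g * LaurentSeries.derivative L f := by
  have inv : (HahnSeries.single (-1 : ℤ) (1 : L)) * (HahnSeries.single (1 : ℤ) (1 : L)) = 1 := by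
    rw [HahnSeries.single_mul_single]; simp
  have supp : ∀ f : L⸨X⸩,
      (HahnSeries.single (1 : ℤ) (1 : L) * LaurentSeries.derivative L f).support ⊆ f.support := by
    intro f n hn
    rw [HahnSeries.mem_support, laurent_single_mul_derivative] at hn
    rw [HahnSeries.mem_support]
    exact fun h => hn (by rw [h, smul_zero])
  have key : HahnSeries.single (1 : ℤ) (1 : L) * LaurentSeries.derivative L (f * g)
      = f * (HahnSeries.single (1 : ℤ) (1 : L) * LaurentSeries.derivative L g)
        + HahnSeries.single (1 : ℤ) (1 : L) * LaurentSeries.derivative L f * g := by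
    ext n
    rw [laurent_single_mul_derivative, HahnSeries.coeff_add,
      HahnSeries.coeff_mul_right' g.isPWO_support (supp g),
      HahnSeries.coeff_mul_left' f.isPWO_support (supp f), HahnSeries.coeff_mul,
      Finset.smul_sum, ← Finset.sum_add_distrib]
    refine Finset.sum_congr rfl fun ij hij => ?_
    rw [laurent_single_mul_derivative, laurent_single_mul_derivative]
    have hn : n = ij.1 + ij.2 := by
      simp only [Finset.mem_antidiagonal] at hij
      exact hij.2.2.symm
    rw [hn, add_smul, smul_mul_assoc, mul_smul_comm, add_comm]
  have := congrArg (fun x => HahnSeries.single (-1 : ℤ) (1 : L) * x) key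
  simp only [mul_add, ← mul_assoc, inv, one_mul] at this
  rw [this]
  rw [mul_comm _ f, mul_assoc f, inv]
  ring

/-- `L((t))` with `d/dt`. -/
instance instDifferentialLaurent (L : Type u) [CommRing L] : Differential L⸨X⸩ :=
  mkDifferential (LaurentSeries.derivative L).toAddMonoidHom laurent_leibniz

lemma laurent_deriv_coeff {L : Type u} [CommRing L] (f : L⸨X⸩) (n : ℤ) :
    (f′).coeff n = (n + 1) • f.coeff (n + 1) := by
  change (LaurentSeries.derivative L f).coeff n = _
  rw [LaurentSeries.derivative_apply, LaurentSeries.hasseDeriv_coeff]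
  simp

/-- The inclusion `L[[t]] → L((t))` of the formal punctured disk into the formal disk. -/
def puncture (L : Type u) [CommRing L] : DiffMap L⟦X⟧ L⸨X⸩ where
  toRingHom := HahnSeries.ofPowerSeries ℤ L
  jac := 1
  deriv_map f := by
    rw [Units.val_one, one_mul]
    ext n
    rw [laurent_deriv_coeff]
    have h1 := PowerSeries.coeff_coe f (n + 1)
    have h2 := PowerSeries.coeff_coe (PowerSeries.derivative L f) n
    refine (congrArg ((n + 1) • ·) h1).trans (Eq.trans ?_ h2.symm)
    rcases lt_trichotomy n (-1) with h | h | h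
    · simp [show n + 1 < 0 by omega, show n < 0 by omega]
    · simp [h]
    · have hn : ((n.natAbs : ℕ) : L) = ((n : ℤ) : L) := by
        rw [← Int.cast_natCast, Int.natCast_natAbs, abs_of_nonneg (by omega)]
      rw [if_neg (by omega), if_neg (by omega), PowerSeries.coeff_derivative, hn,
        show (n + 1).natAbs = n.natAbs + 1 by omega, zsmul_eq_mul, mul_comm]
      push_cast
      rfl

variable (k : Type u) [Field k]

/-- The closed points of the affine line over `k`, that is, the maximal ideals of `k[z]`. -/
abbrev ClosedPoint : Type u := MaximalSpectrum k[X]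

variable {k}

/-- The residue field `k_x` of a closed point. -/
abbrev ResField (x : ClosedPoint k) : Type u := k[X] ⧸ x.asIdeal

/-- The closed point `-x`, the image of `x` under `z ↦ -z`. -/
def negPoint (x : ClosedPoint k) : ClosedPoint k where
  asIdeal := x.asIdeal.comap (algEquivAevalNegX (R := k)).toRingEquiv
  isMaximal := Ideal.comap_isMaximal_of_surjective _ (algEquivAevalNegX (R := k)).surjective

/-- The completion `k[z] → A_x = k_x[[t]]`, `t = z - x`, at a closed point: the coordinate `z` is
sent to `x + t`, where `x ∈ k_x` is the residue of `z`. -/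
def diskAt (x : ClosedPoint k) : DiffMap k[X] (ResField x)⟦X⟧ where
  toRingHom := Polynomial.eval₂RingHom
    (PowerSeries.C.comp ((Ideal.Quotient.mk x.asIdeal).comp Polynomial.C))
    (PowerSeries.C (Ideal.Quotient.mk x.asIdeal X) + PowerSeries.X)
  jac := 1
  deriv_map f := by
    have hd : ∀ g : (ResField x)⟦X⟧, g′ = PowerSeries.derivative (ResField x) g := fun _ => rfl
    rw [deriv_polynomial _ (fun a => by simp [hd])]
    simp [hd]

variable (k)

/-- The unit `-ζ⁻²`, which is `dz/dζ` for `ζ = 1/z`. -/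
def jacInfty : (k⸨X⸩)ˣ where
  val := HahnSeries.single (-2) (-1)
  inv := HahnSeries.single 2 (-1)
  val_inv := by rw [HahnSeries.single_mul_single]; simp
  inv_val := by rw [HahnSeries.single_mul_single]; simp

/-- The punctured formal disk at infinity: `k[z] → K_∞ = k((ζ))`, `z ↦ ζ⁻¹`. -/
def puncturedDiskInfty : DiffMap k[X] k⸨X⸩ where
  toRingHom := Polynomial.eval₂RingHom HahnSeries.C (HahnSeries.single (-1) 1)
  jac := jacInfty k
  deriv_map f := by
    have hs : ∀ (n : ℤ) (a : k), (HahnSeries.single n a : k⸨X⸩)′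
        = HahnSeries.single (n - 1) (n • a) := fun n a => by
      ext m
      rw [laurent_deriv_coeff]
      by_cases h : m = n - 1
      · subst h; simp
      · rw [HahnSeries.coeff_single_of_ne h, HahnSeries.coeff_single_of_ne (by omega), smul_zero]
    rw [deriv_polynomial _ (fun a => by simp [HahnSeries.C_apply, hs])]
    simp [hs, jacInfty]

/-- The extension of constants `k((ζ)) → k̄((ζ))`. -/
def extendConstants : DiffMap k⸨X⸩ (AlgebraicClosure k)⸨X⸩ where
  toRingHom :=
    { toFun := fun f => f.map (algebraMap k (AlgebraicClosure k))
      map_one' := HahnSeries.map_one (algebraMap k (AlgebraicClosure k)).toMonoidWithZeroHom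
      map_mul' := fun _ _ =>
        HahnSeries.map_mul (algebraMap k (AlgebraicClosure k)).toNonUnitalRingHom
      map_zero' := by ext; simp
      map_add' := fun _ _ => by ext; simp }
  jac := 1
  deriv_map f := by
    rw [Units.val_one, one_mul]
    ext n
    rw [laurent_deriv_coeff]
    change _ = algebraMap k (AlgebraicClosure k) ((f′).coeff n)
    rw [laurent_deriv_coeff, map_zsmul]
    rfl

end Rings

/-! ## The Fourier transform -/

section Fourier

variable {k : Type u} [CommRing k]

/-- The action of `k[z]` on the Fourier transform of `M`: constants act as before and `z` acts as
`-∂`. -/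
def fourierAction (M : DMod k[X]) : k[X] →+* AddMonoid.End M.carrier :=
  Polynomial.eval₂RingHom' ((Module.toAddMonoidEnd k[X] M.carrier).comp Polynomial.C)
    (-M.del : M.carrier →+ M.carrier) (fun a => by
      ext m
      have hC : (Polynomial.C a : k[X])′ = 0 := Polynomial.derivative_C
      have h := M.leibniz (Polynomial.C a) m
      rw [hC, zero_smul, zero_add] at h
      change Polynomial.C a • (-M.del m) = -M.del (Polynomial.C a • m)
      rw [h, smul_neg])

lemma fourierAction_C (M : DMod k[X]) (a : k) (m : M.carrier) :
    fourierAction M (Polynomial.C a) m = Polynomial.C a • m := by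
  have h : fourierAction M (Polynomial.C a)
      = (Module.toAddMonoidEnd k[X] M.carrier).comp Polynomial.C a := by
    exact Polynomial.eval₂_C _ _
  rw [h]
  rfl

lemma fourierAction_X (M : DMod k[X]) (m : M.carrier) :
    fourierAction M X m = -M.del m := by
  have h : fourierAction M X = (-M.del : M.carrier →+ M.carrier) := by
    exact Polynomial.eval₂_X _ _
  rw [h]
  rfl

lemma fourierAction_mul (M : DMod k[X]) (p q : k[X]) (m : M.carrier) :
    fourierAction M (p * q) m = fourierAction M p (fourierAction M q m) := by
  rw [map_mul]
  rfl

lemma fourierAction_add (M : DMod k[X]) (p q : k[X]) (m : M.carrier) :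
    fourierAction M (p + q) m = fourierAction M p m + fourierAction M q m := by
  rw [map_add]
  rfl

lemma fourierAction_leibniz (M : DMod k[X]) (r : k[X]) :
    ∀ m : M.carrier, (X : k[X]) • fourierAction M r m
      = fourierAction M (r′) m + fourierAction M r ((X : k[X]) • m) := by
  have hX : (X : k[X])′ = 1 := Polynomial.derivative_X
  have hC : ∀ a : k, (Polynomial.C a : k[X])′ = 0 := fun _ => Polynomial.derivative_C
  have one : ∀ m : M.carrier, fourierAction M 1 m = m := fun m => by rw [map_one]; rfl
  have zero : ∀ m : M.carrier, fourierAction M 0 m = 0 := fun m => by rw [map_zero]; rfl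
  induction r using Polynomial.induction_on with
  | C a => intro m; rw [fourierAction_C, hC, fourierAction_C, zero, zero_add, smul_comm]
  | add p q hp hq =>
    intro m
    have h : (p + q)′ = p′ + q′ := map_add _ _ _
    rw [h]
    simp only [fourierAction_add, smul_add, hp, hq]
    abel
  | monomial n a ih =>
    intro m
    rw [pow_succ, ← mul_assoc]
    generalize Polynomial.C a * X ^ n = q at ih
    have e : (X : k[X]) • fourierAction M X m = m + fourierAction M X ((X : k[X]) • m) := by
      rw [fourierAction_X, fourierAction_X, M.leibniz, hX, one_smul, smul_neg]
      abel
    rw [fourierAction_mul, ih, e, map_add (fourierAction M q), Derivation.leibniz, hX, smul_eq_mul, smul_eq_mul,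
      mul_one, mul_comm X, fourierAction_add, fourierAction_mul, fourierAction_mul]
    abel

lemma fourierAction_natural {M N : DMod k[X]} (f : M ⟶ N) (r : k[X]) :
    ∀ m : M.carrier, f.toLin (fourierAction M r m) = fourierAction N r (f.toLin m) := by
  induction r using Polynomial.induction_on with
  | C a => intro m; rw [fourierAction_C, fourierAction_C, map_smul]
  | add p q hp hq => intro m; rw [fourierAction_add, fourierAction_add, map_add, hp, hq]
  | monomial n a ih =>
    intro m
    rw [pow_succ, ← mul_assoc]
    generalize Polynomial.C a * X ^ n = q at ih
    rw [fourierAction_mul, fourierAction_mul, ih, fourierAction_X,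
      fourierAction_X, map_neg, f.comm]

/-- The Fourier transform `F(M)`: the same group, on which `z` acts as `-∂` and `d/dz` acts
as `z`. -/
def fourierObj (M : DMod k[X]) : DMod k[X] where
  carrier := M.carrier
  module := Module.compHom M.carrier (fourierAction M)
  del := Module.toAddMonoidEnd k[X] M.carrier X
  leibniz := fourierAction_leibniz M

/-- The Fourier transform as a functor. -/
def fourier (k : Type u) [CommRing k] : DMod k[X] ⥤ DMod k[X] where
  obj M := fourierObj M
  map {M N} f :=
    { toLin :=
        { toFun := fun m : M.carrier => (f.toLin m : N.carrier)
          map_add' := fun a b : M.carrier => map_add f.toLin a b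
          map_smul' := fourierAction_natural f }
      comm := fun m : M.carrier => f.toLin.map_smul X m }

end Fourier

/-! ## Extension across the puncture and vanishing cycles -/

section Invert

variable {R : Type u} [CommRing R] [Differential R]

/-- `R ⊗_ℤ M` with `∂ (a ⊗ m) = a′ ⊗ m + a ⊗ ∂ m`. -/
def freeDel (M : DMod R) : R ⊗[ℤ] M.carrier →+ R ⊗[ℤ] M.carrier :=
  TensorProduct.liftAddHom
    (AddMonoidHom.mk' (fun a => AddMonoidHom.mk' (fun m => a′ ⊗ₜ[ℤ] m + a ⊗ₜ[ℤ] M.del m)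
        (fun x y => by simp only [map_add, TensorProduct.tmul_add]; abel))
      (fun x y => by
        ext m
        simp only [map_add, TensorProduct.add_tmul, AddMonoidHom.mk'_apply,
          AddMonoidHom.add_apply]
        abel))
    (fun r s m => by
      change (r • s)′ ⊗ₜ[ℤ] m + (r • s) ⊗ₜ[ℤ] M.del m
        = s′ ⊗ₜ[ℤ] (r • m) + s ⊗ₜ[ℤ] M.del (r • m)
      rw [map_zsmul, map_zsmul, TensorProduct.smul_tmul, TensorProduct.smul_tmul])

@[simp] lemma freeDel_tmul (M : DMod R) (a : R) (m : M.carrier) :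
    freeDel M (a ⊗ₜ m) = a′ ⊗ₜ[ℤ] m + a ⊗ₜ[ℤ] M.del m := rfl

/-- `R ⊗_ℤ M` as a `D_R`-module. -/
def freeObj (M : DMod R) : DMod R where
  carrier := R ⊗[ℤ] M.carrier
  del := freeDel M
  leibniz r x := by
    induction x using TensorProduct.induction_on with
    | zero => simp
    | tmul a m =>
      simp only [TensorProduct.smul_tmul', freeDel_tmul, smul_add, smul_eq_mul,
        Derivation.leibniz, TensorProduct.add_tmul]
      rw [mul_comm a (r′)]
      abel
    | add x y hx hy =>
      simp only [smul_add, map_add, hx, hy]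
      abel

/-- The relations `c ⊗ m = 1 ⊗ c m` for constants `c`, and `a ⊗ ∂ m = 1 ⊗ ∂ (a m)`. -/
def invertRel (M : DMod R) : Submodule R (R ⊗[ℤ] M.carrier) :=
  Submodule.span R
    ({x | ∃ (c : R) (m : M.carrier), c′ = 0 ∧ x = c ⊗ₜ[ℤ] m - (1 : R) ⊗ₜ[ℤ] (c • m)} ∪
      {x | ∃ (a : R) (m : M.carrier), x = a ⊗ₜ[ℤ] M.del m - (1 : R) ⊗ₜ[ℤ] M.del (a • m)})

lemma freeDel_mem (M : DMod R) : ∀ x ∈ invertRel M, freeDel M x ∈ invertRel M := by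
  have h2 : ∀ (a : R) (m : M.carrier),
      a ⊗ₜ[ℤ] M.del m - (1 : R) ⊗ₜ[ℤ] M.del (a • m) ∈ invertRel M := fun a m =>
    Submodule.subset_span (Or.inr ⟨a, m, rfl⟩)
  have h1 : (1 : R)′ = 0 := Derivation.map_one_eq_zero _
  intro x hx
  refine Submodule.span_induction (p := fun x _ => freeDel M x ∈ invertRel M) ?_ ?_ ?_ ?_ hx
  · rintro x (⟨c, m, hc, rfl⟩ | ⟨a, m, rfl⟩)
    · rw [map_sub, freeDel_tmul, freeDel_tmul, hc, h1, TensorProduct.zero_tmul,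
        TensorProduct.zero_tmul, zero_add, zero_add]
      exact h2 c m
    · have e := add_mem (h2 (a′) m) (h2 a (M.del m))
      rw [sub_add_sub_comm, ← TensorProduct.tmul_add, ← map_add, ← M.leibniz a m] at e
      rwa [map_sub, freeDel_tmul, freeDel_tmul, h1, TensorProduct.zero_tmul, zero_add]
  · rw [map_zero]; exact zero_mem _
  · intro x y _ _ hx hy
    rw [map_add]; exact add_mem hx hy
  · intro r x hx' hx
    have e : freeDel M (r • x) = r′ • x + r • freeDel M x := (freeObj M).leibniz r x
    rw [e]
    exact add_mem ((invertRel M).smul_mem _ hx') ((invertRel M).smul_mem _ hx)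

lemma invertRel_stable (M : DMod R) : (freeObj M).Stable (invertRel M) := freeDel_mem M

/-- The `D_R`-module `M'` obtained from `M` by making `∂` invertible. It is generated by symbols
`e_m = 1 ⊗ m` (thought of as `∂⁻¹ m`), linear over the constants in `m`, such that
`∂ e_m = e_{∂ m}` and the canonical map `M → M'`, `m ↦ ∂ e_m`, is a morphism of `D_R`-modules.
For `R = L[[t]]` in characteristic zero, `∂` is bijective on `M'`, the kernel of `M → M'` is the
maximal constant submodule `M^hor`, and `M'` is the universal extension of `M / M^hor` by constant
modules; every morphism from `M` to a module with bijective `∂` factors uniquely through `M'`. -/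
def invertObj (M : DMod R) : DMod R := (freeObj M).quot (invertRel M) (invertRel_stable M)

lemma invertRel_map {M N : DMod R} (f : M ⟶ N) :
    invertRel M ≤ (invertRel N).comap
      (TensorProduct.AlgebraTensorModule.map (LinearMap.id : R →ₗ[R] R)
        f.toLin.toAddMonoidHom.toIntLinearMap) := by
  refine Submodule.span_le.2 ?_
  rintro x (⟨c, m, hc, rfl⟩ | ⟨a, m, rfl⟩)
  · refine Submodule.subset_span (Or.inl ⟨c, f.toLin m, hc, ?_⟩)
    rw [← map_smul]
    exact map_sub _ _ _
  · refine Submodule.subset_span (Or.inr ⟨a, f.toLin m, ?_⟩)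
    rw [← map_smul, ← f.comm, ← f.comm]
    exact map_sub _ _ _

/-- Functoriality of `invertObj`. -/
def invertMap {M N : DMod R} (f : M ⟶ N) : invertObj M ⟶ invertObj N where
  toLin := (invertRel M).mapQ (invertRel N) _ (invertRel_map f)
  comm x := by
    obtain ⟨x, rfl⟩ := Submodule.Quotient.mk_surjective (invertRel M) x
    refine congrArg (invertRel N).mkQ (?_ : TensorProduct.AlgebraTensorModule.map _ _
      (freeDel M x) = freeDel N (TensorProduct.AlgebraTensorModule.map _ _ x))
    induction x using TensorProduct.induction_on with
    | zero => simp
    | tmul a m => simp [f.comm]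
    | add x y hx hy => simp only [map_add, hx, hy]

/-- The functor `M ↦ M'` of `invertObj`. -/
def invert (R : Type u) [CommRing R] [Differential R] : DMod R ⥤ DMod R where
  obj M := invertObj M
  map f := invertMap f
  map_id M := DMod.hom_ext fun x => by
    obtain ⟨x, rfl⟩ := Submodule.Quotient.mk_surjective (invertRel M) x
    refine congrArg (invertRel M).mkQ (?_ : TensorProduct.AlgebraTensorModule.map _ _ x = x)
    induction x using TensorProduct.induction_on with
    | zero => simp
    | tmul a m => rfl
    | add x y hx hy => simp only [map_add, hx, hy]
  map_comp {M N P} f g := DMod.hom_ext fun x => by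
    obtain ⟨x, rfl⟩ := Submodule.Quotient.mk_surjective (invertRel M) x
    refine congrArg (invertRel P).mkQ (?_ : TensorProduct.AlgebraTensorModule.map _ _ x =
      TensorProduct.AlgebraTensorModule.map (LinearMap.id : R →ₗ[R] R)
        g.toLin.toAddMonoidHom.toIntLinearMap
        (TensorProduct.AlgebraTensorModule.map (LinearMap.id : R →ₗ[R] R)
        f.toLin.toAddMonoidHom.toIntLinearMap x))
    induction x using TensorProduct.induction_on with
    | zero => simp
    | tmul a m => rfl
    | add x y hx hy => simp only [map_add, hx, hy]

end Invert

section Disk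

variable (L : Type u) [CommRing L]

/-- The extension functor `j_*` from the punctured disk to the disk. -/
def jStar : DMod L⸨X⸩ ⥤ DMod L⟦X⟧ := (puncture L).pushforward

/-- The extension functor `j_!` from the punctured disk to the disk: `j_! N` is the module obtained
from `j_* N` by making `∂` invertible. For holonomic `N` it is the unique holonomic module with
bijective `∂` that restricts to `N` on the punctured disk. -/
def jShriek : DMod L⸨X⸩ ⥤ DMod L⟦X⟧ := jStar L ⋙ invert L⟦X⟧

/-- Formal vanishing cycles `Φ` on the disk: `j_! Φ(M)` is the module `M'` obtained from `M` by
making `∂` invertible, so `Φ(M)` is the restriction of `M'` to the punctured disk. -/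
def vanishing : DMod L⟦X⟧ ⥤ DMod L⸨X⸩ := invert L⟦X⟧ ⋙ (puncture L).pullback

variable {L}

/-- A subgroup `U` of an `L[[t]]`-module is open if for every finitely generated submodule `N`
there is `n` with `tⁿ N ⊆ U`. -/
def IsOpenSubgroup (M : DMod L⟦X⟧) (U : AddSubgroup M.carrier) : Prop :=
  ∀ N : Submodule L⟦X⟧ M.carrier, N.FG →
    ∃ n : ℕ, ∀ m ∈ N, (PowerSeries.X : L⟦X⟧) ^ n • m ∈ U

/-- The `t`-adic topology on a module over the disk: the open subgroups form a base of
neighbourhoods of zero. -/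
@[reducible] def adicTopology (M : DMod L⟦X⟧) : TopologicalSpace M.carrier where
  IsOpen S := ∀ m ∈ S, ∃ U : AddSubgroup M.carrier, IsOpenSubgroup M U ∧ ∀ u ∈ U, m + u ∈ S
  isOpen_univ := fun _ _ => ⟨⊤, fun _ _ => ⟨0, fun _ _ => AddSubgroup.mem_top _⟩,
    fun _ _ => Set.mem_univ _⟩
  isOpen_inter := by
    rintro S T hS hT m ⟨hmS, hmT⟩
    obtain ⟨U, hU, hUS⟩ := hS m hmS
    obtain ⟨V, hV, hVT⟩ := hT m hmT
    refine ⟨U ⊓ V, fun N hN => ?_, fun u hu => ⟨hUS u hu.1, hVT u hu.2⟩⟩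
    obtain ⟨a, ha⟩ := hU N hN
    obtain ⟨b, hb⟩ := hV N hN
    refine ⟨a + b, fun m hm => ⟨?_, ?_⟩⟩
    · rw [pow_add, mul_smul]
      exact ha _ (N.smul_mem _ hm)
    · rw [add_comm, pow_add, mul_smul]
      exact hb _ (N.smul_mem _ hm)
  isOpen_sUnion := by
    rintro s hs m ⟨T, hT, hm⟩
    obtain ⟨U, hU, h⟩ := hs T hT m hm
    exact ⟨U, hU, fun u hu => ⟨T, hT, h u hu⟩⟩

/-- A map that is a homeomorphism for the adic topologies. -/
def IsAdicHomeomorph {L' : Type u} [CommRing L'] (M : DMod L⟦X⟧) (N : DMod L'⟦X⟧)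
    (f : M.carrier → N.carrier) : Prop :=
  @IsHomeomorph _ _ (adicTopology M) (adicTopology N) f

end Disk

/-! ## Holonomic modules and slopes -/

/-- Holonomic modules over `L((t))`: those of finite rank. -/
def HolK (L : Type u) [CommRing L] : ObjectProperty (DMod L⸨X⸩) :=
  fun M => Module.Finite L⸨X⸩ M.carrier

/-- Holonomic modules on the affine line: finitely generated over the ring of differential
operators and of finite generic rank. -/
def HolA1 (k : Type u) [Field k] : ObjectProperty (DMod k[X]) :=
  fun M => M.FinitelyGenerated ∧
    Module.Finite (FractionRing k[X]) (FractionRing k[X] ⊗[k[X]] M.carrier)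

section Slopes

variable {L : Type u} [Field L]

/-- The operator `θ = t ∂`. -/
def theta (M : DMod L⸨X⸩) (m : M.carrier) : M.carrier :=
  (HahnSeries.single 1 1 : L⸨X⸩) • M.del m

/-- `s` is the slope of the irreducible module `M`, read off the Newton polygon: for a cyclic
vector `v` with `θⁿ v = ∑ a_i θ^i v`, `n = rk M`, it is the maximum of `0` and of the numbers
`-ord(a_i) / (n - i)`. -/
def HasSlope (M : DMod L⸨X⸩) (s : ℚ) : Prop :=
  ∃ (v : M.carrier) (a : Fin (Module.finrank L⸨X⸩ M.carrier) → L⸨X⸩),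
    LinearIndependent L⸨X⸩
      (fun i : Fin (Module.finrank L⸨X⸩ M.carrier) => (theta M)^[i] v) ∧
    (theta M)^[Module.finrank L⸨X⸩ M.carrier] v = ∑ i, a i • (theta M)^[i] v ∧
    IsGreatest ({0} ∪ {r : ℚ | ∃ i, a i ≠ 0 ∧
      r = -((a i).order : ℚ) / ((Module.finrank L⸨X⸩ M.carrier : ℚ) - (i : ℕ))}) s

/-- The slopes of `M` are the slopes of its irreducible components. -/
def slopes (M : DMod L⸨X⸩) : Set ℚ := {s | ∃ X, DMod.IsComponent X M ∧ HasSlope X s}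

/-- The module with `∂` replaced by `∂ + b`, that is, the tensor product of `M` with the rank one
module `(L((t)), d/dt + b)`. -/
def twist (b : L⸨X⸩) (M : DMod L⸨X⸩) : DMod L⸨X⸩ where
  carrier := M.carrier
  del := M.del + DistribSMul.toAddMonoidHom M.carrier b
  leibniz r m := by
    change M.del (r • m) + b • r • m = r′ • m + r • (M.del m + b • m)
    rw [M.leibniz, smul_add, smul_comm b r, add_assoc]

variable (k : Type u) [Field k]

/-- Holonomic modules over `K_∞` all of whose slopes are greater than one. -/
def SlopeGT : ObjectProperty (DMod k⸨X⸩) :=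
  fun M => HolK k M ∧ ∀ s ∈ slopes M, 1 < s

/-- Holonomic modules all of whose slopes are less than one. -/
def SlopeLT : ObjectProperty (DMod k⸨X⸩) :=
  fun M => HolK k M ∧ ∀ s ∈ slopes M, s < 1

variable {k}

/-- The geometric points over a closed point `x`. -/
abbrev GeomPoint (x : ClosedPoint k) : Type u :=
  {β : AlgebraicClosure k // ∀ f ∈ x.asIdeal, Polynomial.aeval β f = 0}

/-- Holonomic modules `M` over `K_∞ = k((ζ))` of class `≤ 1, (x)`: over `k̄((ζ))`, `M` becomes a
direct sum over the geometric points `β` of `x` of modules `ℓ_β ⊗ N_β`, where `N_β` has slopes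
less than one and `ℓ_β` is the rank one module with `∂_ζ = d/dζ + β / ζ²`. -/
def SlopeLE (x : ClosedPoint k) : ObjectProperty (DMod k⸨X⸩) :=
  fun M => HolK k M ∧
    ∃ N : GeomPoint x → DMod (AlgebraicClosure k)⸨X⸩,
      (∀ β, SlopeLT (AlgebraicClosure k) (N β)) ∧
      ∃ f : ∀ β : GeomPoint x,
          twist (HahnSeries.single (-2) β.1) (N β) ⟶ (extendConstants k).pullback.obj M,
        DMod.IsDirectSum _ _ f

variable (k)

/-- The pieces of the decomposition of holonomic modules over `K_∞`: slopes greater than one, and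
for each closed point `x` the class `≤ 1, (x)`. -/
def piece : Option (ClosedPoint k) → ObjectProperty (DMod k⸨X⸩)
  | none => SlopeGT k
  | some x => SlopeLE x

end Slopes

/-! ## The local Fourier transforms -/

section Local

variable {k : Type u} [Field k]

/-- A local Fourier transform `F(x, ∞)`: an equivalence from holonomic modules over `K_x` to
holonomic modules over `K_∞` of class `≤ 1, (-x)`, together with a functorial isomorphism
`F(j_{x*} j_! N) ≅ j_{∞*} F(x, ∞) N` that is a homeomorphism. -/
structure LocalFourierFinInf (x : ClosedPoint k) where
  /-- the equivalence -/
  equiv : (HolK (ResField x)).FullSubcategory ≌ (SlopeLE (negPoint x)).FullSubcategory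
  /-- the comparison with the Fourier transform -/
  iso : (HolK (ResField x)).ι ⋙ jShriek (ResField x) ⋙ (diskAt x).pushforward ⋙ fourier k ≅
    equiv.functor ⋙ (SlopeLE (negPoint x)).ι ⋙ (puncturedDiskInfty k).pushforward
  homeo : ∀ N, IsAdicHomeomorph ((jShriek (ResField x)).obj N.obj)
    ((jStar k).obj (equiv.functor.obj N).obj) (fun m => (iso.hom.app N).toLin m)

/-- A local Fourier transform `F(∞, x)`: an equivalence from holonomic modules over `K_∞` of class
`≤ 1, (x)` to holonomic modules over `K_x`, together with a functorial isomorphism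
`F(j_{∞*} N) ≅ j_{x*} j_! F(∞, x) N` that is a homeomorphism. -/
structure LocalFourierInfFin (x : ClosedPoint k) where
  /-- the equivalence -/
  equiv : (SlopeLE x).FullSubcategory ≌ (HolK (ResField x)).FullSubcategory
  /-- the comparison with the Fourier transform -/
  iso : (SlopeLE x).ι ⋙ (puncturedDiskInfty k).pushforward ⋙ fourier k ≅
    equiv.functor ⋙ (HolK (ResField x)).ι ⋙ jShriek (ResField x) ⋙ (diskAt x).pushforward
  homeo : ∀ N, IsAdicHomeomorph ((jStar k).obj N.obj)
    ((jShriek (ResField x)).obj (equiv.functor.obj N).obj) (fun m => (iso.hom.app N).toLin m)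

variable (k)

/-- A local Fourier transform `F(∞, ∞)`: an auto-equivalence of holonomic modules over `K_∞` with
slopes greater than one, together with a functorial isomorphism
`F(j_{∞*} N) ≅ j_{∞*} F(∞, ∞) N` that is a homeomorphism. -/
structure LocalFourierInfInf where
  /-- the equivalence -/
  equiv : (SlopeGT k).FullSubcategory ≌ (SlopeGT k).FullSubcategory
  /-- the comparison with the Fourier transform -/
  iso : (SlopeGT k).ι ⋙ (puncturedDiskInfty k).pushforward ⋙ fourier k ≅
    equiv.functor ⋙ (SlopeGT k).ι ⋙ (puncturedDiskInfty k).pushforward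
  homeo : ∀ N, IsAdicHomeomorph ((jStar k).obj N.obj)
    ((jStar k).obj (equiv.functor.obj N).obj) (fun m => (iso.hom.app N).toLin m)

/-- The claims that the functors of the theory take values where they should: the Fourier
transform, the formal nearby cycles at infinity and the formal vanishing cycles preserve
holonomicity, and the components of a holonomic module over `K_∞` belong to their classes. This
is used below only as a conclusion, never as a hypothesis. -/
structure WellDefined : Prop where
  fourier : ∀ M : (HolA1 k).FullSubcategory, HolA1 k (((HolA1 k).ι ⋙ fourier k).obj M)
  nearby : ∀ M : (HolA1 k).FullSubcategory,
    HolK k (((HolA1 k).ι ⋙ (puncturedDiskInfty k).pullback).obj M)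
  vanishing : ∀ (x : ClosedPoint k) (M : (HolA1 k).FullSubcategory),
    HolK (ResField x)
      (((HolA1 k).ι ⋙ (diskAt x).pullback ⋙ vanishing (ResField x)).obj M)
  component : ∀ (o : Option (ClosedPoint k)) (N : (HolK k).FullSubcategory),
    piece k o (((HolK k).ι ⋙ DMod.part (piece k o)).obj N)

namespace WellDefined

variable {k} (h : WellDefined k)

/-- The Fourier transform on holonomic modules on the affine line. -/
def Four : (HolA1 k).FullSubcategory ⥤ (HolA1 k).FullSubcategory :=
  (HolA1 k).lift ((HolA1 k).ι ⋙ LocalFourier.fourier k) h.fourier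

/-- The formal nearby cycles `Ψ_∞(M) = K_∞ ⊗ M`. -/
def PsiInfty : (HolA1 k).FullSubcategory ⥤ (HolK k).FullSubcategory :=
  (HolK k).lift ((HolA1 k).ι ⋙ (puncturedDiskInfty k).pullback) h.nearby

/-- The formal vanishing cycles `Φ_x`. -/
def Phi (x : ClosedPoint k) : (HolA1 k).FullSubcategory ⥤ (HolK (ResField x)).FullSubcategory :=
  (HolK (ResField x)).lift
    ((HolA1 k).ι ⋙ (diskAt x).pullback ⋙ LocalFourier.vanishing (ResField x)) (h.vanishing x)

/-- The component `N ↦ N^{>1}`. -/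
def gtPart : (HolK k).FullSubcategory ⥤ (SlopeGT k).FullSubcategory :=
  (SlopeGT k).lift ((HolK k).ι ⋙ DMod.part (SlopeGT k)) (h.component none)

/-- The component `N ↦ N^{≤ 1, (x)}`. -/
def lePart (x : ClosedPoint k) : (HolK k).FullSubcategory ⥤ (SlopeLE x).FullSubcategory :=
  (SlopeLE x).lift ((HolK k).ι ⋙ DMod.part (SlopeLE x)) (h.component (some x))

/-- The summands of the stationary phase decomposition: `F(∞, ∞)(Ψ_∞(M)^{>1})` and
`F(x, ∞) Φ_x(M)` for the closed points `x`. -/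
def phaseTerm (Fxi : ∀ x : ClosedPoint k, LocalFourierFinInf x) (Fii : LocalFourierInfInf k) :
    Option (ClosedPoint k) → ((HolA1 k).FullSubcategory ⥤ DMod k⸨X⸩)
  | none => h.PsiInfty ⋙ h.gtPart ⋙ Fii.equiv.functor ⋙ (SlopeGT k).ι
  | some x => h.Phi x ⋙ (Fxi x).equiv.functor ⋙ (SlopeLE (negPoint x)).ι

end WellDefined

end Local

end LocalFourier

end

open LocalFourier

set_option linter.unusedSectionVars false

open Submodule (smul_mem subset_span span_induction mem_top span mem_sup span_le mem_sup_left mem_sup_right add_mem_sup fg_span span_mono mem_comap mem_iSup_of_mem mem_map_of_mem)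
open LinearMap (ker range mem_ker)
open Function (Injective Bijective Surjective iterate_succ_apply iterate_succ_apply')
open Finset (sum_congr sum_smul smul_sum sum_range_succ)
open PowerSeries (constantCoeff)
open HahnSeries (single)

local notation:max "ϖ" L:max => (PowerSeries.X : PowerSeries L)

noncomputable section

namespace LocalFourier

instance {R : Type u} [CommRing R] [Differential R] : CoeSort (DMod R) (Type u) := ⟨DMod.carrier⟩

open scoped Pointwise

/-! ### Filtered groups and successive approximation -/

section Filtration

variable {Y Y' : Type*} [AddCommGroup Y] [AddCommGroup Y']

/-- Every sequence that is Cauchy for the filtration `U` (with `y (j + 1) - y j ∈ U j`) has a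
limit `l`, in the strong sense that `l - y j ∈ U j` for all `j`. -/
def SeqComplete (U : ℕ → AddSubgroup Y) : Prop :=
  ∀ y : ℕ → Y, (∀ j, y (j + 1) - y j ∈ U j) → ∃ l, ∀ j, l - y j ∈ U j

/-- The filtration `U` has zero intersection. -/
def Separated (U : ℕ → AddSubgroup Y) : Prop := ∀ y, (∀ n, y ∈ U n) → y = 0

lemma sub_mem_of_cauchy {U : ℕ → AddSubgroup Y} (hU : Antitone U) {y : ℕ → Y}
    (hy : ∀ j, y (j + 1) - y j ∈ U j) {i j : ℕ} (hij : i ≤ j) : y j - y i ∈ U i := by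
  induction j, hij using Nat.le_induction with
  | base => simp
  | succ j hij ih =>
    have := (U i).add_mem (hU hij (hy j)) ih
    rwa [sub_add_sub_cancel] at this

/-- Completeness depends only on the topology that the filtration defines. -/
theorem SeqComplete.of_cofinal {U V : ℕ → AddSubgroup Y} (hU : Antitone U) (hVa : Antitone V)
    (hV : SeqComplete V) (h1 : ∀ n, ∃ m, U m ≤ V n) (h2 : ∀ n, ∃ m, V m ≤ U n) :
    SeqComplete U := by
  intro y hy
  choose m hm using h1
  let M : ℕ → ℕ := fun n => n + ∑ i ∈ Finset.range (n + 1), m i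
  have hM : ∀ n, M n ≤ M (n + 1) := fun n => by
    simp only [M, sum_range_succ _ (n + 1)]
    omega
  have hMm : ∀ n, m n ≤ M n := fun n => by simp only [M, sum_range_succ]; omega
  obtain ⟨l, hl⟩ := hV (fun n => y (M n)) fun n =>
    hm n (hU (hMm n) (sub_mem_of_cauchy hU hy (hM n)))
  refine ⟨l, fun j => ?_⟩
  obtain ⟨n, hn⟩ := h2 j
  have e2 : y (M (max n j)) - y j ∈ U j :=
    sub_mem_of_cauchy hU hy ((le_max_right n j).trans (Nat.le_add_right _ _))
  have := (U j).add_mem (hn (hVa (le_max_left n j) (hl _))) e2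
  rwa [sub_add_sub_cancel] at this

/-- Successive approximation: an additive map that is onto up to the next step of the filtration
is onto. -/
theorem surj_of_approx {F : ℕ → AddSubgroup Y} {G : ℕ → AddSubgroup Y'} (hF : SeqComplete F)
    (hG : Separated G) (Q : Y →+ Y') (hQ : ∀ n, ∀ y ∈ F n, Q y ∈ G n)
    (h : ∀ n, ∀ m ∈ G n, ∃ m' ∈ F n, m - Q m' ∈ G (n + 1)) :
    ∀ m ∈ G 0, ∃ m' ∈ F 0, Q m' = m := by
  intro m hm
  choose! c hc hc' using h
  let r : ℕ → Y' := fun n => Nat.rec m (fun n r => r - Q (c n r)) n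
  have hr : ∀ n, r n ∈ G n := fun n => by
    induction n with
    | zero => exact hm
    | succ n ih => exact hc' n _ ih
  obtain ⟨l, hl⟩ := hF (fun n => ∑ i ∈ Finset.range n, c i (r i)) fun n => by
    simpa [sum_range_succ] using hc n _ (hr n)
  have hs : ∀ n, m - Q (∑ i ∈ Finset.range n, c i (r i)) = r n := fun n => by
    induction n with
    | zero => simp [r]
    | succ n ih => rw [sum_range_succ, map_add, ← sub_sub, ih]
  refine ⟨l, by simpa using hl 0, sub_eq_zero.1 (hG _ fun n => ?_)⟩
  have e : Q l - m = Q (l - ∑ i ∈ Finset.range n, c i (r i)) - r n := by grind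
  exact e ▸ (G n).sub_mem (hQ n _ (hl n)) (hr n)

end Filtration

/-! ### Finitely generated modules over formal power series -/

section PowerSeriesModules

variable {L : Type*} [Field L]

lemma exists_powerSeries_sum (c : ℕ → L⟦X⟧) :
    ∃ b : L⟦X⟧, ∀ j, ϖ L ^ j ∣ b - ∑ l ∈ Finset.range j, PowerSeries.X ^ l * c l := by
  refine ⟨PowerSeries.mk fun n => ∑ l ∈ Finset.range (n + 1), PowerSeries.coeff (n - l) (c l),
    fun j => PowerSeries.X_pow_dvd_iff.2 fun m hm => ?_⟩
  rw [map_sub, PowerSeries.coeff_mk, map_sum, sub_eq_zero]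
  simp only [PowerSeries.coeff_X_pow_mul']
  rw [Finset.sum_ite, Finset.sum_const_zero, add_zero]
  refine sum_congr ?_ fun _ _ => rfl
  ext l
  simp
  omega

variable {Y : Type*} [AddCommGroup Y] [Module L⟦X⟧ Y]

/-- The `X`-adic filtration of a submodule. -/
def adicFil (Λ : Submodule L⟦X⟧ Y) (n : ℕ) : AddSubgroup Y :=
  (ϖ L ^ n • Λ).toAddSubgroup

lemma mem_adicFil {Λ : Submodule L⟦X⟧ Y} {n : ℕ} {y : Y} :
    y ∈ adicFil Λ n ↔ ∃ m ∈ Λ, ϖ L ^ n • m = y :=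
  Submodule.mem_smul_pointwise_iff_exists _ _ _

lemma smul_mem_adicFil {Λ : Submodule L⟦X⟧ Y} {n : ℕ} {y : Y} (h : y ∈ adicFil Λ n) (a : L⟦X⟧) :
    a • y ∈ adicFil Λ n :=
  (ϖ L ^ n • Λ).smul_mem a h

lemma adicFil_zero (Λ : Submodule L⟦X⟧ Y) : adicFil Λ 0 = Λ.toAddSubgroup := by
  ext y; simp [mem_adicFil]

lemma pow_smul_mem_adicFil {Λ : Submodule L⟦X⟧ Y} {i n : ℕ} {y : Y} (h : y ∈ adicFil Λ n) :
    ϖ L ^ i • y ∈ adicFil Λ (i + n) := by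
  obtain ⟨m, hm, rfl⟩ := mem_adicFil.1 h
  exact mem_adicFil.2 ⟨m, hm, by rw [pow_add, mul_smul]⟩

lemma adicFil_antitone (Λ : Submodule L⟦X⟧ Y) : Antitone (adicFil Λ) := by
  intro i j hij y hy
  obtain ⟨m, hm, rfl⟩ := mem_adicFil.1 hy
  refine mem_adicFil.2 ⟨ϖ L ^ (j - i) • m, Λ.smul_mem _ hm, ?_⟩
  rw [smul_smul, ← pow_add, Nat.add_sub_cancel' hij]

theorem adicFil_complete {Λ : Submodule L⟦X⟧ Y} (hΛ : Λ.FG) : SeqComplete (adicFil Λ) := by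
  intro y hy
  obtain ⟨r, s, hs⟩ := Submodule.fg_iff_exists_fin_generating_family.1 hΛ
  have hc : ∀ j, ∃ c : Fin r → L⟦X⟧, y (j + 1) - y j = ∑ i, (ϖ L ^ j * c i) • s i := fun j => by
    obtain ⟨m, hm, e⟩ := mem_adicFil.1 (hy j)
    rw [← hs] at hm
    obtain ⟨c, rfl⟩ := (Submodule.mem_span_range_iff_exists_fun _).1 hm
    exact ⟨c, by rw [← e, smul_sum]; simp only [mul_smul]⟩
  choose c hc using hc
  choose b hb using fun i => exists_powerSeries_sum fun j => c j i
  refine ⟨y 0 + ∑ i, b i • s i, fun j => ?_⟩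
  have hsum : y j = y 0 + ∑ i, (∑ l ∈ Finset.range j, PowerSeries.X ^ l * c l i) • s i := by
    induction j with
    | zero => simp
    | succ j ih =>
      rw [← sub_add_cancel (y (j + 1)) (y j), hc, ih]
      simp only [sum_range_succ, add_smul, Finset.sum_add_distrib]
      abel
  rw [hsum, add_sub_add_left_eq_sub, ← Finset.sum_sub_distrib]
  refine AddSubgroup.sum_mem _ fun i _ => ?_
  rw [← sub_smul]
  obtain ⟨d, hd⟩ := hb i j
  rw [hd, mul_smul]
  exact mem_adicFil.2 ⟨_, Λ.smul_mem d (hs ▸ subset_span ⟨i, rfl⟩), rfl⟩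

theorem adicFil_separated {Λ : Submodule L⟦X⟧ Y} (hΛ : Λ.FG) : Separated (adicFil Λ) := by
  intro y hy
  have hy0 : y ∈ Λ := by simpa [adicFil_zero] using hy 0
  have : Module.Finite L⟦X⟧ Λ := Module.Finite.iff_fg.2 hΛ
  have := (IsHausdorff.of_isLocalRing (Ideal.span {ϖ L}) Λ (by
    simp
    exact PowerSeries.X_prime.not_isUnit)).haus
    ⟨y, hy0⟩ fun n => by
      obtain ⟨m, hm, e⟩ := mem_adicFil.1 (hy n)
      rw [SModEq.zero, Ideal.span_singleton_pow]
      have : (⟨y, hy0⟩ : Λ) = ϖ L ^ n • ⟨m, hm⟩ := Subtype.ext e.symm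
      exact this ▸ Submodule.smul_mem_smul (Ideal.mem_span_singleton_self _) trivial
  exact congrArg Subtype.val this

/-- A submodule of a finitely generated module is closed. -/
lemma mem_of_forall_mem_sup {Λ U : Submodule L⟦X⟧ Y} (hΛ : Λ.FG) {y : Y}
    (hy : ∀ n, ∃ u ∈ U, y - u ∈ adicFil Λ n) : y ∈ U := by
  have := adicFil_separated (hΛ.map U.mkQ) (U.mkQ y) fun n => by
    obtain ⟨u, hu, h⟩ := hy n
    obtain ⟨m, hm, e⟩ := mem_adicFil.1 h
    refine mem_adicFil.2 ⟨U.mkQ m, mem_map_of_mem hm, ?_⟩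
    rw [← map_smul, e, map_sub, sub_eq_self]
    exact (Submodule.Quotient.mk_eq_zero U).2 hu
  exact (Submodule.Quotient.mk_eq_zero U).1 this

lemma exists_trunc (a : L⟦X⟧) (n : ℕ) : ∃ (c : Fin n → L) (b : L⟦X⟧),
    a = ∑ i, PowerSeries.C (c i) * PowerSeries.X ^ (i : ℕ) + PowerSeries.X ^ n * b := by
  induction n with
  | zero => exact ⟨Fin.elim0, a, by simp⟩
  | succ n ih =>
    obtain ⟨c, b, h⟩ := ih
    have hb : b = PowerSeries.C (constantCoeff b)
        + PowerSeries.X * PowerSeries.mk fun p => PowerSeries.coeff (p + 1) b := by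
      rw [add_comm]; exact PowerSeries.eq_X_mul_shift_add_const b
    refine ⟨Fin.snoc c (constantCoeff b),
      PowerSeries.mk fun p => PowerSeries.coeff (p + 1) b, ?_⟩
    rw [Fin.sum_univ_castSucc]
    simp
    conv_lhs => rw [h, hb]
    ring

/-- A finitely generated module is finite dimensional modulo `X ^ n`. -/
lemma exists_span_mod_adic {Λ : Submodule L⟦X⟧ Y} (hΛ : Λ.FG) (n : ℕ) :
    ∃ (ι : Type) (_ : Fintype ι) (v : ι → Y), (∀ i, v i ∈ Λ) ∧ ∀ m ∈ Λ, ∃ c : ι → L,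
      m - ∑ i, (PowerSeries.C (c i) : L⟦X⟧) • v i ∈ adicFil Λ n := by
  obtain ⟨d, v, rfl⟩ := Submodule.fg_iff_exists_fin_generating_family.1 hΛ
  have hv : ∀ i, v i ∈ span L⟦X⟧ (Set.range v) := fun i =>
    subset_span ⟨i, rfl⟩
  refine ⟨Fin d × Fin n, inferInstance, fun i => ϖ L ^ (i.2 : ℕ) • v i.1,
    fun i => smul_mem _ _ (hv i.1), fun m hm => ?_⟩
  obtain ⟨a, rfl⟩ := (Submodule.mem_span_range_iff_exists_fun _).1 hm
  choose c b hcb using fun i => exists_trunc (a i) n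
  refine ⟨fun i => c i.1 i.2, mem_adicFil.2 ⟨∑ i, b i • v i,
    Submodule.sum_mem _ fun i _ => smul_mem _ _ (hv i), ?_⟩⟩
  rw [Fintype.sum_prod_type, ← Finset.sum_sub_distrib, smul_sum]
  refine sum_congr rfl fun i _ => ?_
  rw [congrArg (· • v i) (hcb i), add_smul, sum_smul]
  simp only [smul_smul]
  abel

/-- Modulo a power of `X`, a finitely generated module has finite length. -/
lemma isArtinian_quotient_adic {Λ : Submodule L⟦X⟧ Y} (hΛ : Λ.FG) (n : ℕ) :
    IsArtinian L⟦X⟧ (Λ ⧸ (ϖ L ^ n • Λ).submoduleOf Λ) := by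
  let Q := Λ ⧸ (ϖ L ^ n • Λ).submoduleOf Λ
  let : Module L Q := Module.compHom Q (PowerSeries.C)
  have : IsScalarTower L L⟦X⟧ Q := ⟨fun a b q => by
    change (a • b) • q = PowerSeries.C a • b • q
    rw [PowerSeries.smul_eq_C_mul, mul_smul]⟩
  obtain ⟨ι, _, v, hv, hvs⟩ := exists_span_mod_adic hΛ n
  have : Module.Finite L Q := Module.Finite.of_surjective (Fintype.linearCombination L
      fun i => (Submodule.Quotient.mk ⟨v i, hv i⟩ : Q)) fun q => by
    obtain ⟨⟨m, hm⟩, rfl⟩ := Submodule.Quotient.mk_surjective _ q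
    obtain ⟨c, hc⟩ := hvs m hm
    refine ⟨c, Eq.trans (map_sum (Submodule.mkQ _)
      (fun i => PowerSeries.C (c i) • (⟨v i, hv i⟩ : Λ)) _).symm ((Submodule.Quotient.eq _).2 ?_).symm⟩
    change ((⟨m, hm⟩ - ∑ i, PowerSeries.C (c i) • (⟨v i, hv i⟩ : Λ) : Λ) : Y) ∈ adicFil Λ n
    simpa using hc
  exact isArtinian_of_tower L (inferInstanceAs (IsArtinian L Q))

lemma exists_sup_adic_stable {Λ : Submodule L⟦X⟧ Y} (hΛ : Λ.FG) {U : ℕ → Submodule L⟦X⟧ Y}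
    (hU : Antitone U) (hUΛ : ∀ n, U n ≤ Λ) (n : ℕ) :
    ∃ c, ∀ c' ≥ c, ∀ y ∈ U c, ∃ u ∈ U c', y - u ∈ adicFil Λ n := by
  have := isArtinian_quotient_adic hΛ n
  obtain ⟨c, hc⟩ := IsArtinian.monotone_stabilizes
    (⟨fun c => OrderDual.toDual (((U c).submoduleOf Λ).map
      ((ϖ L ^ n • Λ).submoduleOf Λ).mkQ), fun i j hij =>
        OrderDual.toDual_le_toDual.2 (Submodule.map_mono (Submodule.comap_mono (hU hij)))⟩)
  refine ⟨c, fun c' hc' y hy => ?_⟩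
  have h := hc c' hc'
  have hmem : ((ϖ L ^ n • Λ).submoduleOf Λ).mkQ ⟨y, hUΛ c hy⟩ ∈
      ((U c').submoduleOf Λ).map ((ϖ L ^ n • Λ).submoduleOf Λ).mkQ := by
    have h' : ((U c).submoduleOf Λ).map ((ϖ L ^ n • Λ).submoduleOf Λ).mkQ
        = ((U c').submoduleOf Λ).map ((ϖ L ^ n • Λ).submoduleOf Λ).mkQ := h
    exact h' ▸ mem_map_of_mem hy
  obtain ⟨⟨u, hu⟩, hu', e⟩ := hmem
  exact ⟨u, hu', (Submodule.Quotient.eq ((ϖ L ^ n • Λ).submoduleOf Λ)).1 e.symm⟩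

/-- Chevalley's theorem: a decreasing sequence of submodules with zero intersection is eventually
contained in `X Λ`. -/
theorem exists_le_adic_of_separated {Λ : Submodule L⟦X⟧ Y} (hΛ : Λ.FG)
    {U : ℕ → Submodule L⟦X⟧ Y} (hU : Antitone U) (hUΛ : ∀ n, U n ≤ Λ)
    (hsep : ∀ y, (∀ n, y ∈ U n) → y = 0) : ∃ n, ∀ y ∈ U n, y ∈ adicFil Λ 1 := by
  by_contra! hcon
  choose c hc using exists_sup_adic_stable hΛ hU hUΛ
  -- `W n` is the intersection of the submodules `U i + X ^ (n + 1) Λ`.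
  let W : ℕ → Set Y := fun n => {y | ∀ i, ∃ u ∈ U i, y - u ∈ adicFil Λ (n + 1)}
  have hcW : ∀ n, ∀ y ∈ U (c (n + 1)), y ∈ W n := fun n y hy i => by
    obtain ⟨u, hu, h⟩ := hc (n + 1) (max i (c (n + 1))) (le_max_right _ _) y hy
    exact ⟨u, hU (le_max_left _ _) hu, h⟩
  have step : ∀ n, ∀ y ∈ W n, ∃ y' ∈ W (n + 1), y' - y ∈ adicFil Λ (n + 1) := fun n y hy => by
    obtain ⟨u, hu, h⟩ := hy (c (n + 2))
    refine ⟨u, hcW (n + 1) u hu, ?_⟩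
    rw [← neg_sub]
    exact neg_mem h
  choose! f hf hf' using step
  obtain ⟨y0, hy0, hy0'⟩ := hcon (c 1)
  let y : ℕ → Y := fun n => Nat.rec y0 (fun n y => f n y) n
  have hy : ∀ n, y n ∈ W n := fun n => by
    induction n with
    | zero => exact hcW 0 _ hy0
    | succ n ih => exact hf n _ ih
  obtain ⟨l, hl⟩ := adicFil_complete hΛ (fun n => y (n - 1)) fun n => by
    cases n with
    | zero => simp
    | succ n => exact hf' n _ (hy n)
  have := hl 1
  rw [(hsep l fun i => mem_of_forall_mem_sup hΛ fun n => by
    obtain ⟨u, hu, h⟩ := hy n i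
    refine ⟨u, hu, ?_⟩
    have := (adicFil Λ n).add_mem (adicFil_antitone Λ n.le_succ (hl (n + 1)))
      (adicFil_antitone Λ n.le_succ h)
    simpa using this)] at this
  exact hy0' (by simpa [y] using neg_mem this)

end PowerSeriesModules

/-! ### The chain of submodules generated by a derivation -/

section Chain

variable {R : Type*} [CommRing R] {Y : Type*} [AddCommGroup Y] [Module R Y]

/-- The operator `D` is a derivation of the module `Y` over some map `R → R`. -/
def IsLeibniz (R : Type*) [CommRing R] {Y : Type*} [AddCommGroup Y] [Module R Y]
    (D : Y →+ Y) : Prop :=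
  ∀ r : R, ∃ r' : R, ∀ m : Y, D (r • m) = r' • m + r • D m

/-- The submodules `Λ + D Λ + ⋯ + D ^ i Λ`. -/
def chain (R : Type*) [CommRing R] {Y : Type*} [AddCommGroup Y] [Module R Y]
    (D : Y →+ Y) (Λ : Submodule R Y) : ℕ → Submodule R Y
  | 0 => Λ
  | i + 1 => chain R D Λ i ⊔ span R (D '' chain R D Λ i)

variable {D : Y →+ Y} {Λ : Submodule R Y}

lemma chain_mono : Monotone (chain R D Λ) := monotone_nat_of_le_succ fun _ => le_sup_left

lemma le_chain (i : ℕ) : Λ ≤ chain R D Λ i := chain_mono (Nat.zero_le i)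

lemma apply_mem_chain {i : ℕ} {m : Y} (h : m ∈ chain R D Λ i) : D m ∈ chain R D Λ (i + 1) :=
  mem_sup_right (subset_span ⟨m, h, rfl⟩)

/-- A derivation maps the span of a set into every submodule that contains the set and its image. -/
lemma IsLeibniz.apply_mem_of_span (hD : IsLeibniz R D) {S : Set Y} {E : Submodule R Y}
    (hS : S ⊆ E) (h : ∀ s ∈ S, D s ∈ E) {m : Y} (hm : m ∈ span R S) : D m ∈ E := by
  refine span_induction h (by rw [map_zero]; exact zero_mem _)
    (fun x y _ _ hx hy => by rw [map_add]; exact add_mem hx hy) (fun r x hx' hx => ?_) hm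
  obtain ⟨r', e⟩ := hD r
  exact e x ▸ add_mem (smul_mem _ _ (span_le.2 hS hx')) (smul_mem _ _ hx)

lemma exists_le_of_fg {W : ℕ → Submodule R Y} (hW : Monotone W) (hΛ : Λ.FG)
    (h : ∀ m ∈ Λ, ∃ i, m ∈ W i) : ∃ i, Λ ≤ W i := by
  obtain ⟨S, rfl⟩ := hΛ
  choose! f hf using h
  exact ⟨S.sup f, span_le.2 fun s hs =>
    hW (Finset.le_sup hs) (hf s (subset_span hs))⟩

lemma chain_fg (hΛ : Λ.FG) (hD : IsLeibniz R D) (i : ℕ) : (chain R D Λ i).FG := by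
  induction i with
  | zero => exact hΛ
  | succ i ih =>
    obtain ⟨S, hS⟩ := id ih
    have hSc : (S : Set Y) ⊆ chain R D Λ i := by rw [← hS]; exact subset_span
    have : chain R D Λ (i + 1) = chain R D Λ i ⊔ span R (D '' S) := by
      refine le_antisymm (sup_le le_sup_left (span_le.2 ?_))
        (sup_le_sup_left (span_mono (Set.image_mono hSc)) _)
      rintro _ ⟨m, hm, rfl⟩
      rw [← hS] at hm
      exact hD.apply_mem_of_span (fun s hs => mem_sup_left (hSc hs))
        (fun s hs => mem_sup_right (subset_span (Set.mem_image_of_mem D hs))) hm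
    rw [this]
    exact ih.sup (fg_span (S.finite_toSet.image _))

lemma mem_chain_succ (hD : IsLeibniz R D) {i : ℕ} {m : Y} :
    m ∈ chain R D Λ (i + 1) ↔ ∃ a ∈ chain R D Λ i, ∃ b ∈ chain R D Λ i, m = a + D b := by
  refine ⟨fun hm => ?_, fun ⟨a, ha, b, hb, e⟩ =>
    e ▸ add_mem (chain_mono i.le_succ ha) (apply_mem_chain hb)⟩
  rw [chain, ← Submodule.span_eq (chain R D Λ i), ← Submodule.span_union] at hm
  refine span_induction ?_ ⟨0, zero_mem _, 0, zero_mem _, by simp⟩ ?_ ?_ hm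
  · rintro _ (ha | ⟨b, hb, rfl⟩)
    · exact ⟨_, ha, 0, zero_mem _, by simp⟩
    · exact ⟨0, zero_mem _, b, span_le.2 subset_rfl hb, by simp⟩
  · rintro _ _ _ _ ⟨a1, ha1, b1, hb1, rfl⟩ ⟨a2, ha2, b2, hb2, rfl⟩
    exact ⟨a1 + a2, add_mem ha1 ha2, b1 + b2, add_mem hb1 hb2, by rw [map_add]; abel⟩
  · rintro r _ _ ⟨a1, ha1, b1, hb1, rfl⟩
    obtain ⟨r', h⟩ := hD r
    exact ⟨r • a1 - r' • b1, sub_mem (smul_mem _ _ ha1) (smul_mem _ _ hb1), r • b1,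
      smul_mem _ _ hb1, by rw [h, smul_add]; abel⟩

lemma mem_chain_succ_iterate (hD : IsLeibniz R D) {i : ℕ} {m : Y}
    (hm : m ∈ chain R D Λ (i + 1)) :
    ∃ a ∈ chain R D Λ i, ∃ b ∈ Λ, m = a + D^[i + 1] b := by
  induction i generalizing m with
  | zero =>
    obtain ⟨a, ha, b, hb, rfl⟩ := (mem_chain_succ hD).1 hm
    exact ⟨a, ha, b, hb, rfl⟩
  | succ i ih =>
    obtain ⟨a, ha, b, hb, rfl⟩ := (mem_chain_succ hD).1 hm
    obtain ⟨a', ha', b', hb', rfl⟩ := ih hb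
    refine ⟨a + D a', add_mem ha (apply_mem_chain ha'), b', hb', ?_⟩
    rw [map_add, iterate_succ_apply' D (i + 1), add_assoc]

lemma iterate_mem_chain {m : Y} (hm : m ∈ Λ) (i : ℕ) : D^[i] m ∈ chain R D Λ i := by
  induction i with
  | zero => exact hm
  | succ i ih => rw [iterate_succ_apply']; exact apply_mem_chain ih

lemma iterate_smul_sub_mem (hD : IsLeibniz R D) (r : R) {m : Y} (hm : m ∈ Λ) (i : ℕ) :
    D^[i + 1] (r • m) - r • D^[i + 1] m ∈ chain R D Λ i := by
  obtain ⟨r', h⟩ := hD r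
  induction i with
  | zero =>
    rw [Function.iterate_one, h, add_sub_cancel_right]
    exact Λ.smul_mem _ hm
  | succ i ih =>
    have e : D^[i + 1 + 1] (r • m) - r • D^[i + 1 + 1] m
        = D (D^[i + 1] (r • m) - r • D^[i + 1] m) + r' • D^[i + 1] m := by
      rw [iterate_succ_apply' D (i + 1), iterate_succ_apply' D (i + 1), map_sub, h]
      abel
    exact e ▸ add_mem (apply_mem_chain ih) (smul_mem _ _ (iterate_mem_chain hm _))

/-- Eventually `D` induces isomorphisms between the successive quotients of the chain: these maps
are onto, and the kernels of their composites form an ascending chain of submodules of `Λ`. -/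
theorem exists_chain_stable [IsNoetherianRing R] (hΛ : Λ.FG) (hD : IsLeibniz R D) :
    ∃ i₁, ∀ i ≥ i₁, ∀ j, ∀ m ∈ chain R D Λ j, D m ∈ chain R D Λ (i + 1) → m ∈ chain R D Λ i := by
  have := isNoetherian_of_fg_of_noetherian Λ hΛ
  let K : ℕ → Submodule R Λ := fun j =>
    { carrier := {m | D^[j + 1] m ∈ chain R D Λ j}
      add_mem' := fun {a b} ha hb => by simp at *; exact add_mem ha hb
      zero_mem' := by simp
      smul_mem' := fun r m hm => by
        have := add_mem (iterate_smul_sub_mem hD r m.2 j) (smul_mem _ r hm)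
        rwa [sub_add_cancel] at this }
  have hK : Monotone K := monotone_nat_of_le_succ fun j m hm => by
    change D^[j + 1 + 1] m ∈ chain R D Λ (j + 1)
    rw [iterate_succ_apply']
    exact apply_mem_chain hm
  obtain ⟨i₁, hi₁⟩ := monotone_stabilizes_iff_noetherian.2 ‹_› ⟨K, hK⟩
  have key : ∀ i ≥ i₁, ∀ m ∈ chain R D Λ (i + 1), D m ∈ chain R D Λ (i + 1) →
      m ∈ chain R D Λ i := by
    intro i hi m hm hDm
    obtain ⟨a, ha, b, hb, rfl⟩ := mem_chain_succ_iterate hD hm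
    refine add_mem ha ?_
    rw [map_add, ← iterate_succ_apply' D] at hDm
    have h1 : ⟨b, hb⟩ ∈ K (i + 1) := (add_mem_cancel_left (apply_mem_chain ha)).1 hDm
    have h2 : K (i + 1) = K i := (hi₁ (i + 1) (by omega)).symm.trans (hi₁ i hi)
    rwa [h2] at h1
  refine ⟨i₁, fun i hi j m hm hDm => ?_⟩
  induction j with
  | zero => exact le_chain i hm
  | succ j ih =>
    rcases le_or_gt (j + 1) i with h | h
    · exact chain_mono h hm
    · exact ih (key j (by omega) m hm (chain_mono (by omega) hDm))

end Chain

open scoped Pointwise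

/-! ### Lattices in vector spaces over Laurent series -/

section Lattices

variable {L : Type*} [Field L]

/-- The power `X ^ n` of the coordinate, for an integer `n`. -/
abbrev tpow (L : Type*) [Field L] (n : ℤ) : L⸨X⸩ := single n (1 : L)

lemma tpow_mul (a b : ℤ) : tpow L a * tpow L b = tpow L (a + b) := by
  simp [tpow, HahnSeries.single_mul_single]

lemma coe_X_pow (n : ℕ) : algebraMap L⟦X⟧ L⸨X⸩ (PowerSeries.X ^ n) = tpow L n := by
  rw [LaurentSeries.coe_algebraMap, HahnSeries.ofPowerSeries_X_pow]

lemma tpow_deriv (n : ℤ) : (tpow L n)′ = n • tpow L (n - 1) := by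
  ext m
  rw [laurent_deriv_coeff, HahnSeries.coeff_smul]
  by_cases h : m = n - 1
  · subst h; simp
  · rw [HahnSeries.coeff_single_of_ne h, HahnSeries.coeff_single_of_ne (by omega), smul_zero,
      smul_zero]

lemma algebraMap_deriv (a : L⟦X⟧) : (algebraMap L⟦X⟧ L⸨X⸩ a)′ = algebraMap L⟦X⟧ L⸨X⸩ (a′) := by
  have := (puncture L).deriv_map a
  rwa [show ((puncture L).jac : L⸨X⸩) = 1 from rfl, one_mul] at this

lemma exists_tpow_mul_mem (a : L⸨X⸩) :
    ∃ (n : ℕ) (b : L⟦X⟧), tpow L n * a = algebraMap L⟦X⟧ L⸨X⸩ b := by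
  refine ⟨a.order.natAbs, PowerSeries.X ^ (a.order + a.order.natAbs).toNat * a.powerSeriesPart, ?_⟩
  rw [map_mul, coe_X_pow, Int.toNat_of_nonneg (by omega), add_comm, ← tpow_mul, mul_assoc]
  congr 1
  exact (LaurentSeries.single_order_mul_powerSeriesPart a).symm

variable {N : Type*} [AddCommGroup N] [Module L⸨X⸩ N] [Module L⟦X⟧ N]
  [IsScalarTower L⟦X⟧ L⸨X⸩ N]

lemma tpow_smul_smul (a b : ℤ) (m : N) : tpow L a • tpow L b • m = tpow L (a + b) • m := by
  rw [smul_smul, tpow_mul]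

@[simp] lemma tpow_zero_smul (m : N) : tpow L 0 • m = m := by
  rw [show tpow L 0 = 1 from rfl, one_smul]

lemma tpow_neg_smul_smul (a : ℤ) (m : N) : tpow L (-a) • tpow L a • m = m := by
  rw [tpow_smul_smul, neg_add_cancel, tpow_zero_smul]

lemma tpow_smul_neg_smul (a : ℤ) (m : N) : tpow L a • tpow L (-a) • m = m := by
  rw [tpow_smul_smul, add_neg_cancel, tpow_zero_smul]

lemma tpow_natCast_smul (n : ℕ) (m : N) : tpow L n • m = ϖ L ^ n • m := by
  rw [← coe_X_pow, algebraMap_smul]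

lemma tpow_one_smul (m : N) : tpow L 1 • m = ϖ L • m := by
  simpa using tpow_natCast_smul (L := L) 1 m

lemma tpow_smul_comm (n : ℤ) (a : L⟦X⟧) (m : N) : tpow L n • a • m = a • tpow L n • m :=
  smul_comm _ _ _

/-- The translate `X ^ n Λ`, for an integer `n`. -/
def shift (n : ℤ) (Λ : Submodule L⟦X⟧ N) : Submodule L⟦X⟧ N :=
  Λ.map (DistribSMul.toLinearMap L⟦X⟧ N (tpow L n))

lemma mem_shift {n : ℤ} {Λ : Submodule L⟦X⟧ N} {m : N} :
    m ∈ shift n Λ ↔ tpow L (-n) • m ∈ Λ := by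
  constructor
  · rintro ⟨y, hy, rfl⟩
    change tpow L (-n) • tpow L n • y ∈ Λ
    rwa [tpow_neg_smul_smul]
  · intro h
    exact ⟨_, h, tpow_smul_neg_smul n m⟩

lemma tpow_smul_mem_shift {n : ℤ} {Λ : Submodule L⟦X⟧ N} {m : N} (h : m ∈ Λ) :
    tpow L n • m ∈ shift n Λ := ⟨m, h, rfl⟩

lemma shift_fg {Λ : Submodule L⟦X⟧ N} (h : Λ.FG) (n : ℤ) : (shift n Λ).FG := h.map _

lemma mem_adicFil_iff_shift {Λ : Submodule L⟦X⟧ N} {n : ℕ} {m : N} :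
    m ∈ adicFil Λ n ↔ tpow L (-n) • m ∈ Λ := by
  rw [mem_adicFil]
  constructor
  · rintro ⟨y, hy, rfl⟩
    rwa [← tpow_natCast_smul, tpow_neg_smul_smul]
  · intro h
    exact ⟨_, h, by rw [← tpow_natCast_smul, tpow_smul_neg_smul]⟩

/-- The `L[[X]]`-module `Λ` contains a multiple of every element of the vector space `E`. -/
def Absorbs (Λ : Submodule L⟦X⟧ N) (E : Submodule L⸨X⸩ N) : Prop :=
  ∀ m ∈ E, ∃ n : ℕ, ϖ L ^ n • m ∈ Λ

lemma pow_smul_mem_of_le {Λ : Submodule L⟦X⟧ N} {m : N} {a b : ℕ} (hab : a ≤ b)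
    (h : ϖ L ^ a • m ∈ Λ) : ϖ L ^ b • m ∈ Λ := by
  rw [← Nat.sub_add_cancel hab, pow_add, mul_smul]
  exact Λ.smul_mem _ h

/-- A finitely generated module is contained in a translate of any absorbing one. -/
lemma Absorbs.exists_le_shift {Λ Λ' : Submodule L⟦X⟧ N} {E : Submodule L⸨X⸩ N}
    (h : Absorbs Λ E) (hΛ' : Λ'.FG) (hE : ∀ m ∈ Λ', m ∈ E) :
    ∃ n : ℕ, ∀ m ∈ Λ', ϖ L ^ n • m ∈ Λ :=
  exists_le_of_fg (W := fun n => Λ.comap (LinearMap.lsmul _ _ (ϖ L ^ n)))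
    (fun _ _ hab _ h => pow_smul_mem_of_le hab h) hΛ' fun m hm => h m (hE m hm)

lemma absorbs_span (S : Set N) : Absorbs (span L⟦X⟧ S) (span L⸨X⸩ S) := by
  intro m hm
  refine span_induction (fun x hx => ⟨0, by simpa using subset_span hx⟩) ⟨0, by simp⟩ ?_ ?_ hm
  · rintro x y _ _ ⟨a, ha⟩ ⟨b, hb⟩
    refine ⟨max a b, ?_⟩
    rw [smul_add]
    exact add_mem (pow_smul_mem_of_le (le_max_left _ _) ha)
      (pow_smul_mem_of_le (le_max_right _ _) hb)
  · rintro c x _ ⟨a, ha⟩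
    obtain ⟨n, b, hb⟩ := exists_tpow_mul_mem c
    refine ⟨a + n, ?_⟩
    rw [pow_add, mul_smul, ← tpow_natCast_smul n, smul_smul (tpow L n), hb, algebraMap_smul,
      smul_comm]
    exact smul_mem _ _ ha

lemma mem_of_mem_span {S : Set N} {E : Submodule L⸨X⸩ N} (h : ∀ s ∈ S, s ∈ E) {m : N}
    (hm : m ∈ span L⟦X⟧ S) : m ∈ E :=
  (span_le.2 h : span L⟦X⟧ S ≤ E.restrictScalars L⟦X⟧) hm

/-- Every finite dimensional subspace has a lattice. -/
lemma exists_lattice (E : Submodule L⸨X⸩ N) (hE : E.FG) :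
    ∃ Λ : Submodule L⟦X⟧ N, Λ.FG ∧ (∀ m ∈ Λ, m ∈ E) ∧ Absorbs Λ E := by
  obtain ⟨S, rfl⟩ := hE
  exact ⟨span L⟦X⟧ S, ⟨S, rfl⟩,
    fun m hm => mem_of_mem_span (fun s hs => subset_span hs) hm, absorbs_span _⟩

/-- A subspace of an `L((X))`-vector space from a set that is stable under `L[[X]]` and under
division by `X`. -/
def subspaceOf (E : Submodule L⟦X⟧ N) (h : ∀ m ∈ E, tpow L (-1) • m ∈ E) :
    Submodule L⸨X⸩ N where
  carrier := E
  add_mem' := E.add_mem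
  zero_mem' := E.zero_mem
  smul_mem' c m hm := by
    obtain ⟨n, b, hb⟩ := exists_tpow_mul_mem c
    have hn : ∀ (n : ℕ), ∀ m ∈ E, tpow L (-n) • m ∈ E := fun n => by
      induction n with
      | zero => intro m hm; simpa using hm
      | succ n ih =>
        intro m hm
        have := h _ (ih m hm)
        rw [tpow_smul_smul] at this
        convert this using 3
        push_cast; ring
    have e : c • m = tpow L (-n) • b • m := by
      rw [← algebraMap_smul L⸨X⸩ b, ← hb, smul_smul, ← mul_assoc, tpow_mul, neg_add_cancel]
      rw [show tpow L 0 = 1 from rfl, one_mul]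
    change c • m ∈ E
    rw [e]
    exact hn n _ (E.smul_mem b hm)

/-- The largest subspace contained in an `L[[X]]`-submodule. -/
def divPart (E : Submodule L⟦X⟧ N) : Submodule L⸨X⸩ N :=
  subspaceOf
    { carrier := {m | ∀ n : ℕ, tpow L (-n) • m ∈ E}
      add_mem' := fun {a b} ha hb n => by rw [smul_add]; exact E.add_mem (ha n) (hb n)
      zero_mem' := fun n => by rw [smul_zero]; exact E.zero_mem
      smul_mem' := fun a m hm n => by
        rw [tpow_smul_comm]; exact E.smul_mem a (hm n) }
    (fun m hm n => by
      rw [tpow_smul_smul]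
      convert hm (n + 1) using 3
      push_cast; ring)

lemma mem_divPart {E : Submodule L⟦X⟧ N} {m : N} :
    m ∈ divPart E ↔ ∀ n : ℕ, tpow L (-n) • m ∈ E := Iff.rfl

lemma divPart_le {E : Submodule L⟦X⟧ N} {m : N} (h : m ∈ divPart E) : m ∈ E := by
  simpa using h 0

/-- A submodule of a finite dimensional space without lines is bounded, by Chevalley's theorem. -/
lemma fg_of_divPart_eq_bot [Module.Finite L⸨X⸩ N] {E : Submodule L⟦X⟧ N}
    (h : ∀ m ∈ divPart E, m = 0) : E.FG := by
  obtain ⟨Λ, hΛ, -, habs⟩ := exists_lattice (⊤ : Submodule L⸨X⸩ N) Module.Finite.fg_top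
  let U : ℕ → Submodule L⟦X⟧ N := fun c => Λ ⊓ shift c E
  obtain ⟨c, hc⟩ := exists_le_adic_of_separated hΛ (antitone_nat_of_succ_le fun c m hm => by
    refine ⟨hm.1, mem_shift.2 ?_⟩
    have := E.smul_mem ϖ L (mem_shift.1 hm.2)
    rw [← tpow_one_smul, tpow_smul_smul] at this
    convert this using 3
    push_cast; ring) (fun _ => inf_le_left)
    fun y hy => h y fun n => mem_shift.1 (hy n).2
  have hle : E ≤ shift (-c) Λ := by
    intro x hx
    rw [mem_shift]
    by_contra hcon
    have hex : ∃ j : ℕ, ϖ L ^ j • tpow L c • x ∈ Λ := habs _ trivial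
    classical
    have hj := Nat.find_spec hex
    have hpos : Nat.find hex ≠ 0 := fun h0 => hcon (by simpa [h0] using hj)
    obtain ⟨j, hj'⟩ := Nat.exists_eq_succ_of_ne_zero hpos
    have hmin : ¬ ϖ L ^ j • tpow L c • x ∈ Λ := Nat.find_min hex (by omega)
    rw [hj'] at hj
    have h1 : ϖ L ^ (j + 1) • tpow L c • x ∈ U c := by
      refine ⟨hj, mem_shift.2 ?_⟩
      rw [tpow_smul_comm, tpow_neg_smul_smul]
      exact E.smul_mem _ hx
    have h2 := mem_adicFil_iff_shift.1 (hc _ h1)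
    rw [pow_succ', mul_smul, ← tpow_one_smul, tpow_smul_smul] at h2
    exact hmin (by simpa using h2)
  exact Submodule.FG.of_le (shift_fg hΛ (-c)) hle

/-- A submodule of a finite dimensional space is the sum of its largest subspace and of a finitely
generated module. -/
lemma exists_le_divPart_sup [Module.Finite L⸨X⸩ N] (E : Submodule L⟦X⟧ N) :
    ∃ Λ ≤ E, Λ.FG ∧ E ≤ (divPart E).restrictScalars L⟦X⟧ ⊔ Λ := by
  obtain ⟨W, hW⟩ := Submodule.exists_isCompl (divPart E)
  refine ⟨E ⊓ W.restrictScalars L⟦X⟧, inf_le_left, fg_of_divPart_eq_bot fun m hm => ?_,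
    fun m hm => ?_⟩
  · have h1 := fun n => (hm n).1
    exact (Submodule.disjoint_def.1 hW.disjoint) m h1 (by simpa using (hm 0).2)
  · obtain ⟨a, ha, b, hb, rfl⟩ := mem_sup.1 (hW.sup_eq_top ▸ mem_top : m ∈ divPart E ⊔ W)
    exact add_mem_sup ha ⟨(E.add_mem_iff_right (divPart_le ha)).1 hm, hb⟩

end Lattices

/-! ### Derivations of vector spaces over Laurent series: the expansive part -/

section Derivations

variable {L : Type*} [Field L] {N : Type*} [AddCommGroup N] [Module L⸨X⸩ N] [Module L⟦X⟧ N]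
  [IsScalarTower L⟦X⟧ L⸨X⸩ N]

/-- `D` satisfies the Leibniz rule over the derivation `X w d/dX` of `L((X))`. The cases `w = 1`
and `w = -X` are those of `X d/dX` and of `d/dz`, `z = 1/X`. -/
def IsDer (w : L⟦X⟧) (D : N →+ N) : Prop :=
  ∀ (a : L⸨X⸩) (m : N), D (a • m) = (algebraMap L⟦X⟧ L⸨X⸩ (PowerSeries.X * w) * a′) • m + a • D m

/-- The operator `D + b`. -/
def addScalar (D : N →+ N) (b : L⟦X⟧) : N →+ N := D + DistribSMul.toAddMonoidHom N b

@[simp] lemma addScalar_apply (D : N →+ N) (b : L⟦X⟧) (m : N) : addScalar D b m = D m + b • m := rfl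

lemma addScalar_zero (D : N →+ N) : addScalar D (0 : L⟦X⟧) = D := by ext; simp

variable {w : L⟦X⟧} {D : N →+ N}

lemma IsDer.isLeibniz (hD : IsDer w D) : IsLeibniz L⟦X⟧ D := fun r =>
  ⟨PowerSeries.X * w * r′, fun m => by
    have := hD (algebraMap L⟦X⟧ L⸨X⸩ r) m
    rwa [algebraMap_deriv, ← map_mul, algebraMap_smul, algebraMap_smul, algebraMap_smul] at this⟩


protected lemma IsDer.tpow (hD : IsDer w D) (n : ℤ) (m : N) :
    D (tpow L n • m) = tpow L n • (D m + (n • w) • m) := by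
  have e : algebraMap L⟦X⟧ L⸨X⸩ (PowerSeries.X * w) * (tpow L n)′
      = tpow L n * algebraMap L⟦X⟧ L⸨X⸩ (n • w) := by
    have h1 := coe_X_pow (L := L) 1
    rw [pow_one, Nat.cast_one] at h1
    rw [tpow_deriv, map_mul, h1, map_zsmul, mul_smul_comm, mul_smul_comm, mul_assoc, mul_comm _ (tpow L (n-1)),
      ← mul_assoc, tpow_mul]
    congr 3
    ring
  rw [hD, e, mul_smul, algebraMap_smul, smul_add, add_comm]

lemma IsDer.addScalar_tpow (hD : IsDer w D) (b : L⟦X⟧) (n : ℤ) (m : N) :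
    addScalar D b (tpow L n • m)
      = tpow L n • addScalar D (b + n • w) m := by
  simp only [addScalar_apply, hD.tpow, add_smul, smul_add, tpow_smul_comm]
  abel

lemma IsDer.neg_tpow_addScalar (hD : IsDer w D) (b : L⟦X⟧) (n : ℤ) (m : N) :
    tpow L (-n) • addScalar D b m = addScalar D (b + n • w) (tpow L (-n) • m) := by
  rw [hD.addScalar_tpow, neg_smul, add_neg_cancel_right]

lemma IsDer.shift_stable (hD : IsDer w D) {E : Submodule L⟦X⟧ N} (h : ∀ m ∈ E, D m ∈ E) (n : ℤ) :
    ∀ m ∈ shift n E, D m ∈ shift n E := by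
  rintro _ ⟨x, hx, rfl⟩
  change D (tpow L n • x) ∈ _
  rw [hD.tpow]
  exact tpow_smul_mem_shift (add_mem (h x hx) (smul_mem _ _ hx))

lemma IsDer.neg_tpow_addScalar_iterate (hD : IsDer w D) (b : L⟦X⟧) (n : ℤ) (r : ℕ) (m : N) :
    tpow L (-n) • (addScalar D b)^[r] m = (addScalar D (b + n • w))^[r] (tpow L (-n) • m) :=
  Function.Semiconj.iterate_right (f := (tpow L (-n) • ·)) (hD.neg_tpow_addScalar b n) r m

lemma IsDer.addScalar_tpow_iterate (hD : IsDer w D) (b : L⟦X⟧) (n : ℤ) (r : ℕ) (m : N) :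
    (addScalar D b)^[r] (tpow L n • m) = tpow L n • (addScalar D (b + n • w))^[r] m :=
  (Function.Semiconj.iterate_right (f := (tpow L n • ·)) (fun y => (hD.addScalar_tpow b n y).symm)
    r m).symm

/-- The operator `D` is expansive on the subspace `E`: it is bijective on `E`, and its inverse is
a contraction for the lattice `Λ`. The same then holds for the operators `D + b`, `b ∈ L[[X]]`. -/
structure IsExpansive (D : N →+ N) (E : Submodule L⸨X⸩ N) (Λ : Submodule L⟦X⟧ N) : Prop where
  fg : Λ.FG
  le : ∀ m ∈ Λ, m ∈ E
  absorbs : Absorbs Λ E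
  stable : ∀ m ∈ E, D m ∈ E
  inj : ∀ b : L⟦X⟧, ∀ m ∈ E, addScalar D b m = 0 → m = 0
  surj : ∀ b : L⟦X⟧, ∀ m ∈ E, ∃ m' ∈ E, addScalar D b m' = m
  mem : ∀ b : L⟦X⟧, ∀ m ∈ E, addScalar D b m ∈ Λ → m ∈ Λ
  contr : ∃ r : ℕ, ∀ b : L⟦X⟧, ∀ m ∈ E, (addScalar D b)^[r] m ∈ Λ → m ∈ adicFil Λ 1

/-- If the submodules `Λ + D Λ + ⋯ + D ^ i Λ` exhaust a subspace, then `D` is expansive on it. -/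
theorem exists_isExpansive (hD : IsDer w D) {Λ : Submodule L⟦X⟧ N} (hΛ : Λ.FG)
    {E : Submodule L⸨X⸩ N} (hEfg : E.FG) (hE : ∀ m, m ∈ E ↔ ∃ i, m ∈ chain L⟦X⟧ D Λ i) :
    ∃ i, IsExpansive D E (chain L⟦X⟧ D Λ i) := by
  obtain ⟨i₁, hi₁⟩ := exists_chain_stable hΛ hD.isLeibniz
  have memE : ∀ {i m}, m ∈ chain L⟦X⟧ D Λ i → m ∈ E := fun {i m} h => (hE m).2 ⟨i, h⟩
  have stE : ∀ m ∈ E, D m ∈ E := fun m hm => by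
    obtain ⟨i, hi⟩ := (hE m).1 hm
    exact memE (apply_mem_chain hi)
  have stA : ∀ i ≥ i₁, ∀ (b : L⟦X⟧), ∀ m ∈ E, addScalar D b m ∈ chain L⟦X⟧ D Λ (i + 1) →
      m ∈ chain L⟦X⟧ D Λ i := by
    intro i hi b m hm h
    obtain ⟨j, hj⟩ := (hE m).1 hm
    induction j with
    | zero => exact le_chain i hj
    | succ j ih =>
      rcases le_or_gt (j + 1) i with h' | h'
      · exact chain_mono h' hj
      · refine ih (hi₁ j (by omega) (j + 1) m hj ?_)
        rw [eq_sub_of_add_eq (addScalar_apply D b m).symm]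
        exact sub_mem (chain_mono (by omega) h) (smul_mem _ _ hj)
  have stB : ∀ i, ∀ (b : L⟦X⟧), ∀ m ∈ E, ∃ m' ∈ E, m - addScalar D b m' ∈ chain L⟦X⟧ D Λ i := by
    intro i b m hm
    obtain ⟨j, hj⟩ := (hE m).1 hm
    clear hm
    induction j generalizing m with
    | zero => exact ⟨0, zero_mem _, by rw [map_zero, sub_zero]; exact le_chain i hj⟩
    | succ j ih =>
      obtain ⟨a, ha, c, hc, rfl⟩ := (mem_chain_succ hD.isLeibniz).1 hj
      obtain ⟨m', hm', h⟩ := ih (a - b • c) (sub_mem ha (smul_mem _ _ hc))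
      refine ⟨c + m', add_mem (memE hc) hm', ?_⟩
      rw [map_add, addScalar_apply D b c]
      convert h using 1
      abel
  have surj : ∀ i ≥ i₁, ∀ b : L⟦X⟧, ∀ m ∈ chain L⟦X⟧ D Λ (i + 1), ∃ m' ∈ chain L⟦X⟧ D Λ i,
      addScalar D b m' = m := by
    intro i hi b
    have := surj_of_approx (adicFil_complete (chain_fg hΛ hD.isLeibniz i))
      (adicFil_separated (chain_fg hΛ hD.isLeibniz (i + 1))) (addScalar D b) ?_ ?_
    · simpa only [adicFil_zero, Submodule.mem_toAddSubgroup] using this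
    · intro n y hy
      obtain ⟨z, hz, rfl⟩ := mem_adicFil.1 hy
      rw [← tpow_natCast_smul, hD.addScalar_tpow, tpow_natCast_smul]
      exact mem_adicFil.2 ⟨_, add_mem (apply_mem_chain hz)
        (smul_mem _ _ (chain_mono i.le_succ hz)), rfl⟩
    · intro n y hy
      have hyE : y ∈ E := memE (i := i + 1) (by
        simpa [adicFil_zero] using adicFil_antitone _ n.zero_le hy)
      obtain ⟨v, hv, h⟩ := stB (i + 1) (b + ((n + 1 : ℕ) : ℤ) • w) (tpow L (-(n + 1 : ℕ)) • y)
        (E.smul_mem _ hyE)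
      have h1 : y - addScalar D b (tpow L (n + 1 : ℕ) • v)
          ∈ adicFil (chain L⟦X⟧ D Λ (i + 1)) (n + 1) := by
        rwa [mem_adicFil_iff_shift, smul_sub, hD.neg_tpow_addScalar, tpow_neg_smul_smul]
      refine ⟨_, ?_, h1⟩
      have h2 := sub_mem hy (adicFil_antitone _ n.le_succ h1)
      rw [sub_sub_cancel, mem_adicFil_iff_shift, hD.neg_tpow_addScalar] at h2
      exact mem_adicFil_iff_shift.2 (stA i hi _ _ (E.smul_mem _ (E.smul_mem _ hv)) h2)
  obtain ⟨S, rfl⟩ := hEfg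
  obtain ⟨i₂, hSi⟩ := exists_le_of_fg (chain_mono (D := D)) (fg_span S.finite_toSet)
    fun m hm => (hE m).1 (mem_of_mem_span (fun s hs => subset_span hs) hm)
  replace hSi := hSi.trans (chain_mono (le_max_right i₁ i₂))
  have hi₂ := le_max_left i₁ i₂
  generalize max i₁ i₂ = i₂ at hSi hi₂
  refine ⟨i₂, chain_fg hΛ hD.isLeibniz i₂, fun m hm => memE hm,
    fun m hm => (absorbs_span _ m hm).imp fun n hn => hSi hn, stE, fun b m hm h => ?_,
    fun b m hm => ?_, fun b m hm h => stA i₂ hi₂ b m hm (chain_mono i₂.le_succ h), ?_⟩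
  · refine adicFil_separated (chain_fg hΛ hD.isLeibniz i₁) m fun n => ?_
    refine mem_adicFil_iff_shift.2 (stA i₁ le_rfl (b + (n : ℤ) • w) _ (smul_mem _ _ hm) ?_)
    rw [← hD.neg_tpow_addScalar, h, smul_zero]
    exact zero_mem _
  · obtain ⟨j, hj⟩ := (hE m).1 hm
    obtain ⟨m', hm', h⟩ := surj (max i₁ j) (le_max_left _ _) b m (chain_mono (by omega) hj)
    exact ⟨m', memE hm', h⟩
  · obtain ⟨r, hr⟩ := exists_le_of_fg
      (W := fun r => (chain L⟦X⟧ D Λ (i₂ + r)).comap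
        (DistribSMul.toLinearMap _ _ (tpow L (-(1 : ℕ)))))
      (fun r s h m hm => chain_mono (by omega) hm) (chain_fg hΛ hD.isLeibniz i₂) fun m hm =>
        ((hE _).1 (smul_mem _ (tpow L (-(1 : ℕ))) (memE hm))).imp fun i hi =>
          chain_mono (Nat.le_add_left _ _) hi
    have iter : ∀ r, ∀ b : L⟦X⟧, ∀ m ∈ span L⸨X⸩ (S : Set N),
        (addScalar D b)^[r] m ∈ chain L⟦X⟧ D Λ (i₂ + r) → m ∈ chain L⟦X⟧ D Λ i₂ := by
      intro r b m hm h
      induction r with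
      | zero => exact h
      | succ r ih =>
        rw [iterate_succ_apply'] at h
        refine ih (stA (i₂ + r) (by omega) b _ ?_ h)
        exact Set.MapsTo.iterate (s := span L⸨X⸩ (S : Set N)) (fun m hm =>
          add_mem (stE m hm) (((span L⸨X⸩ (S : Set N)).restrictScalars L⟦X⟧).smul_mem b hm))
          r hm
    refine ⟨r, fun b m hm h => ?_⟩
    refine mem_adicFil_iff_shift.2 (iter r (b + ((1 : ℕ) : ℤ) • w) _ (smul_mem _ _ hm) ?_)
    rw [← hD.neg_tpow_addScalar_iterate]
    exact hr h

end Derivations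

open scoped Pointwise

section Splitting

variable {L : Type*} [Field L] {N : Type*} [AddCommGroup N] [Module L⸨X⸩ N] [Module L⟦X⟧ N]
  [IsScalarTower L⟦X⟧ L⸨X⸩ N] {w : L⟦X⟧} {D : N →+ N} {E : Submodule L⸨X⸩ N}
  {Λ : Submodule L⟦X⟧ N}

namespace IsExpansive

lemma pow_smul_mem (_ : IsExpansive D E Λ) {m : N} (hm : m ∈ E) (a : L⟦X⟧) : a • m ∈ E := by
  rw [← algebraMap_smul L⸨X⸩]
  exact E.smul_mem _ hm

lemma stable_add (h : IsExpansive D E Λ) (b : L⟦X⟧) {m : N} (hm : m ∈ E) :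
    addScalar D b m ∈ E := add_mem (h.stable m hm) (h.pow_smul_mem hm b)

lemma stable_iterate (h : IsExpansive D E Λ) (b : L⟦X⟧) (r : ℕ) {m : N} (hm : m ∈ E) :
    (addScalar D b)^[r] m ∈ E :=
  Set.MapsTo.iterate (s := (E : Set N)) (fun _ => h.stable_add b) r hm

lemma surj_iterate (h : IsExpansive D E Λ) (b : L⟦X⟧) (r : ℕ) {m : N} (hm : m ∈ E) :
    ∃ m' ∈ E, (addScalar D b)^[r] m' = m :=
  Set.SurjOn.iterate (s := (E : Set N)) (h.surj b) r hm

lemma contr_pow (h : IsExpansive D E Λ) (hD : IsDer w D) :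
    ∃ r : ℕ, ∀ n, ∀ b : L⟦X⟧, ∀ m ∈ E, (addScalar D b)^[n * r] m ∈ Λ → m ∈ adicFil Λ n := by
  obtain ⟨r, hr⟩ := h.contr
  refine ⟨r, fun n b m hm h' => ?_⟩
  induction n generalizing b m with
  | zero => simpa [adicFil_zero] using h'
  | succ n ih =>
    rw [Nat.succ_mul, add_comm, Function.iterate_add_apply] at h'
    have h1 := hr b _ (h.stable_iterate b _ hm) h'
    rw [mem_adicFil_iff_shift, hD.neg_tpow_addScalar_iterate] at h1
    have h2 := ih _ _ (E.smul_mem _ hm) h1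
    rwa [mem_adicFil_iff_shift, tpow_smul_smul, ← neg_add, ← Nat.cast_add,
      ← mem_adicFil_iff_shift] at h2

protected lemma shift (h : IsExpansive D E Λ) (hD : IsDer w D) (k : ℤ) :
    IsExpansive D E (shift k Λ) where
  fg := shift_fg h.fg k
  le m hm := by
    have := E.smul_mem (tpow L k) (h.le _ (mem_shift.1 hm))
    rwa [tpow_smul_neg_smul] at this
  absorbs m hm := by
    obtain ⟨n, hn⟩ := h.absorbs _ (E.smul_mem (tpow L (-k)) hm)
    exact ⟨n, mem_shift.2 (by rwa [tpow_smul_comm])⟩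
  stable := h.stable
  inj := h.inj
  surj := h.surj
  mem b m hm h' := by
    rw [mem_shift, hD.neg_tpow_addScalar] at h'
    exact mem_shift.2 (h.mem _ _ (E.smul_mem _ hm) h')
  contr := h.contr.imp fun r hr b m hm h' => by
    rw [mem_shift, hD.neg_tpow_addScalar_iterate] at h'
    rw [mem_adicFil_iff_shift, mem_shift, smul_comm, ← mem_adicFil_iff_shift]
    exact hr _ _ (E.smul_mem _ hm) h'

/-- The orbits of an expansive operator are unbounded. -/
lemma eq_zero_of_bounded (h : IsExpansive D E Λ) (hD : IsDer w D) {m : N} (hm : m ∈ E) (n : ℕ)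
    (hn : ∀ i, ϖ L ^ n • D^[i] m ∈ Λ) : m = 0 := by
  obtain ⟨r, hr⟩ := h.contr_pow hD
  have h0 : tpow L n • m = 0 := adicFil_separated h.fg _ fun k => by
    refine hr k (-((n : ℤ) • w)) _ (E.smul_mem _ hm) ?_
    rw [hD.addScalar_tpow_iterate, neg_add_cancel, addScalar_zero, tpow_natCast_smul]
    exact hn _
  have := congrArg (tpow L (-n) • ·) h0
  simpa using this

/-- Every vector is the image under a power of an expansive operator of arbitrarily small ones. -/
lemma exists_small_preimage (h : IsExpansive D E Λ) (hD : IsDer w D) {m : N} (hm : m ∈ E) :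
    ∃ n : ℕ, ∀ k, ∃ i, ∃ y ∈ E, D^[i] y = m ∧ ϖ L ^ n • y ∈ adicFil Λ k := by
  obtain ⟨n, hn⟩ := h.absorbs m hm
  obtain ⟨r, hr⟩ := h.contr_pow hD
  refine ⟨n, fun k => ?_⟩
  obtain ⟨y, hy, e⟩ := h.surj_iterate 0 (k * r) hm
  rw [addScalar_zero] at e
  refine ⟨k * r, y, hy, e, ?_⟩
  rw [← tpow_natCast_smul]
  refine hr k (-((n : ℤ) • w)) _ (E.smul_mem _ hy) ?_
  rwa [hD.addScalar_tpow_iterate, neg_add_cancel, addScalar_zero, tpow_natCast_smul, e]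

lemma smul_mem_preimage (h : IsExpansive D E Λ) (hD : IsDer w D) (n : ℕ) {u : N} (hu : u ∈ E)
    (hn : D^[n] u ∈ Λ) (a : L⟦X⟧) : D^[n] (a • u) ∈ Λ := by
  induction n generalizing u a with
  | zero => exact Λ.smul_mem a hn
  | succ n ih =>
    obtain ⟨a', ha'⟩ := hD.isLeibniz a
    rw [iterate_succ_apply, ha', iterate_map_add]
    have h0 := h.stable_iterate 0 n hu
    have h1 : D^[n] u ∈ Λ := by
      refine h.mem 0 _ (by rwa [addScalar_zero] at h0) ?_
      rwa [addScalar_zero, ← iterate_succ_apply' D]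
    exact add_mem (ih hu h1 a') (ih (h.stable u hu) (by rwa [← iterate_succ_apply]) a)

lemma exists_bound (h : IsExpansive D E Λ) (hD : IsDer w D) : ∃ a : ℕ, ∀ m ∈ Λ,
    ϖ L ^ a • D m ∈ Λ := by
  obtain ⟨a, ha⟩ := h.absorbs.exists_le_shift (chain_fg h.fg hD.isLeibniz 1) (fun m hm => by
    obtain ⟨a, ha, b, hb, rfl⟩ := (mem_chain_succ hD.isLeibniz).1 hm
    exact add_mem (h.le a ha) (h.stable b (h.le b hb)))
  exact ⟨a, fun m hm => ha _ (apply_mem_chain hm)⟩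

end IsExpansive

/-- The subgroup of the vectors of `E` that `D ^ n` maps to `Λ`. -/
def preimageFil (D : N →+ N) (E : Submodule L⸨X⸩ N) (Λ : Submodule L⟦X⟧ N) (n : ℕ) :
    AddSubgroup N where
  carrier := {u | u ∈ E ∧ D^[n] u ∈ Λ}
  add_mem' ha hb := ⟨add_mem ha.1 hb.1, by
    rw [iterate_map_add]; exact add_mem ha.2 hb.2⟩
  zero_mem' := ⟨zero_mem _, by rw [iterate_map_zero]; exact zero_mem _⟩
  neg_mem' ha := ⟨neg_mem ha.1, by rw [iterate_map_neg]; exact neg_mem ha.2⟩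

lemma mem_preimageFil {n : ℕ} {u : N} : u ∈ preimageFil D E Λ n ↔ u ∈ E ∧ D^[n] u ∈ Λ := Iff.rfl

namespace IsExpansive

lemma preimageFil_antitone (h : IsExpansive D E Λ) : Antitone (preimageFil D E Λ) := by
  refine antitone_nat_of_succ_le fun n u hu => ⟨hu.1, ?_⟩
  have h0 := h.stable_iterate 0 n hu.1
  rw [addScalar_zero] at h0
  refine h.mem 0 _ h0 ?_
  rw [addScalar_zero, ← iterate_succ_apply' D]
  exact hu.2

lemma preimageFil_le_adic (h : IsExpansive D E Λ) (hD : IsDer w D) (n : ℕ) :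
    ∃ m, preimageFil D E Λ m ≤ adicFil Λ n := by
  obtain ⟨r, hr⟩ := h.contr_pow hD
  exact ⟨n * r, fun u hu => hr n 0 u hu.1 (by rw [addScalar_zero]; exact hu.2)⟩

lemma adic_le_preimageFil (h : IsExpansive D E Λ) (hD : IsDer w D) (n : ℕ) :
    ∃ m, adicFil Λ m ≤ preimageFil D E Λ n := by
  obtain ⟨a, ha⟩ := h.exists_bound hD
  refine ⟨n * a, fun u hu => ⟨h.le u ?_, ?_⟩⟩
  · have := adicFil_antitone Λ (Nat.zero_le _) hu
    rwa [adicFil_zero] at this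
  · have key : ∀ n j, ∀ u ∈ adicFil Λ (n * a + j), D^[n] u ∈ adicFil Λ j := by
      intro n
      induction n with
      | zero => intro j u hu; simpa using hu
      | succ n ih =>
        intro j u hu
        refine ih j _ ?_
        obtain ⟨m, hm, rfl⟩ := mem_adicFil.1 hu
        rw [← tpow_natCast_smul, hD.tpow, tpow_natCast_smul,
          show (n + 1) * a + j = n * a + j + a by ring, pow_add, mul_smul, smul_add]
        exact mem_adicFil.2 ⟨_, add_mem (ha m hm) (Λ.smul_mem _ (Λ.smul_mem _ hm)), rfl⟩
    have := key n 0 u hu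
    rwa [adicFil_zero] at this

lemma preimageFil_complete (h : IsExpansive D E Λ) (hD : IsDer w D) :
    SeqComplete (preimageFil D E Λ) :=
  SeqComplete.of_cofinal h.preimageFil_antitone (adicFil_antitone Λ) (adicFil_complete h.fg)
    (h.preimageFil_le_adic hD) (h.adic_le_preimageFil hD)

lemma preimageFil_separated (h : IsExpansive D E Λ) (hD : IsDer w D) :
    Separated (preimageFil D E Λ) := fun u hu =>
  adicFil_separated h.fg u fun n => by obtain ⟨m, hm⟩ := h.preimageFil_le_adic hD n; exact hm (hu m)

/-- The contraction principle: linear systems `D u = A u + c` with integral matrix `A` have a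
solution in the expansive part. -/
theorem solve (h : IsExpansive D E Λ) (hD : IsDer w D) {r : ℕ} (A : Fin r → Fin r → L⟦X⟧)
    (c : Fin r → N) (hc : ∀ i, c i ∈ E) :
    ∃ u : Fin r → N, (∀ i, u i ∈ E) ∧ ∀ i, D (u i) - ∑ j, A i j • u j = c i := by
  choose c' hc' e using fun i => h.surj 0 (c i) (hc i)
  simp only [addScalar_zero] at e
  choose n hn using fun i => h.absorbs (c' i) (hc' i)
  obtain ⟨k, hk⟩ : ∃ k : ℕ, ∀ i, c' i ∈ shift (-k) Λ := by
    refine ⟨Finset.univ.sup n, fun i => ?_⟩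
    rw [mem_shift, neg_neg, tpow_natCast_smul]
    exact pow_smul_mem_of_le (Finset.le_sup (Finset.mem_univ i)) (hn i)
  have h' := h.shift hD (-k)
  generalize shift (-k) Λ = Λ' at hk h'
  let F : ℕ → AddSubgroup (Fin r → N) := fun n =>
    AddSubgroup.pi Set.univ fun _ => preimageFil D E Λ' n
  let G : ℕ → AddSubgroup (Fin r → N) := fun n =>
    AddSubgroup.pi Set.univ fun _ => (preimageFil D E Λ' n).map D
  have hF : SeqComplete F := fun y hy => by
    choose l hl using fun i => h'.preimageFil_complete hD (fun j => y j i)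
      fun j => hy j i trivial
    exact ⟨l, fun j i _ => hl i j⟩
  have hG : Separated G := fun y hy => by
    funext i
    obtain ⟨u, hu, e⟩ := hy 0 i trivial
    have : u = 0 := h'.preimageFil_separated hD u fun n => by
      obtain ⟨u', hu', e'⟩ := hy n i trivial
      have : u - u' = 0 := h'.inj 0 _ (sub_mem hu.1 hu'.1) (by
        rw [addScalar_zero, map_sub, e, e', sub_self])
      rwa [sub_eq_zero.1 this]
    rw [← e, this, map_zero]; rfl
  let Q : (Fin r → N) →+ (Fin r → N) := AddMonoidHom.mk' (fun u i => D (u i) - ∑ j, A i j • u j)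
    fun a b => by
      funext i
      simp only [Pi.add_apply, map_add, smul_add, Finset.sum_add_distrib]
      abel
  have hAu : ∀ n, ∀ u ∈ F n, ∀ i, ∑ j, A i j • u j ∈ (preimageFil D E Λ' (n + 1)).map D := by
    intro n u hu i
    refine AddSubgroup.sum_mem _ fun j _ => ?_
    obtain ⟨v, hv, e⟩ := h'.surj 0 (A i j • u j) (h.pow_smul_mem (hu j trivial).1 _)
    rw [addScalar_zero] at e
    refine ⟨v, ⟨hv, ?_⟩, e⟩
    rw [iterate_succ_apply, e]
    exact h'.smul_mem_preimage hD n (hu j trivial).1 (hu j trivial).2 _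
  have hmono : ∀ n, (preimageFil D E Λ' (n + 1)).map D ≤ (preimageFil D E Λ' n).map D :=
    fun n => AddSubgroup.map_mono (h'.preimageFil_antitone n.le_succ)
  obtain ⟨u, hu, e'⟩ := surj_of_approx hF hG Q
    (fun n u hu i _ => (AddSubgroup.sub_mem _ ⟨u i, hu i trivial, rfl⟩ (hmono n (hAu n u hu i)) :
      D (u i) - ∑ j, A i j • u j ∈ (preimageFil D E Λ' n).map D))
    (fun n m hm => by
      choose u hu e using fun i => hm i trivial
      refine ⟨u, fun i _ => hu i, fun i _ => ?_⟩
      have := hAu n u (fun i _ => hu i) i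
      change m i - (D (u i) - ∑ j, A i j • u j) ∈ (preimageFil D E Λ' (n + 1)).map D
      rwa [e, sub_sub_cancel]) c (fun i _ => ⟨c' i, ⟨hc' i, hk i⟩, e i⟩)
  exact ⟨u, fun i => (hu i trivial).1, fun i => congrFun e' i⟩

end IsExpansive

/-- A lattice `Λ` of the subspace `F` that is stable under `D`. -/
structure IsStableLattice (D : N →+ N) (F : Submodule L⸨X⸩ N) (Λ : Submodule L⟦X⟧ N) : Prop where
  fg : Λ.FG
  le : ∀ m ∈ Λ, m ∈ F
  absorbs : Absorbs Λ F
  stable : ∀ m ∈ Λ, D m ∈ Λ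

lemma IsDer.stable_of_absorbs (hD : IsDer w D) {F : Submodule L⸨X⸩ N}
    (habs : Absorbs Λ F) (h : ∀ m ∈ Λ, D m ∈ F) : ∀ m ∈ F, D m ∈ F := by
  intro m hm
  obtain ⟨n, hn⟩ := habs m hm
  have h1 := h _ hn
  rw [← tpow_natCast_smul, hD.tpow] at h1
  have h2 := F.smul_mem (tpow L (-n)) h1
  rw [tpow_neg_smul_smul, ← algebraMap_smul L⸨X⸩] at h2
  exact (F.add_mem_iff_left (F.smul_mem _ hm)).1 h2

/-- Given a stable subspace `E` on which `D` is expansive, such that the quotient has a stable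
lattice, there is a complementary stable subspace with a stable lattice. -/
theorem exists_stable_complement (h : IsExpansive D E Λ) (hD : IsDer w D)
    {Λ₀ : Submodule L⟦X⟧ N} (hΛ₀ : Λ₀.FG) (hst : ∀ m ∈ Λ₀, D m ∈ E.restrictScalars L⟦X⟧ ⊔ Λ₀)
    (habs : Absorbs (E.restrictScalars L⟦X⟧ ⊔ Λ₀) (⊤ : Submodule L⸨X⸩ N)) :
    ∃ (F : Submodule L⸨X⸩ N) (Λ' : Submodule L⟦X⟧ N), E ⊔ F = ⊤ ∧ IsStableLattice D F Λ' := by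
  obtain ⟨r, e, rfl⟩ := Submodule.fg_iff_exists_fin_generating_family.1 hΛ₀
  choose c hc b hb hDe using fun i => mem_sup.1 (hst (e i) (subset_span ⟨i, rfl⟩))
  choose A hA using fun i => (Submodule.mem_span_range_iff_exists_fun _).1 (hb i)
  obtain ⟨u, hu, hsol⟩ := h.solve hD A (fun i => -c i) fun i => neg_mem (hc i)
  let f : Fin r → N := fun i => e i + u i
  refine ⟨span L⸨X⸩ (Set.range f), span L⟦X⟧ (Set.range f), ?_,
    fg_span (Set.finite_range f),
    fun m hm => mem_of_mem_span (fun s hs => subset_span hs) hm, absorbs_span _,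
    fun m hm => hD.isLeibniz.apply_mem_of_span subset_span ?_ hm⟩
  · rw [eq_top_iff]
    intro m _
    obtain ⟨n, hn⟩ := habs m trivial
    generalize hT : E ⊔ span L⸨X⸩ (Set.range f) = T
    have hle : E.restrictScalars L⟦X⟧ ⊔ span L⟦X⟧ (Set.range e)
        ≤ T.restrictScalars L⟦X⟧ := by
      subst hT
      refine sup_le (fun _ h => mem_sup_left (S := E) h) (span_le.2 ?_)
      rintro _ ⟨i, rfl⟩
      rw [← add_sub_cancel_right (e i) (u i)]
      exact sub_mem (mem_sup_right (subset_span ⟨i, rfl⟩)) (mem_sup_left (hu i))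
    have := T.smul_mem (tpow L (-n)) (hle hn)
    rwa [← tpow_natCast_smul, tpow_neg_smul_smul] at this
  · rintro _ ⟨i, rfl⟩
    have : D (f i) = ∑ j, A i j • f j := by
      have h1 := hsol i
      rw [sub_eq_iff_eq_add] at h1
      simp only [f, map_add, ← hDe, ← hA, h1, smul_add, Finset.sum_add_distrib]
      abel
    rw [this]
    exact Submodule.sum_mem _ fun j _ => smul_mem _ _ (subset_span ⟨j, rfl⟩)

/-- The union of the modules `Λ + D Λ + ⋯ + D ^ i Λ`. -/
def chainSup (D : N →+ N) (Λ : Submodule L⟦X⟧ N) : Submodule L⟦X⟧ N := ⨆ i, chain L⟦X⟧ D Λ i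

lemma mem_chainSup {m : N} : m ∈ chainSup D Λ ↔ ∃ i, m ∈ chain L⟦X⟧ D Λ i :=
  Submodule.mem_iSup_of_directed _ (chain_mono.directed_le)

lemma apply_mem_chainSup {m : N} (h : m ∈ chainSup D Λ) : D m ∈ chainSup D Λ := by
  obtain ⟨i, hi⟩ := mem_chainSup.1 h
  exact mem_chainSup.2 ⟨_, apply_mem_chain hi⟩

lemma le_chainSup {m : N} (h : m ∈ Λ) : m ∈ chainSup D Λ := mem_chainSup.2 ⟨0, h⟩

lemma chainSup_le (hD : IsDer w D) {E : Submodule L⟦X⟧ N} (hle : ∀ m ∈ Λ, m ∈ E)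
    (h : ∀ m ∈ E, D m ∈ E) {m : N} (hm : m ∈ chainSup D Λ) : m ∈ E := by
  obtain ⟨i, hi⟩ := mem_chainSup.1 hm
  induction i generalizing m with
  | zero => exact hle m hi
  | succ i ih =>
    obtain ⟨a, ha, b, hb, rfl⟩ := (mem_chain_succ hD.isLeibniz).1 hi
    exact add_mem (ih (mem_chainSup.2 ⟨i, ha⟩) ha) (h _ (ih (mem_chainSup.2 ⟨i, hb⟩) hb))

/-- A finite dimensional space with a derivation is the sum of a stable subspace on which the
derivation is expansive and of a stable subspace that has a stable lattice. The first one is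
chosen of minimal dimension among the stable subspaces such that the quotient has a stable
lattice. -/
theorem exists_expansive_sup_stable [Module.Finite L⸨X⸩ N] (hD : IsDer w D) :
    ∃ (E F : Submodule L⸨X⸩ N) (Λ Λ' : Submodule L⟦X⟧ N), E ⊔ F = ⊤ ∧ (∀ m ∈ E, D m ∈ E) ∧
      Λ.FG ∧ (∀ m, m ∈ E ↔ m ∈ chainSup D Λ) ∧ IsStableLattice D F Λ' := by
  obtain ⟨E, ⟨Λ₀, hst, hfg, hder, habs⟩, hmin⟩ :=
    (wellFounded_lt (α := Submodule L⸨X⸩ N)).has_min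
      {E | ∃ Λ₀ : Submodule L⟦X⟧ N, (∀ m ∈ E, D m ∈ E) ∧ Λ₀.FG ∧
        (∀ m ∈ Λ₀, D m ∈ E.restrictScalars L⟦X⟧ ⊔ Λ₀) ∧
          Absorbs (E.restrictScalars L⟦X⟧ ⊔ Λ₀) (⊤ : Submodule L⸨X⸩ N)}
      ⟨⊤, ⊥, fun _ _ => trivial, Submodule.fg_bot, fun _ _ => mem_sup_left trivial,
        fun _ _ => ⟨0, mem_sup_left trivial⟩⟩
  obtain ⟨Λ, hΛ, hΛE, hΛabs⟩ := exists_lattice E (IsNoetherian.noetherian E)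
  have hleE : ∀ m ∈ chainSup D Λ, m ∈ E := fun m hm =>
    chainSup_le hD (E := E.restrictScalars L⟦X⟧) hΛE hst hm
  have hchain : ∀ m, m ∈ E ↔ m ∈ chainSup D Λ := by
    by_contra hcon
    -- otherwise the largest subspace of the union of the chain is a smaller candidate
    refine hmin (divPart (chainSup D Λ)) ?_ (lt_of_le_of_ne (fun m hm => hleE m (divPart_le hm))
      fun heq => hcon fun m => ⟨fun hm => divPart_le (heq ▸ hm), hleE m⟩)
    obtain ⟨Λ₁, hΛ₁le, hΛ₁fg, hΛ₁⟩ := exists_le_divPart_sup (chainSup D Λ)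
    -- a power of `X` bringing the `E`-components of `D Λ₀` into the union of the chain
    obtain ⟨n, hn⟩ : ∃ n : ℕ, ∀ m ∈ Λ₀, D m ∈ shift (-n) (chainSup D Λ) ⊔ Λ₀ := by
      obtain ⟨S, rfl⟩ := hfg
      choose! a ha b hb e using fun m hm => mem_sup.1 (hder m hm)
      choose! f hf using hΛabs
      refine ⟨S.sup fun s => f (a s), fun m hm => hD.isLeibniz.apply_mem_of_span
        (fun s hs => mem_sup_right (subset_span hs)) (fun s hs => ?_) hm⟩
      rw [← e s (subset_span hs)]
      refine add_mem_sup (mem_shift.2 ?_) (hb s (subset_span hs))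
      rw [neg_neg, tpow_natCast_smul]
      exact le_chainSup (pow_smul_mem_of_le (Finset.le_sup (f := fun s => f (a s)) hs)
        (hf _ (ha s (subset_span hs))))
    have hCst := fun i => hD.shift_stable (fun _ => apply_mem_chainSup (D := D) (Λ := Λ)) i
    have hΛC : Λ ≤ chainSup D Λ := fun _ => le_chainSup
    generalize chainSup D Λ = C at *
    have hC : shift (-n) C ⊔ Λ₀ ≤ (divPart C).restrictScalars L⟦X⟧ ⊔ (shift (-n) Λ₁ ⊔ Λ₀) := by
      refine sup_le ?_ (le_sup_right.trans le_sup_right)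
      rintro _ ⟨x, hx, rfl⟩
      obtain ⟨a, ha, b, hb, rfl⟩ := mem_sup.1 (hΛ₁ hx)
      rw [map_add]
      exact add_mem_sup (smul_mem (divPart C) (tpow L (-n)) ha)
        (mem_sup_left (tpow_smul_mem_shift hb))
    refine ⟨shift (-n) Λ₁ ⊔ Λ₀, fun m hm i => mem_shift.1 (hCst i m (mem_shift.2 (hm i))),
      (shift_fg hΛ₁fg _).sup hfg, fun m hm => hC ?_, fun m _ => ?_⟩
    · obtain ⟨x, hx, y, hy, rfl⟩ := mem_sup.1 hm
      rw [map_add]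
      exact add_mem (mem_sup_left (hCst _ _ (Submodule.map_mono hΛ₁le hx))) (hn y hy)
    · obtain ⟨p, hp⟩ := habs m trivial
      obtain ⟨a, ha, b, hb, e⟩ := mem_sup.1 hp
      obtain ⟨q, hq⟩ := hΛabs a ha
      refine ⟨q + p, hC ?_⟩
      rw [pow_add, mul_smul, ← e, smul_add]
      refine add_mem_sup (mem_shift.2 ?_) (smul_mem _ _ hb)
      rw [neg_neg, tpow_natCast_smul]
      exact smul_mem _ _ (hΛC hq)
  obtain ⟨i, hi⟩ := exists_isExpansive hD hΛ (IsNoetherian.noetherian E)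
    fun m => (hchain m).trans mem_chainSup
  obtain ⟨F, Λ', hEF, hF⟩ := exists_stable_complement hi hD hfg hder habs
  exact ⟨E, F, Λ, Λ', hEF, hst, hΛ, hchain, hF⟩

end Splitting

/-! ### The decomposition at infinity -/

section Calculus

variable {L : Type u} [Field L] {N : Type*} [AddCommGroup N] [Module L⸨X⸩ N] [Module L⟦X⟧ N]
  [IsScalarTower L⟦X⟧ L⸨X⸩ N] {D : N →+ N} {ρ : L[X] →+* AddMonoid.End N}
  {F : Submodule L⸨X⸩ N} {Λ : Submodule L⟦X⟧ N}

/-- `ρ` is the functional calculus `f ↦ f(-D)`. -/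
structure IsCalculus (D : N →+ N) (ρ : L[X] →+* AddMonoid.End N) : Prop where
  const : ∀ a m, ρ (C a) m = (PowerSeries.C a : L⟦X⟧) • m
  var : ∀ m, ρ X m = - D m

lemma calculus_mul (p q : L[X]) (m : N) : ρ (p * q) m = ρ p (ρ q m) := by rw [map_mul]; rfl

lemma calculus_add (p q : L[X]) (m : N) : ρ (p + q) m = ρ p m + ρ q m := by rw [map_add]; rfl

lemma calculus_sub (p q : L[X]) (m : N) : ρ (p - q) m = ρ p m - ρ q m := by rw [map_sub]; rfl

lemma calculus_one (m : N) : ρ 1 m = m := by rw [map_one]; rfl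

lemma calculus_comm (p q : L[X]) (m : N) : ρ p (ρ q m) = ρ q (ρ p m) := by
  rw [← calculus_mul, mul_comm, calculus_mul]

lemma IsCalculus.mem (h : IsCalculus D ρ) {S : AddSubgroup N}
    (hC : ∀ (a : L), ∀ m ∈ S, (PowerSeries.C a : L⟦X⟧) • m ∈ S) (hS : ∀ m ∈ S, D m ∈ S)
    (p : L[X]) : ∀ m ∈ S, ρ p m ∈ S := by
  induction p using Polynomial.induction_on with
  | C a => intro m hm; rw [h.const]; exact hC a m hm
  | add p q hp hq => intro m hm; rw [calculus_add]; exact add_mem (hp m hm) (hq m hm)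
  | monomial n a ih =>
    intro m hm
    rw [pow_succ, ← mul_assoc, calculus_mul, h.var]
    exact ih _ (neg_mem (hS m hm))

lemma IsCalculus.apply_mem (h : IsCalculus D ρ) (hst : ∀ m ∈ Λ, D m ∈ Λ) (p : L[X]) {m : N}
    (hm : m ∈ Λ) : ρ p m ∈ Λ :=
  h.mem (S := Λ.toAddSubgroup) (fun _ _ hm => Λ.smul_mem _ hm) hst p m hm

lemma IsStableLattice.calculus (hΛ : IsStableLattice D F Λ) (h : IsCalculus D ρ) (p : L[X])
    {m : N} (hm : m ∈ Λ) : ρ p m ∈ Λ := h.apply_mem hΛ.stable p hm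

lemma calculus_mem_space (h : IsCalculus D ρ) (hF : ∀ m ∈ F, D m ∈ F) (p : L[X])
    {m : N} (hm : m ∈ F) : ρ p m ∈ F :=
  h.mem (S := F.toAddSubgroup) (fun a m hm => by
      rw [← algebraMap_smul L⸨X⸩]
      exact F.smul_mem _ hm) hF p m hm

lemma shift_le_of_le {a b : ℤ} (h : a ≤ b) {m : N} (hm : m ∈ shift b Λ) : m ∈ shift a Λ := by
  obtain ⟨n, rfl⟩ := Int.le.dest h
  rw [mem_shift] at hm ⊢
  have := Λ.smul_mem (ϖ L ^ n) hm
  rw [← tpow_natCast_smul, tpow_smul_smul] at this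
  convert this using 3
  ring

lemma mem_shift_zero {m : N} : m ∈ shift 0 Λ ↔ m ∈ Λ := by rw [mem_shift]; simp

lemma tpow_smul_mem_shift_iff {a b : ℤ} {m : N} :
    tpow L a • m ∈ shift (a + b) Λ ↔ m ∈ shift b Λ := by
  rw [mem_shift, mem_shift, tpow_smul_smul]
  ring

lemma adicFil_eq_shift (n : ℕ) {m : N} : m ∈ adicFil Λ n ↔ m ∈ shift n Λ := by
  rw [mem_adicFil_iff_shift, mem_shift]

lemma Absorbs.exists_mem_shift (h : Absorbs Λ F) {m : N} (hm : m ∈ F) :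
    ∃ e : ℕ, m ∈ shift (-e) Λ := by
  obtain ⟨n, hn⟩ := h m hm
  exact ⟨n, by rwa [mem_shift, neg_neg, tpow_natCast_smul]⟩

lemma eq_zero_of_mem_shift (hΛ : Λ.FG) {m : N} (h : ∀ n : ℕ, m ∈ shift n Λ) : m = 0 :=
  adicFil_separated hΛ m fun n => (adicFil_eq_shift n).2 (h n)

variable {w : L⟦X⟧}

lemma IsStableLattice.space_stable (hΛ : IsStableLattice D F Λ) (hD : IsDer w D) :
    ∀ m ∈ F, D m ∈ F :=
  hD.stable_of_absorbs hΛ.absorbs fun m hm => hΛ.le _ (hΛ.stable m hm)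

protected lemma IsStableLattice.shift (hΛ : IsStableLattice D F Λ) (hD : IsDer w D) (n : ℤ) :
    IsStableLattice D F (shift n Λ) where
  fg := shift_fg hΛ.fg n
  le m hm := by
    have := F.smul_mem (tpow L n) (hΛ.le _ (mem_shift.1 hm))
    rwa [tpow_smul_neg_smul] at this
  absorbs m hm := by
    obtain ⟨k, hk⟩ := hΛ.absorbs _ (F.smul_mem (tpow L (-n)) hm)
    exact ⟨k, mem_shift.2 (by rwa [tpow_smul_comm])⟩
  stable := hD.shift_stable hΛ.stable n

protected lemma IsDer.tpow_smul_smul' (hD : IsDer (-ϖ L) D) (c : ℤ) (b : L⟦X⟧) :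
    ∃ b' : L⟦X⟧, ∀ m, D (tpow L c • b • m)
      = tpow L c • b • D m + tpow L (c + 1) • b' • m := by
  refine ⟨-(PowerSeries.X * b′) - c • b, fun m => ?_⟩
  have h1 := hD (algebraMap L⟦X⟧ L⸨X⸩ b) m
  rw [algebraMap_deriv, ← map_mul, algebraMap_smul, algebraMap_smul, algebraMap_smul] at h1
  rw [hD.tpow, h1, ← tpow_smul_smul c 1, tpow_one_smul, ← smul_add, smul_smul PowerSeries.X,
    smul_smul, add_comm _ (b • D m), add_assoc, ← add_smul]
  congr 4
  simp only [zsmul_eq_mul]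
  ring

lemma IsCalculus.apply_mem_shift (h : IsCalculus D ρ) (hD : IsDer w D) (hst : ∀ m ∈ Λ, D m ∈ Λ)
    (n : ℤ) (p : L[X]) {m : N} (hm : m ∈ shift n Λ) : ρ p m ∈ shift n Λ :=
  h.apply_mem (hD.shift_stable hst n) p hm

/-- Multiplication by a Laurent series commutes with the calculus up to higher powers of `X`. -/
lemma IsCalculus.tpow_smul_sub_mem (h : IsCalculus D ρ) (hD : IsDer (-ϖ L) D)
    (hst : ∀ m ∈ Λ, D m ∈ Λ) (p : L[X]) : ∀ (c : ℤ) (b : L⟦X⟧), ∀ m ∈ Λ,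
      ρ p (tpow L c • b • m) - tpow L c • b • ρ p m ∈ shift (c + 1) Λ := by
  induction p using Polynomial.induction_on with
  | C a =>
    intro c b m _
    rw [h.const, h.const, smul_comm _ (tpow L c), smul_comm _ b, sub_self]
    exact zero_mem _
  | add p q hp hq =>
    intro c b m hm
    rw [calculus_add, calculus_add, smul_add, smul_add, add_sub_add_comm]
    exact add_mem (hp c b m hm) (hq c b m hm)
  | monomial n a ih =>
    intro c b m hm
    obtain ⟨b', hb'⟩ := hD.tpow_smul_smul' c b
    rw [pow_succ, ← mul_assoc]
    generalize C a * X ^ n = q at ih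
    rw [calculus_mul, calculus_mul, h.var, h.var, hb', neg_add, map_add, ← smul_neg, ← smul_neg,
      add_sub_right_comm]
    exact add_mem (ih c b _ (neg_mem (hst m hm))) (h.apply_mem_shift hD hst _ _
      (neg_mem (tpow_smul_mem_shift (Λ.smul_mem _ hm))))

lemma IsCalculus.smul_sub_mem (h : IsCalculus D ρ) (hD : IsDer (-ϖ L) D)
    (hst : ∀ m ∈ Λ, D m ∈ Λ) (p : L[X]) (b : L⟦X⟧) {m : N} (hm : m ∈ Λ) :
    ρ p (b • m) - b • ρ p m ∈ shift 1 Λ := by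
  simpa using h.tpow_smul_sub_mem hD hst p 0 b m hm

lemma IsCalculus.apply_mem_of_span (h : IsCalculus D ρ) (hD : IsDer (-ϖ L) D)
    (hst : ∀ m ∈ Λ, D m ∈ Λ) (p : L[X]) {S : Set N} (hS : S ⊆ Λ)
    (hp : ∀ s ∈ S, ρ p s ∈ shift 1 Λ) {m : N} (hm : m ∈ span L⟦X⟧ S) :
    ρ p m ∈ shift 1 Λ := by
  refine span_induction hp (by rw [map_zero]; exact zero_mem _)
    (fun x y _ _ hx hy => by rw [map_add]; exact add_mem hx hy) (fun a x hx' hx => ?_) hm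
  rw [← sub_add_cancel (ρ p (a • x)) (a • ρ p x)]
  exact add_mem (h.smul_sub_mem hD hst p a (span_le.2 hS hx')) (smul_mem _ _ hx)

/-- If `g(-D)` maps `Λ` to `X Λ`, then its powers tend to zero. -/
lemma IsCalculus.pow_apply_mem (h : IsCalculus D ρ) (hD : IsDer (-ϖ L) D)
    (hst : ∀ m ∈ Λ, D m ∈ Λ) {g : L[X]} (hg : ∀ m ∈ Λ, ρ g m ∈ shift 1 Λ) (c : ℤ) (n : ℕ) :
    ∀ m ∈ shift c Λ, ρ (g ^ n) m ∈ shift (c + n) Λ := by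
  have key : ∀ c : ℤ, ∀ m ∈ shift c Λ, ρ g m ∈ shift (c + 1) Λ := by
    rintro c _ ⟨y, hy, rfl⟩
    have := add_mem (h.tpow_smul_sub_mem hD hst g c 1 y hy)
      (tpow_smul_mem_shift_iff.2 (hg y hy) : tpow L c • ρ g y ∈ _)
    rw [one_smul, one_smul, sub_add_cancel] at this
    exact this
  induction n with
  | zero => intro m hm; rw [pow_zero, calculus_one]; simpa using hm
  | succ n ih =>
    intro m hm
    rw [pow_succ', calculus_mul, Nat.cast_succ, ← add_assoc]
    exact key _ _ (ih m hm)

/-- The operator induced by `D` on the fibre `Λ / X Λ` is algebraic. -/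
lemma IsStableLattice.exists_annihilator (hΛ : IsStableLattice D F Λ)
    (hD : IsDer (-ϖ L) D) (h : IsCalculus D ρ) :
    ∃ g : L[X], g ≠ 0 ∧ ∀ m ∈ Λ, ρ g m ∈ shift 1 Λ := by
  obtain ⟨ι, _, v, -, hvs⟩ := exists_span_mod_adic hΛ.fg 1
  have key : ∀ m ∈ Λ, ∃ g : L[X], g ≠ 0 ∧ ρ g m ∈ shift 1 Λ := by
    intro m hm
    choose c hc using fun j : Fin (Fintype.card ι + 1) => hvs _ (h.apply_mem hΛ.stable (X ^ j.1) hm)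
    -- the coordinates modulo `X` of the first powers of `-D` on `m` are linearly dependent
    obtain ⟨a, ha, ha0⟩ := (Submodule.ne_bot_iff _).1 (LinearMap.ker_ne_bot_of_finrank_lt
      (f := Fintype.linearCombination L c) (by simp))
    refine ⟨∑ j, C (a j) * X ^ j.1, fun h0 => ha0 (funext fun i => ?_), ?_⟩
    · have := congrArg (coeff · i) h0
      simpa [finsetSum_coeff, coeff_X_pow, Fin.val_inj] using this
    · have e : ρ (∑ j, C (a j) * X ^ j.1) m = ∑ j, PowerSeries.C (a j) •
          (ρ (X ^ j.1) m - ∑ i, (PowerSeries.C (c j i) : L⟦X⟧) • v i) := by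
        have h0 : ∑ j, (PowerSeries.C (a j) : L⟦X⟧) • ∑ i, (PowerSeries.C (c j i) : L⟦X⟧) • v i
            = 0 := by
          simp only [smul_sum, smul_smul, ← map_mul]
          rw [Finset.sum_comm]
          refine Finset.sum_eq_zero fun i _ => ?_
          rw [← sum_smul, ← map_sum]
          have := congrFun ha i
          simp only [Fintype.linearCombination_apply, Finset.sum_apply, Pi.smul_apply,
            smul_eq_mul, Pi.zero_apply] at this
          rw [this, map_zero, zero_smul]
        simp only [smul_sub, Finset.sum_sub_distrib, h0, sub_zero]
        rw [map_sum]
        refine (AddMonoidHom.finsetSum_apply _ _ _).trans (sum_congr rfl fun j _ => ?_)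
        exact (calculus_mul _ _ _).trans (h.const _ _)
      rw [e]
      exact Submodule.sum_mem _ fun j _ => smul_mem _ _ ((adicFil_eq_shift 1).1 (hc j))
  obtain ⟨S, hS⟩ := hΛ.fg
  have hS' : ∀ s ∈ S, s ∈ Λ := fun s hs => hS ▸ subset_span hs
  choose! f hf0 hf using key
  refine ⟨∏ s ∈ S, f s, Finset.prod_ne_zero_iff.2 fun s hs => hf0 s (hS' s hs),
    fun m hm => h.apply_mem_of_span hD hΛ.stable _ hS' (fun s hs => ?_) (hS ▸ hm)⟩
  obtain ⟨q, hq⟩ := Finset.dvd_prod_of_mem f hs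
  rw [hq, mul_comm, calculus_mul]
  exact h.apply_mem_shift hD hΛ.stable 1 _ (hf s (hS' s hs))

/-- The additive group of the vectors that powers of `g(-D)` bring into a given lattice. -/
def nullGroup (ρ : L[X] →+* AddMonoid.End N) (g : L[X]) (Λ : Submodule L⟦X⟧ N)
    (hΛ : ∀ p : L[X], ∀ m ∈ Λ, ρ p m ∈ Λ) : AddSubgroup N where
  carrier := {m | ∃ j, ρ (g ^ j) m ∈ Λ}
  zero_mem' := ⟨0, by rw [map_zero]; exact zero_mem _⟩
  add_mem' := by
    rintro a b ⟨i, hi⟩ ⟨j, hj⟩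
    refine ⟨i + j, ?_⟩
    rw [map_add, pow_add]
    refine add_mem ?_ ?_
    · rw [mul_comm, calculus_mul]; exact hΛ _ _ hi
    · rw [calculus_mul]; exact hΛ _ _ hj
  neg_mem' := by
    rintro a ⟨i, hi⟩
    exact ⟨i, by rw [map_neg]; exact neg_mem hi⟩

/-- The vectors `m` of `F` such that `g(-D)^j m` tends to zero. They form a subspace since
commutators with powers of `X` gain powers of `X`. -/
lemma exists_nullSpace (hΛ : IsStableLattice D F Λ) (hD : IsDer (-ϖ L) D)
    (h : IsCalculus D ρ) (g : L[X]) :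
    ∃ F' : Submodule L⸨X⸩ N, ∀ m, m ∈ F' ↔ m ∈ F ∧ ∀ n : ℤ, ∃ j, ρ (g ^ j) m ∈ shift n Λ := by
  have hst := fun n p m hm => h.apply_mem_shift hD hΛ.stable n p (m := m) hm
  let G : ℤ → AddSubgroup N := fun n => nullGroup ρ g (shift n Λ) (hst n)
  have hGρ : ∀ n p m, m ∈ G n → ρ p m ∈ G n := by
    rintro n p m ⟨j, hj⟩
    exact ⟨j, by rw [calculus_comm]; exact hst n p _ hj⟩
  have hGpow : ∀ n j m, ρ (g ^ j) m ∈ G n → m ∈ G n := by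
    rintro n j m ⟨i, hi⟩
    exact ⟨i + j, by rwa [pow_add, calculus_mul]⟩
  have hG0 : ∀ n m, m ∈ shift n Λ → m ∈ G n := fun n m hm => ⟨0, by rwa [pow_zero, calculus_one]⟩
  have hsmul : ∀ e : ℕ, ∀ m ∈ shift (-e) Λ, (∀ n, m ∈ G n) →
      ∀ (n c : ℤ) (b : L⟦X⟧), tpow L c • b • m ∈ G n := by
    intro e m₀ hm₀ hmG₀ n c b₀
    let Z : Set N := {m | m ∈ shift (-e) Λ ∧ ∀ n, m ∈ G n}
    have hU : ∀ m ∈ span L⟦X⟧ Z, D m ∈ span L⟦X⟧ Z := fun m =>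
      hD.isLeibniz.apply_mem_of_span subset_span fun s hs => by
        rw [← neg_neg (D s), ← h.var]
        exact neg_mem (subset_span ⟨hst _ _ _ hs.1, fun n => hGρ _ _ _ (hs.2 n)⟩)
    -- descending induction on `c`
    have key : ∀ (k : ℕ) (c : ℤ), n + e - k ≤ c → ∀ u ∈ shift c (span L⟦X⟧ Z), u ∈ G n := by
      intro k
      induction k with
      | zero =>
        rintro c hc _ ⟨u, hu, rfl⟩
        exact hG0 _ _ (shift_le_of_le (b := c + -e) (by push_cast at hc; omega)
          (tpow_smul_mem_shift_iff.2 (span_le.2 (fun s hs => hs.1) hu)))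
      | succ k ih =>
        rintro c hc _ ⟨u, hu, rfl⟩
        refine Submodule.closure_induction (p := fun u _ => tpow L c • u ∈ G n)
          (by rw [smul_zero]; exact zero_mem _)
          (fun x y _ _ hx hy => by rw [smul_add]; exact add_mem hx hy) (fun b z hz => ?_) hu
        obtain ⟨j, hj⟩ := hz.2 (n - c)
        refine hGpow n j _ ?_
        rw [← sub_add_cancel (ρ (g ^ j) (tpow L c • b • z)) (tpow L c • b • ρ (g ^ j) z)]
        refine add_mem (ih (c + 1) (by push_cast at hc; omega) _
          (h.tpow_smul_sub_mem hD hU (g ^ j) c b z (subset_span hz))) (hG0 _ _ ?_)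
        have := (tpow_smul_mem_shift_iff (a := c)).2 (smul_mem _ b hj)
        rwa [add_sub_cancel] at this
    exact key (n + e - c).toNat c (by omega) _
      (tpow_smul_mem_shift (smul_mem _ b₀ (subset_span ⟨hm₀, hmG₀⟩)))
  refine ⟨{ carrier := {m | m ∈ F ∧ ∀ n, m ∈ G n}
            add_mem' := fun ha hb => ⟨add_mem ha.1 hb.1, fun n => add_mem (ha.2 n) (hb.2 n)⟩
            zero_mem' := ⟨zero_mem _, fun n => zero_mem _⟩
            smul_mem' := fun a m hm => ⟨F.smul_mem _ hm.1, fun n => ?_⟩ }, fun m => Iff.rfl⟩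
  obtain ⟨i, b, hb⟩ := exists_tpow_mul_mem a
  obtain ⟨e, he⟩ := hΛ.absorbs.exists_mem_shift hm.1
  have e1 : a • m = tpow L (-i) • b • m := by
    rw [← algebraMap_smul L⸨X⸩ b, ← hb, mul_smul, tpow_neg_smul_smul]
  exact e1 ▸ hsmul e m he hm.2 n _ b

/-- The subspace `F` has a stable lattice on which `D` is, up to sign and topologically nilpotent
operators, the point `x`. -/
def IsPunctualAt (D : N →+ N) (ρ : L[X] →+* AddMonoid.End N) (x : ClosedPoint L)
    (F : Submodule L⸨X⸩ N) : Prop :=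
  ∃ Λ, IsStableLattice D F Λ ∧ ∀ f ∈ x.asIdeal, ∃ j : ℕ, ∀ m ∈ Λ, ρ (f ^ j) m ∈ shift 1 Λ

/-- The subspace `F` is generated by a lattice and the derivation. -/
def IsIrregular (D : N →+ N) (F : Submodule L⸨X⸩ N) : Prop :=
  (∀ m ∈ F, D m ∈ F) ∧ ∃ Λ : Submodule L⟦X⟧ N, Λ.FG ∧ ∀ m, m ∈ F ↔ m ∈ chainSup D Λ

/-- The types of subspaces in the decomposition at infinity. -/
def IsPiece (D : N →+ N) (ρ : L[X] →+* AddMonoid.End N) :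
    Option (ClosedPoint L) → Submodule L⸨X⸩ N → Prop
  | none, F => IsIrregular D F
  | some x, F => IsPunctualAt D ρ x F

/-- For coprime `g₁`, `g₂`, a lattice on which `g₁ g₂` is nilpotent modulo `X` splits. -/
lemma exists_coprime_splitting (hΛ : IsStableLattice D F Λ)
    (hD : IsDer (-ϖ L) D) (h : IsCalculus D ρ) {g₁ g₂ : L[X]}
    (hg : IsCoprime g₁ g₂) (hgΛ : ∀ m ∈ Λ, ρ (g₁ * g₂) m ∈ shift 1 Λ) :
    ∀ m ∈ Λ, ∃ y, y ∈ Λ ∧ (∀ n : ℕ, ρ (g₁ ^ n) y ∈ shift n Λ) ∧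
      ∀ n : ℕ, ρ (g₂ ^ n) (m - y) ∈ shift n Λ := by
  intro m hm
  have hst := fun n p m hm => h.apply_mem_shift hD hΛ.stable n p (m := m) hm
  have hpow : ∀ (n : ℕ) p, (g₁ * g₂) ^ n ∣ p → ρ p m ∈ shift n Λ := by
    rintro n _ ⟨q, rfl⟩
    have := h.pow_apply_mem hD hΛ.stable hgΛ 0 n m (mem_shift_zero.2 hm)
    rw [zero_add] at this
    rw [mul_comm, calculus_mul]
    exact hst _ _ _ this
  have he : ∀ n : ℕ, ∃ e : L[X], g₂ ^ n ∣ e ∧ g₁ ^ n ∣ 1 - e := fun n => by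
    obtain ⟨a, b, hab⟩ := hg.pow (m := n) (n := n)
    exact ⟨b * g₂ ^ n, dvd_mul_left _ _, a, by rw [← hab]; ring⟩
  choose e he2 he1 using he
  obtain ⟨y, hy⟩ := adicFil_complete hΛ.fg (fun n => ρ (e n) m) fun n => by
    rw [adicFil_eq_shift, ← calculus_sub]
    refine hpow n _ ?_
    rw [mul_pow]
    refine hg.pow.mul_dvd ?_ (dvd_sub ((pow_dvd_pow _ n.le_succ).trans (he2 (n + 1))) (he2 n))
    have := dvd_sub (he1 n) ((pow_dvd_pow _ n.le_succ).trans (he1 (n + 1)))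
    rwa [sub_sub_sub_cancel_left] at this
  have hy' : ∀ n : ℕ, y - ρ (e n) m ∈ shift n Λ := fun n => (adicFil_eq_shift n).1 (hy n)
  refine ⟨y, ?_, fun n => ?_, fun n => ?_⟩
  · have := add_mem (mem_shift_zero.1 (hy' 0)) (h.apply_mem hΛ.stable (e 0) hm)
    rwa [sub_add_cancel] at this
  · rw [← sub_add_cancel y (ρ (e n) m), map_add, ← calculus_mul]
    exact add_mem (hst _ _ _ (hy' n)) (hpow n _ (mul_pow g₁ g₂ n ▸ mul_dvd_mul_left _ (he2 n)))
  · have e1 : m - y = ρ (1 - e n) m - (y - ρ (e n) m) := by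
      rw [calculus_sub, calculus_one]; abel
    rw [e1, map_sub, ← calculus_mul]
    exact sub_mem (hpow n _ (by rw [mul_pow, mul_comm]; exact mul_dvd_mul_left _ (he1 n)))
      (hst _ _ _ (hy' n))

/-- The part of `F` on which `g(-D)` is topologically nilpotent has a stable lattice. -/
lemma exists_nullLattice (hΛ : IsStableLattice D F Λ) (hD : IsDer (-ϖ L) D)
    (h : IsCalculus D ρ) (g : L[X]) :
    ∃ (F' : Submodule L⸨X⸩ N) (Λ' : Submodule L⟦X⟧ N),
      (∀ m, m ∈ F' ↔ m ∈ F ∧ ∀ n : ℤ, ∃ j, ρ (g ^ j) m ∈ shift n Λ) ∧ IsStableLattice D F' Λ' ∧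
      ∃ j, ∀ m ∈ Λ', ρ (g ^ j) m ∈ shift 1 Λ' := by
  obtain ⟨F', hF'⟩ := exists_nullSpace hΛ hD h g
  have hst := fun n p m hm => h.apply_mem_shift hD hΛ.stable n p (m := m) hm
  have hF'ρ : ∀ p, ∀ m ∈ F', ρ p m ∈ F' := fun p m hm => by
    rw [hF'] at hm ⊢
    exact ⟨calculus_mem_space h (hΛ.space_stable hD) p hm.1, fun n => (hm.2 n).imp fun j hj => by
      rw [calculus_comm]; exact hst _ _ _ hj⟩
  have hΛ' : IsStableLattice D F' (Λ ⊓ F'.restrictScalars L⟦X⟧) :=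
    ⟨Submodule.FG.of_le hΛ.fg inf_le_left, fun m hm => hm.2, fun m hm =>
      (hΛ.absorbs m ((hF' m).1 hm).1).imp fun n hn => ⟨hn, by
        rw [← tpow_natCast_smul]
        exact F'.smul_mem _ hm⟩, fun m hm => ⟨hΛ.stable m hm.1, by
        have := hF'ρ X m hm.2
        rw [h.var] at this
        exact neg_mem_iff.1 this⟩⟩
  refine ⟨F', _, hF', hΛ', ?_⟩
  obtain ⟨S, hS⟩ := hΛ'.fg
  have hS' : ∀ s ∈ S, s ∈ Λ ⊓ F'.restrictScalars L⟦X⟧ := fun s hs => hS ▸ subset_span hs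
  choose! f hf using fun s hs => ((hF' s).1 (hS' s hs).2).2 1
  refine ⟨S.sup f, fun m hm => mem_shift.2 ⟨mem_shift.1 (h.apply_mem_of_span hD hΛ.stable _
    (fun s hs => (hS' s hs).1) (fun s hs => ?_) (hS ▸ hm)), F'.smul_mem _ (hF'ρ _ _ hm.2)⟩⟩
  rw [← Nat.sub_add_cancel (Finset.le_sup (f := f) hs), pow_add, calculus_mul]
  exact hst _ _ _ (hf s hs)

lemma IsStableLattice.le_sSup_punctual (hΛ : IsStableLattice D F Λ)
    (hD : IsDer (-ϖ L) D) (h : IsCalculus D ρ) :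
    F ≤ sSup {F | ∃ x, IsPunctualAt D ρ x F} := by
  obtain ⟨g, hg0, hg⟩ := hΛ.exists_annihilator hD h
  replace hg : ∃ k, ∀ m ∈ Λ, ρ (g ^ k) m ∈ shift 1 Λ := ⟨1, by rwa [pow_one]⟩
  induction g using UniqueFactorizationMonoid.induction_on_coprime generalizing F Λ with
  | h0 => exact absurd rfl hg0
  | h1 hu =>
    rename_i u
    obtain ⟨k, hg⟩ := hg
    obtain ⟨v, hv⟩ := (hu.pow k).exists_left_inv
    intro m hm
    obtain ⟨n, hn⟩ := hΛ.absorbs m hm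
    have h1 := eq_zero_of_mem_shift hΛ.fg fun i => by
      have := h.apply_mem_shift hD hΛ.stable _ (v ^ i)
        (h.pow_apply_mem hD hΛ.stable hg 0 i _ (mem_shift_zero.2 hn))
      rwa [zero_add, ← calculus_mul, ← mul_pow, hv, one_pow, calculus_one] at this
    rw [← tpow_neg_smul_smul (L := L) n m, tpow_natCast_smul, h1, smul_zero]
    exact zero_mem _
  | hpr i hp =>
    rename_i p
    obtain ⟨k, hg⟩ := hg
    have hmax : (Ideal.span {p}).IsMaximal :=
      PrincipalIdealRing.isMaximal_of_irreducible hp.irreducible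
    refine le_sSup ⟨⟨Ideal.span {p}, hmax⟩, Λ, hΛ, fun f hf => ⟨i * k, fun m hm => ?_⟩⟩
    obtain ⟨q, rfl⟩ := Ideal.mem_span_singleton.1 hf
    rw [mul_pow, mul_comm, calculus_mul]
    exact h.apply_mem_shift hD hΛ.stable 1 _ (by rw [pow_mul]; exact hg m hm)
  | hcp hcop h1 h2 =>
    rename_i g₁ g₂
    obtain ⟨k, hg⟩ := hg
    obtain ⟨F₁, Λ₁, hF₁, hΛ₁, j₁, hj₁⟩ := exists_nullLattice hΛ hD h g₁
    obtain ⟨F₂, Λ₂, hF₂, hΛ₂, j₂, hj₂⟩ := exists_nullLattice hΛ hD h g₂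
    have hl1 := h1 hΛ₁ (left_ne_zero_of_mul hg0) ⟨j₁, hj₁⟩
    have hl2 := h2 hΛ₂ (right_ne_zero_of_mul hg0) ⟨j₂, hj₂⟩
    have hint : ∀ g : L[X], ∀ y, (∀ n : ℕ, ρ ((g ^ k) ^ n) y ∈ shift n Λ) →
        ∀ n : ℤ, ∃ j, ρ (g ^ j) y ∈ shift n Λ := fun g y hy n =>
      ⟨k * n.toNat, by rw [pow_mul]; exact shift_le_of_le (Int.self_le_toNat n) (hy _)⟩
    intro m hm
    obtain ⟨n, hn⟩ := hΛ.absorbs m hm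
    obtain ⟨y, hy, hy1, hy2⟩ := exists_coprime_splitting hΛ hD h
      (hcop.isCoprime.pow (m := k) (n := k)) (by rwa [← mul_pow]) _ hn
    have e1 : m = tpow L (-n) • y + tpow L (-n) • (ϖ L ^ n • m - y) := by
      rw [← smul_add, add_sub_cancel, ← tpow_natCast_smul, tpow_neg_smul_smul]
    rw [e1]
    refine add_mem (smul_mem _ _ (hl1 ((hF₁ _).2 ⟨hΛ.le _ hy, hint _ _ hy1⟩)))
      (smul_mem _ _ (hl2 ((hF₂ _).2 ⟨sub_mem (hΛ.le _ hn) (hΛ.le _ hy), hint _ _ hy2⟩)))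

/-- A finite dimensional space with a derivation is the sum of subspaces of the various types. -/
theorem sSup_isPiece_eq_top [Module.Finite L⸨X⸩ N] (hD : IsDer (-ϖ L) D)
    (h : IsCalculus D ρ) : sSup {F | ∃ o, IsPiece D ρ o F} = ⊤ := by
  obtain ⟨E, F, Λ, Λ', hEF, hE, hΛ, hΛE, hΛ'⟩ := exists_expansive_sup_stable (N := N) hD
  rw [eq_top_iff, ← hEF]
  refine sup_le (le_sSup ⟨none, hE, Λ, hΛ, hΛE⟩) ((hΛ'.le_sSup_punctual hD h).trans ?_)
  exact sSup_le_sSup fun F ⟨x, hx⟩ => ⟨some x, hx⟩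

end Calculus

/-! ### Orthogonality of the pieces -/

section Orthogonality

variable {L : Type u} [Field L] {N : Type*} [AddCommGroup N] [Module L⸨X⸩ N] [Module L⟦X⟧ N]
  [IsScalarTower L⟦X⟧ L⸨X⸩ N] {D : N →+ N} {ρ : L[X] →+* AddMonoid.End N}
  {F : Submodule L⸨X⸩ N} {Λ : Submodule L⟦X⟧ N}
variable {L' : Type u} [Field L'] {N' : Type*} [AddCommGroup N'] [Module L'⸨X⸩ N']
  [Module L'⟦X⟧ N'] [IsScalarTower L'⟦X⟧ L'⸨X⸩ N'] {D' : N' →+ N'}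
  {ρ' : L'[X] →+* AddMonoid.End N'}

/-- `φ` is a semilinear map compatible with the derivations and with the functional calculi. -/
structure IsHorizontal (D : N →+ N) (ρ : L[X] →+* AddMonoid.End N) (D' : N' →+ N')
    (ρ' : L'[X] →+* AddMonoid.End N') (σ : L⟦X⟧ →+* L'⟦X⟧) (τ : L[X] →+* L'[X])
    (φ : N →+ N') : Prop where
  map_X : σ PowerSeries.X = PowerSeries.X
  smul : ∀ (a : L⟦X⟧) m, φ (a • m) = σ a • φ m
  del : ∀ m, φ (D m) = D' (φ m)
  calculus : ∀ p m, φ (ρ p m) = ρ' (τ p) (φ m)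

variable {σ : L⟦X⟧ →+* L'⟦X⟧} {τ : L[X] →+* L'[X]} {φ : N →+ N'}

namespace IsHorizontal

lemma iterate (h : IsHorizontal D ρ D' ρ' σ τ φ) (i : ℕ) (m : N) : φ (D^[i] m) = D'^[i] (φ m) :=
  Function.Semiconj.iterate_right (f := φ) h.del i m

lemma fg_span_image (h : IsHorizontal D ρ D' ρ' σ τ φ) (hΛ : Λ.FG) :
    (span L'⟦X⟧ (φ '' Λ)).FG := by
  obtain ⟨S, hS⟩ := hΛ
  let φ' : N →ₛₗ[σ] N' := { φ with map_smul' := h.smul }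
  refine .of_le (fg_span (S.finite_toSet.image φ)) (span_le.2
    (Set.image_subset_iff.2 fun m hm => (span_le (p := (span L'⟦X⟧
      (φ '' S)).comap φ')).2 (fun s hs => subset_span ?_) (hS ▸ hm)))
  exact Set.mem_image_of_mem φ hs

lemma stable_span_image (h : IsHorizontal D ρ D' ρ' σ τ φ) (hst : ∀ m ∈ Λ, D m ∈ Λ)
    (hD' : IsDer (-ϖ L') D') :
    ∀ m ∈ span L'⟦X⟧ (φ '' Λ), D' m ∈ span L'⟦X⟧ (φ '' Λ) := fun _ =>
  hD'.isLeibniz.apply_mem_of_span subset_span (by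
    rintro _ ⟨m, hm, rfl⟩
    exact h.del m ▸ subset_span ⟨_, hst m hm, rfl⟩)

protected lemma tpow (h : IsHorizontal D ρ D' ρ' σ τ φ) (n : ℤ) (m : N) :
    φ (tpow L n • m) = tpow L' n • φ m := by
  have key (n : ℕ) (m : N) : φ (tpow L n • m) = tpow L' n • φ m := by
    rw [tpow_natCast_smul, tpow_natCast_smul, h.smul, map_pow, h.map_X]
  obtain ⟨n, rfl | rfl⟩ := n.eq_nat_or_neg
  · exact key n m
  · have := congrArg (tpow L' (-n) • ·) (key n (tpow L (-n) • m))
    simp only [tpow_smul_neg_smul, tpow_neg_smul_smul] at this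
    exact this.symm

/-- The image of a finitely generated module is contained in a finitely generated one. -/
lemma map_le (h : IsHorizontal D ρ D' ρ' σ τ φ) (hΛ : Λ.FG) :
    ∃ Λ' : Submodule L'⟦X⟧ N', Λ'.FG ∧ (∀ m ∈ Λ, φ m ∈ Λ') ∧
      ((∀ m ∈ Λ, D m ∈ Λ) → IsDer (-ϖ L') D' → ∀ m ∈ Λ', D' m ∈ Λ') :=
  ⟨span L'⟦X⟧ (φ '' Λ), h.fg_span_image hΛ,
    fun m hm => subset_span ⟨m, hm, rfl⟩, h.stable_span_image⟩

lemma map_mem_shift (h : IsHorizontal D ρ D' ρ' σ τ φ) {Λ' : Submodule L'⟦X⟧ N'}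
    (hle : ∀ m ∈ Λ, φ m ∈ Λ') {n : ℤ} {m : N} (hm : m ∈ shift n Λ) : φ m ∈ shift n Λ' := by
  rw [mem_shift] at hm ⊢
  rw [← h.tpow]
  exact hle _ hm

end IsHorizontal

/-- `g(-D)^j m` tends to zero in a stable lattice. -/
def IsNull (D : N →+ N) (ρ : L[X] →+* AddMonoid.End N) (g : L[X]) (m : N) : Prop :=
  ∃ Λ : Submodule L⟦X⟧ N, Λ.FG ∧ (∀ m ∈ Λ, D m ∈ Λ) ∧ ∀ n : ℕ, ∃ j, ρ (g ^ j) m ∈ shift n Λ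

lemma isStableLattice_span (hΛ : Λ.FG) (hst : ∀ m ∈ Λ, D m ∈ Λ) :
    IsStableLattice D (span L⸨X⸩ (Λ : Set N)) Λ :=
  ⟨hΛ, fun _ hm => subset_span hm, by
    have := absorbs_span (L := L) (Λ : Set N)
    rwa [Submodule.span_eq] at this, hst⟩

lemma shift_mono {Λ' : Submodule L⟦X⟧ N} (hle : Λ ≤ Λ') {n : ℤ} {m : N} (hm : m ∈ shift n Λ) :
    m ∈ shift n Λ' := mem_shift.2 (hle (mem_shift.1 hm))

lemma sup_stable {R : Type*} [Semiring R] [Module R N] {Λ Λ' : Submodule R N}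
    (h : ∀ m ∈ Λ, D m ∈ Λ) (h' : ∀ m ∈ Λ', D m ∈ Λ') : ∀ m ∈ Λ ⊔ Λ', D m ∈ Λ ⊔ Λ' := by
  intro m hm
  obtain ⟨a, ha, b, hb, rfl⟩ := mem_sup.1 hm
  exact map_add D a b ▸ add_mem_sup (h a ha) (h' b hb)

namespace IsNull

lemma zero {g : L[X]} : IsNull D ρ g 0 :=
  ⟨⊥, Submodule.fg_bot, by simp, fun n => ⟨0, by rw [map_zero]; exact zero_mem _⟩⟩

lemma add (hD : IsDer (-ϖ L) D) (h : IsCalculus D ρ) {g₁ g₂ : L[X]} {m₁ m₂ : N}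
    (h₁ : IsNull D ρ g₁ m₁) (h₂ : IsNull D ρ g₂ m₂) : IsNull D ρ (g₁ * g₂) (m₁ + m₂) := by
  obtain ⟨Λ₁, hf₁, hs₁, h₁⟩ := h₁
  obtain ⟨Λ₂, hf₂, hs₂, h₂⟩ := h₂
  have hs := sup_stable hs₁ hs₂
  refine ⟨_, hf₁.sup hf₂, hs, fun n => ?_⟩
  obtain ⟨i, hi⟩ := h₁ n
  obtain ⟨j, hj⟩ := h₂ n
  refine ⟨i + j, map_add (ρ _) m₁ m₂ ▸ add_mem ?_ ?_⟩
  · rw [show (g₁ * g₂) ^ (i + j) = g₁ ^ j * g₂ ^ (i + j) * g₁ ^ i by ring, calculus_mul]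
    exact h.apply_mem_shift hD hs _ _ (shift_mono le_sup_left hi)
  · rw [show (g₁ * g₂) ^ (i + j) = g₁ ^ (i + j) * g₂ ^ i * g₂ ^ j by ring, calculus_mul]
    exact h.apply_mem_shift hD hs _ _ (shift_mono le_sup_right hj)

lemma eq_zero (hD : IsDer (-ϖ L) D) (h : IsCalculus D ρ) {g₁ g₂ : L[X]} {m : N}
    (h₁ : IsNull D ρ g₁ m) (h₂ : IsNull D ρ g₂ m) (hg : IsCoprime g₁ g₂) : m = 0 := by
  obtain ⟨Λ₁, hf₁, hs₁, h₁⟩ := h₁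
  obtain ⟨Λ₂, hf₂, hs₂, h₂⟩ := h₂
  have hs := sup_stable hs₁ hs₂
  refine eq_zero_of_mem_shift (hf₁.sup hf₂) fun n => ?_
  obtain ⟨i, hi⟩ := h₁ n
  obtain ⟨j, hj⟩ := h₂ n
  obtain ⟨a, b, hab⟩ := hg.pow (m := i) (n := j)
  rw [← calculus_one (ρ := ρ) m, ← hab, calculus_add, calculus_mul, calculus_mul]
  exact add_mem (h.apply_mem_shift hD hs _ _ (shift_mono le_sup_left hi))
    (h.apply_mem_shift hD hs _ _ (shift_mono le_sup_right hj))

lemma map (hh : IsHorizontal D ρ D' ρ' σ τ φ) (hD' : IsDer (-ϖ L') D')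
    {g : L[X]} {m : N} (h : IsNull D ρ g m) : IsNull D' ρ' (τ g) (φ m) := by
  obtain ⟨Λ, hf, hs, h⟩ := h
  obtain ⟨Λ', hf', hle, hs'⟩ := hh.map_le hf
  refine ⟨Λ', hf', hs' hs hD', fun n => ?_⟩
  obtain ⟨j, hj⟩ := h n
  exact ⟨j, by rw [← map_pow, ← hh.calculus]; exact hh.map_mem_shift hle hj⟩

end IsNull

lemma IsStableLattice.isNull (hΛ : IsStableLattice D F Λ)
    (hD : IsDer (-ϖ L) D) (h : IsCalculus D ρ) {g : L[X]} {j : ℕ}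
    (hg : ∀ m ∈ Λ, ρ (g ^ j) m ∈ shift 1 Λ) {m : N} (hm : m ∈ F) :
    IsNull D ρ g m := by
  refine ⟨Λ, hΛ.fg, hΛ.stable, fun n => ?_⟩
  obtain ⟨e, he⟩ := hΛ.absorbs.exists_mem_shift hm
  refine ⟨j * (e + n), pow_mul g j _ ▸ ?_⟩
  simpa using h.pow_apply_mem hD hΛ.stable hg _ (e + n) m he

lemma IsPunctualAt.isNull (hD : IsDer (-ϖ L) D) (h : IsCalculus D ρ)
    {x : ClosedPoint L} (hF : IsPunctualAt D ρ x F) {g : L[X]} (hg : g ∈ x.asIdeal) {m : N}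
    (hm : m ∈ F) : IsNull D ρ g m := by
  obtain ⟨Λ, hΛ, hx⟩ := hF
  obtain ⟨j, hj⟩ := hx g hg
  exact hΛ.isNull hD h hj hm

/-- The vector `m` is contained in a stable finitely generated module. -/
def IsBounded (D : N →+ N) (m : N) : Prop :=
  ∃ Λ : Submodule L⟦X⟧ N, Λ.FG ∧ (∀ m ∈ Λ, D m ∈ Λ) ∧ m ∈ Λ

lemma IsBounded.map (hh : IsHorizontal D ρ D' ρ' σ τ φ)
    (hD' : IsDer (-ϖ L') D')
    {m : N} (h : IsBounded (L := L) D m) : IsBounded (L := L') D' (φ m) := by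
  obtain ⟨Λ, hf, hs, h⟩ := h
  obtain ⟨Λ', hf', hle, hs'⟩ := hh.map_le hf
  exact ⟨Λ', hf', hs' hs hD', hle m h⟩

lemma IsStableLattice.isBounded (hΛ : IsStableLattice D F Λ)
    (hD : IsDer (-ϖ L) D) {m : N} (hm : m ∈ F) : IsBounded (L := L) D m := by
  obtain ⟨e, he⟩ := hΛ.absorbs.exists_mem_shift hm
  exact ⟨_, (hΛ.shift hD (-e)).fg, (hΛ.shift hD (-e)).stable, he⟩

variable [Module.Finite L⸨X⸩ N]

lemma IsIrregular.exists_isExpansive (hD : IsDer (-ϖ L) D)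
    (hF : IsIrregular D F) : ∃ Λ, IsExpansive D F Λ := by
  obtain ⟨-, Λ, hΛ, h⟩ := hF
  obtain ⟨i, hi⟩ := LocalFourier.exists_isExpansive hD hΛ (IsNoetherian.noetherian F)
    (fun m => (h m).trans mem_chainSup)
  exact ⟨_, hi⟩

/-- Irregular modules have no bounded vectors. -/
lemma IsIrregular.eq_zero_of_isBounded (hD : IsDer (-ϖ L) D)
    (hF : IsIrregular D F) {m : N} (hm : m ∈ F) (hb : IsBounded (L := L) D m) : m = 0 := by
  obtain ⟨Λ, hΛ⟩ := hF.exists_isExpansive hD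
  obtain ⟨Λ', hf, hs, hm'⟩ := hb
  obtain ⟨n, hn⟩ := hΛ.absorbs.exists_le_shift (Λ' := Λ' ⊓ F.restrictScalars L⟦X⟧)
    (Submodule.FG.of_le hf inf_le_left) fun m hm => hm.2
  exact hΛ.eq_zero_of_bounded hD hm n fun i => hn _ ⟨(show Set.MapsTo D Λ' Λ' from hs).iterate i hm',
    (show Set.MapsTo D F F from hF.1).iterate i hm⟩

/-- Irregular modules have no maps to modules with a stable lattice. -/
lemma IsIrregular.map_eq_zero (hD : IsDer (-ϖ L) D) (hF : IsIrregular D F)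
    (hh : IsHorizontal D ρ D' ρ' σ τ φ) (hD' : IsDer (-ϖ L') D')
    {F' : Submodule L'⸨X⸩ N'} {Λ' : Submodule L'⟦X⟧ N'} (hΛ' : IsStableLattice D' F' Λ')
    (hle : ∀ m ∈ F, φ m ∈ F') {m : N} (hm : m ∈ F) : φ m = 0 := by
  obtain ⟨Λ, hΛ⟩ := hF.exists_isExpansive hD
  obtain ⟨n, hn⟩ := hΛ.exists_small_preimage hD hm
  obtain ⟨Λ'', hf, hle', -⟩ := hh.map_le hΛ.fg
  obtain ⟨c, hc⟩ := hΛ'.absorbs.exists_le_shift (Λ' := Λ'' ⊓ F'.restrictScalars L'⟦X⟧)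
    (Submodule.FG.of_le hf inf_le_left) fun m hm => hm.2
  refine eq_zero_of_mem_shift hΛ'.fg fun k => ?_
  obtain ⟨i, y, hy, rfl, h⟩ := hn (k + n + c)
  rw [hh.iterate]
  refine (show Set.MapsTo D' (shift k Λ') _ from (hΛ'.shift hD' k).stable).iterate i ?_
  rw [adicFil_eq_shift, ← tpow_natCast_smul, mem_shift, tpow_smul_smul] at h
  have h1 := hc (φ (tpow L (-((k + n + c : ℕ) : ℤ) + n) • y))
    ⟨hle' _ h, hle _ (F.smul_mem _ hy)⟩
  rw [hh.tpow, ← tpow_natCast_smul, tpow_smul_smul] at h1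
  refine mem_shift.2 ?_
  convert h1 using 3
  push_cast; ring

/-! ### Sums of pieces -/

/-- The chain of a larger lattice is larger. -/
lemma chainSup_mono (hD : IsDer (-ϖ L) D) {Λ Λ' : Submodule L⟦X⟧ N} (h : Λ ≤ Λ') :
    chainSup D Λ ≤ chainSup D Λ' := fun _ =>
  chainSup_le hD (fun _ hm => le_chainSup (h hm)) fun _ => apply_mem_chainSup

lemma IsIrregular.sup (hD : IsDer (-ϖ L) D) {F₁ F₂ : Submodule L⸨X⸩ N}
    (h₁ : IsIrregular D F₁) (h₂ : IsIrregular D F₂) : IsIrregular D (F₁ ⊔ F₂) := by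
  obtain ⟨s₁, Λ₁, f₁, e₁⟩ := h₁
  obtain ⟨s₂, Λ₂, f₂, e₂⟩ := h₂
  have hst := sup_stable s₁ s₂
  refine ⟨hst, Λ₁ ⊔ Λ₂, f₁.sup f₂, fun m => ⟨fun hm => ?_, fun hm => ?_⟩⟩
  · obtain ⟨a, ha, b, hb, rfl⟩ := mem_sup.1 hm
    exact add_mem (chainSup_mono hD le_sup_left ((e₁ a).1 ha))
      (chainSup_mono hD le_sup_right ((e₂ b).1 hb))
  · refine chainSup_le hD (E := (F₁ ⊔ F₂).restrictScalars L⟦X⟧) (fun m hm => ?_) hst hm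
    obtain ⟨a, ha, b, hb, rfl⟩ := mem_sup.1 hm
    exact add_mem_sup ((e₁ a).2 (le_chainSup ha)) ((e₂ b).2 (le_chainSup hb))

lemma IsStableLattice.sup {F₁ F₂ : Submodule L⸨X⸩ N} {Λ₁ Λ₂ : Submodule L⟦X⟧ N}
    (h₁ : IsStableLattice D F₁ Λ₁) (h₂ : IsStableLattice D F₂ Λ₂) :
    IsStableLattice D (F₁ ⊔ F₂) (Λ₁ ⊔ Λ₂) where
  fg := h₁.fg.sup h₂.fg
  le m hm := by
    obtain ⟨a, ha, b, hb, rfl⟩ := mem_sup.1 hm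
    exact add_mem_sup (h₁.le a ha) (h₂.le b hb)
  absorbs m hm := by
    obtain ⟨a, ha, b, hb, rfl⟩ := mem_sup.1 hm
    obtain ⟨i, hi⟩ := h₁.absorbs a ha
    obtain ⟨j, hj⟩ := h₂.absorbs b hb
    refine ⟨max i j, ?_⟩
    rw [smul_add]
    exact add_mem_sup (pow_smul_mem_of_le (le_max_left _ _) hi)
      (pow_smul_mem_of_le (le_max_right _ _) hj)
  stable := sup_stable h₁.stable h₂.stable

lemma IsPunctualAt.sup (hD : IsDer (-ϖ L) D) (h : IsCalculus D ρ)
    {x : ClosedPoint L} {F₁ F₂ : Submodule L⸨X⸩ N}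
    (h₁ : IsPunctualAt D ρ x F₁) (h₂ : IsPunctualAt D ρ x F₂) : IsPunctualAt D ρ x (F₁ ⊔ F₂) := by
  obtain ⟨Λ₁, h₁, e₁⟩ := h₁
  obtain ⟨Λ₂, h₂, e₂⟩ := h₂
  refine ⟨_, h₁.sup h₂, fun f hf => ?_⟩
  obtain ⟨i, hi⟩ := e₁ f hf
  obtain ⟨j, hj⟩ := e₂ f hf
  refine ⟨i + j, fun m hm => ?_⟩
  obtain ⟨a, ha, b, hb, rfl⟩ := mem_sup.1 hm
  rw [map_add]
  refine add_mem (shift_mono le_sup_left ?_) (shift_mono le_sup_right ?_)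
  · rw [pow_add, mul_comm, calculus_mul]
    exact (h₁.shift hD 1).calculus h _ (hi a ha)
  · rw [pow_add, calculus_mul]
    exact (h₂.shift hD 1).calculus h _ (hj b hb)

lemma isStableLattice_bot : IsStableLattice D (⊥ : Submodule L⸨X⸩ N) ⊥ :=
  ⟨Submodule.fg_bot, fun m hm => hm, fun m hm => ⟨0, by simpa using hm⟩, by simp⟩

lemma IsPiece.bot (hD : IsDer (-ϖ L) D) :
    ∀ o, IsPiece D ρ o (⊥ : Submodule L⸨X⸩ N)
  | none => ⟨by simp, ⊥, Submodule.fg_bot, fun m => ⟨fun hm => by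
      rw [(Submodule.mem_bot _).1 hm]; exact zero_mem _,
      chainSup_le hD (E := ⊥) (fun m hm => hm) (by simp)⟩⟩
  | some _ => ⟨⊥, isStableLattice_bot, fun f _ => ⟨0, fun m hm => by
      rw [(Submodule.mem_bot _).1 hm, map_zero]; exact zero_mem _⟩⟩

lemma IsPiece.sup (hD : IsDer (-ϖ L) D) (h : IsCalculus D ρ)
    {F₁ F₂ : Submodule L⸨X⸩ N} : ∀ {o}, IsPiece D ρ o F₁ → IsPiece D ρ o F₂ →
      IsPiece D ρ o (F₁ ⊔ F₂)
  | none, h₁, h₂ => IsIrregular.sup hD h₁ h₂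
  | some _, h₁, h₂ => IsPunctualAt.sup hD h h₁ h₂

lemma sSup_mem_of_sup_closed {P : Submodule L⸨X⸩ N → Prop} (h0 : P ⊥)
    (hsup : ∀ F₁ F₂, P F₁ → P F₂ → P (F₁ ⊔ F₂)) : P (sSup {F | P F}) :=
  (CompleteLattice.isSupClosedCompact_iff_wellFoundedGT (α := Submodule L⸨X⸩ N)).2
    inferInstance {F | P F} ⟨⊥, h0⟩ fun _ h₁ _ h₂ => hsup _ _ h₁ h₂

/-- The largest subspace of the given type. -/
def maxPiece (D : N →+ N) (ρ : L[X] →+* AddMonoid.End N) (o : Option (ClosedPoint L)) :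
    Submodule L⸨X⸩ N := sSup {F | IsPiece D ρ o F}

lemma isPiece_maxPiece (hD : IsDer (-ϖ L) D) (h : IsCalculus D ρ)
    (o : Option (ClosedPoint L)) : IsPiece D ρ o (maxPiece D ρ o) :=
  sSup_mem_of_sup_closed (IsPiece.bot hD o) fun _ _ => IsPiece.sup hD h

lemma IsPiece.le_maxPiece {o : Option (ClosedPoint L)} (h : IsPiece D ρ o F) :
    F ≤ maxPiece D ρ o := le_sSup h

lemma iSup_maxPiece (hD : IsDer (-ϖ L) D) (h : IsCalculus D ρ) :
    ⨆ o, maxPiece D ρ o = (⊤ : Submodule L⸨X⸩ N) := by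
  rw [eq_top_iff, ← sSup_isPiece_eq_top hD h]
  exact sSup_le fun F ⟨o, ho⟩ => (IsPiece.le_maxPiece ho).trans (le_iSup _ o)

/-- There is a largest subspace with a stable lattice. -/
lemma exists_isStableLattice (D : N →+ N) :
    ∃ (S : Submodule L⸨X⸩ N) (Λ : Submodule L⟦X⟧ N), IsStableLattice D S Λ ∧
      ∀ (F : Submodule L⸨X⸩ N) (Λ : Submodule L⟦X⟧ N), IsStableLattice D F Λ → F ≤ S := by
  obtain ⟨Λ, hΛ⟩ := sSup_mem_of_sup_closed
    (P := fun F : Submodule L⸨X⸩ N => ∃ Λ : Submodule L⟦X⟧ N, IsStableLattice D F Λ)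
    ⟨⊥, isStableLattice_bot⟩ fun _ _ ⟨_, h₁⟩ ⟨_, h₂⟩ => ⟨_, h₁.sup h₂⟩
  exact ⟨_, Λ, hΛ, fun F Λ h => le_sSup ⟨Λ, h⟩⟩

lemma exists_mem_notMem {x y : ClosedPoint L} (h : y ≠ x) : ∃ g ∈ y.asIdeal, g ∉ x.asIdeal := by
  by_contra! hcon
  exact h (MaximalSpectrum.ext (y.isMaximal.eq_of_le x.isMaximal.ne_top hcon))

/-- Away from a point, punctual vectors are killed by polynomials not vanishing there. -/
lemma iSup_ne_isNull (hD : IsDer (-ϖ L) D) (h : IsCalculus D ρ)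
    (x : ClosedPoint L) {m : N} (hm : m ∈ ⨆ y : {y // y ≠ x}, maxPiece D ρ (some y.1)) :
    ∃ g, g ∉ x.asIdeal ∧ IsNull D ρ g m := by
  refine Submodule.iSup_induction _ (motive := fun m => ∃ g, g ∉ x.asIdeal ∧ IsNull D ρ g m) hm
    (fun y m hm => ?_) ⟨1, (Ideal.ne_top_iff_one _).1 x.isMaximal.ne_top, .zero⟩ ?_
  · obtain ⟨g, hg, hg'⟩ := exists_mem_notMem y.2
    exact ⟨g, hg', IsPunctualAt.isNull hD h (isPiece_maxPiece hD h (some y.1)) hg hm⟩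
  · rintro a b ⟨g, hg, ha⟩ ⟨g', hg', hb⟩
    exact ⟨g * g', fun hmem => (x.isMaximal.isPrime.mem_or_mem hmem).elim hg hg',
      ha.add hD h hb⟩

lemma exists_isCoprime_of_notMem (x : ClosedPoint L) {g : L[X]} (hg : g ∉ x.asIdeal) :
    ∃ f ∈ x.asIdeal, IsCoprime f g := by
  obtain ⟨a, f, hf, e⟩ := x.isMaximal.exists_inv hg
  exact ⟨f, hf, 1, a, by linear_combination e⟩

lemma exists_isCoprime {x y : ClosedPoint L} (h : y ≠ x) :
    ∃ f ∈ x.asIdeal, ∃ g ∈ y.asIdeal, IsCoprime f g := by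
  obtain ⟨g, hg, hg'⟩ := exists_mem_notMem h
  obtain ⟨f, hf, hfg⟩ := exists_isCoprime_of_notMem x hg'
  exact ⟨f, hf, g, hg, hfg⟩

theorem iSupIndep_maxPiece (hD : IsDer (-ϖ L) D) (h : IsCalculus D ρ) :
    iSupIndep (maxPiece D ρ : Option (ClosedPoint L) → Submodule L⸨X⸩ N) := by
  obtain ⟨S, Λ, hΛ, hS⟩ := exists_isStableLattice (L := L) (N := N) D
  have hle : ∀ y, maxPiece D ρ (some y) ≤ S := fun y => by
    obtain ⟨Λ, hΛ, -⟩ := isPiece_maxPiece hD h (some y)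
    exact hS _ _ hΛ
  have hnone : ∀ a ∈ maxPiece D ρ none, a ∈ S → a = 0 := fun a ha hb =>
    IsIrregular.eq_zero_of_isBounded hD (isPiece_maxPiece hD h none) ha (hΛ.isBounded hD hb)
  rintro (_ | x) <;> rw [Submodule.disjoint_def] <;> intro m hm hm'
  · refine hnone m hm ((show _ ≤ S from iSup₂_le fun j hj => ?_) hm')
    obtain ⟨y, rfl⟩ := Option.ne_none_iff_exists'.1 hj
    exact hle y
  · have hle' : (⨆ (j) (_ : j ≠ some x), maxPiece D ρ j) ≤
        (maxPiece D ρ none ⊔ ⨆ y : {y // y ≠ x}, maxPiece D ρ (some y.1) : Submodule L⸨X⸩ N) := by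
      refine iSup₂_le fun j hj => ?_
      rcases j with _ | y
      · exact le_sup_left
      · exact le_trans (le_iSup (fun y : {y // y ≠ x} => (maxPiece D ρ (some y.1) :
          Submodule L⸨X⸩ N)) ⟨y, fun e => hj (congrArg some e)⟩) le_sup_right
    obtain ⟨a, ha, b, hb, rfl⟩ := mem_sup.1 (hle' hm')
    have hle₂ : (⨆ y : {y // y ≠ x}, maxPiece D ρ (some y.1)) ≤ S := iSup_le fun y => hle y.1
    have ha0 : a = 0 := hnone a ha ((add_mem_cancel_right (hle₂ hb)).1 (hle x hm))
    rw [ha0, zero_add] at hm ⊢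
    obtain ⟨g, hg, hnull⟩ := iSup_ne_isNull hD h x hb
    obtain ⟨f, hf, hfg⟩ := exists_isCoprime_of_notMem x hg
    exact (IsPunctualAt.isNull hD h (isPiece_maxPiece hD h (some x)) hf hm).eq_zero hD h hnull hfg

/-- Horizontal maps between pieces of different types vanish. -/
theorem IsPiece.map_eq_zero {ρ₂ : L[X] →+* AddMonoid.End N'} [Module L⸨X⸩ N'] [Module L⟦X⟧ N']
    [IsScalarTower L⟦X⟧ L⸨X⸩ N'] [Module.Finite L⸨X⸩ N']
    (hD : IsDer (-ϖ L) D) (h : IsCalculus D ρ)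
    (hD' : IsDer (-ϖ L) D') (h' : IsCalculus D' ρ₂)
    (hh : IsHorizontal D ρ D' ρ₂ (RingHom.id L⟦X⟧) (RingHom.id L[X]) φ)
    {o o' : Option (ClosedPoint L)} (ho : o ≠ o') (hF : IsPiece D ρ o F)
    {F' : Submodule L⸨X⸩ N'} (hF' : IsPiece D' ρ₂ o' F') (hle : ∀ m ∈ F, φ m ∈ F')
    {m : N} (hm : m ∈ F) : φ m = 0 := by
  cases o with
  | none =>
    cases o' with
    | none => exact absurd rfl ho
    | some y =>
      obtain ⟨Λ', hΛ', -⟩ : IsPunctualAt D' ρ₂ y F' := hF'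
      exact IsIrregular.map_eq_zero hD hF hh hD' hΛ' hle hm
  | some x =>
    cases o' with
    | none =>
      obtain ⟨Λ, hΛ, -⟩ : IsPunctualAt D ρ x F := hF
      exact IsIrregular.eq_zero_of_isBounded hD' hF' (hle m hm) ((hΛ.isBounded hD hm).map hh hD')
    | some y =>
      obtain ⟨f, hf, g, hg, hfg⟩ := exists_isCoprime (x := x) (y := y) (by rintro rfl; exact ho rfl)
      exact ((IsPunctualAt.isNull hD h hF hf hm).map hh hD').eq_zero hD' h'
        (IsPunctualAt.isNull hD' h' hF' hg (hle m hm)) hfg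

end Orthogonality

/-! ### The decomposition of holonomic modules -/

section Modules

variable {L : Type u} [Field L]

instance instModulePowerSeries (N : DMod L⸨X⸩) : Module L⟦X⟧ N.carrier :=
  Module.compHom N (puncture L).toRingHom

instance instIsScalarTowerPowerSeries (N : DMod L⸨X⸩) : IsScalarTower L⟦X⟧ L⸨X⸩ N.carrier :=
  ⟨fun a b m => by
    rw [Algebra.smul_def, mul_smul]
    rfl⟩

/-- The operator `d/dz`, `z = 1/X`, on a module over `L((X))`. -/
def delZ (N : DMod L⸨X⸩) : N →+ N.carrier :=
  ((puncturedDiskInfty L).pushforward.obj N).del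

/-- The functional calculus `f ↦ f(-d/dz)`. -/
def calc' (N : DMod L⸨X⸩) : L[X] →+* AddMonoid.End N.carrier :=
  fourierAction ((puncturedDiskInfty L).pushforward.obj N)

lemma delZ_apply (N : DMod L⸨X⸩) (m : N) :
    delZ N m = (single 2 (-1) : L⸨X⸩) • N.del m := rfl

lemma delZ_isDer (N : DMod L⸨X⸩) : IsDer (-ϖ L) (delZ N) := fun a m => by
  have e : (algebraMap L⟦X⟧ L⸨X⸩) (PowerSeries.X * -PowerSeries.X)
      = single 2 (-1 : L) := by
    rw [mul_neg, ← pow_two, map_neg, coe_X_pow]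
    simp [tpow]
  rw [delZ_apply, delZ_apply, N.leibniz, smul_add, e, smul_smul, smul_comm a]

lemma calc_isCalculus (N : DMod L⸨X⸩) : IsCalculus (delZ N) (calc' N) where
  const a m := by
    refine (fourierAction_C ((puncturedDiskInfty L).pushforward.obj N) a m).trans ?_
    change (puncturedDiskInfty L).toRingHom (C a) • m = (puncture L).toRingHom (PowerSeries.C a) • m
    congr 1
    refine (Polynomial.eval₂_C _ _).trans ?_
    exact (HahnSeries.ofPowerSeries_C a).symm
  var m := fourierAction_X ((puncturedDiskInfty L).pushforward.obj N) m

lemma hom_isHorizontal {N N' : DMod L⸨X⸩} (f : N ⟶ N') :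
    IsHorizontal (delZ N) (calc' N) (delZ N') (calc' N') (RingHom.id L⟦X⟧) (RingHom.id L[X])
      f.toLin.toAddMonoidHom where
  map_X := rfl
  smul a m := f.toLin.map_smul ((puncture L).toRingHom a) m
  del m := ((puncturedDiskInfty L).pushforward.map f).comm m
  calculus p m := fourierAction_natural ((puncturedDiskInfty L).pushforward.map f) p m

/-- The morphism as a map of modules over the power series ring. -/
def powLin {N N' : DMod L⸨X⸩} (f : N ⟶ N') : N →ₗ[L⟦X⟧] N' where
  toFun := f.toLin
  map_add' := map_add _
  map_smul' := (hom_isHorizontal f).smul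

@[simp] lemma powLin_apply {N N' : DMod L⸨X⸩} (f : N ⟶ N') (m : N) :
    powLin f m = f.toLin m := rfl

lemma map_delZ {N N' : DMod L⸨X⸩} (f : N ⟶ N') (m : N) :
    f.toLin (delZ N m) = delZ N' (f.toLin m) := (hom_isHorizontal f).del m

lemma map_calc {N N' : DMod L⸨X⸩} (f : N ⟶ N') (p : L[X]) (m : N) :
    f.toLin (calc' N p m) = calc' N' p (f.toLin m) := (hom_isHorizontal f).calculus p m

lemma map_tpow {N N' : DMod L⸨X⸩} (f : N ⟶ N') (n : ℤ) (m : N) :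
    f.toLin (tpow L n • m) = tpow L n • f.toLin m := map_smul _ _ _

section Transfer

variable {N N' : DMod L⸨X⸩} (f : N ⟶ N') {F : Submodule L⸨X⸩ N}
  {Λ : Submodule L⟦X⟧ N}

lemma map_mem_shift {n : ℤ} {m : N} (hm : m ∈ shift n Λ) :
    f.toLin m ∈ shift n (Λ.map (powLin f)) :=
  (hom_isHorizontal f).map_mem_shift (fun _ h => mem_map_of_mem (f := powLin f) h) hm

lemma chainSup_map : chainSup (delZ N') (Λ.map (powLin f)) = (chainSup (delZ N) Λ).map (powLin f) := by
  refine le_antisymm (fun m hm => chainSup_le (delZ_isDer N') (E := (chainSup (delZ N) Λ).map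
    (powLin f)) ?_ ?_ hm) (Submodule.map_le_iff_le_comap.2 fun m hm => chainSup_le (delZ_isDer N)
    (E := (chainSup (delZ N') (Λ.map (powLin f))).comap (powLin f))
    (fun m hm => le_chainSup (mem_map_of_mem hm)) (fun m hm => ?_) hm)
  · rintro _ ⟨y, hy, rfl⟩
    exact ⟨y, le_chainSup hy, rfl⟩
  · rintro _ ⟨y, hy, rfl⟩
    exact ⟨_, apply_mem_chainSup hy, map_delZ f y⟩
  · rw [mem_comap, powLin_apply, map_delZ]
    exact apply_mem_chainSup hm

lemma IsPiece.map : ∀ {o : Option (ClosedPoint L)}, IsPiece (delZ N) (calc' N) o F →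
    IsPiece (delZ N') (calc' N') o (F.map f.toLin)
  | none, ⟨hst, Λ, hΛ, h⟩ => by
    refine ⟨?_, Λ.map (powLin f), hΛ.map _, fun m => ?_⟩
    · rintro _ ⟨m, hm, rfl⟩
      exact ⟨_, hst m hm, map_delZ f m⟩
    · rw [chainSup_map]
      exact exists_congr fun y => and_congr_left' (h y)
  | some x, ⟨Λ, hΛ, h⟩ => by
    refine ⟨Λ.map (powLin f), ⟨hΛ.fg.map _, ?_, ?_, ?_⟩, fun g hg => (h g hg).imp fun j hj => ?_⟩
    · rintro _ ⟨y, hy, rfl⟩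
      exact ⟨y, hΛ.le y hy, rfl⟩
    · rintro _ ⟨y, hy, rfl⟩
      exact (hΛ.absorbs y hy).imp fun n hn => ⟨_, hn, (powLin f).map_smul _ _⟩
    · rintro _ ⟨y, hy, rfl⟩
      exact ⟨_, hΛ.stable y hy, map_delZ f y⟩
    · rintro _ ⟨y, hy, rfl⟩
      rw [powLin_apply, ← map_calc]
      exact map_mem_shift f (hj y hy)

lemma IsPiece.of_map (hf : Injective f.toLin) {o : Option (ClosedPoint L)}
    (h : IsPiece (delZ N') (calc' N') o (F.map f.toLin)) : IsPiece (delZ N) (calc' N) o F := by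
  have hF : ∀ {m}, f.toLin m ∈ F.map f.toLin ↔ m ∈ F := hf.mem_set_image
  have hlat : ∀ Λ' : Submodule L⟦X⟧ N', (∀ m ∈ Λ', m ∈ F.map f.toLin) →
      (Λ'.comap (powLin f)).map (powLin f) = Λ' := fun Λ' h =>
    Submodule.map_comap_eq_of_le fun m hm => (h m hm).imp fun y hy => hy.2
  have hfg : ∀ Λ' : Submodule L⟦X⟧ N', (∀ m ∈ Λ', m ∈ F.map f.toLin) → Λ'.FG →
      (Λ'.comap (powLin f)).FG := fun Λ' h hΛ' =>
    Submodule.fg_of_fg_map_injective (powLin f) hf (by rwa [hlat Λ' h])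
  rcases o with _ | x
  · obtain ⟨hst, Λ', hΛ', h⟩ := h
    have hle : ∀ m ∈ Λ', m ∈ F.map f.toLin := fun m hm => (h m).2 (le_chainSup hm)
    refine ⟨fun m hm => hF.1 ?_, Λ'.comap (powLin f), hfg Λ' hle hΛ', fun m => ?_⟩
    · rw [map_delZ]
      exact hst _ (hF.2 hm)
    · rw [← hF, h, ← hlat Λ' hle, chainSup_map, hlat Λ' hle]
      exact hf.mem_set_image
  · obtain ⟨Λ', hΛ', h⟩ := h
    refine ⟨Λ'.comap (powLin f), ⟨hfg Λ' hΛ'.le hΛ'.fg, fun m hm => hF.1 (hΛ'.le _ hm),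
      fun m hm => (hΛ'.absorbs _ (hF.2 hm)).imp fun n hn => ?_, fun m hm => ?_⟩,
      fun g hg => (h g hg).imp fun j hj m hm => ?_⟩
    · rwa [mem_comap, map_smul]
    · rw [mem_comap, powLin_apply, map_delZ]
      exact hΛ'.stable _ hm
    · rw [mem_shift, mem_comap, powLin_apply, map_tpow, map_calc, ← mem_shift]
      exact hj _ hm

end Transfer

/-- Holonomic modules of a given type. -/
def IsOfType (o : Option (ClosedPoint L)) : ObjectProperty (DMod L⸨X⸩) := fun N =>
  HolK L N ∧ IsPiece (delZ N) (calc' N) o ⊤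

namespace IsOfType

variable {o : Option (ClosedPoint L)} {N N' : DMod L⸨X⸩}

/-- The subobject of `N` given by a subspace of some type. -/
lemma sub (hN : HolK L N) {F : Submodule L⸨X⸩ N} (hF : IsPiece (delZ N) (calc' N) o F)
    (h : N.Stable F) : IsOfType o (N.sub F h) := by
  have : Module.Finite L⸨X⸩ N.carrier := hN
  refine ⟨(inferInstance : Module.Finite L⸨X⸩ F), ?_⟩
  let i : N.sub F h ⟶ N := ⟨F.subtype, fun _ => rfl⟩
  refine IsPiece.of_map i Subtype.val_injective ?_
  rw [Submodule.map_top]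
  convert hF
  exact Submodule.range_subtype F

lemma map_eq_zero (hN : IsOfType o N) {o' : Option (ClosedPoint L)} (hN' : IsOfType o' N')
    (ho : o ≠ o') (f : N ⟶ N') (m : N) : f.toLin m = 0 := by
  have : Module.Finite L⸨X⸩ N.carrier := hN.1
  have : Module.Finite L⸨X⸩ N'.carrier := hN'.1
  exact IsPiece.map_eq_zero (delZ_isDer N) (calc_isCalculus N) (delZ_isDer N')
    (calc_isCalculus N') (hom_isHorizontal f) ho hN.2 hN'.2 (fun _ _ => trivial) trivial

lemma of_surjective (hN : IsOfType o N) (f : N ⟶ N') (hf : Surjective f.toLin) :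
    IsOfType o N' := by
  have : Module.Finite L⸨X⸩ N.carrier := hN.1
  refine ⟨Module.Finite.of_surjective f.toLin hf, ?_⟩
  have := hN.2.map f
  rwa [Submodule.map_top, LinearMap.range_eq_top.2 hf] at this

end IsOfType

lemma stable_of_delZ {N : DMod L⸨X⸩} {F : Submodule L⸨X⸩ N}
    (h : ∀ m ∈ F, delZ N m ∈ F) : N.Stable F := fun m hm => by
  have := F.smul_mem (single (-2) (-1)) (h m hm)
  rwa [delZ_apply, smul_smul, HahnSeries.single_mul_single, show (-1 : L) * -1 = 1 by ring,
    show (-2 : ℤ) + 2 = 0 by ring, show (single 0 1 : L⸨X⸩) = 1 from rfl,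
    one_smul] at this

lemma IsPiece.stable {N : DMod L⸨X⸩} {F : Submodule L⸨X⸩ N} :
    ∀ {o : Option (ClosedPoint L)}, IsPiece (delZ N) (calc' N) o F → N.Stable F
  | none, h => stable_of_delZ h.1
  | some _, ⟨_, h, _⟩ => stable_of_delZ (h.space_stable (delZ_isDer N))

lemma isPiece_maxPiece' {N : DMod L⸨X⸩} (hN : HolK L N) (o : Option (ClosedPoint L)) :
    IsPiece (delZ N) (calc' N) o (maxPiece (delZ N) (calc' N) o) := by
  have : Module.Finite L⸨X⸩ N.carrier := hN
  exact isPiece_maxPiece (delZ_isDer N) (calc_isCalculus N) o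

/-- A module is of type `o` if its other components vanish. -/
lemma IsOfType.of_maxPiece_eq_bot {N : DMod L⸨X⸩} (hN : HolK L N) {o : Option (ClosedPoint L)}
    (hz : ∀ o' ≠ o, maxPiece (delZ N) (calc' N) o' = ⊥) : IsOfType o N := by
  have : Module.Finite L⸨X⸩ N.carrier := hN
  have htop : maxPiece (delZ N) (calc' N) o = ⊤ := by
    rw [← iSup_maxPiece (delZ_isDer N) (calc_isCalculus N)]
    exact (iSup_eq_of_forall_le_of_forall_lt_exists_gt (fun o' => by
      rcases eq_or_ne o' o with rfl | h
      · exact le_rfl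
      · exact hz o' h ▸ bot_le) fun _ hw => ⟨o, hw⟩).symm
  exact ⟨hN, htop ▸ isPiece_maxPiece' hN o⟩

/-- The component of type `o` is the largest subspace of type `o`. -/
lemma partSub_isOfType {N : DMod L⸨X⸩} (hN : HolK L N) (o : Option (ClosedPoint L)) :
    DMod.partSub (IsOfType o) N = maxPiece (delZ N) (calc' N) o := by
  have : Module.Finite L⸨X⸩ N.carrier := hN
  have hmax := isPiece_maxPiece' hN o
  refine le_antisymm (iSup_le fun f => ?_) fun m hm => ?_
  · have := (f.1.2.2.map f.2).le_maxPiece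
    rwa [Submodule.map_top] at this
  · let S : (IsOfType (L := L) o).FullSubcategory := ⟨_, IsOfType.sub hN hmax hmax.stable⟩
    exact mem_iSup_of_mem (⟨S, ⟨Submodule.subtype _, fun _ => rfl⟩⟩ :
      Σ X : (IsOfType o).FullSubcategory, (X.obj ⟶ N)) ⟨⟨m, hm⟩, rfl⟩

lemma part_isOfType {N : DMod L⸨X⸩} (hN : HolK L N) (o : Option (ClosedPoint L)) :
    IsOfType o ((DMod.part (IsOfType o)).obj N) := by
  refine IsOfType.sub hN ?_ (DMod.partSub_stable _ N)
  rw [partSub_isOfType hN]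
  exact isPiece_maxPiece' hN o

/-- Injective morphisms with independent images spanning everything form a direct sum. -/
lemma isDirectSum_of_iSupIndep {R : Type u} [CommRing R] [Differential R] {ι : Type*}
    {N : ι → DMod R} {M : DMod R} (f : ∀ i, N i ⟶ M)
    (hf : ∀ i, Injective (f i).toLin)
    (h1 : iSupIndep fun i => range (f i).toLin)
    (h2 : ⨆ i, range (f i).toLin = ⊤) : DMod.IsDirectSum N M f := by
  classical
  have h := DirectSum.isInternal_submodule_of_iSupIndep_of_iSup_eq_top h1 h2
  let e : ∀ i, (N i) ≃ₗ[R] range (f i).toLin := fun i =>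
    LinearEquiv.ofInjective _ (hf i)
  have heq : DirectSum.toModule R ι M (fun i => (f i).toLin)
      = (DirectSum.coeLinearMap fun i => range (f i).toLin) ∘ₗ
        (DFinsupp.mapRange.linearEquiv e).toLinearMap := by
    refine DirectSum.linearMap_ext R fun i => LinearMap.ext fun m => ?_
    simp only [LinearMap.comp_apply, DirectSum.toModule_lof]
    change _ = (DirectSum.coeLinearMap _) ((DFinsupp.mapRange.linearEquiv e) (DFinsupp.single i m))
    have e2 : (DFinsupp.mapRange.linearEquiv e) (DFinsupp.single i m)
        = DFinsupp.single i (e i m) :=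
      DFinsupp.mapRange_single (hf := fun i => map_zero (e i))
    rw [e2]
    exact (DirectSum.coeLinearMap_of (fun i => range (f i).toLin) i (e i m)).symm
  have hb : Bijective ((DirectSum.coeLinearMap fun i => range (f i).toLin) ∘ₗ
      (DFinsupp.mapRange.linearEquiv e).toLinearMap) :=
    h.comp (DFinsupp.mapRange.linearEquiv e).bijective
  rw [← heq] at hb
  unfold DMod.IsDirectSum
  convert hb

/-- Every holonomic module is the direct sum of its components. -/
theorem isDirectSum_part {N : DMod L⸨X⸩} (hN : HolK L N) :
    DMod.IsDirectSum (fun o => (DMod.part (IsOfType o)).obj N) N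
      (fun o => DMod.partInc (IsOfType o) N) := by
  have : Module.Finite L⸨X⸩ N.carrier := hN
  have hr : ∀ o, range (DMod.partInc (IsOfType o) N).toLin
      = maxPiece (delZ N) (calc' N) o := fun o =>
    (Submodule.range_subtype _).trans (partSub_isOfType hN o)
  refine isDirectSum_of_iSupIndep _ (fun o => Subtype.val_injective) ?_ ?_
  · simp only [hr]
    exact iSupIndep_maxPiece (delZ_isDer N) (calc_isCalculus N)
  · simp only [hr]
    exact iSup_maxPiece (delZ_isDer N) (calc_isCalculus N)

/-- Submodules of modules of a given type are of that type. -/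
lemma IsOfType.of_injective {o : Option (ClosedPoint L)} {N N' : DMod L⸨X⸩} (hN : IsOfType o N)
    (f : N' ⟶ N) (hf : Injective f.toLin) : IsOfType o N' := by
  have : Module.Finite L⸨X⸩ N.carrier := hN.1
  have hfin : HolK L N' := Module.Finite.of_injective f.toLin hf
  refine .of_maxPiece_eq_bot hfin fun o' ho' => eq_bot_iff.2 fun m hm => ?_
  have hmax := isPiece_maxPiece' hfin o'
  have := (IsOfType.sub hfin hmax hmax.stable).map_eq_zero hN ho'
    (⟨f.toLin ∘ₗ Submodule.subtype _, fun m => f.comm _⟩ : _ ⟶ N) ⟨m, hm⟩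
  exact hf (this.trans (map_zero _).symm)

/-- The irreducible components of a module of some type are of that type. -/
lemma IsOfType.of_isComponent {o : Option (ClosedPoint L)} {N M : DMod L⸨X⸩} (hN : IsOfType o N)
    (h : DMod.IsComponent M N) : IsOfType o M := by
  obtain ⟨-, Y, i, q, hi, hq⟩ := h
  exact (hN.of_injective i hi).of_surjective q hq

end Modules

/-! ### Slopes -/

section SlopeLattice

variable {L : Type u} [Field L] (N : DMod L⸨X⸩) (v : N)

/-- The vectors `t ^ j θ ^ j v`. -/
def thetaVec (j : ℕ) : N.carrier := tpow L j • (theta N)^[j] v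

/-- The module spanned by the first `k` vectors `t ^ j θ ^ j v`. -/
def thetaSpan (k : ℕ) : Submodule L⟦X⟧ N.carrier :=
  span L⟦X⟧ (thetaVec N v '' Set.Iio k)

/-- The module spanned by all vectors `t ^ j θ ^ j v`. -/
def thetaSup : Submodule L⟦X⟧ N.carrier := span L⟦X⟧ (Set.range (thetaVec N v))

variable {N v}

lemma delZ_thetaVec (j : ℕ) : delZ N (thetaVec N v j)
    = -thetaVec N v (j + 1) + (j • (-ϖ L)) • thetaVec N v j := by
  have e : ∀ m, delZ N m = -(tpow L 1 • theta N m) := fun m => by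
    rw [delZ_apply, theta, smul_smul, HahnSeries.single_mul_single, ← neg_smul]
    simp
  rw [thetaVec, (delZ_isDer N).tpow, e, smul_add, smul_neg, tpow_smul_smul, tpow_smul_comm,
    thetaVec, iterate_succ_apply', natCast_zsmul]
  push_cast
  rfl

lemma thetaVec_mem_span {j k : ℕ} (h : j < k) : thetaVec N v j ∈ thetaSpan N v k :=
  subset_span ⟨j, h, rfl⟩

lemma thetaVec_mem_sup (j : ℕ) : thetaVec N v j ∈ thetaSup N v := subset_span ⟨j, rfl⟩

lemma thetaSpan_le_sup (k : ℕ) : thetaSpan N v k ≤ thetaSup N v :=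
  span_mono (Set.image_subset_range _ _)

lemma thetaSpan_mono : Monotone (thetaSpan N v) := fun _ _ h =>
  span_mono (Set.image_mono (Set.Iio_subset_Iio h))

lemma thetaSpan_fg (k : ℕ) : (thetaSpan N v k).FG :=
  fg_span ((Set.finite_Iio k).image _)

lemma span_stable {S : Set N} {M : Submodule L⟦X⟧ N}
    (hS : ∀ s ∈ S, delZ N s ∈ M) (hM : span L⟦X⟧ S ≤ M) :
    ∀ m ∈ span L⟦X⟧ S, delZ N m ∈ M := by
  intro m hm
  refine span_induction (p := fun m _ => delZ N m ∈ M) hS ?_ ?_ ?_ hm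
  · rw [map_zero]; exact zero_mem _
  · intro x y _ _ hx hy
    rw [map_add]; exact add_mem hx hy
  · intro a x hx' hx
    obtain ⟨a', ha'⟩ := (delZ_isDer N).isLeibniz a
    rw [ha']
    exact add_mem (smul_mem _ _ (hM hx')) (smul_mem _ _ hx)

lemma thetaSup_stable : ∀ m ∈ thetaSup N v, delZ N m ∈ thetaSup N v := by
  refine span_stable ?_ le_rfl
  rintro _ ⟨j, rfl⟩
  rw [delZ_thetaVec]
  exact add_mem (neg_mem (thetaVec_mem_sup _)) (smul_mem _ _ (thetaVec_mem_sup _))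

lemma thetaSup_fg {Λ : Submodule L⟦X⟧ N} (hΛ : IsStableLattice (delZ N) ⊤ Λ) :
    (thetaSup N v).FG := by
  obtain ⟨e, he⟩ := hΛ.absorbs.exists_mem_shift (m := v) trivial
  have h := hΛ.shift (delZ_isDer N) (-e)
  have hmem : ∀ j, thetaVec N v j ∈ shift (-e) Λ := by
    intro j
    induction j with
    | zero => simpa [thetaVec] using he
    | succ j ih =>
      have h1 := delZ_thetaVec (N := N) (v := v) j
      have h2 : thetaVec N v (j + 1) = (j • (-ϖ L)) • thetaVec N v j
        - delZ N (thetaVec N v j) := by rw [h1]; abel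
      rw [h2]
      exact sub_mem (smul_mem _ _ ih) (h.stable _ ih)
  refine Submodule.FG.of_le h.fg (span_le.2 ?_)
  rintro _ ⟨j, rfl⟩
  exact hmem j

lemma calculus_thetaVec (i r : ℕ) :
    calc' N (X ^ r) (thetaVec N v i) - thetaVec N v (i + r) ∈ shift 1 (thetaSup N v) := by
  have hst := thetaSup_stable (N := N) (v := v)
  induction r generalizing i with
  | zero => rw [pow_zero, calculus_one, add_zero, sub_self]; exact zero_mem _
  | succ r ih =>
    have e : calc' N (X ^ (r + 1)) (thetaVec N v i) - thetaVec N v (i + (r + 1))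
        = -delZ N (calc' N (X ^ r) (thetaVec N v i) - thetaVec N v (i + r))
          - ((i + r) • (-ϖ L)) • thetaVec N v (i + r) := by
      rw [pow_succ', calculus_mul, (calc_isCalculus N).var, map_sub, delZ_thetaVec, add_assoc]
      abel
    have hs : ∀ m ∈ shift 1 (thetaSup N v), delZ N m ∈ shift 1 (thetaSup N v) := by
      rintro _ ⟨y, hy, rfl⟩
      change delZ N (tpow L 1 • y) ∈ _
      rw [(delZ_isDer N).tpow]
      exact tpow_smul_mem_shift (add_mem (hst y hy) (smul_mem _ _ hy))
    rw [e]
    refine sub_mem (neg_mem (hs _ (ih i))) ?_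
    rw [smul_neg, neg_smul, smul_assoc, ← tpow_one_smul]
    exact neg_mem (nsmul_mem (tpow_smul_mem_shift (thetaVec_mem_sup _)) _)

/-- If `t ^ k θ ^ k v` is modulo `X` a combination of the vectors of smaller index, then these span
everything, by Nakayama. -/
lemma thetaSup_le_of_mem (hfg : (thetaSup N v).FG) {k : ℕ}
    (hk : thetaVec N v k ∈ thetaSpan N v k ⊔ shift 1 (thetaSup N v)) :
    thetaSup N v = thetaSpan N v k := by
  have hst := thetaSup_stable (N := N) (v := v)
  have hX : ∀ m ∈ thetaSup N v, ϖ L • m ∈ shift 1 (thetaSup N v) :=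
    fun m hm => by rw [← tpow_one_smul]; exact tpow_smul_mem_shift hm
  have hj : ∀ (j : ℕ) (m), m ∈ thetaSup N v →
      (j • (-ϖ L)) • m ∈ shift 1 (thetaSup N v) := fun j m hm => by
    rw [smul_neg, neg_smul, smul_assoc]
    exact neg_mem (nsmul_mem (hX m hm) _)
  have hs : ∀ m ∈ shift 1 (thetaSup N v), delZ N m ∈ shift 1 (thetaSup N v) := by
    rintro _ ⟨y, hy, rfl⟩
    change delZ N (tpow L 1 • y) ∈ _
    rw [(delZ_isDer N).tpow]
    exact tpow_smul_mem_shift (add_mem (hst y hy) (smul_mem _ _ hy))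
  have h1 : ∀ m ∈ thetaSpan N v k ⊔ shift 1 (thetaSup N v),
      delZ N m ∈ thetaSpan N v k ⊔ shift 1 (thetaSup N v) := by
    intro m hm
    obtain ⟨a, ha, b, hb, rfl⟩ := mem_sup.1 hm
    rw [map_add]
    refine add_mem (span_stable ?_ le_sup_left a ha) (mem_sup_right (hs b hb))
    rintro _ ⟨j, hjk, rfl⟩
    rw [delZ_thetaVec]
    refine add_mem (neg_mem ?_) (mem_sup_right (hj _ _ (thetaVec_mem_sup _)))
    rcases lt_or_eq_of_le (Nat.succ_le_of_lt hjk) with h | h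
    · exact mem_sup_left (thetaVec_mem_span h)
    · change thetaVec N v j.succ ∈ _
      rw [h]; exact hk
  have h2 : ∀ j, thetaVec N v j ∈ thetaSpan N v k ⊔ shift 1 (thetaSup N v) := by
    intro j
    induction j with
    | zero =>
      rcases Nat.eq_zero_or_pos k with rfl | h
      · exact hk
      · exact mem_sup_left (thetaVec_mem_span h)
    | succ j ih =>
      have e : thetaVec N v (j + 1) = (j • (-ϖ L)) • thetaVec N v j
        - delZ N (thetaVec N v j) := by rw [delZ_thetaVec]; abel
      rw [e]
      exact sub_mem (mem_sup_right (hj _ _ (thetaVec_mem_sup _))) (h1 _ ih)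
  refine le_antisymm ?_ (thetaSpan_le_sup k)
  refine Submodule.le_of_le_smul_of_le_jacobson_bot (I := Ideal.span {PowerSeries.X}) hfg ?_ ?_
  · rw [IsLocalRing.jacobson_eq_maximalIdeal ⊥ bot_ne_top, Ideal.span_singleton_le_iff_mem]
    exact (IsLocalRing.mem_maximalIdeal _).2 PowerSeries.X_prime.not_isUnit
  · refine span_le.2 ?_
    rintro _ ⟨j, rfl⟩
    have hle : shift 1 (thetaSup N v) ≤
        Ideal.span {ϖ L} • thetaSup N v := by
      rintro _ ⟨y, hy, rfl⟩
      change tpow L 1 • y ∈ _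
      rw [tpow_one_smul]
      exact Submodule.smul_mem_smul (Ideal.mem_span_singleton_self _) hy
    exact sup_le_sup_left hle _ (h2 j)

variable {n : ℕ} {a : Fin n → L⸨X⸩}

lemma thetaVec_rel (hrel : (theta N)^[n] v = ∑ i, a i • (theta N)^[i] v) :
    thetaVec N v n = ∑ i : Fin n, (tpow L (n - (i : ℕ) : ℤ) * a i) • thetaVec N v i := by
  rw [thetaVec, hrel, smul_sum]
  refine sum_congr rfl fun i _ => ?_
  rw [thetaVec, smul_smul, smul_smul, mul_right_comm, tpow_mul, sub_add_cancel]

lemma thetaVec_linearIndependent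
    (hli : LinearIndependent L⸨X⸩ fun i : Fin n => (theta N)^[i] v) :
    LinearIndependent L⸨X⸩ fun i : Fin n => thetaVec N v i := by
  let u : Fin n → L⸨X⸩ˣ := fun i => ⟨tpow L (i : ℕ), tpow L (-(i : ℕ)), by simp, by simp⟩
  exact hli.units_smul u

lemma mem_thetaSpan_iff {k : ℕ} {m : N} :
    m ∈ thetaSpan N v k ↔ ∃ c : Fin k → L⟦X⟧, ∑ i, c i • thetaVec N v i = m := by
  have : thetaVec N v '' Set.Iio k = Set.range fun i : Fin k => thetaVec N v i := by
    ext y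
    constructor
    · rintro ⟨j, hj, rfl⟩; exact ⟨⟨j, hj⟩, rfl⟩
    · rintro ⟨j, rfl⟩; exact ⟨j, j.2, rfl⟩
  rw [thetaSpan, this, Submodule.mem_span_range_iff_exists_fun]

/-- No vector of index `< n` is modulo `X` a combination of the preceding ones; if a lattice is
stable under `d/dz`, then the coefficients of the equation for a cyclic vector are integral. -/
lemma thetaSup_eq_span (hfg : (thetaSup N v).FG)
    (hli : LinearIndependent L⸨X⸩ fun i : Fin n => (theta N)^[i] v)
    (hrel : (theta N)^[n] v = ∑ i, a i • (theta N)^[i] v) :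
    (∀ k < n, thetaVec N v k ∉ thetaSpan N v k ⊔ shift 1 (thetaSup N v)) ∧
      thetaSup N v = thetaSpan N v n := by
  have hmin : ∀ k < n, thetaVec N v k ∉ thetaSpan N v k ⊔ shift 1 (thetaSup N v) := by
    intro k hk hmem
    have h := thetaSup_le_of_mem hfg hmem
    have h1 : thetaVec N v k ∈ thetaSpan N v k := h ▸ thetaVec_mem_sup k
    have hw := thetaVec_linearIndependent hli
    refine hw.notMem_span_image (s := {i : Fin n | (i : ℕ) < k}) (x := ⟨k, hk⟩) (by simp) ?_
    refine mem_of_mem_span (fun s hs => ?_) h1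
    obtain ⟨j, hj, rfl⟩ := hs
    exact subset_span ⟨⟨j, lt_trans hj hk⟩, hj, rfl⟩
  refine ⟨hmin, ?_⟩
  by_contra hcon
  -- clear denominators in the equation
  choose r b hb using fun i : Fin n => exists_tpow_mul_mem (tpow L (n - (i : ℕ) : ℤ) * a i)
  have hex : ∃ R : ℕ, ∃ c : Fin n → L⟦X⟧, tpow L R • thetaVec N v n
      = ∑ i, c i • thetaVec N v i := by
    refine ⟨Finset.univ.sup r, fun i => PowerSeries.X ^ (Finset.univ.sup r - r i) * b i, ?_⟩
    rw [thetaVec_rel hrel, smul_sum]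
    refine sum_congr rfl fun i _ => ?_
    have hle := Finset.le_sup (f := r) (Finset.mem_univ i)
    rw [smul_smul, ← algebraMap_smul L⸨X⸩ (_ * b i), map_mul, coe_X_pow, ← hb, ← mul_assoc (tpow L
      ((Finset.univ.sup r - r i : ℕ) : ℤ)), tpow_mul, ← Nat.cast_add, Nat.sub_add_cancel hle]
  classical
  obtain ⟨c, hc⟩ := Nat.find_spec hex
  rcases Nat.eq_zero_or_pos (Nat.find hex) with h0 | hpos
  · refine hcon (thetaSup_le_of_mem hfg (mem_sup_left (mem_thetaSpan_iff.2 ⟨c, ?_⟩)))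
    rw [← hc, h0]; simp
  · have hXmem : ∀ m ∈ thetaSup N v, ϖ L • m ∈ shift 1 (thetaSup N v) :=
      fun m hm => by rw [← tpow_one_smul]; exact tpow_smul_mem_shift hm
    by_cases hall : ∀ i, constantCoeff (c i) = 0
    · choose c' hc' using fun i => PowerSeries.X_dvd_iff.2 (hall i)
      refine Nat.find_min hex (m := Nat.find hex - 1) (by omega) ⟨c', ?_⟩
      have : tpow L 1 • tpow L (Nat.find hex - 1 : ℕ) • thetaVec N v n
          = tpow L 1 • ∑ i, c' i • thetaVec N v i := by
        rw [tpow_smul_smul, smul_sum]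
        convert hc using 3
        · push_cast [hpos]; ring
        · rename_i i _
          rw [tpow_one_smul, smul_smul, ← hc']
      have h2 := congrArg (tpow L (-1) • ·) this
      simpa only [tpow_neg_smul_smul] using h2
    · push Not at hall
      obtain ⟨j, hj, hjmax⟩ : ∃ j, constantCoeff (c j) ≠ 0 ∧
          ∀ i > j, constantCoeff (c i) = 0 := by
        obtain ⟨j, hj⟩ := (Finset.univ.filter fun i => constantCoeff (c i) ≠ 0).exists_maximal
          (by obtain ⟨i, hi⟩ := hall; exact ⟨i, by simpa using hi⟩)
        have hj1 := hj.1
        refine ⟨j, by simpa using hj1, fun i hi => ?_⟩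
        by_contra hi0
        exact absurd (hj.2 (by simpa using hi0) hi.le) (not_le.2 hi)
      have hu : IsUnit (c j) := PowerSeries.isUnit_iff_constantCoeff.2 (isUnit_iff_ne_zero.2 hj)
      obtain ⟨c', hc'⟩ := hu.exists_left_inv
      refine hmin j j.2 ?_
      have e : thetaVec N v j = c' • (tpow L (Nat.find hex) • thetaVec N v n
          - ∑ i ∈ Finset.univ.erase j, c i • thetaVec N v i) := by
        rw [hc, ← Finset.add_sum_erase _ _ (Finset.mem_univ j), add_sub_cancel_right, smul_smul, hc',
          one_smul]
      rw [e]
      refine smul_mem _ _ (sub_mem ?_ (Submodule.sum_mem _ fun i hi => ?_))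
      · refine mem_sup_right ?_
        obtain ⟨R, hR⟩ := Nat.exists_eq_succ_of_ne_zero hpos.ne'
        rw [hR, tpow_natCast_smul, Nat.succ_eq_add_one, pow_succ', mul_smul]
        exact hXmem _ (smul_mem _ _ (thetaVec_mem_sup _))
      · rcases lt_or_gt_of_ne (Finset.ne_of_mem_erase hi) with h | h
        · exact mem_sup_left (smul_mem _ _ (thetaVec_mem_span h))
        · obtain ⟨b, hb⟩ := PowerSeries.X_dvd_iff.2 (hjmax i h)
          rw [hb, mul_smul]
          exact mem_sup_right (hXmem _ (smul_mem _ _ (thetaVec_mem_sup _)))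

/-- The coefficients of the equation of a cyclic vector, in the presence of a stable lattice. -/
lemma exists_integral_coeff (hfg : (thetaSup N v).FG)
    (hli : LinearIndependent L⸨X⸩ fun i : Fin n => (theta N)^[i] v)
    (hrel : (theta N)^[n] v = ∑ i, a i • (theta N)^[i] v) :
    ∃ b : Fin n → L⟦X⟧, (∀ i : Fin n, tpow L (n - (i : ℕ) : ℤ) * a i = algebraMap _ _ (b i)) ∧
      thetaVec N v n = ∑ i, b i • thetaVec N v i := by
  have h := (thetaSup_eq_span hfg hli hrel).2
  obtain ⟨b, hb⟩ := mem_thetaSpan_iff.1 (h ▸ thetaVec_mem_sup (N := N) (v := v) n)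
  refine ⟨b, fun i => ?_, hb.symm⟩
  have hw := thetaVec_linearIndependent hli
  have e : ∑ i : Fin n, (tpow L (n - (i : ℕ) : ℤ) * a i) • thetaVec N v i
      = ∑ i : Fin n, (algebraMap L⟦X⟧ L⸨X⸩ (b i)) • thetaVec N v i := by
    rw [← thetaVec_rel hrel, ← hb]
    exact sum_congr rfl fun i _ => (algebraMap_smul _ _ _).symm
  have := Fintype.linearIndependent_iff.1 hw
    (fun i => tpow L (n - (i : ℕ) : ℤ) * a i - algebraMap L⟦X⟧ L⸨X⸩ (b i)) (by
      simp only [sub_smul, Finset.sum_sub_distrib, e, sub_self]) i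
  exact sub_eq_zero.1 this

/-- If moreover `d/dz` is topologically nilpotent, then the coefficients are divisible by `X`. -/
lemma coeff_of_isNull (hfg : (thetaSup N v).FG)
    (hli : LinearIndependent L⸨X⸩ fun i : Fin n => (theta N)^[i] v)
    (hrel : (theta N)^[n] v = ∑ i, a i • (theta N)^[i] v)
    (hnull : ∃ k, thetaVec N v k ∈ shift 1 (thetaSup N v)) {b : Fin n → L⟦X⟧}
    (hb : thetaVec N v n = ∑ i, b i • thetaVec N v i) (i : Fin n) :
    constantCoeff (b i) = 0 := by
  obtain ⟨hmin, -⟩ := thetaSup_eq_span hfg hli hrel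
  have hst := thetaSup_stable (N := N) (v := v)
  have hstab : ∀ k, thetaVec N v k ∈ shift 1 (thetaSup N v) →
      ∀ l ≥ k, thetaVec N v l ∈ shift 1 (thetaSup N v) := fun k hk l hl => by
    have h1 := calculus_thetaVec (N := N) (v := v) k (l - k)
    rw [Nat.add_sub_cancel' hl] at h1
    have h2 := (calc_isCalculus N).apply_mem_shift (delZ_isDer N) hst 1 (X ^ (l - k)) hk
    have := sub_mem h2 h1
    rwa [sub_sub_cancel] at this
  by_contra hi
  classical
  obtain ⟨j, hj, hjmin⟩ : ∃ j, constantCoeff (b j) ≠ 0 ∧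
      ∀ i < j, constantCoeff (b i) = 0 :=
    ⟨_, WellFounded.min_mem wellFounded_lt {i | constantCoeff (b i) ≠ 0} ⟨i, hi⟩,
      fun i hi => not_not.1 fun h => WellFounded.not_lt_min wellFounded_lt _ h hi⟩
  have hk := Nat.find_spec hnull
  have hkmin : ∀ l < Nat.find hnull, thetaVec N v l ∉ shift 1 (thetaSup N v) := fun l hl =>
    Nat.find_min hnull hl
  generalize Nat.find hnull = k at hk hkmin
  have hnk : n ≤ k := by
    by_contra! h
    exact hmin k h (mem_sup_right hk)
  have hjn := j.2
  obtain ⟨r, hr⟩ : ∃ r, k = j + r + 1 := ⟨k - 1 - j, by omega⟩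
  have hXmem : ∀ m ∈ thetaSup N v, ϖ L • m ∈ shift 1 (thetaSup N v) :=
    fun m hm => by rw [← tpow_one_smul]; exact tpow_smul_mem_shift hm
  refine hkmin (j + r) (by omega) ?_
  -- apply `(-d/dz) ^ r` to the equation, modulo `X`
  have hterm : ∀ i, calc' N (X ^ r) (b i • thetaVec N v i) - b i • thetaVec N v (i + r)
      ∈ shift 1 (thetaSup N v) := fun i => by
    have h1 := (calc_isCalculus N).smul_sub_mem (delZ_isDer N) hst (X ^ r) (b i)
      (thetaVec_mem_sup (N := N) (v := v) i)
    have h2 := smul_mem _ (b i) (calculus_thetaVec (N := N) (v := v) i r)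
    rw [smul_sub] at h2
    have := add_mem h1 h2
    rwa [sub_add_sub_cancel] at this
  have hsum : calc' N (X ^ r) (thetaVec N v n) - ∑ i, b i • thetaVec N v (i + r)
      ∈ shift 1 (thetaSup N v) := by
    rw [hb, map_sum, ← Finset.sum_sub_distrib]
    exact Submodule.sum_mem _ fun i _ => hterm i
  have hn : calc' N (X ^ r) (thetaVec N v n) ∈ shift 1 (thetaSup N v) := by
    have := add_mem (calculus_thetaVec (N := N) (v := v) n r) (hstab k hk (n + r) (by omega))
    rwa [sub_add_cancel] at this
  have hsum' := sub_mem hn hsum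
  rw [sub_sub_cancel, ← Finset.add_sum_erase _ _ (Finset.mem_univ j)] at hsum'
  have hrest : ∑ i ∈ Finset.univ.erase j, b i • thetaVec N v (i + r)
      ∈ shift 1 (thetaSup N v) := Submodule.sum_mem _ fun i hi => by
    rcases lt_or_gt_of_ne (Finset.ne_of_mem_erase hi) with h | h
    · obtain ⟨c, hc⟩ := PowerSeries.X_dvd_iff.2 (hjmin i h)
      rw [hc, mul_smul]
      exact hXmem _ (smul_mem _ _ (thetaVec_mem_sup _))
    · refine smul_mem _ _ (hstab k hk _ ?_)
      have : (j : ℕ) < i := h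
      omega
  have h3 := sub_mem hsum' hrest
  rw [add_sub_cancel_right] at h3
  have hu : IsUnit (b j) := PowerSeries.isUnit_iff_constantCoeff.2 (isUnit_iff_ne_zero.2 hj)
  obtain ⟨c', hc'⟩ := hu.exists_left_inv
  have := smul_mem _ c' h3
  rwa [smul_smul, hc', one_smul] at this

end SlopeLattice

section SlopeTypes

variable {L : Type u} [Field L]

lemma order_of_integral {m : ℤ} {a : L⸨X⸩} {b : L⟦X⟧} (ha : a ≠ 0)
    (h : tpow L m * a = algebraMap _ _ b) :
    0 ≤ a.order + m ∧ (constantCoeff b = 0 → 0 < a.order + m) := by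
  have h1 : (tpow L m * a).coeff (a.order + m) = a.coeff a.order := by
    rw [HahnSeries.coeff_single_mul_add, one_mul]
  have h2 : (algebraMap L⟦X⟧ L⸨X⸩ b).coeff (a.order + m) ≠ 0 := by
    rw [← h, h1]; exact HahnSeries.coeff_order_eq_zero.not.2 ha
  rw [LaurentSeries.coe_algebraMap] at h2
  have h3 := PowerSeries.coeff_coe b (a.order + m)
  have h4 : 0 ≤ a.order + m := by
    by_contra! hneg
    rw [if_pos hneg] at h3
    exact h2 h3
  refine ⟨h4, fun h0 => lt_of_le_of_ne h4 fun heq => h2 ?_⟩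
  refine h3.trans ?_
  rw [← heq]
  simpa using h0

lemma exists_integral_of_order {m : ℤ} {a : L⸨X⸩} (h : 0 ≤ a.order + m) :
    ∃ b : L⟦X⟧, tpow L m * a = algebraMap _ _ b ∧
      (0 < a.order + m → constantCoeff b = 0) := by
  refine ⟨PowerSeries.X ^ (a.order + m).toNat * a.powerSeriesPart, ?_, fun hpos => ?_⟩
  · rw [map_mul, coe_X_pow, Int.toNat_of_nonneg h, add_comm, ← tpow_mul, mul_assoc]
    congr 1
    exact (LaurentSeries.single_order_mul_powerSeriesPart a).symm
  · rw [map_mul, map_pow, PowerSeries.constantCoeff_X, zero_pow (by omega), zero_mul]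

/-- The closed point `β` of the affine line. -/
def pointAt (β : L) : ClosedPoint L :=
  ⟨Ideal.span {X - C β}, PrincipalIdealRing.isMaximal_of_irreducible (irreducible_X_sub_C β)⟩

lemma mem_pointAt {β : L} {f : L[X]} : f ∈ (pointAt β).asIdeal ↔ f.eval β = 0 := by
  rw [pointAt, Ideal.mem_span_singleton, dvd_iff_isRoot]
  rfl

variable {N : DMod L⸨X⸩}

lemma slope_den_pos (i : Fin (Module.finrank L⸨X⸩ N)) :
    (0 : ℚ) < (Module.finrank L⸨X⸩ N : ℚ) - (i : ℕ) := by
  have := i.2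
  rw [sub_pos]
  exact_mod_cast this

lemma slope_le_one_iff {a : L⸨X⸩} {n i : ℕ} (h : i < n) :
    -((a.order : ℤ) : ℚ) / ((n : ℚ) - i) ≤ 1 ↔ 0 ≤ a.order + (n - i : ℤ) := by
  have hpos : (0 : ℚ) < (n : ℚ) - i := by rw [sub_pos]; exact_mod_cast h
  rw [div_le_one hpos]
  constructor
  · intro h
    have : (-(a.order : ℤ) : ℚ) ≤ ((n - i : ℤ) : ℚ) := by push_cast; exact h
    have := (by exact_mod_cast this : -a.order ≤ (n - i : ℤ))
    omega
  · intro h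
    have : -a.order ≤ (n - i : ℤ) := by omega
    have : ((-a.order : ℤ) : ℚ) ≤ ((n - i : ℤ) : ℚ) := by exact_mod_cast this
    push_cast at this
    exact this

lemma slope_lt_one_iff {a : L⸨X⸩} {n i : ℕ} (h : i < n) :
    -((a.order : ℤ) : ℚ) / ((n : ℚ) - i) < 1 ↔ 0 < a.order + (n - i : ℤ) := by
  have hpos : (0 : ℚ) < (n : ℚ) - i := by rw [sub_pos]; exact_mod_cast h
  rw [div_lt_one hpos]
  constructor
  · intro h
    have : (-(a.order : ℤ) : ℚ) < ((n - i : ℤ) : ℚ) := by push_cast; exact h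
    have := (by exact_mod_cast this : -a.order < (n - i : ℤ))
    omega
  · intro h
    have : -a.order < (n - i : ℤ) := by omega
    have : ((-a.order : ℤ) : ℚ) < ((n - i : ℤ) : ℚ) := by exact_mod_cast this
    push_cast at this
    exact this

/-- A slope at most one gives a lattice stable under `d/dz`; if the slope is less than one, then
`d/dz` is topologically nilpotent. -/
lemma exists_lattice_of_slope [Module.Finite L⸨X⸩ N] {s : ℚ} (hs : s ≤ 1) {n : ℕ}
    (hn : n = Module.finrank L⸨X⸩ N) {v : N} {a : Fin n → L⸨X⸩}
    (hli : LinearIndependent L⸨X⸩ fun i : Fin n => (theta N)^[i] v)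
    (hrel : (theta N)^[n] v = ∑ i, a i • (theta N)^[i] v)
    (hle : ∀ i, a i ≠ 0 → -((a i).order : ℚ) / ((n : ℚ) - (i : ℕ)) ≤ s) :
    ∃ Λ : Submodule L⟦X⟧ N, IsStableLattice (delZ N) ⊤ Λ ∧
      (s < 1 → ∃ j, ∀ m ∈ Λ, calc' N (X ^ j) m ∈ shift 1 Λ) := by
  have hb : ∀ i : Fin n, ∃ b : L⟦X⟧, tpow L (n - (i : ℕ) : ℤ) * a i = algebraMap _ _ b ∧
      (s < 1 → constantCoeff b = 0) := by
    intro i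
    by_cases h0 : a i = 0
    · exact ⟨0, by rw [h0, mul_zero, map_zero], fun _ => map_zero _⟩
    · have hle := hle i h0
      obtain ⟨b, hb, hb'⟩ := exists_integral_of_order ((slope_le_one_iff i.2).1 (hle.trans hs))
      exact ⟨b, hb, fun hs' => hb' ((slope_lt_one_iff i.2).1 (hle.trans_lt hs'))⟩
  choose b hb hb' using hb
  have hwn : thetaVec N v n = ∑ i, b i • thetaVec N v i := by
    rw [thetaVec_rel hrel]
    exact sum_congr rfl fun i _ => by rw [hb, algebraMap_smul]
  have hwn' : thetaVec N v n ∈ thetaSpan N v n := mem_thetaSpan_iff.2 ⟨b, hwn.symm⟩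
  have hst : ∀ m ∈ thetaSpan N v n, delZ N m ∈ thetaSpan N v n := by
    refine span_stable ?_ le_rfl
    rintro _ ⟨j, hj, rfl⟩
    rw [delZ_thetaVec]
    refine add_mem (neg_mem ?_) (smul_mem _ _ (thetaVec_mem_span hj))
    rcases lt_or_eq_of_le (Nat.succ_le_of_lt hj) with h | h
    · exact thetaVec_mem_span h
    · change thetaVec N v j.succ ∈ _
      rw [h]; exact hwn'
  have htop : span L⸨X⸩ (thetaSpan N v n : Set N) = ⊤ := by
    rw [eq_top_iff, ← (thetaVec_linearIndependent hli).span_eq_top_of_card_eq_finrank'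
      ((Fintype.card_fin n).trans hn)]
    refine span_mono ?_
    rintro _ ⟨i, rfl⟩
    exact thetaVec_mem_span i.2
  have hlat := isStableLattice_span (thetaSpan_fg n) hst
  rw [htop] at hlat
  refine ⟨_, hlat, fun hs' => ⟨n, ?_⟩⟩
  have hX := hlat.shift (delZ_isDer N) 1
  have hwn1 : thetaVec N v n ∈ shift 1 (thetaSpan N v n) := by
    rw [hwn]
    refine Submodule.sum_mem _ fun i _ => ?_
    obtain ⟨c, hc⟩ := PowerSeries.X_dvd_iff.2 (hb' i hs')
    rw [hc, mul_smul, ← tpow_one_smul]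
    exact tpow_smul_mem_shift (smul_mem _ _ (thetaVec_mem_span i.2))
  refine fun m => (calc_isCalculus N).apply_mem_of_span (delZ_isDer N) hst _ subset_span ?_
  rintro _ ⟨j, hj, rfl⟩
  have key : ∀ r, j + r ≤ n → calc' N (X ^ r) (thetaVec N v j) - thetaVec N v (j + r)
      ∈ shift 1 (thetaSpan N v n) := by
    intro r
    induction r with
    | zero => intro _; rw [pow_zero, calculus_one, add_zero, sub_self]; exact zero_mem _
    | succ r ih =>
      intro hr
      have e : calc' N (X ^ (r + 1)) (thetaVec N v j) - thetaVec N v (j + (r + 1))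
          = -delZ N (calc' N (X ^ r) (thetaVec N v j) - thetaVec N v (j + r))
            - ((j + r) • (-ϖ L)) • thetaVec N v (j + r) := by
        rw [pow_succ', calculus_mul, (calc_isCalculus N).var, map_sub, delZ_thetaVec, add_assoc]
        abel
      rw [e]
      refine sub_mem (neg_mem (hX.stable _ (ih (by omega)))) ?_
      rw [smul_neg, neg_smul, smul_assoc, ← tpow_one_smul]
      exact neg_mem (nsmul_mem (tpow_smul_mem_shift (thetaVec_mem_span (by omega))) _)
  have hj' : j < n := hj
  have h1 := key (n - j) (by omega)
  rw [Nat.add_sub_cancel' hj'.le] at h1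
  have h2 := add_mem h1 hwn1
  rw [sub_add_cancel] at h2
  rw [show (X : L[X]) ^ n = X ^ j * X ^ (n - j) by rw [← pow_add, Nat.add_sub_cancel' hj'.le],
    calculus_mul]
  exact hX.calculus (calc_isCalculus N) (X ^ j) h2

lemma HasSlope.exists_lattice [Module.Finite L⸨X⸩ N] {s : ℚ} (h : HasSlope N s)
    (hs : s ≤ 1) : ∃ Λ : Submodule L⟦X⟧ N, IsStableLattice (delZ N) ⊤ Λ ∧
      (s < 1 → ∃ j, ∀ m ∈ Λ, calc' N (X ^ j) m ∈ shift 1 Λ) := by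
  obtain ⟨v, a, hli, hrel, hgr⟩ := h
  exact exists_lattice_of_slope hs rfl hli hrel fun i h0 => hgr.2 (Or.inr ⟨i, h0, rfl⟩)

lemma HasSlope.le_one {s : ℚ} (h : HasSlope N s) {Λ : Submodule L⟦X⟧ N}
    (hΛ : IsStableLattice (delZ N) ⊤ Λ) : s ≤ 1 := by
  obtain ⟨v, a, hli, hrel, hgr⟩ := h
  obtain ⟨b, hb, -⟩ := exists_integral_coeff (thetaSup_fg hΛ) hli hrel
  rcases hgr.1 with rfl | ⟨i, h0, rfl⟩
  · exact zero_le_one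
  · exact (slope_le_one_iff i.2).2 (order_of_integral h0 (hb i)).1

lemma HasSlope.lt_one [Module.Finite L⸨X⸩ N] {s : ℚ} (h : HasSlope N s)
    (hN : IsPunctualAt (delZ N) (calc' N) (pointAt 0) ⊤) : s < 1 := by
  obtain ⟨v, a, hli, hrel, hgr⟩ := h
  obtain ⟨Λ, hΛ, hx⟩ := hN
  have hfg := thetaSup_fg (v := v) hΛ
  obtain ⟨b, hb, hbn⟩ := exists_integral_coeff hfg hli hrel
  have hnull : ∃ k, thetaVec N v k ∈ shift 1 (thetaSup N v) := by
    obtain ⟨j, hj⟩ := hx X (mem_pointAt.2 (by simp))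
    obtain ⟨Λ', hfg', hst', hnull'⟩ := hΛ.isNull (delZ_isDer N) (calc_isCalculus N) hj
      (m := v) trivial
    have habs : Absorbs (thetaSup N v) (⊤ : Submodule L⸨X⸩ N) := by
      have htop : span L⸨X⸩ (Set.range (thetaVec N v)) = ⊤ := by
        rw [eq_top_iff, ← (thetaVec_linearIndependent hli).span_eq_top_of_card_eq_finrank'
          (Fintype.card_fin _)]
        refine span_mono ?_
        rintro _ ⟨i, rfl⟩
        exact ⟨i, rfl⟩
      rw [← htop]
      exact absorbs_span _
    obtain ⟨c, hc⟩ := habs.exists_le_shift hfg' (fun _ _ => trivial)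
    obtain ⟨k, hk⟩ := hnull' (c + 1)
    refine ⟨k, ?_⟩
    have h1 := calculus_thetaVec (N := N) (v := v) 0 k
    rw [zero_add] at h1
    have h2 : calc' N (X ^ k) (thetaVec N v 0) ∈ shift 1 (thetaSup N v) := by
      rw [show thetaVec N v 0 = v by simp [thetaVec]]
      rw [mem_shift] at hk ⊢
      have := hc _ hk
      rw [← tpow_natCast_smul, tpow_smul_smul] at this
      convert this using 3
      push_cast; ring
    have := sub_mem h2 h1
    rwa [sub_sub_cancel] at this
  rcases hgr.1 with rfl | ⟨i, h0, rfl⟩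
  · exact zero_lt_one
  · exact (slope_lt_one_iff i.2).2 ((order_of_integral h0 (hb i)).2
      (coeff_of_isNull hfg hli hrel hnull hbn i))

lemma theta_smul (a : L⸨X⸩) (m : N) :
    theta N (a • m) = (tpow L 1 * a′) • m + a • theta N m := by
  rw [theta, N.leibniz, smul_add, smul_smul, smul_comm, ← theta]

lemma theta_add (m m' : N) : theta N (m + m') = theta N m + theta N m' := by
  rw [theta, map_add, smul_add, ← theta, ← theta]

lemma theta_zero : theta N 0 = 0 := by rw [theta, map_zero, smul_zero]

/-- In an irreducible module every non-zero vector is cyclic. -/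
lemma exists_hasSlope [Module.Finite L⸨X⸩ N] (hN : N.IsIrreducible) :
    ∃ s, HasSlope N s := by
  obtain ⟨hnt, hirr⟩ := hN
  obtain ⟨v, hv⟩ := exists_ne (0 : N)
  let S : ℕ →o Submodule L⸨X⸩ N.carrier :=
    ⟨fun k => span L⸨X⸩ (Set.range fun i : Fin k => (theta N)^[i] v), fun k l hkl =>
      span_mono (by rintro _ ⟨i, rfl⟩; exact ⟨⟨i, i.2.trans_le hkl⟩, rfl⟩)⟩
  have hSmem : ∀ {i k : ℕ}, i < k → (theta N)^[i] v ∈ S k := fun {i k} h =>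
    subset_span ⟨⟨i, h⟩, rfl⟩
  have hex : ∃ k, (theta N)^[k] v ∈ S k := by
    obtain ⟨k, hk⟩ := monotone_stabilizes_iff_noetherian.2
      (inferInstance : IsNoetherian L⸨X⸩ N) S
    exact ⟨k, hk (k + 1) k.le_succ ▸ hSmem k.lt_succ_self⟩
  classical
  have hk := Nat.find_spec hex
  have hmin : ∀ l < Nat.find hex, (theta N)^[l] v ∉ S l := fun l hl => Nat.find_min hex hl
  generalize Nat.find hex = k at hk hmin
  have hk0 : 0 < k := by
    rcases Nat.eq_zero_or_pos k with rfl | h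
    · have : S 0 = ⊥ := by
        rw [eq_bot_iff]
        refine span_le.2 ?_
        rintro _ ⟨i, rfl⟩
        exact i.elim0
      rw [this] at hk
      exact absurd hk hv
    · exact h
  have hst : N.Stable (S k) := by
    have hth : ∀ m ∈ S k, theta N m ∈ S k := by
      intro m hm
      refine span_induction (p := fun m _ => theta N m ∈ S k) ?_ ?_ ?_ ?_ hm
      · rintro _ ⟨i, rfl⟩
        change theta N ((theta N)^[i] v) ∈ _
        rw [← iterate_succ_apply' (theta N)]
        rcases lt_or_eq_of_le (Nat.succ_le_of_lt i.2) with h | h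
        · exact hSmem h
        · rw [h]; exact hk
      · rw [theta_zero]; exact zero_mem _
      · intro x y _ _ hx hy
        rw [theta_add]; exact add_mem hx hy
      · intro a x hx' hx
        rw [theta_smul]
        exact add_mem (smul_mem _ _ hx') (smul_mem _ _ hx)
    intro m hm
    have := (S k).smul_mem (tpow L (-1)) (hth m hm)
    rwa [theta, tpow_neg_smul_smul] at this
  have htop : S k = ⊤ := by
    rcases hirr _ hst with h | h
    · have := hSmem hk0
      rw [h] at this
      exact absurd this hv
    · exact h
  have hli : ∀ l ≤ k, LinearIndependent L⸨X⸩ fun i : Fin l => (theta N)^[i] v := by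
    intro l
    induction l with
    | zero => intro _; exact linearIndependent_empty_type
    | succ l ih =>
      intro hl
      rw [linearIndependent_finSucc']
      exact ⟨ih (by omega), hmin l (by omega)⟩
  have hkn : k = Module.finrank L⸨X⸩ N.carrier := by
    have h1 : Module.finrank L⸨X⸩ (S k) = Fintype.card (Fin k) :=
      finrank_span_eq_card (hli k le_rfl)
    rw [Fintype.card_fin, htop, finrank_top] at h1
    exact h1.symm
  subst hkn
  obtain ⟨a, ha⟩ := (Submodule.mem_span_range_iff_exists_fun _).1 hk
  have hfin : ({0} ∪ {r : ℚ | ∃ i, a i ≠ 0 ∧ r = -((a i).order : ℚ) /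
      ((Module.finrank L⸨X⸩ N : ℚ) - (i : ℕ))}).Finite := by
    refine (Set.finite_singleton _).union ((Set.finite_range fun i =>
      -((a i).order : ℚ) / ((Module.finrank L⸨X⸩ N : ℚ) - (i : ℕ))).subset ?_)
    rintro r ⟨i, -, rfl⟩
    exact ⟨i, rfl⟩
  obtain ⟨s, hs, hmax⟩ := Set.exists_max_image _ id hfin ⟨0, Or.inl rfl⟩
  exact ⟨s, v, a, hli _ le_rfl, ha.symm, hs, fun r hr => hmax r hr⟩

/-- Non-zero stable subspaces contain irreducible ones. -/
lemma exists_irreducible_component [Module.Finite L⸨X⸩ N] {F : Submodule L⸨X⸩ N}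
    (hF : N.Stable F) (h0 : F ≠ ⊥) :
    ∃ M : DMod L⸨X⸩, DMod.IsComponent M N ∧ HolK L M ∧
      ∃ i : M ⟶ N.sub F hF, Injective i.toLin := by
  obtain ⟨G, ⟨hG, hG0, hGF⟩, hmin⟩ := (wellFounded_lt (α := Submodule L⸨X⸩ N)).has_min
    {G | N.Stable G ∧ G ≠ ⊥ ∧ G ≤ F} ⟨F, hF, h0, le_rfl⟩
  let i : N.sub G hG ⟶ N := ⟨G.subtype, fun _ => rfl⟩
  have hirr : (N.sub G hG).IsIrreducible := by
    refine ⟨(Submodule.nontrivial_iff_ne_bot).2 hG0, fun H hH => ?_⟩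
    have hst : N.Stable (H.map i.toLin) := by
      rintro _ ⟨y, hy, rfl⟩
      exact ⟨_, hH y hy, i.comm y⟩
    have hle : H.map i.toLin ≤ G := by
      rintro _ ⟨y, hy, rfl⟩
      exact y.2
    by_cases hH0 : H.map i.toLin = ⊥
    · refine Or.inl (eq_bot_iff.2 fun y hy => ?_)
      have : i.toLin y ∈ H.map i.toLin := ⟨y, hy, rfl⟩
      rw [hH0] at this
      exact Subtype.ext this
    · refine Or.inr (eq_top_iff.2 fun y _ => ?_)
      have heq : H.map i.toLin = G := by
        by_contra hne
        exact hmin _ ⟨hst, hH0, hle.trans hGF⟩ (lt_of_le_of_ne hle hne)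
      have : i.toLin y ∈ H.map i.toLin := by rw [heq]; exact y.2
      obtain ⟨z, hz, e⟩ := this
      exact (Subtype.ext e : z = y) ▸ hz
  exact ⟨N.sub G hG, ⟨hirr, N.sub G hG, i, 𝟙 _, Subtype.val_injective, Function.surjective_id⟩,
    (inferInstance : Module.Finite L⸨X⸩ G),
    ⟨Submodule.inclusion hGF, fun _ => rfl⟩, Submodule.inclusion_injective hGF⟩

/-- A module without components of the other types is of the given type. -/
lemma isOfType_of_components (hN : HolK L N) (o : Option (ClosedPoint L))
    (h : ∀ M : DMod L⸨X⸩, DMod.IsComponent M N → HolK L M → ∀ o' ≠ o, ¬ IsOfType o' M) :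
    IsOfType o N := by
  have : Module.Finite L⸨X⸩ N.carrier := hN
  refine .of_maxPiece_eq_bot hN fun o' ho => by_contra fun h0 => ?_
  have hmax := isPiece_maxPiece' hN o'
  obtain ⟨M, hM, hMK, i, hi⟩ := exists_irreducible_component hmax.stable h0
  exact h M hM hMK o' ho ((IsOfType.sub hN hmax hmax.stable).of_injective i hi)

lemma IsOfType.subsingleton {o o' : Option (ClosedPoint L)} (h : IsOfType o N)
    (h' : IsOfType o' N) (ho : o ≠ o') : Subsingleton N.carrier :=
  subsingleton_of_forall_eq 0 fun m => h.map_eq_zero h' ho (𝟙 N) m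

/-- Slopes greater than one. -/
theorem slopeGT_iff : SlopeGT L N ↔ IsOfType none N := by
  constructor
  · rintro ⟨hN, hs⟩
    refine isOfType_of_components hN none fun M hM hMK o' ho' hM' => ?_
    have : Module.Finite L⸨X⸩ M.carrier := hMK
    obtain ⟨x, rfl⟩ := Option.ne_none_iff_exists'.1 ho'
    obtain ⟨-, Λ, hΛ, -⟩ := hM'
    obtain ⟨s, h⟩ := exists_hasSlope hM.1
    exact absurd (h.le_one hΛ) (not_le.2 (hs s ⟨M, hM, h⟩))
  · intro hN
    refine ⟨hN.1, ?_⟩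
    rintro s ⟨M, hM, hs⟩
    have hM' := hN.of_isComponent hM
    have : Module.Finite L⸨X⸩ M.carrier := hM'.1
    by_contra! hcon
    obtain ⟨Λ, hΛ, -⟩ := hs.exists_lattice hcon
    obtain ⟨v, hv⟩ := @exists_ne M hM.1.1 0
    exact hv (IsIrregular.eq_zero_of_isBounded (delZ_isDer M) hM'.2 trivial
      (hΛ.isBounded (delZ_isDer M) trivial))

/-- Slopes less than one. -/
theorem slopeLT_iff : SlopeLT L N ↔ IsOfType (some (pointAt 0)) N := by
  constructor
  · rintro ⟨hN, hs⟩
    refine isOfType_of_components hN _ fun M hM hMK o' ho' hM' => ?_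
    have : Module.Finite L⸨X⸩ M.carrier := hMK
    obtain ⟨s, h⟩ := exists_hasSlope hM.1
    have hs1 := hs s ⟨M, hM, h⟩
    obtain ⟨Λ, hΛ, hj⟩ := h.exists_lattice hs1.le
    obtain ⟨j, hj⟩ := hj hs1
    have : IsOfType (some (pointAt 0)) M := ⟨hMK, Λ, hΛ, fun f hf => ⟨j, fun m hm => by
      obtain ⟨q, rfl⟩ := Ideal.mem_span_singleton.1 hf
      rw [C_0, sub_zero, mul_pow, mul_comm, calculus_mul]
      exact (hΛ.shift (delZ_isDer M) 1).calculus (calc_isCalculus M) _ (hj m hm)⟩⟩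
    have := this.subsingleton hM' ho'.symm
    exact not_nontrivial_iff_subsingleton.2 this hM.1.1
  · intro hN
    refine ⟨hN.1, ?_⟩
    rintro s ⟨M, hM, hs⟩
    have hM' := hN.of_isComponent hM
    have : Module.Finite L⸨X⸩ M.carrier := hM'.1
    exact hs.lt_one hM'.2

end SlopeTypes

/-! ### Inverse images -/

namespace DiffMap

variable {R S : Type u} [CommRing R] [Differential R] [CommRing S] [Differential S]
  (φ : DiffMap R S) (M : DMod R)

/-- The canonical map from `M` to its inverse image, as a morphism to the direct image. -/
def unit : M ⟶ φ.pushforward.obj (φ.pullback.obj M) :=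
  letI : Algebra R S := φ.toRingHom.toAlgebra
  { toLin :=
      letI : Module R (φ.pullback.obj M).carrier :=
        (φ.pushforward.obj (φ.pullback.obj M)).module
      { toFun := fun m => ((1 : S) ⊗ₜ[R] m : S ⊗[R] M)
        map_add' := fun _ _ => TensorProduct.tmul_add _ _ _
        map_smul' := fun r m => by
          change (1 : S) ⊗ₜ[R] (r • m) = φ.toRingHom r • ((1 : S) ⊗ₜ[R] m)
          rw [← TensorProduct.smul_tmul, TensorProduct.smul_tmul', Algebra.smul_def, smul_eq_mul]
          rfl }
    comm := fun m => by
      change (1 : S) ⊗ₜ[R] M.del m = ((φ.jac⁻¹ : Sˣ) : S) • ((1 : S)′ ⊗ₜ[R] m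
        + ((φ.jac : S) * 1) ⊗ₜ[R] M.del m)
      rw [Derivation.map_one_eq_zero, TensorProduct.zero_tmul, zero_add, TensorProduct.smul_tmul',
        smul_eq_mul, mul_one, Units.inv_mul] }

/-- The map underlying the unit. -/
def incl : M →+ (φ.pullback.obj M).carrier := (φ.unit M).toLin.toAddMonoidHom

variable {M}

lemma incl_smul (r : R) (m : M) : φ.incl M (r • m) = φ.toRingHom r • φ.incl M m :=
  (φ.unit M).toLin.map_smul r m

lemma del_incl (m : M) :
    (φ.pullback.obj M).del (φ.incl M m) = (φ.jac : S) • φ.incl M (M.del m) := by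
  have h := (φ.unit M).comm m
  change φ.incl M (M.del m) = ((φ.jac⁻¹ : Sˣ) : S) • (φ.pullback.obj M).del (φ.incl M m) at h
  rw [h, smul_smul, Units.mul_inv, one_smul]

lemma span_incl : span S (Set.range (φ.incl M)) = ⊤ := by
  let _ : Algebra R S := φ.toRingHom.toAlgebra
  rw [eq_top_iff]
  rintro x -
  change S ⊗[R] M at x
  induction x using TensorProduct.induction_on with
  | zero => exact zero_mem _
  | tmul s m =>
    have : (s ⊗ₜ[R] m : S ⊗[R] M) = s • ((1 : S) ⊗ₜ[R] m) := by
      rw [TensorProduct.smul_tmul', smul_eq_mul, mul_one]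
    rw [this]
    exact smul_mem _ _ (subset_span ⟨m, rfl⟩)
  | add x y hx hy => exact add_mem hx hy

lemma pullback_hom_ext {Y : DMod S} {f g : φ.pullback.obj M ⟶ Y}
    (h : ∀ m, f.toLin (φ.incl M m) = g.toLin (φ.incl M m)) : f = g :=
  DMod.Hom.ext (LinearMap.ext_on_range (v := φ.incl M) φ.span_incl h)

/-- The inverse image is left adjoint to the direct image: the morphism extending `f`. -/
def lift {Y : DMod S} (f : M ⟶ φ.pushforward.obj Y) : φ.pullback.obj M ⟶ Y :=
  letI : Algebra R S := φ.toRingHom.toAlgebra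
  letI : Module R Y.carrier := (φ.pushforward.obj Y).module
  have : IsScalarTower R S Y.carrier := ⟨fun r s m => by
    rw [Algebra.smul_def, mul_smul]; rfl⟩
  let f₀ : M →ₗ[R] Y.carrier := f.toLin
  let g : S ⊗[R] M →ₗ[S] Y.carrier :=
    TensorProduct.AlgebraTensorModule.lift
      { toFun := fun s => s • f₀
        map_add' := fun _ _ => add_smul _ _ _
        map_smul' := fun _ _ => mul_smul _ _ _ }
  have hg : ∀ (s : S) (m : M), g (s ⊗ₜ m) = s • f₀ m := fun _ _ => rfl
  { toLin := g
    comm := fun x => by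
      change S ⊗[R] M at x
      change g (tensorDel (φ.jac : S) φ.deriv_map M x) = Y.del (g x)
      have hf : ∀ m, (φ.jac : S) • f₀ (M.del m) = Y.del (f₀ m) := by
        intro m
        have h : f₀ (M.del m) = ((φ.jac⁻¹ : Sˣ) : S) • Y.del (f₀ m) := f.comm m
        rw [h, smul_smul, Units.mul_inv, one_smul]
      induction x using TensorProduct.induction_on with
      | zero => simp only [map_zero]
      | tmul s m =>
        rw [tensorDel_tmul, map_add, hg, hg, hg, Y.leibniz, mul_comm, mul_smul, hf]
      | add x y hx hy => rw [map_add, map_add, map_add, map_add, hx, hy] }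

@[simp] lemma lift_incl {Y : DMod S} (f : M ⟶ φ.pushforward.obj Y) (m : M) :
    (φ.lift f).toLin (φ.incl M m) = f.toLin m := by
  let m' : Y.carrier := f.toLin m
  exact one_smul S m'

lemma map_incl {M' : DMod R} (f : M ⟶ M') (m : M) :
    (φ.pullback.map f).toLin (φ.incl M m) = φ.incl M' (f.toLin m) := rfl

end DiffMap

/-! ### Extension of constants -/

section Extend

variable {k : Type u} [Field k] (N : DMod k⸨X⸩)

/-- The module over the Laurent series with coefficients in the algebraic closure. -/
abbrev extended : DMod (AlgebraicClosure k)⸨X⸩ := (extendConstants k).pullback.obj N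

lemma incl_injective : Injective ((extendConstants k).incl N) := by
  let _ : Algebra k⸨X⸩ (AlgebraicClosure k)⸨X⸩ := (extendConstants k).toRingHom.toAlgebra
  exact Module.FaithfullyFlat.tensorProduct_mk_injective (A := k⸨X⸩)
    (B := (AlgebraicClosure k)⸨X⸩) N

lemma extended_finite (hN : HolK k N) : HolK (AlgebraicClosure k) (extended N) := by
  let _ : Algebra k⸨X⸩ (AlgebraicClosure k)⸨X⸩ := (extendConstants k).toRingHom.toAlgebra
  have : Module.Finite k⸨X⸩ N.carrier := hN
  exact Module.Finite.base_change k⸨X⸩ (AlgebraicClosure k)⸨X⸩ N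

lemma extendConstants_single (n : ℤ) (a : k) :
    (extendConstants k).toRingHom (single n a)
      = single n (algebraMap k (AlgebraicClosure k) a) :=
  HahnSeries.map_single (algebraMap k (AlgebraicClosure k)).toZeroHom

lemma extendConstants_powerSeries (a : k⟦X⟧) :
    (extendConstants k).toRingHom ((puncture k).toRingHom a)
      = (puncture (AlgebraicClosure k)).toRingHom
        (PowerSeries.map (algebraMap k (AlgebraicClosure k)) a) := by
  ext n
  have h1 := PowerSeries.coeff_coe a n
  have h2 := PowerSeries.coeff_coe (PowerSeries.map (algebraMap k (AlgebraicClosure k)) a) n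
  refine (congrArg (algebraMap k (AlgebraicClosure k)) h1).trans (Eq.trans ?_ h2.symm)
  split_ifs <;> simp

lemma incl_isHorizontal : IsHorizontal (delZ N) (calc' N) (delZ (extended N)) (calc' (extended N))
    (PowerSeries.map (algebraMap k (AlgebraicClosure k)))
    (mapRingHom (algebraMap k (AlgebraicClosure k))) ((extendConstants k).incl N) := by
  have hsmul : ∀ (a : k⟦X⟧) m, (extendConstants k).incl N (a • m)
      = PowerSeries.map (algebraMap k (AlgebraicClosure k)) a • (extendConstants k).incl N m := by
    intro a m
    refine ((extendConstants k).incl_smul _ m).trans ?_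
    exact congrArg (· • (extendConstants k).incl N m) (extendConstants_powerSeries a)
  have hdel : ∀ m, (extendConstants k).incl N (delZ N m)
      = delZ (extended N) ((extendConstants k).incl N m) := by
    intro m
    rw [delZ_apply, delZ_apply, DiffMap.incl_smul, DiffMap.del_incl, extendConstants_single,
      map_neg, map_one]
    congr 1
    exact (one_smul (AlgebraicClosure k)⸨X⸩ _).symm
  refine ⟨by simp, hsmul, hdel, fun p => ?_⟩
  induction p using Polynomial.induction_on with
  | C a =>
    intro m
    rw [(calc_isCalculus N).const, hsmul, coe_mapRingHom, map_C,
      (calc_isCalculus (extended N)).const, PowerSeries.map_C]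
  | add p q hp hq => intro m; rw [calculus_add, map_add, map_add, calculus_add, hp, hq]
  | monomial n a ih =>
    intro m
    rw [pow_succ, ← mul_assoc]
    generalize C a * X ^ n = q at ih
    rw [calculus_mul, map_mul, calculus_mul, ih, (calc_isCalculus N).var, coe_mapRingHom, map_X,
      (calc_isCalculus (extended N)).var, map_neg, hdel]

end Extend

/-! ### Twists -/

section Twist

variable {L : Type u} [Field L] (M : DMod L⸨X⸩)

lemma delZ_twist (γ : L) (m : M) :
    (delZ (twist (single (-2) γ) M) m : M)
      = delZ M m - (PowerSeries.C γ : L⟦X⟧) • m := by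
  rw [delZ_apply]
  change (single 2 (-1) : L⸨X⸩) • (M.del m + (single (-2) γ : L⸨X⸩) • m) = _
  rw [smul_add, smul_smul, HahnSeries.single_mul_single, sub_eq_add_neg, ← neg_smul]
  congr 1
  change _ = (puncture L).toRingHom (-PowerSeries.C γ) • m
  congr 1
  rw [← map_neg]
  refine Eq.trans ?_ (HahnSeries.ofPowerSeries_C (-γ)).symm
  simp [HahnSeries.C_apply]

lemma calc_twist (γ : L) (p : L[X]) : ∀ m : M,
    (calc' (twist (single (-2) γ) M) p m : M)
      = calc' M (p.comp (X + C γ)) m := by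
  have h := calc_isCalculus (twist (single (-2) γ) M)
  have h' := calc_isCalculus M
  induction p using Polynomial.induction_on with
  | C a => intro m; rw [C_comp, h'.const]; exact h.const a m
  | add p q hp hq => 
    intro m; rw [add_comp, calculus_add, ← hp, ← hq]; exact calculus_add _ _ _
  | monomial n a ih =>
    intro m
    rw [pow_succ, ← mul_assoc]
    generalize C a * X ^ n = q at ih
    rw [mul_comp, X_comp, calculus_mul, calculus_add, h'.const, h'.var, ← ih]
    refine (calculus_mul (ρ := calc' (twist (single (-2) γ) M)) _ _ m).trans ?_
    congr 1
    refine (h.var m).trans ?_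
    refine (congrArg Neg.neg (delZ_twist M γ m)).trans ?_
    abel

variable {M}

/-- Twisting by `γ / X ^ 2` translates the type by `γ`. -/
lemma IsOfType.twist {β : L} (γ : L) (h : IsOfType (some (pointAt β)) M) :
    IsOfType (some (pointAt (β + γ))) (twist (single (-2) γ) M) := by
  obtain ⟨hM, Λ, hΛ, hx⟩ := h
  refine ⟨hM, Λ, ⟨hΛ.fg, fun _ _ => trivial, hΛ.absorbs, ?_⟩, fun f hf => ?_⟩
  · have e : ∀ m ∈ Λ, delZ M m - (PowerSeries.C γ : L⟦X⟧) • m ∈ Λ := fun m hm =>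
      sub_mem (hΛ.stable m hm) (Λ.smul_mem _ hm)
    simp only [← delZ_twist] at e
    exact e
  · obtain ⟨j, hj⟩ := hx (f.comp (X + C γ)) (by
      rw [mem_pointAt] at hf ⊢
      simpa using hf)
    simp only [← pow_comp, ← calc_twist] at hj
    exact ⟨j, hj⟩

end Twist

/-! ### The classes of slope at most one -/

section SlopeLE

variable {k : Type u} [Field k] {N : DMod k⸨X⸩}

lemma pointAt_injective {L : Type u} [Field L] : Injective (pointAt (L := L)) := by
  intro β γ h
  have : X - C β ∈ (pointAt γ).asIdeal := by rw [← h, mem_pointAt]; simp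
  rw [mem_pointAt] at this
  simpa [sub_eq_zero, eq_comm] using this

lemma exists_eq_pointAt {L : Type u} [Field L] [IsAlgClosed L] (x : ClosedPoint L) :
    ∃ β, x = pointAt β := by
  obtain ⟨g, hg⟩ := (inferInstance : IsPrincipalIdealRing L[X]).principal x.asIdeal
  have hg0 : g.degree ≠ 0 := by
    intro h
    apply x.isMaximal.ne_top
    rw [hg]
    exact Ideal.span_singleton_eq_top.2 (isUnit_iff_degree_eq_zero.2 h)
  obtain ⟨β, hβ⟩ := IsAlgClosed.exists_root g hg0
  refine ⟨β, MaximalSpectrum.ext (x.isMaximal.eq_of_le (pointAt β).isMaximal.ne_top ?_)⟩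
  intro f hf
  rw [hg] at hf
  obtain ⟨q, rfl⟩ := Ideal.mem_span_singleton'.1 hf
  rw [mem_pointAt, eval_mul, hβ.eq_zero, mul_zero]

/-- After extension of constants, a module of type `x` keeps a stable lattice on which the
elements of the ideal of `x` are nilpotent. -/
lemma exists_lattice_extended {x : ClosedPoint k} (h : IsOfType (some x) N) :
    ∃ Λ : Submodule (AlgebraicClosure k)⟦X⟧ (extended N),
      IsStableLattice (delZ (extended N)) ⊤ Λ ∧ ∀ f ∈ x.asIdeal, ∃ j, ∀ m ∈ Λ,
      calc' (extended N) (f.map (algebraMap k (AlgebraicClosure k)) ^ j) m ∈ shift 1 Λ := by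
  obtain ⟨hN, Λ, hΛ, hx⟩ := h
  have hh := incl_isHorizontal N
  have hf := hh.fg_span_image hΛ.fg
  have hs := hh.stable_span_image hΛ.stable (delZ_isDer (extended N))
  set Λ' := span (AlgebraicClosure k)⟦X⟧ ((extendConstants k).incl N '' Λ) with hΛ'
  have hle : ∀ m ∈ Λ, (extendConstants k).incl N m ∈ Λ' := fun m hm =>
    subset_span ⟨m, hm, rfl⟩
  have htop : span (AlgebraicClosure k)⸨X⸩ (Λ' : Set (extended N))
      = ⊤ := by
    rw [eq_top_iff, ← (extendConstants k).span_incl (M := N), span_le]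
    rintro _ ⟨m, rfl⟩
    obtain ⟨e, he⟩ := hΛ.absorbs.exists_mem_shift (m := m) trivial
    have := smul_mem (span (AlgebraicClosure k)⸨X⸩
      (Λ' : Set (extended N))) (tpow (AlgebraicClosure k) (-e)) (subset_span
        (mem_shift.1 (hh.map_mem_shift hle he)))
    rwa [tpow_smul_neg_smul] at this
  have hL := isStableLattice_span hf hs
  rw [htop] at hL
  refine ⟨Λ', hL, fun f hfx => ?_⟩
  obtain ⟨j, hj⟩ := hx f hfx
  refine ⟨j, fun m => (calc_isCalculus _).apply_mem_of_span (delZ_isDer _) hs _ subset_span ?_⟩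
  rintro _ ⟨m, hm, rfl⟩
  rw [← Polynomial.map_pow, ← coe_mapRingHom, ← hh.calculus]
  exact hh.map_mem_shift hle (hj m hm)

theorem slopeLE_iff {x : ClosedPoint k} : SlopeLE x N ↔ IsOfType (some x) N := by
  constructor
  · rintro ⟨hN, M, hM, f, hf⟩
    have hN' := extended_finite N hN
    have : Module.Finite k⸨X⸩ N.carrier := hN
    have : Module.Finite (AlgebraicClosure k)⸨X⸩ (extended N).carrier := hN'
    have hh := incl_isHorizontal N
    have hM' : ∀ β, IsPiece (delZ (extended N)) (calc' (extended N)) (some (pointAt β.1))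
        (range (f β).toLin) := fun β => by
      have h := (slopeLT_iff.1 (hM β)).twist β.1
      rw [zero_add] at h
      rw [← Submodule.map_top]
      exact h.2.map (f β)
    have htop : ⨆ β, range (f β).toLin = ⊤ := by
      classical
      rw [eq_top_iff]
      rintro m -
      obtain ⟨y, rfl⟩ := hf.2 m
      induction y using DirectSum.induction_on with
      | zero => rw [map_zero]; exact zero_mem _
      | of β y =>
        refine mem_iSup_of_mem β ⟨y, ?_⟩
        refine Eq.trans (DirectSum.toModule_lof (AlgebraicClosure k)⸨X⸩
          (φ := fun β => (f β).toLin) β y).symm ?_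
        congr!
      | add y z hy hz => rw [map_add]; exact add_mem hy hz
    refine .of_maxPiece_eq_bot hN fun o ho => ?_
    have hmax := isPiece_maxPiece' hN o
    rw [eq_bot_iff]
    intro v hv
    refine incl_injective N ?_
    rw [map_zero]
    cases o with
    | none =>
      obtain ⟨S, Λ, hΛ, hS⟩ := exists_isStableLattice (L := AlgebraicClosure k) (delZ (extended N))
      have hle : ⊤ ≤ S := htop ▸ iSup_le fun β => by
        obtain ⟨Λ, hΛ, -⟩ := hM' β
        exact hS _ _ hΛ
      exact IsIrregular.map_eq_zero (delZ_isDer N) hmax hh (delZ_isDer _) hΛ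
        (fun m _ => hle trivial) hv
    | some y =>
      obtain ⟨p, hp, g, hg, hpg⟩ := exists_isCoprime (x := y) (y := x) (by rintro rfl; exact ho rfl)
      have hnull : ∀ m : (extended N), ∃ n : ℕ, IsNull (delZ (extended N))
          (calc' (extended N)) (mapRingHom (algebraMap k (AlgebraicClosure k)) g ^ n) m := by
        intro m
        have hm : m ∈ ⨆ β, range (f β).toLin := htop ▸ trivial
        refine Submodule.iSup_induction _ (motive := fun m => ∃ n : ℕ, IsNull (delZ (extended N))
          (calc' (extended N)) (mapRingHom (algebraMap k (AlgebraicClosure k)) g ^ n) m) hm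
          ?_ ?_ ?_
        · intro β m hm
          refine ⟨1, IsPunctualAt.isNull (delZ_isDer _) (calc_isCalculus _) (hM' β) ?_ hm⟩
          rw [pow_one, mem_pointAt, coe_mapRingHom, eval_map_algebraMap]
          exact β.2 g hg
        · exact ⟨0, .zero⟩
        · rintro a b ⟨i, hi⟩ ⟨j, hj⟩
          exact ⟨i + j, by rw [pow_add]; exact hi.add (delZ_isDer _) (calc_isCalculus _) hj⟩
      obtain ⟨n, hn⟩ := hnull ((extendConstants k).incl N v)
      exact ((IsPunctualAt.isNull (delZ_isDer N) (calc_isCalculus N) hmax hp hv).map hh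
        (delZ_isDer _)).eq_zero (delZ_isDer _) (calc_isCalculus _) hn
        ((hpg.map (mapRingHom (algebraMap k (AlgebraicClosure k)))).pow_right)
  · intro h
    have hN' := extended_finite N h.1
    have : Module.Finite (AlgebraicClosure k)⸨X⸩ (extended N).carrier := hN'
    obtain ⟨Λ, hΛ, hx⟩ := exists_lattice_extended h
    have hmax := isPiece_maxPiece' hN'
    let S : GeomPoint x → DMod (AlgebraicClosure k)⸨X⸩ := fun β =>
      (extended N).sub _ (hmax (some (pointAt β.1))).stable
    have hS : ∀ β, IsOfType (some (pointAt β.1)) (S β) := fun β => IsOfType.sub hN' (hmax _) _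
    let f : ∀ β : GeomPoint x, twist (single (-2) β.1)
        (twist (single (-2) (-β.1)) (S β)) ⟶ extended N := fun β =>
      { toLin := (maxPiece (delZ (extended N)) (calc' (extended N))
          (some (pointAt β.1))).subtype
        comm := fun m => by
          change (extended N).del m.1 + (single (-2) (-β.1) : (AlgebraicClosure k)⸨X⸩) •
            m.1 + (single (-2) β.1 : (AlgebraicClosure k)⸨X⸩) • m.1
            = (extended N).del m.1
          rw [add_assoc, ← add_smul, HahnSeries.single_neg, neg_add_cancel, zero_smul, add_zero] }
    have hr : ∀ β, range (f β).toLin = maxPiece (delZ (extended N)) (calc' (extended N))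
      (some (pointAt β.1)) := fun β => Submodule.range_subtype _
    refine ⟨h.1, fun β => twist (single (-2) (-β.1)) (S β), fun β => ?_, f,
      isDirectSum_of_iSupIndep f (fun β => Subtype.val_injective) ?_ ?_⟩
    · have := (hS β).twist (-β.1)
      rw [add_neg_cancel] at this
      exact slopeLT_iff.2 this
    · simp only [hr]
      exact (iSupIndep_maxPiece (delZ_isDer (extended N)) (calc_isCalculus (extended N))).comp
        (f := fun β : GeomPoint x => some (pointAt β.1)) fun β γ hβ =>
          Subtype.ext (pointAt_injective (Option.some_injective _ hβ))
    · rw [eq_top_iff, ← iSup_maxPiece (delZ_isDer (extended N)) (calc_isCalculus (extended N))]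
      refine iSup_le fun o => ?_
      by_cases ho : ∃ β : GeomPoint x, o = some (pointAt β.1)
      · obtain ⟨β, rfl⟩ := ho
        rw [← hr]
        exact le_iSup (fun β => range (f β).toLin) β
      · intro v hv
        have : v = 0 := by
          cases o with
          | none =>
            exact IsIrregular.eq_zero_of_isBounded (delZ_isDer _) (hmax none) hv
              (hΛ.isBounded (delZ_isDer _) trivial)
          | some y =>
            obtain ⟨β, rfl⟩ := exists_eq_pointAt y
            obtain ⟨g, hg, hgβ⟩ : ∃ g ∈ x.asIdeal, aeval β g ≠ 0 := by
              by_contra! hcon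
              exact ho ⟨⟨β, hcon⟩, rfl⟩
            obtain ⟨p, hp, hpg⟩ := exists_isCoprime_of_notMem (pointAt β)
              (g := g.map (algebraMap k (AlgebraicClosure k))) (by
                rwa [mem_pointAt, eval_map_algebraMap])
            obtain ⟨j, hj⟩ := hx g hg
            have hpt : IsPunctualAt (delZ (extended N)) (calc' (extended N)) (pointAt β)
              (maxPiece (delZ (extended N)) (calc' (extended N)) (some (pointAt β))) := hmax (some (pointAt β))
            exact (hpt.isNull (delZ_isDer _) (calc_isCalculus _) hp hv).eq_zero
              (delZ_isDer _) (calc_isCalculus _)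
              (hΛ.isNull (delZ_isDer _) (calc_isCalculus _) hj trivial) hpg
        rw [this]
        exact zero_mem _

/-- The slope classes are the types. -/
theorem piece_eq (o : Option (ClosedPoint k)) : piece k o = IsOfType o := by
  funext N
  cases o with
  | none => exact propext slopeGT_iff
  | some x => exact propext slopeLE_iff

end SlopeLE

/-! ### Extension of actions by continuity -/

lemma deriv_mul {R : Type u} [CommRing R] [Differential R] (a b : R) :
    (a * b)′ = a * b′ + b * a′ := Derivation.leibniz _ _ _

lemma powerSeries_deriv_X_mul {L : Type u} [CommRing L] (b : L⟦X⟧) :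
    (PowerSeries.X * b)′ = PowerSeries.X * b′ + b := by
  rw [deriv_mul, show (ϖ L)′ = 1 from PowerSeries.derivative_X, mul_one]

lemma powerSeries_dvd_deriv {L : Type u} [CommRing L] {n : ℕ} {a : L⟦X⟧}
    (h : ϖ L ^ (n + 1) ∣ a) : ϖ L ^ n ∣ a′ := by
  obtain ⟨b, rfl⟩ := h
  induction n generalizing b with
  | zero => simp
  | succ n ih =>
    rw [pow_succ' _ (n + 1), mul_assoc, powerSeries_deriv_X_mul]
    refine dvd_add ?_ (Dvd.intro _ rfl)
    have h := mul_dvd_mul_left ϖ L (ih b)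
    rwa [← pow_succ'] at h

section Completion

variable {P L : Type u} [CommRing P] [Field L] {Y : Type*} [AddCommGroup Y] [Module P Y]

/-- `y` is the limit of `p • m` as `φ p` tends to `r`. -/
def IsLim (φ : P →+* L⟦X⟧) (U : ℕ → AddSubgroup Y) (r : L⟦X⟧) (m y : Y) : Prop :=
  ∀ n, ∃ j, ∀ i ≥ j, ∀ p, ϖ L ^ i ∣ r - φ p → y - p • m ∈ U n

variable {φ : P →+* L⟦X⟧} {U : ℕ → AddSubgroup Y}

lemma exists_isLim (hd : ∀ r n, ∃ p, ϖ L ^ n ∣ r - φ p)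
    (hcont : ∀ m n, ∃ j, ∀ p, ϖ L ^ j ∣ φ p → p • m ∈ U n) (hc : SeqComplete U) (r : L⟦X⟧) (m : Y) :
    ∃ y, IsLim φ U r m y := by
  choose j hj using hcont m
  choose p hp using hd r
  let i : ℕ → ℕ := fun n => ∑ l ∈ Finset.range (n + 1), j l
  have hi : ∀ n, j n ≤ i n := fun n =>
    Finset.single_le_sum (f := j) (fun _ _ => Nat.zero_le _) (Finset.self_mem_range_succ n)
  have hmono : ∀ n, i n ≤ i (n + 1) := fun n =>
    (Nat.le_add_right _ _).trans (sum_range_succ j (n + 1)).ge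
  have key : ∀ n q q', ϖ L ^ i n ∣ r - φ q → ϖ L ^ i n ∣ r - φ q' → q • m - q' • m ∈ U n :=
    fun n q q' hq hq' => by
      rw [← sub_smul]
      refine hj n _ ((pow_dvd_pow _ (hi n)).trans ?_)
      simpa using dvd_sub hq' hq
  obtain ⟨l, hl⟩ := hc (fun n => p (i n) • m) fun n =>
    key n _ _ ((pow_dvd_pow _ (hmono n)).trans (hp _)) (hp _)
  refine ⟨l, fun n => ⟨i n, fun a ha q hq => ?_⟩⟩
  rw [← sub_add_sub_cancel l (p (i n) • m)]
  exact add_mem (hl n) (key n _ _ (hp _) ((pow_dvd_pow _ ha).trans hq))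

/-- Uniqueness of limits, with a weak hypothesis on the second limit. -/
lemma IsLim.eq (hsep : Separated U) {r : L⟦X⟧} {m y y' : Y} (hy : IsLim φ U r m y)
    (hy' : ∀ n j, ∃ p, ϖ L ^ j ∣ r - φ p ∧ y' - p • m ∈ U n) : y' = y := by
  rw [← sub_eq_zero]
  refine hsep _ fun n => ?_
  obtain ⟨j, hj⟩ := hy n
  obtain ⟨p, hp, hp'⟩ := hy' n j
  rw [← sub_sub_sub_cancel_right y' y (p • m)]
  exact sub_mem hp' (hj j le_rfl p hp)

variable [Differential P]

/-- A module that is complete for a filtration, on which a dense homomorphism `φ` to a ring of power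
series acts continuously, comes from a module over the power series. -/
theorem exists_completion (φ : DiffMap P L⟦X⟧) (M : DMod P) (U : ℕ → AddSubgroup M)
    (hd : ∀ r n, ∃ p, ϖ L ^ n ∣ r - φ.toRingHom p)
    (hcont : ∀ m n, ∃ j, ∀ p, ϖ L ^ j ∣ φ.toRingHom p → p • m ∈ U n)
    (hmem : ∀ (p : P) n, ∀ m ∈ U n, p • m ∈ U n) (hdel : ∀ n, ∃ j, ∀ m ∈ U j, M.del m ∈ U n)
    (hc : SeqComplete U) (hsep : Separated U) :
    ∃ (Y : DMod L⟦X⟧) (e : M ⟶ φ.pushforward.obj Y) (V : ℕ → Submodule L⟦X⟧ Y),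
      Bijective e.toLin ∧ ∀ n m, (e.toLin m : Y) ∈ V n ↔ m ∈ U n := by
  choose f hf using exists_isLim hd hcont hc
  have hle : ∀ {a b : ℕ} {r : L⟦X⟧}, a ≤ b → ϖ L ^ b ∣ r → ϖ L ^ a ∣ r :=
    fun hab h => (pow_dvd_pow _ hab).trans h
  have hφ : ∀ p m, p • m = f (φ.toRingHom p) m := fun p m =>
    (hf _ m).eq hsep fun n j => ⟨p, by simp, by simp [zero_mem]⟩
  have hadd : ∀ r m m', f r (m + m') = f r m + f r m' := fun r m m' =>
    ((hf r _).eq hsep fun n j => by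
      obtain ⟨j₁, h₁⟩ := hf r m n
      obtain ⟨j₂, h₂⟩ := hf r m' n
      obtain ⟨p, hp⟩ := hd r (j + j₁ + j₂)
      refine ⟨p, hle (by omega) hp, ?_⟩
      rw [smul_add, add_sub_add_comm]
      exact add_mem (h₁ _ (by omega) p hp) (h₂ _ (by omega) p hp)).symm
  have hadd' : ∀ r r' m, f (r + r') m = f r m + f r' m := fun r r' m =>
    ((hf _ m).eq hsep fun n j => by
      obtain ⟨j₁, h₁⟩ := hf r m n
      obtain ⟨j₂, h₂⟩ := hf r' m n
      obtain ⟨p, hp⟩ := hd r (j + j₁)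
      obtain ⟨p', hp'⟩ := hd r' (j + j₂)
      refine ⟨p + p', ?_, ?_⟩
      · rw [map_add, add_sub_add_comm]
        exact dvd_add (hle (by omega) hp) (hle (by omega) hp')
      · rw [add_smul, add_sub_add_comm]
        exact add_mem (h₁ _ (by omega) p hp) (h₂ _ (by omega) p' hp')).symm
  have hmul : ∀ r r' m, f (r * r') m = f r (f r' m) := fun r r' m =>
    ((hf _ m).eq hsep fun n j => by
      obtain ⟨j₁, h₁⟩ := hf r (f r' m) n
      obtain ⟨j₂, h₂⟩ := hf r' m n
      obtain ⟨p, hp⟩ := hd r (j + j₁)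
      obtain ⟨p', hp'⟩ := hd r' (j + j₂)
      refine ⟨p * p', ?_, ?_⟩
      · rw [map_mul, show r * r' - φ.toRingHom p * φ.toRingHom p'
          = r' * (r - φ.toRingHom p) + φ.toRingHom p * (r' - φ.toRingHom p') by ring]
        exact dvd_add ((hle (by omega) hp).mul_left _) ((hle (by omega) hp').mul_left _)
      · rw [mul_smul, ← sub_add_sub_cancel _ (p • f r' m), ← smul_sub]
        exact add_mem (h₁ _ (by omega) p hp) (hmem _ _ _ (h₂ _ (by omega) p' hp'))).symm
  have hleib : ∀ r m, M.del (f r m) = f (((φ.jac⁻¹ : L⟦X⟧ˣ) : L⟦X⟧) * r′) m + f r (M.del m) :=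
    fun r m => by
      rw [← sub_eq_iff_eq_add]
      refine (hf _ m).eq hsep fun n j => ?_
      obtain ⟨n', hn'⟩ := hdel n
      obtain ⟨j₁, h₁⟩ := hf r m n'
      obtain ⟨j₂, h₂⟩ := hf r (M.del m) n
      obtain ⟨p, hp⟩ := hd r (j + 1 + j₁ + j₂)
      refine ⟨p′, ?_, ?_⟩
      · have := powerSeries_dvd_deriv (n := j) (hle (by omega) hp)
        rw [map_sub, φ.deriv_map] at this
        simpa [mul_sub] using this.mul_left ((φ.jac⁻¹ : L⟦X⟧ˣ) : L⟦X⟧)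
      · rw [show M.del (f r m) - f r (M.del m) - p′ • m
            = M.del (f r m - p • m) - (f r (M.del m) - p • M.del m) by
          rw [map_sub, M.leibniz]; abel]
        exact sub_mem (hn' _ (h₁ _ (by omega) p hp)) (h₂ _ (by omega) p hp)
  let Y : DMod L⟦X⟧ :=
    { carrier := M
      module :=
        { smul := f
          one_smul := fun m => show f 1 m = m by simpa using (hφ 1 m).symm
          mul_smul := hmul
          smul_zero := fun r => show f r 0 = 0 by simpa using hadd r 0 0
          smul_add := hadd
          add_smul := hadd'
          zero_smul := fun m => show f 0 m = 0 by simpa using (hφ 0 m).symm }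
      del := (AddMonoidHom.mk' (f φ.jac) (hadd φ.jac)).comp M.del
      leibniz := fun r m => by
        change f φ.jac (M.del (f r m)) = f r′ m + f r (f φ.jac (M.del m))
        rw [hleib, hadd, ← hmul, ← hmul, ← hmul, mul_comm r, Units.mul_inv_cancel_left] }
  refine ⟨Y, ⟨{ toFun := fun m => (m : M), map_add' := fun _ _ => rfl, map_smul' := hφ },
    fun m => ?_⟩, fun n => { U n with smul_mem' := fun a m hm => ?_ },
    Function.bijective_id, fun n m => Iff.rfl⟩
  · change M.del m = f ((φ.jac⁻¹ : L⟦X⟧ˣ) : L⟦X⟧) (f φ.jac (M.del m))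
    rw [← hmul, Units.inv_mul, ← map_one φ.toRingHom, ← hφ, one_smul]
  · obtain ⟨j, hj⟩ := hf a m n
    obtain ⟨p, hp⟩ := hd a j
    change f a m ∈ U n
    rw [← sub_add_cancel (f a m) (p • m)]
    exact add_mem (hj j le_rfl p hp) (hmem p n m hm)

end Completion

/-! ### Modules over a formal disk from operators -/

section Disk

variable {k : Type u} [Field k] (x : ClosedPoint k)

lemma constantCoeff_diskAt (p : k[X]) :
    constantCoeff ((diskAt x).toRingHom p) = Ideal.Quotient.mk x.asIdeal p := by
  have : (PowerSeries.constantCoeff (R := ResField x)).comp (diskAt x).toRingHom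
      = Ideal.Quotient.mk x.asIdeal := by
    refine Polynomial.ringHom_ext' (RingHom.ext fun a => ?_) ?_
    · simp [diskAt]
    · simp [diskAt]
  exact congrArg (fun f : k[X] →+* ResField x => f p) this

/-- The field structure of the residue field. -/
instance resFieldField : Field (ResField x) := Ideal.Quotient.field x.asIdeal

/-- In characteristic zero the generator of the ideal of `x` is a uniformizer of the completion. -/
lemma exists_uniformizer [CharZero k] : ∃ f : k[X], x.asIdeal = Ideal.span {f} ∧
    ∃ b : (ResField x)⟦X⟧, IsUnit b ∧ (diskAt x).toRingHom f = PowerSeries.X * b := by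
  obtain ⟨f, hf⟩ := (inferInstance : IsPrincipalIdealRing k[X]).principal x.asIdeal
  have hf : x.asIdeal = Ideal.span {f} := hf
  have hf0 : f ≠ 0 := by
    rintro rfl
    have hmax := x.isMaximal
    rw [hf, Ideal.span_singleton_eq_bot.2 rfl] at hmax
    have : IsField k[X] := Ring.isField_iff_maximal_bot.2 hmax
    obtain ⟨g, hg⟩ := this.mul_inv_cancel (X_ne_zero (R := k))
    exact not_isUnit_X (IsUnit.of_mul_eq_one g hg)
  have hirr : Irreducible f := by
    have : (Ideal.span {f}).IsPrime := hf ▸ x.isMaximal.isPrime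
    exact ((Ideal.span_singleton_prime hf0).1 this).irreducible
  have hsep : derivative f ∉ x.asIdeal := fun h => by
    have h1 := hirr.separable
    obtain ⟨a, b, hab⟩ := h1
    refine x.isMaximal.ne_top ((Ideal.eq_top_iff_one _).2 (hab ▸ add_mem ?_ ?_))
    · exact x.asIdeal.mul_mem_left _ (hf ▸ Ideal.mem_span_singleton_self f)
    · exact x.asIdeal.mul_mem_left _ h
  have h0 : constantCoeff ((diskAt x).toRingHom f) = 0 := by
    rw [constantCoeff_diskAt, Ideal.Quotient.eq_zero_iff_mem, hf]
    exact Ideal.mem_span_singleton_self f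
  obtain ⟨b, hb⟩ := PowerSeries.X_dvd_iff.2 h0
  refine ⟨f, hf, b, ?_, hb⟩
  rw [PowerSeries.isUnit_iff_constantCoeff, isUnit_iff_ne_zero]
  intro hb0
  have h1 := (diskAt x).deriv_map f
  have h2 : ((diskAt x).jac : (ResField x)⟦X⟧) = 1 := rfl
  rw [h2, one_mul, hb] at h1
  have h3 := congrArg PowerSeries.constantCoeff h1
  rw [constantCoeff_diskAt] at h3
  refine hsep (Ideal.Quotient.eq_zero_iff_mem.1 (Eq.trans h3.symm ?_))
  rw [powerSeries_deriv_X_mul, map_add, map_mul, hb0]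
  simp

lemma diskAt_dense [CharZero k] (r : (ResField x)⟦X⟧) (n : ℕ) :
    ∃ p, ϖ (ResField x) ^ n ∣ r - (diskAt x).toRingHom p := by
  obtain ⟨f, hf, b, hb, hfb⟩ := exists_uniformizer x
  have hb0 : constantCoeff b ≠ 0 :=
    isUnit_iff_ne_zero.1 (PowerSeries.isUnit_iff_constantCoeff.1 hb)
  induction n with
  | zero => exact ⟨0, by simp⟩
  | succ n ih =>
    obtain ⟨p, a, ha⟩ := ih
    obtain ⟨q, hq⟩ := Ideal.Quotient.mk_surjective
      (constantCoeff a / constantCoeff b ^ n)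
    refine ⟨p + f ^ n * q, ?_⟩
    have e : r - (diskAt x).toRingHom (p + f ^ n * q)
        = PowerSeries.X ^ n * (a - b ^ n * (diskAt x).toRingHom q) := by
      rw [map_add, map_mul, map_pow, hfb, mul_sub, ← ha]; ring
    rw [e, pow_succ]
    refine mul_dvd_mul_left _ (PowerSeries.X_dvd_iff.2 ?_)
    rw [map_sub, map_mul, map_pow, constantCoeff_diskAt, hq, mul_div_cancel₀ _ (pow_ne_zero _ hb0),
      sub_self]

lemma mem_pow_of_dvd [CharZero k] {n : ℕ} {p : k[X]}
    (h : ϖ (ResField x) ^ n ∣ (diskAt x).toRingHom p) : p ∈ x.asIdeal ^ n := by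
  obtain ⟨f, hf, b, hb, hfb⟩ := exists_uniformizer x
  induction n generalizing p with
  | zero => simp
  | succ n ih =>
    have h0 : p ∈ x.asIdeal := by
      rw [← Ideal.Quotient.eq_zero_iff_mem, ← constantCoeff_diskAt, ← PowerSeries.X_dvd_iff]
      exact (dvd_pow_self _ n.succ_ne_zero).trans h
    obtain ⟨q, rfl⟩ := Ideal.mem_span_singleton.1 (hf ▸ h0)
    rw [map_mul, hfb, pow_succ', mul_assoc,
      mul_dvd_mul_iff_left PowerSeries.X_ne_zero] at h
    rw [pow_succ', hf]
    exact Ideal.mul_mem_mul (Ideal.mem_span_singleton_self f)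
      (hf ▸ ih (hb.dvd_mul_left.1 h))

/-- A module over the Weyl algebra that is complete for a filtration defining a coarser topology
than the `x`-adic one comes from a module over the formal disk at `x`. -/
theorem exists_disk_module [CharZero k] (M : DMod k[X]) (U : ℕ → AddSubgroup M)
    (hc : SeqComplete U) (hsep : Separated U)
    (hx : ∀ m n, ∃ j, ∀ p ∈ x.asIdeal ^ j, p • m ∈ U n)
    (hmem : ∀ (p : k[X]) n, ∀ m ∈ U n, p • m ∈ U n)
    (hdel : ∀ n, ∃ j, ∀ m ∈ U j, M.del m ∈ U n) :
    ∃ (Y : DMod (ResField x)⟦X⟧) (e : M ⟶ (diskAt x).pushforward.obj Y)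
      (V : ℕ → Submodule (ResField x)⟦X⟧ Y), Bijective e.toLin ∧
        ∀ n m, (e.toLin m : Y) ∈ V n ↔ m ∈ U n :=
  exists_completion (diskAt x) M U (diskAt_dense x)
    (fun m n => (hx m n).imp fun _ h p hp => h p (mem_pow_of_dvd x hp)) hmem hdel hc hsep

end Disk

/-! ### Finite generation -/

section Finite

variable {L : Type u} [Field L] {Y : Type*} [AddCommGroup Y] [Module L⟦X⟧ Y]

/-- A separated module that is finite dimensional modulo `X` is finitely generated. -/
theorem fg_of_separated {Λ : Submodule L⟦X⟧ Y} (hsep : Separated (adicFil Λ))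
    {S : Finset Y} (hS : ∀ s ∈ S, s ∈ Λ)
    (h : ∀ m ∈ Λ, ∃ y ∈ span L⟦X⟧ (S : Set Y), m - y ∈ adicFil Λ 1) : Λ.FG := by
  have hle : span L⟦X⟧ (S : Set Y) ≤ Λ := span_le.2 hS
  refine ⟨S, le_antisymm hle fun m hm => ?_⟩
  have hm0 : m ∈ adicFil Λ 0 := by rwa [adicFil_zero]
  obtain ⟨y, hy, rfl⟩ := surj_of_approx
    (adicFil_complete (Λ := span L⟦X⟧ (S : Set Y)) ⟨S, rfl⟩) hsep (AddMonoidHom.id Y)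
    (fun n y hy => by
      obtain ⟨z, hz, rfl⟩ := mem_adicFil.1 hy
      exact mem_adicFil.2 ⟨z, hle hz, rfl⟩) (fun n m hm => by
      obtain ⟨z, hz, rfl⟩ := mem_adicFil.1 hm
      obtain ⟨y, hy, hzy⟩ := h z hz
      refine ⟨_, mem_adicFil.2 ⟨y, hy, rfl⟩, ?_⟩
      rw [AddMonoidHom.id_apply, ← smul_sub]
      exact pow_smul_mem_adicFil hzy) m hm0
  rwa [adicFil_zero] at hy

end Finite

/-! ### Fourier pairs -/

section Pair

variable {k : Type u} [Field k]

/-- The bijection `e` exchanges `z` and `d/dz` up to signs. For `σ = 1` it identifies `Q` with the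
Fourier transform of `P`, for `σ = -1` it identifies `P` with the Fourier transform of `Q`. -/
structure FourierPair (σ : ℤˣ) (P Q : DMod k[X]) (e : P ≃+ Q) : Prop where
  const : ∀ (a : k) m, e ((C a : k[X]) • m) = (C a : k[X]) • e m
  var : ∀ m, (X : k[X]) • e m = -(σ • e (P.del m))
  del : ∀ m, Q.del (e m) = σ • e ((X : k[X]) • m)

lemma map_units_smul {A B F : Type*} [AddCommGroup A] [AddCommGroup B] [FunLike F A B]
    [AddMonoidHomClass F A B] (f : F) (σ : ℤˣ) (m : A) : f (σ • m) = σ • f m := by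
  rw [Units.smul_def, Units.smul_def, map_zsmul]

lemma units_smul_mem_iff {A S : Type*} [AddCommGroup A] [SetLike S A] [AddSubgroupClass S A]
    {U : S} (σ : ℤˣ) {m : A} : σ • m ∈ U ↔ m ∈ U := by
  rcases Int.units_eq_one_or σ with rfl | rfl <;> simp [Units.neg_smul]

lemma SeqComplete.of_equiv {A B : Type*} [AddCommGroup A] [AddCommGroup B] (e : A ≃+ B)
    {U : ℕ → AddSubgroup A} {V : ℕ → AddSubgroup B} (h : ∀ n m, e m ∈ V n ↔ m ∈ U n)
    (hU : SeqComplete U) : SeqComplete V := fun y hy => by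
  obtain ⟨l, hl⟩ := hU (fun n => e.symm (y n)) fun j => by
    rw [← map_sub, ← h, e.apply_symm_apply]
    exact hy j
  exact ⟨e l, fun j => by simpa using (h j _).2 (hl j)⟩

lemma Separated.of_equiv {A B : Type*} [AddCommGroup A] [AddCommGroup B] (e : A ≃+ B)
    {U : ℕ → AddSubgroup A} {V : ℕ → AddSubgroup B} (h : ∀ n m, e m ∈ V n ↔ m ∈ U n)
    (hU : Separated U) : Separated V := fun y hy => by
  obtain ⟨y, rfl⟩ := e.surjective y
  rw [hU y fun n => (h n y).1 (hy n), map_zero]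

lemma comp_units_smul_X_comp (σ : ℤˣ) (q : k[X]) :
    (q.comp (σ • X : k[X])).comp (σ • X : k[X]) = q := by
  rw [comp_assoc]
  rcases Int.units_eq_one_or σ with rfl | rfl <;> simp

namespace FourierPair

variable {σ : ℤˣ} {P Q : DMod k[X]} {e : P ≃+ Q}

lemma symm (h : FourierPair σ P Q e) : FourierPair (-σ) Q P e.symm where
  const a m := e.injective (by rw [h.const, e.apply_symm_apply, e.apply_symm_apply])
  var m := e.injective (by
    obtain ⟨m, rfl⟩ := e.surjective m
    simp [h.del, Units.neg_smul, smul_smul, ← sq, Int.units_sq])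
  del m := e.injective (by
    obtain ⟨m, rfl⟩ := e.surjective m
    simp [h.var, Units.neg_smul, smul_smul, ← sq, Int.units_sq])

lemma action (h : FourierPair σ P Q e) (p : k[X]) :
    ∀ m, fourierAction Q p (e m) = e ((p.comp ((-σ) • X : k[X])) • m) := by
  induction p using Polynomial.induction_on with
  | C a => intro m; rw [fourierAction_C, C_comp, h.const]
  | add p q hp hq => intro m; rw [fourierAction_add, hp, hq, add_comp, add_smul, map_add]
  | monomial n a ih =>
    intro m
    rw [pow_succ, ← mul_assoc]
    generalize C a * X ^ n = q at ih
    rw [fourierAction_mul, fourierAction_X, h.del, mul_comp, X_comp, mul_smul, ← ih]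
    congr 1
    rcases Int.units_eq_one_or σ with rfl | rfl <;> simp

lemma smul_apply (h : FourierPair σ P Q e) (q : k[X]) (m : P) :
    q • e m = e (fourierAction P (q.comp (σ • X : k[X])) m) := by
  have := h.symm.action (q.comp (σ • X : k[X])) (e m)
  rw [neg_neg, comp_units_smul_X_comp, e.symm_apply_apply] at this
  rw [this, e.apply_symm_apply]

/-- For the sign `1`, a Fourier pair is an isomorphism with the Fourier transform. -/
def iso (h : FourierPair 1 P Q e) : (fourier k).obj P ≅ Q where
  hom :=
    { toLin :=
        { toFun := fun m : P => e m
          map_add' := fun a b : P => map_add e a b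
          map_smul' := fun p m => by
            have := h.smul_apply p m
            rw [one_smul, comp_X] at this
            exact this.symm }
      comm := fun m : P => by
        have := h.del m
        rw [one_smul] at this
        exact this.symm }
  inv :=
    { toLin :=
        { toFun := fun m => (e.symm m : P)
          map_add' := fun a b => map_add e.symm a b
          map_smul' := fun p m => by
            change e.symm (p • m) = fourierAction P p (e.symm m)
            rw [h.symm.action p]
            simp }
      comm := fun m => by
        have := h.del (e.symm m)
        rw [one_smul, e.apply_symm_apply] at this
        change e.symm (Q.del m) = (X : k[X]) • e.symm m
        rw [this, e.symm_apply_apply] }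
  hom_inv_id := DMod.hom_ext fun m : P => e.symm_apply_apply m
  inv_hom_id := DMod.hom_ext fun m => e.apply_symm_apply m

/-- A Fourier pair can be continued by an isomorphism. -/
lemma trans {Q' : DMod k[X]} (h : FourierPair σ P Q e) (f : Q ⟶ Q') (e' : Q ≃+ Q')
    (he' : ∀ m, f.toLin m = e' m) : FourierPair σ P Q' (e.trans e') where
  const a m := by
    change e' (e _) = C a • e' (e _)
    rw [h.const, ← he', ← he', map_smul]
  var m := by
    change X • e' (e _) = -(σ • e' (e _))
    rw [← he', ← he', ← map_smul, h.var, map_neg]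
    exact congrArg Neg.neg (map_units_smul f.toLin σ _)
  del m := by
    change Q'.del (e' (e _)) = σ • e' (e _)
    rw [← he', ← he', ← f.comm, h.del]
    exact map_units_smul f.toLin σ _

end FourierPair

lemma fourierPair_fourier (P : DMod k[X]) :
    FourierPair 1 P (fourierObj P) (AddEquiv.refl P) where
  const a m := (fourierAction_C P a m).symm
  var m := by
    rw [one_smul]
    exact fourierAction_X P m
  del m := by rw [one_smul]; rfl

/-- The third power of the Fourier transform is its inverse. -/
lemma exists_fourierPair (σ : ℤˣ) (P : DMod k[X]) :
    ∃ (Q : DMod k[X]) (e : P ≃+ Q), FourierPair σ P Q e := by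
  rcases Int.units_eq_one_or σ with rfl | rfl
  · exact ⟨_, _, fourierPair_fourier P⟩
  have h1 := fourierPair_fourier P
  have h2 := fourierPair_fourier (fourierObj P)
  have h3 := fourierPair_fourier (fourierObj (fourierObj P))
  refine ⟨fourierObj (fourierObj (fourierObj P)), AddEquiv.refl P,
    fun a m => (h1.const a m).trans ((h2.const a m).trans (h3.const a m)), fun m => ?_, fun m => ?_⟩
  · have e2 := h2.del m
    have e1 := h1.var m
    have e3 := h3.var m
    rw [one_smul] at e1 e2 e3
    rw [Units.neg_smul, one_smul, neg_neg]
    exact e3.trans ((congrArg Neg.neg (e2.trans e1)).trans (neg_neg (P.del m)))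
  · have e1 := h3.del m
    have e2 := h2.var m
    have e3 := h1.del m
    rw [one_smul] at e1 e2 e3
    rw [Units.neg_smul, one_smul]
    exact e1.trans (e2.trans (congrArg Neg.neg e3))

/-- The point `-x` for the sign `1`, and `x` for the sign `-1`. -/
def signedPoint (σ : ℤˣ) (x : ClosedPoint k) : ClosedPoint k := if σ = 1 then negPoint x else x

lemma mem_signedPoint {σ : ℤˣ} {x : ClosedPoint k} {f : k[X]} :
    f ∈ (signedPoint σ x).asIdeal ↔ f.comp ((-σ) • X : k[X]) ∈ x.asIdeal := by
  rcases Int.units_eq_one_or σ with rfl | rfl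
  · rw [signedPoint, if_pos rfl, Units.neg_smul, one_smul]
    exact Iff.rfl
  · rw [signedPoint, if_neg (by decide), neg_neg, one_smul, comp_X]

end Pair

/-! ### Open subgroups -/

section Open

variable {L L' : Type u} [Field L] [Field L']

/-- The bijection `e` identifies the open subgroups. -/
def IsOpenIso (M : DMod L⟦X⟧) (M' : DMod L'⟦X⟧) (e : M ≃+ M') : Prop :=
  ∀ U : AddSubgroup M',
    IsOpenSubgroup M (U.comap (e : M →+ M')) ↔ IsOpenSubgroup M' U

lemma IsOpenIso.symm {M : DMod L⟦X⟧} {M' : DMod L'⟦X⟧} {e : M ≃+ M'}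
    (h : IsOpenIso M M' e) : IsOpenIso M' M e.symm := fun U => by
  rw [← h, AddSubgroup.comap_comap]
  convert Iff.rfl
  ext m
  simp

lemma IsOpenIso.isAdicHomeomorph {M : DMod L⟦X⟧} {M' : DMod L'⟦X⟧} {e : M ≃+ M'}
    (h : IsOpenIso M M' e) : IsAdicHomeomorph M M' e := by
  let _ := adicTopology M
  let _ := adicTopology M'
  refine ⟨⟨fun S hS m hm => ?_⟩, fun S hS => ?_, e.bijective⟩
  · obtain ⟨U, hU, h'⟩ := hS _ hm
    refine ⟨U.comap (e : M →+ M'), (h U).2 hU, fun u hu => ?_⟩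
    change e (m + u) ∈ S
    rw [map_add]
    exact h' _ hu
  · rintro _ ⟨m, hm, rfl⟩
    obtain ⟨U, hU, h'⟩ := hS m hm
    refine ⟨U.comap (e.symm : M' →+ M), (h.symm U).2 hU, fun u hu => ?_⟩
    refine ⟨m + e.symm u, h' _ hu, ?_⟩
    rw [map_add, e.apply_symm_apply]

lemma isOpenSubgroup_iff {M : DMod L⟦X⟧} {F : ℕ → AddSubgroup M}
    (hF : ∀ n, IsOpenSubgroup M (F n)) {Λ : Submodule L⟦X⟧ M} (hΛ : Λ.FG)
    (h : ∀ n, ∃ j, F j ≤ adicFil Λ n) (U : AddSubgroup M) :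
    IsOpenSubgroup M U ↔ ∃ n, F n ≤ U := by
  constructor
  · intro hU
    obtain ⟨n, hn⟩ := hU Λ hΛ
    obtain ⟨j, hj⟩ := h n
    refine ⟨j, fun m hm => ?_⟩
    obtain ⟨y, hy, rfl⟩ := mem_adicFil.1 (hj hm)
    exact hn y hy
  · rintro ⟨n, hn⟩ Λ' hΛ'
    obtain ⟨j, hj⟩ := hF n Λ' hΛ'
    exact ⟨j, fun m hm => hn (hj m hm)⟩

/-- On a module over the punctured disk, the multiples of a lattice are a base of open subgroups. -/
lemma isOpenSubgroup_jStar {N : DMod L⸨X⸩} {Λ : Submodule L⟦X⟧ N} (hΛ : Λ.FG)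
    (habs : Absorbs Λ ⊤) {F : ℕ → AddSubgroup N} (h1 : ∀ n, ∃ j, adicFil Λ j ≤ F n)
    (h2 : ∀ n, ∃ j, F j ≤ adicFil Λ n) (U : AddSubgroup N) :
    IsOpenSubgroup ((jStar L).obj N) U ↔ ∃ n, F n ≤ U := by
  refine isOpenSubgroup_iff (M := (jStar L).obj N) (fun n Λ' hΛ' => ?_) (Λ := Λ) hΛ h2 U
  obtain ⟨j, hj⟩ := h1 n
  obtain ⟨i, hi⟩ := habs.exists_le_shift hΛ' fun _ _ => mem_top
  refine ⟨j + i, fun m hm => hj (mem_adicFil.2 ⟨_, hi m hm, ?_⟩)⟩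
  change N at m
  change _ = ϖ L ^ (j + i) • m
  rw [pow_add, mul_smul]

end Open

/-! ### Modules over the disk with invertible derivation -/

section DelLattice

variable {L : Type u} [Field L]

/-- A finitely generated submodule `Λ` of a module with bijective `∂` such that the `∂⁻ⁿ Λ` are
finitely generated submodules that form a base of open subgroups, and the `∂ⁿ Λ` exhaust the
module. The modules that have one are the `j_! N` with `N` holonomic. -/
structure IsDelLattice (Y : DMod L⟦X⟧) (Λ : Submodule L⟦X⟧ Y) : Prop where
  fg : Λ.FG
  bijective : Bijective Y.del
  mem : ∀ m, Y.del m ∈ Λ → m ∈ Λ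
  bound : ∃ c : ℕ, ∀ m ∈ Λ, ϖ L ^ c • Y.del m ∈ Λ
  contr : ∀ n, ∃ j : ℕ, ∀ m, Y.del^[j] m ∈ Λ → m ∈ adicFil Λ n
  exhaust : ∀ m, ∃ i, ∃ y ∈ Λ, Y.del^[i] y = m

/-- The submodule `∂⁻ⁿ Λ`, where `∂⁻¹ Λ ⊆ Λ`. -/
def delPreimage {Y : DMod L⟦X⟧} {Λ : Submodule L⟦X⟧ Y}
    (hmem : ∀ m, Y.del m ∈ Λ → m ∈ Λ) (n : ℕ) : Submodule L⟦X⟧ Y where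
  carrier := {m | Y.del^[n] m ∈ Λ}
  zero_mem' := by simp
  add_mem' {a b} ha hb := by simpa using add_mem ha hb
  smul_mem' a m hm := by
    rw [Set.mem_ofPred_eq] at *
    induction n generalizing a m with
    | zero => exact Λ.smul_mem a hm
    | succ n ih =>
      rw [iterate_succ_apply, Y.leibniz, iterate_map_add]
      refine add_mem (ih _ _ (hmem _ ?_)) (ih _ _ hm)
      rwa [← iterate_succ_apply' Y.del]

namespace IsDelLattice

variable {Y : DMod L⟦X⟧} {Λ : Submodule L⟦X⟧ Y}

/-- The filtration by the submodules `∂⁻ⁿ Λ`. -/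
def fil (h : IsDelLattice Y Λ) (n : ℕ) : Submodule L⟦X⟧ Y.carrier := delPreimage h.mem n

lemma mem_fil (h : IsDelLattice Y Λ) {n : ℕ} {m : Y} : m ∈ h.fil n ↔ Y.del^[n] m ∈ Λ :=
  Iff.rfl

lemma fil_antitone (h : IsDelLattice Y Λ) : Antitone h.fil := by
  refine antitone_nat_of_succ_le fun n m hm => ?_
  rw [mem_fil, iterate_succ_apply'] at hm
  exact h.mem _ hm

/-- The submodule `Λ` absorbs every element. -/
lemma absorbs (h : IsDelLattice Y Λ) (m : Y) :
    ∃ b : ℕ, ϖ L ^ b • m ∈ Λ := by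
  obtain ⟨c, hc⟩ := h.bound
  obtain ⟨i, y, hy, rfl⟩ := h.exhaust m
  induction i with
  | zero => exact ⟨0, by simpa using hy⟩
  | succ i ih =>
    obtain ⟨b, hb⟩ := ih
    rw [iterate_succ_apply']
    obtain ⟨a, ha⟩ := powerSeries_dvd_deriv (dvd_refl (ϖ L ^ (b + 1)))
    have h1 := hc _ (Λ.smul_mem PowerSeries.X hb)
    rw [smul_smul, ← pow_succ', Y.leibniz, ha, smul_add] at h1
    refine ⟨c + (b + 1), ?_⟩
    rw [pow_add, mul_smul]
    refine (Submodule.add_mem_iff_right _ ?_).1 h1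
    rw [mul_comm, mul_smul]
    exact Λ.smul_mem _ (Λ.smul_mem _ hb)

lemma adic_le_fil (h : IsDelLattice Y Λ) (n : ℕ) :
    ∃ j : ℕ, ∀ m ∈ Λ, ϖ L ^ j • m ∈ h.fil n := by
  obtain ⟨c, hc⟩ := h.bound
  induction n with
  | zero => exact ⟨0, fun m hm => by rw [pow_zero, one_smul]; exact hm⟩
  | succ n ih =>
    obtain ⟨j, hj⟩ := ih
    refine ⟨j + c + 1, fun m hm => ?_⟩
    rw [mem_fil, iterate_succ_apply, ← mem_fil h, Y.leibniz]
    obtain ⟨a, ha⟩ := powerSeries_dvd_deriv (dvd_refl (ϖ L ^ (j + c + 1)))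
    rw [ha]
    refine add_mem ?_ ?_
    · rw [pow_add, mul_assoc, mul_smul]
      exact hj _ (Λ.smul_mem _ hm)
    · rw [show j + c + 1 = j + (1 + c) by ring, pow_add, mul_smul, pow_add, mul_smul]
      exact hj _ (Λ.smul_mem _ (hc m hm))

lemma isOpenSubgroup_fil (h : IsDelLattice Y Λ) (n : ℕ) :
    IsOpenSubgroup Y (h.fil n).toAddSubgroup := by
  rintro _ ⟨S, rfl⟩
  obtain ⟨j, hj⟩ := h.adic_le_fil n
  choose b hb using h.absorbs
  have : span L⟦X⟧ S ≤ (h.fil n).comap (LinearMap.lsmul _ _ (ϖ L ^ (j + S.sup b))) := by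
    refine span_le.2 fun s hs => ?_
    change ϖ L ^ (j + S.sup b) • s ∈ h.fil n
    rw [pow_add, mul_smul, ← Nat.sub_add_cancel (Finset.le_sup (f := b) hs), pow_add, mul_smul]
    exact hj _ (Λ.smul_mem _ (hb s))
  exact ⟨_, fun m hm => this hm⟩

lemma isOpenSubgroup_iff (h : IsDelLattice Y Λ) (U : AddSubgroup Y) :
    IsOpenSubgroup Y U ↔ ∃ n, (h.fil n).toAddSubgroup ≤ U :=
  LocalFourier.isOpenSubgroup_iff h.isOpenSubgroup_fil h.fg h.contr U

lemma fil_complete (h : IsDelLattice Y Λ) : SeqComplete fun n => (h.fil n).toAddSubgroup := by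
  refine SeqComplete.of_cofinal (fun a b hab => h.fil_antitone hab) (adicFil_antitone Λ)
    (adicFil_complete h.fg) h.contr fun n => ?_
  obtain ⟨j, hj⟩ := h.adic_le_fil n
  refine ⟨j, fun m hm => ?_⟩
  obtain ⟨y, hy, rfl⟩ := mem_adicFil.1 hm
  exact hj y hy

lemma fil_separated (h : IsDelLattice Y Λ) : Separated fun n => (h.fil n).toAddSubgroup :=
  fun y hy => adicFil_separated h.fg y fun n => (h.contr n).elim fun j hj => hj y (hy j)

end IsDelLattice

end DelLattice

/-! ### Construction of local Fourier transforms at infinity -/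

section Generators

variable {L : Type*} [Field L] {Y : Type*} [AddCommGroup Y] [Module L⟦X⟧ Y]

lemma fg_of_separated' {Λ : Submodule L⟦X⟧ Y} (hsep : Separated (adicFil Λ)) {ι : Type*}
    [Fintype ι] {v : ι → Y} (hv : ∀ i, v i ∈ Λ) (h : ∀ m ∈ Λ, ∃ c : ι → L,
      m - ∑ i, (PowerSeries.C (c i) : L⟦X⟧) • v i ∈ adicFil Λ 1) : Λ.FG := by
  classical
  refine fg_of_separated hsep (S := Finset.univ.image v) (fun s hs => ?_) fun m hm => ?_
  · obtain ⟨i, _, rfl⟩ := Finset.mem_image.1 hs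
    exact hv i
  · obtain ⟨c, hc⟩ := h m hm
    exact ⟨_, Submodule.sum_mem _ fun i _ => smul_mem _ _
      (subset_span (by simp)), hc⟩

end Generators

lemma finite_of_lattice {L : Type*} [Field L] {N : Type*} [AddCommGroup N] [Module L⸨X⸩ N]
    [Module L⟦X⟧ N] [IsScalarTower L⟦X⟧ L⸨X⸩ N] {Λ : Submodule L⟦X⟧ N} (hΛ : Λ.FG)
    (habs : Absorbs Λ ⊤) : Module.Finite L⸨X⸩ N := by
  obtain ⟨S, rfl⟩ := hΛ
  refine ⟨S, (Submodule.eq_top_iff'.2 fun m => ?_)⟩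
  obtain ⟨n, hn⟩ := habs m mem_top
  have := (span L⸨X⸩ (S : Set N)).smul_mem (tpow L (-n))
    (mem_of_mem_span (E := span L⸨X⸩ (S : Set N))
    (fun s hs => subset_span hs) hn)
  rwa [← tpow_natCast_smul, tpow_neg_smul_smul] at this

section Infinity

variable {k : Type u} [Field k]

/-- The localization map `Z → L((t)) ⊗ Z`. -/
def punctureLin (Z : DMod k⟦X⟧) : Z →ₗ[k⟦X⟧] ((puncture k).pullback.obj Z).carrier :=
  { (puncture k).incl Z with map_smul' := fun a m => (puncture k).incl_smul a m }

lemma del_punctureLin {Z : DMod k⟦X⟧} (m : Z) :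
    ((puncture k).pullback.obj Z).del (punctureLin Z m) = punctureLin Z (Z.del m) :=
  ((puncture k).del_incl m).trans (one_smul _ _)

lemma punctureLin_eq_zero {Z : DMod k⟦X⟧} {m : Z} (h : punctureLin Z m = 0) :
    ∃ n : ℕ, ϖ k ^ n • m = 0 := by
  obtain ⟨⟨_, n, rfl⟩, hn⟩ := (IsLocalizedModule.eq_zero_iff
    (Submonoid.powers ϖ k) (TensorProduct.mk k⟦X⟧ k⸨X⸩ Z 1)).1 h
  exact ⟨n, hn⟩

lemma exists_pow_smul_punctureLin {Z : DMod k⟦X⟧} (x : ((puncture k).pullback.obj Z)) :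
    ∃ (n : ℕ) (y : Z), punctureLin Z y = ϖ k ^ n • x := by
  obtain ⟨⟨y, ⟨_, n, rfl⟩⟩, hn⟩ := IsLocalizedModule.surj
    (Submonoid.powers ϖ k) (TensorProduct.mk k⟦X⟧ k⸨X⸩ Z 1) x
  exact ⟨n, y, hn.symm⟩

/-- The formal disk at the origin. -/
def polyDisk (L : Type u) [CommRing L] : DiffMap L[X] L⟦X⟧ where
  toRingHom := Polynomial.coeToPowerSeries.ringHom
  jac := 1
  deriv_map f := by
    rw [Units.val_one, one_mul]
    exact PowerSeries.derivative_coe f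

lemma polyDisk_del {L : Type u} [CommRing L] (Y : DMod L⟦X⟧) (m : Y) :
    ((polyDisk L).pushforward.obj Y).del m = Y.del m := by
  change ((1⁻¹ : L⟦X⟧ˣ) : L⟦X⟧) • Y.del m = _
  rw [inv_one, Units.val_one, one_smul]

lemma infty_X_smul (N : DMod k⸨X⸩) (m : ((puncturedDiskInfty k).pushforward.obj N)) :
    ((X : k[X]) • m : ((puncturedDiskInfty k).pushforward.obj N))
      = tpow k (-1) • (show N from m) := by
  change ((puncturedDiskInfty k).toRingHom X) • (show N from m) = _
  rw [show (puncturedDiskInfty k).toRingHom X = single (-1) 1 from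
        Polynomial.eval₂_X _ _]

lemma infty_C_smul (N : DMod k⸨X⸩) (a : k)
    (m : ((puncturedDiskInfty k).pushforward.obj N)) :
    ((C a : k[X]) • m : ((puncturedDiskInfty k).pushforward.obj N))
      = (PowerSeries.C a : k⟦X⟧) • (show N from m) := by
  change ((puncturedDiskInfty k).toRingHom (C a)) • (show N from m)
    = ((puncture k).toRingHom (PowerSeries.C a)) • (show N from m)
  rw [show (puncturedDiskInfty k).toRingHom (C a) = HahnSeries.C a from
        Polynomial.eval₂_C _ _]
  congr 1
  exact (HahnSeries.ofPowerSeries_C a).symm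

lemma units_smul_neg_units_smul {A : Type*} [AddCommGroup A] (σ : ℤˣ) (m : A) :
    σ • (-σ) • m = -m := by
  rw [Units.neg_smul, smul_neg, smul_smul, ← sq, Int.units_sq, one_smul]

/-- If `∂` is invertible, the module is also a module over the Weyl algebra in the coordinate
`∓∂⁻¹`, which is the inverse of the coordinate of the Fourier transform. -/
lemma exists_inverse_coordinate (σ : ℤˣ) (P : DMod k[X]) (hbij : Bijective P.del) :
    ∃ (M : DMod k[X]) (e : P ≃+ M),
      (∀ (a : k) m, (C a : k[X]) • e m = e ((C a : k[X]) • m)) ∧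
      (∀ m, (X : k[X]) • e (P.del m) = (-σ) • e m) ∧
      ∀ m, M.del (e m) = e (-(σ • P.del (P.del ((X : k[X]) • m)))) := by
  let _ : Module k P.carrier := Module.compHom P (C : k →+* k[X])
  have hCs : ∀ (a : k) (m : P), a • m = (C a : k[X]) • m := fun _ _ => rfl
  have hCdel : ∀ (a : k) m, P.del (a • m) = a • P.del m := fun a m => by
    rw [hCs, P.leibniz, show (C a : k[X])′ = 0 from derivative_C, zero_smul, zero_add, ← hCs]
  let z : P ≃ₗ[k] P.carrier := LinearEquiv.ofBijective
    { toFun := fun m => (-σ) • P.del m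
      map_add' := fun a b => by rw [map_add, smul_add]
      map_smul' := fun a m => by rw [hCdel, RingHom.id_apply, smul_comm] }
    ((MulAction.bijective (-σ)).comp hbij)
  let s : Module.End k P.carrier := z.symm
  have hsz : ∀ m, s (P.del m) = (-σ) • m := fun m => by
    have : s ((-σ) • P.del m) = m := z.symm_apply_apply m
    rw [map_units_smul s] at this
    rw [← Int.units_inv_eq_self (-σ), ← smul_eq_iff_eq_inv_smul, this]
  let D : P →+ P.carrier := -(σ • (P.del.comp P.del).comp
    (DistribSMul.toAddMonoidHom P (X : k[X])))
  have hD : ∀ m, D m = -(σ • P.del (P.del ((X : k[X]) • m))) := fun _ => rfl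
  have hDs : ∀ m, D (s m) = m + s (D m) := fun m => by
    obtain ⟨y, rfl⟩ := hbij.2 m
    have h1 : (X : k[X]) • P.del y = P.del ((X : k[X]) • y) - y := by
      rw [P.leibniz, show (X : k[X])′ = 1 from derivative_X, one_smul, add_sub_cancel_left]
    rw [hsz, map_units_smul D, hD, hD, h1, map_neg s, map_units_smul s, map_sub, map_sub, map_sub,
      hsz, hsz, ← smul_sub, units_smul_neg_units_smul, smul_neg, Units.neg_smul, neg_neg, smul_smul,
      ← sq, Int.units_sq, one_smul]
    abel
  have hDC : ∀ (a : k) m, D (a • m) = a • D m := fun a m => by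
    rw [hD, hD, hCs, smul_comm, ← hCs, hCdel, hCdel, smul_comm, smul_neg]
  let M : DMod k[X] :=
    { carrier := P
      module := Module.compHom P (aeval s : k[X] →ₐ[k] Module.End k P).toRingHom
      del := D
      leibniz := fun p => by
        change ∀ m, D (aeval s p m) = aeval s p′ m + aeval s p (D m)
        induction p using Polynomial.induction_on with
        | C a =>
          intro m
          rw [show (C a : k[X])′ = 0 from derivative_C]
          simp [hDC]
        | add p q hp hq =>
          intro m
          simp only [map_add, LinearMap.add_apply, hp, hq]
          abel
        | monomial n a ih =>
          intro m
          rw [pow_succ, ← mul_assoc]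
          generalize C a * X ^ n = q at ih
          rw [deriv_mul, show (X : k[X])′ = 1 from derivative_X, mul_one, mul_comm X, map_add,
            map_mul, map_mul, aeval_X]
          simp only [LinearMap.add_apply, Module.End.mul_apply, ih, hDs, map_add]
          abel }
  refine ⟨M, AddEquiv.refl P, fun a m => ?_, fun m => ?_, fun m => rfl⟩
  · change aeval s (C a) m = _
    rw [aeval_C]
    rfl
  · change aeval s X (P.del m) = (-σ) • m
    rw [aeval_X, hsz]

/-- A module over the Weyl algebra on which `∂` is invertible and that is complete for the
filtration `∂⁻ⁿ Λ` is a Fourier transform of a module over the punctured disk at infinity. -/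
theorem exists_fourier_laurent (σ : ℤˣ) (P : DMod k[X]) (hbij : Bijective P.del)
    (F : ℕ → AddSubgroup P) (hF : ∀ n m, m ∈ F (n + 1) ↔ P.del m ∈ F n)
    (hC : ∀ a : k, ∀ m ∈ F 0, (C a : k[X]) • m ∈ F 0)
    (hanti : ∀ m, P.del m ∈ F 0 → m ∈ F 0) (hexh : ∀ m, ∃ n, ∃ y ∈ F 0, P.del^[n] y = m)
    (hc : SeqComplete F) (hsep : Separated F) (hX : ∀ n, ∃ j, ∀ m ∈ F j, (X : k[X]) • m ∈ F n) :
    ∃ (N : DMod k⸨X⸩) (e : P ≃+ N) (Λ : Submodule k⟦X⟧ N),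
      FourierPair σ P ((puncturedDiskInfty k).pushforward.obj N) e ∧ Absorbs Λ ⊤ ∧
        ∀ (n : ℕ) m, e m ∈ adicFil Λ n ↔ m ∈ F n := by
  obtain ⟨M, e, heC, heX, heD⟩ := exists_inverse_coordinate σ P hbij
  let G : ℕ → AddSubgroup M.carrier := fun n => (F n).comap (e.symm : M →+ P)
  have hG : ∀ n m, e m ∈ G n ↔ m ∈ F n := fun n m => by
    change e.symm (e m) ∈ F n ↔ _
    rw [e.symm_apply_apply]
  have hXe : ∀ m, ∃ y, m = e (P.del y) ∧ (X : k[X]) • m = (-σ) • e y := fun m => by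
    obtain ⟨y, hy⟩ := hbij.2 (e.symm m)
    obtain rfl : e (P.del y) = m := by rw [hy, e.apply_symm_apply]
    exact ⟨y, rfl, heX y⟩
  have hXG : ∀ {n m}, (X : k[X]) • m ∈ G (n + 1) ↔ m ∈ G n := fun {n m} => by
    obtain ⟨y, rfl, h⟩ := hXe m
    rw [h, units_smul_mem_iff, hG, hG, hF]
  have hXG' : ∀ n m, (X : k[X]) ^ n • m ∈ G n ↔ m ∈ G 0 := fun n m => by
    induction n with
    | zero => rw [pow_zero, one_smul]
    | succ n ih => rw [pow_succ', mul_smul, hXG, ih]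
  have hFC : ∀ (a : k) n, ∀ m ∈ F n, (C a : k[X]) • m ∈ F n := fun a n => by
    induction n with
    | zero => exact hC a
    | succ n ih =>
      intro m hm
      rw [hF, P.leibniz, show (C a : k[X])′ = 0 from derivative_C, zero_smul, zero_add]
      exact ih _ ((hF n m).1 hm)
  have hFle : ∀ n, ∀ m ∈ F (n + 1), m ∈ F n := fun n => by
    induction n with
    | zero => exact fun m hm => hanti m ((hF 0 m).1 hm)
    | succ n ih => exact fun m hm => (hF _ _).2 (ih _ ((hF _ m).1 hm))
  have hGp : ∀ (p : k[X]) n, ∀ m ∈ G n, p • m ∈ G n := fun p n m hm => by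
    induction p using Polynomial.induction_on with
    | C a =>
      obtain ⟨m, rfl⟩ := e.surjective m
      exact heC a m ▸ (hG n _).2 (hFC a n m ((hG n m).1 hm))
    | add p q hp hq =>
      rw [add_smul]
      exact add_mem hp hq
    | monomial i a ih =>
      rw [pow_succ', mul_left_comm, mul_smul]
      generalize (C a * X ^ i : k[X]) • m = y at ih
      obtain ⟨y, rfl⟩ := e.surjective y
      have h := hXG.2 ih
      obtain ⟨w, hw⟩ := e.surjective ((X : k[X]) • e y)
      rw [← hw, hG] at h ⊢
      exact hFle _ _ h
  have hexh' : ∀ m, ∃ n : ℕ, (X : k[X]) ^ n • m ∈ G 0 := fun m => by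
    obtain ⟨m, rfl⟩ := e.surjective m
    obtain ⟨n, y, hy, rfl⟩ := hexh m
    refine ⟨n, ?_⟩
    induction n with
    | zero => simpa using (hG 0 y).2 hy
    | succ n ih =>
      rw [iterate_succ_apply' P.del, pow_succ, mul_smul, heX, smul_comm, units_smul_mem_iff]
      exact ih
  obtain ⟨Y, f, V, hf, hV⟩ := exists_completion (polyDisk k) M G
    (fun r n => ⟨PowerSeries.trunc n r, PowerSeries.X_pow_dvd_iff.2 fun i hi => by
      change PowerSeries.coeff i (r - ((PowerSeries.trunc n r : k[X]) : k⟦X⟧)) = 0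
      simp [PowerSeries.coeff_trunc, hi]⟩)
    (fun m n => by
      obtain ⟨i, hi⟩ := hexh' m
      refine ⟨n + i, fun p hp => ?_⟩
      obtain ⟨q, rfl⟩ : X ^ (n + i) ∣ p := X_pow_dvd_iff.2 fun d hd =>
        (coeff_coe p d).symm.trans (PowerSeries.X_pow_dvd_iff.1 hp d hd)
      rw [mul_comm, mul_smul, pow_add, mul_smul]
      exact hGp q n _ ((hXG' n _).2 hi))
    hGp
    (fun n => by
      obtain ⟨j, hj⟩ := hX (n + 2)
      refine ⟨j, fun m hm => ?_⟩
      obtain ⟨m, rfl⟩ := e.surjective m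
      rw [heD, hG]
      exact neg_mem ((units_smul_mem_iff σ).2
        ((hF n _).1 ((hF (n + 1) _).1 (hj m ((hG j m).1 hm))))))
    (hc.of_equiv e hG) (hsep.of_equiv e hG)
  obtain ⟨g, hf, hV, hfp, hfd⟩ : ∃ g : M →+ Y, Bijective g ∧
      (∀ n m, g m ∈ V n ↔ m ∈ G n) ∧ (∀ (p : k[X]) m, g (p • m) = (p : k⟦X⟧) • g m) ∧
        ∀ m, Y.del (g m) = g (M.del m) :=
    ⟨f.toLin.toAddMonoidHom, hf, hV, f.toLin.map_smul, fun m =>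
      (polyDisk_del Y _).symm.trans (f.comm m).symm⟩
  have hfX : ∀ (n : ℕ) m, g ((X : k[X]) ^ n • m) = ϖ k ^ n • g m := fun n m => by
    rw [hfp, Polynomial.coe_pow, Polynomial.coe_X]
  let N := (puncture k).pullback.obj Y
  have hcancel : ∀ (n : ℕ) {x y : N}, ϖ k ^ n • x = ϖ k ^ n • y → x = y := fun n x y h => by
    rw [← tpow_natCast_smul, ← tpow_natCast_smul] at h
    rw [← tpow_neg_smul_smul (L := k) n x, h, tpow_neg_smul_smul]
  have hbijX : Bijective fun m : M => (X : k[X]) • m := by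
    rw [← Function.Bijective.of_comp_iff _ (e.bijective.comp hbij),
      show _ ∘ (e ∘ P.del) = ((-σ) • ·) ∘ e from funext heX]
    exact (MulAction.bijective (-σ)).comp e.bijective
  have hbijX' : ∀ n : ℕ, Bijective fun m : M => (X : k[X]) ^ n • m := fun n => by
    rw [← smul_iterate]
    exact hbijX.iterate n
  have hinj : Injective (punctureLin Y) := (injective_iff_map_eq_zero _).2 fun y hy => by
    obtain ⟨n, hn⟩ := punctureLin_eq_zero hy
    obtain ⟨m, rfl⟩ := hf.2 y
    rw [← hfX, ← map_zero g] at hn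
    rw [(hbijX' n).1 ((hf.1 hn).trans (smul_zero _).symm), map_zero]
  let u : P ≃+ N.carrier := e.trans (AddEquiv.ofBijective
    ((punctureLin Y).toAddMonoidHom.comp g) ⟨hinj.comp hf.1, fun x => by
      obtain ⟨n, y, hy⟩ := exists_pow_smul_punctureLin x
      obtain ⟨m, rfl⟩ := hf.2 y
      obtain ⟨m, rfl⟩ := (hbijX' n).2 m
      refine ⟨m, hcancel n (Eq.trans ?_ hy)⟩
      exact (map_smul (punctureLin Y) _ _).symm.trans (congrArg _ (hfX n m).symm)⟩)
  have hu : ∀ m, u m = punctureLin Y (g (e m)) := fun _ => rfl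
  have hudel : ∀ m, u (P.del m) = (-σ) • tpow k (-1) • u m := fun m => by
    have : ϖ k • u (P.del m) = (-σ) • u m := by
      rw [hu, ← map_smul, ← pow_one (ϖ k), ← hfX, pow_one, heX, map_units_smul g,
        map_units_smul (punctureLin Y), hu]
    rw [← tpow_neg_smul_smul (L := k) 1 (u (P.del m)), tpow_one_smul, this, smul_comm]
  refine ⟨N, u, (V 0).map (punctureLin Y), ⟨fun a m => ?_, fun m => ?_, fun m => ?_⟩,
    fun x _ => ?_, fun n m => ?_⟩
  · refine Eq.trans ?_ (infty_C_smul N a (u m)).symm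
    change u _ = PowerSeries.C a • u m
    rw [hu, ← heC, hfp, Polynomial.coe_C, map_smul, hu]
  · refine (infty_X_smul N (u m)).trans ?_
    change tpow k (-1) • u m = -(σ • u _)
    rw [hudel, units_smul_neg_units_smul, neg_neg]
  · refine (delZ_apply N (u m)).trans ?_
    change _ = σ • u _
    rw [hu m, del_punctureLin, hfd, heD, ← hu, map_neg u, map_units_smul u, hudel, hudel,
      smul_comm (tpow k (-1)), tpow_smul_smul, units_smul_neg_units_smul, neg_neg, smul_comm,
      HahnSeries.single_neg, neg_smul, Units.neg_smul, smul_neg, neg_neg]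
    exact congrArg (σ • ·) (tpow_smul_neg_smul (L := k) 2 (u _))
  · obtain ⟨m, rfl⟩ := u.surjective x
    refine (hexh' (e m)).imp fun n hn => ⟨_, (hV _ _).2 hn, ?_⟩
    rw [hfX, map_smul, hu]
  · rw [mem_adicFil_iff_shift]
    induction n generalizing m with
    | zero =>
      rw [← hG, ← hV]
      simpa using ⟨fun ⟨y, hy, h⟩ => hinj h ▸ hy, fun h => ⟨_, h, rfl⟩⟩
    | succ n ih =>
      rw [hF, ← ih, hudel, smul_comm, units_smul_mem_iff, tpow_smul_smul, Nat.cast_succ, neg_add]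

lemma fg_of_fourierPair {σ : ℤˣ} {P : DMod k[X]} {N : DMod k⸨X⸩} {e : P ≃+ N}
    (h : FourierPair σ P ((puncturedDiskInfty k).pushforward.obj N) e)
    {F : ℕ → AddSubgroup P} {Λ : Submodule k⟦X⟧ N}
    (hmem : ∀ (n : ℕ) m, e m ∈ adicFil Λ n ↔ m ∈ F n) (hsep : Separated F) {ι : Type*} [Fintype ι]
    {v : ι → P} (hv : ∀ i, v i ∈ F 0)
    (hvs : ∀ m ∈ F 0, ∃ c : ι → k, m - ∑ i, (C (c i) : k[X]) • v i ∈ F 1) : Λ.FG := by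
  have hmem0 : ∀ m, e m ∈ Λ ↔ m ∈ F 0 := fun m => by
    rw [← hmem, adicFil_zero]; rfl
  refine fg_of_separated' (v := fun i => e (v i)) (fun y hy => ?_) (fun i => (hmem0 _).2 (hv i))
    fun m hm => ?_
  · obtain ⟨y, rfl⟩ := e.surjective y
    rw [hsep y fun n => (hmem n y).1 (hy n), map_zero]
  · obtain ⟨m, rfl⟩ := e.surjective m
    obtain ⟨c, hc⟩ := hvs m ((hmem0 m).1 hm)
    refine ⟨c, ?_⟩
    have := (hmem 1 _).2 hc
    rw [map_sub, map_sum] at this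
    convert this using 3 with i
    exact ((h.const (c i) (v i)).trans (infty_C_smul N (c i) (e (v i)))).symm

lemma FourierPair.del_infty {σ : ℤˣ} {N : DMod k⸨X⸩} {Q : DMod k[X]} {e : N ≃+ Q}
    (h : FourierPair σ ((puncturedDiskInfty k).pushforward.obj N) Q e) (m : N) :
    Q.del (e m) = e (σ • tpow k (-1) • m) := by
  rw [map_units_smul e]
  exact (h.del m).trans (congrArg (fun y => σ • e y) (infty_X_smul N m))

lemma isOpenIso_of_fourierPair {L : Type u} [Field L] {Y : DMod L⟦X⟧} {N : DMod k⸨X⸩}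
    (e : Y ≃+ N) {F : ℕ → AddSubgroup Y} {Λ : Submodule k⟦X⟧ N}
    (hΛ : Λ.FG) (habs : Absorbs Λ ⊤) (hmem : ∀ (n : ℕ) m, e m ∈ adicFil Λ n ↔ m ∈ F n)
    (hF : ∀ U, IsOpenSubgroup Y U ↔ ∃ n, F n ≤ U) : IsOpenIso Y ((jStar k).obj N) e := by
  intro U
  refine (hF _).trans (Iff.trans ?_ (isOpenSubgroup_jStar hΛ habs (F := adicFil Λ)
    (fun n => ⟨n, le_rfl⟩) (fun n => ⟨n, le_rfl⟩) U).symm)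
  refine exists_congr fun n => ⟨fun h m hm => ?_, fun h m hm => h ((hmem n m).2 hm)⟩
  obtain ⟨m, rfl⟩ := e.surjective m
  exact h ((hmem n m).1 hm)

/-- The Fourier transform of an irregular module. -/
theorem exists_irregular_partner (σ : ℤˣ) {N : DMod k⸨X⸩} (hN : IsOfType none N) :
    ∃ (N' : DMod k⸨X⸩) (e : N ≃+ N'), IsOfType none N' ∧
      FourierPair σ ((puncturedDiskInfty k).pushforward.obj N)
        ((puncturedDiskInfty k).pushforward.obj N') e ∧
      IsOpenIso ((jStar k).obj N) ((jStar k).obj N') e := by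
  obtain ⟨hfin, hirr⟩ := hN
  have : Module.Finite k⸨X⸩ N.carrier := hfin
  have hD := delZ_isDer N
  obtain ⟨Λ, h⟩ := IsIrregular.exists_isExpansive hD hirr
  have hadd : ∀ m, addScalar (delZ N) (0 : k⟦X⟧) m = delZ N m := fun m => by
    rw [addScalar_zero]
  let F := preimageFil (delZ N) ⊤ Λ
  have hF0 : ∀ m, m ∈ F 0 ↔ m ∈ Λ := fun m => mem_preimageFil.trans (and_iff_right mem_top)
  have hbij : Bijective (delZ N) :=
    ⟨(injective_iff_map_eq_zero _).2 fun m hm => h.inj 0 m mem_top ((hadd m).trans hm),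
      fun b => (h.surj 0 b mem_top).imp fun a ha => (hadd a).symm.trans ha.2⟩
  have hF : ∀ n m, m ∈ F (n + 1) ↔ delZ N m ∈ F n := fun n m => by
    rw [mem_preimageFil, mem_preimageFil, iterate_succ_apply]
    exact and_congr (iff_of_true mem_top mem_top) Iff.rfl
  have hexh : ∀ m, ∃ n, ∃ y ∈ F 0, (delZ N)^[n] y = m := fun m => by
    obtain ⟨n, hn⟩ := h.exists_small_preimage hD (m := m) mem_top
    obtain ⟨i, y, _, hy, hy'⟩ := hn n
    refine ⟨i, y, (hF0 y).2 ?_, hy⟩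
    rwa [mem_adicFil_iff_shift, ← tpow_natCast_smul, tpow_neg_smul_smul] at hy'
  have hX : ∀ n, ∃ j, ∀ m ∈ F j, tpow k (-1) • m ∈ F n := fun n => by
    obtain ⟨i, hi⟩ := h.adic_le_preimageFil hD n
    obtain ⟨j, hj⟩ := h.preimageFil_le_adic hD (i + 1)
    refine ⟨j, fun m hm => hi ?_⟩
    have := hj hm
    rw [mem_adicFil_iff_shift] at this ⊢
    rwa [tpow_smul_smul, ← neg_add, ← Nat.cast_succ]
  obtain ⟨N', e, Λ', hpair, habs, hmem⟩ := exists_fourier_laurent σ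
    ((puncturedDiskInfty k).pushforward.obj N) hbij F hF
    (fun a m hm => by
      rw [infty_C_smul]
      exact (hF0 _).2 (Λ.smul_mem _ ((hF0 m).1 hm)))
    (fun m hm => (hF0 m).2 (h.mem 0 m mem_top
      ((congrArg (· ∈ Λ) (hadd m)).mpr ((hF0 (delZ N m)).1 hm)))) hexh
    (h.preimageFil_complete hD) (h.preimageFil_separated hD)
    (fun n => (hX n).imp fun j hj m hm => by
      rw [infty_X_smul]
      exact hj m hm)
  change N ≃+ N' at e
  have hΛ' : Λ'.FG := by
    obtain ⟨j, hj⟩ := h.adic_le_preimageFil hD 1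
    obtain ⟨ι, _, v, hv, hvs⟩ := exists_span_mod_adic h.fg j
    refine fg_of_fourierPair hpair hmem (h.preimageFil_separated hD) (v := v)
      (fun i => (hF0 _).2 (hv i)) fun m hm => ?_
    obtain ⟨c, hc⟩ := hvs m ((hF0 m).1 hm)
    refine ⟨c, ?_⟩
    rw [sum_congr rfl fun i _ => infty_C_smul N (c i) (v i)]
    exact hj hc
  refine ⟨N', e, ⟨finite_of_lattice hΛ' habs, fun _ _ => mem_top, Λ', hΛ', fun m =>
    ⟨fun _ => ?_, fun _ => mem_top⟩⟩, hpair,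
    isOpenIso_of_fourierPair (Y := (jStar k).obj N) e hΛ' habs hmem
      (isOpenSubgroup_jStar h.fg h.absorbs (h.adic_le_preimageFil hD)
        (h.preimageFil_le_adic hD))⟩
  obtain ⟨m, rfl⟩ := e.surjective m
  obtain ⟨n, hn⟩ := h.absorbs m mem_top
  have key : ∀ n : ℕ, ∀ m, m ∈ Λ → e (tpow k (-n) • m) ∈ chainSup (delZ N') Λ' := by
    intro n m hm
    induction n with
    | zero =>
      have h0 := (hmem 0 m).2 ((hF0 m).2 hm)
      rw [adicFil_zero] at h0
      exact le_chainSup (by simpa using show e m ∈ Λ' from h0)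
    | succ n ih =>
      have h1 := apply_mem_chainSup ih
      rw [show delZ N' (e _) = σ • e (tpow k (-1) • tpow k (-n) • m) from
        (hpair.del_infty _).trans (map_units_smul e _ _), units_smul_mem_iff] at h1
      rwa [tpow_smul_smul, ← neg_add, add_comm, ← Nat.cast_succ] at h1
  have := key n _ hn
  rwa [← tpow_natCast_smul, tpow_neg_smul_smul] at this

section Disk

variable {x : ClosedPoint k}

lemma disk_C_smul (Y : DMod (ResField x)⟦X⟧) (a : k) (m : ((diskAt x).pushforward.obj Y)) :
    ((C a : k[X]) • m : ((diskAt x).pushforward.obj Y))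
      = (PowerSeries.C (algebraMap k (ResField x) a) : (ResField x)⟦X⟧) •
        (show Y from m) := by
  change ((diskAt x).toRingHom (C a)) • (show Y from m) = _
  rw [show (diskAt x).toRingHom (C a) = PowerSeries.C (algebraMap k (ResField x) a) from
        Polynomial.eval₂_C _ _]

lemma disk_del (Y : DMod (ResField x)⟦X⟧) (m : ((diskAt x).pushforward.obj Y)) :
    ((diskAt x).pushforward.obj Y).del m = Y.del m := by
  change (((1 : ((ResField x)⟦X⟧)ˣ)⁻¹ : ((ResField x)⟦X⟧)ˣ) : (ResField x)⟦X⟧) •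
    (Y.del (show Y from m)) = _
  rw [inv_one, Units.val_one, one_smul]

instance resField_finite : Module.Finite k (ResField x) :=
  finite_of_finite_type_of_isJacobsonRing k (ResField x)

/-- The Fourier transform of `j_! N`. -/
theorem exists_infinity_partner [CharZero k] (σ : ℤˣ) {Y : DMod (ResField x)⟦X⟧}
    {Λ : Submodule (ResField x)⟦X⟧ Y} (h : IsDelLattice Y Λ) :
    ∃ (N : DMod k⸨X⸩) (e : Y ≃+ N), IsOfType (some (signedPoint σ x)) N ∧
      FourierPair σ ((diskAt x).pushforward.obj Y)
        ((puncturedDiskInfty k).pushforward.obj N) e ∧ IsOpenIso Y ((jStar k).obj N) e := by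
  have hF0 : ∀ m, m ∈ (h.fil 0).toAddSubgroup ↔ m ∈ Λ := fun m => Iff.rfl
  have hdel : ((diskAt x).pushforward.obj Y).del = Y.del := AddMonoidHom.ext fun m => disk_del Y m
  obtain ⟨N, e, Λ', hpair, habs, hmem⟩ := exists_fourier_laurent σ
    ((diskAt x).pushforward.obj Y) (by rw [hdel]; exact h.bijective)
    (fun n => (h.fil n).toAddSubgroup)
    (fun n m => by rw [hdel]; exact Iff.rfl)
    (fun a m hm => by
      rw [disk_C_smul]
      exact smul_mem _ _ hm)
    (fun m hm => by
      rw [hdel] at hm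
      exact h.mem m hm)
    (fun m => by rw [hdel]; exact h.exhaust m) h.fil_complete h.fil_separated
    (fun n => ⟨n, fun m hm => (h.fil n).smul_mem ((diskAt x).toRingHom X) hm⟩)
  change Y ≃+ N at e
  have hΛ' : Λ'.FG := by
    obtain ⟨j, hj⟩ := h.adic_le_fil 1
    obtain ⟨ι, _, v, hv, hvs⟩ := exists_span_mod_adic h.fg j
    let b := Module.finBasis k (ResField x)
    refine fg_of_fourierPair hpair hmem h.fil_separated (ι := ι × Fin _)
      (v := fun i => (PowerSeries.C (b i.2) : (ResField x)⟦X⟧) • v i.1)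
      (fun i => (h.fil 0).smul_mem _ (hv i.1)) fun m hm => ?_
    change Y at m
    obtain ⟨c, hc⟩ := hvs m hm
    refine ⟨fun i => b.repr (c i.1) i.2, ?_⟩
    have hfil : m - ∑ i, (PowerSeries.C (c i) : (ResField x)⟦X⟧) • v i ∈ h.fil 1 := by
      obtain ⟨y, hy, hy'⟩ := mem_adicFil.1 hc
      rw [← hy']
      exact hj y hy
    refine (congrArg (fun y : Y => m - y ∈ h.fil 1) ?_).mpr hfil
    refine (sum_congr rfl fun i _ => disk_C_smul Y _ _).trans ?_
    refine Eq.trans (Fintype.sum_prod_type (γ := Y) _)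
      (sum_congr rfl fun i _ => ?_)
    change ∑ j, (PowerSeries.C (algebraMap k (ResField x) (b.repr (c i) j)) : (ResField x)⟦X⟧) •
      (PowerSeries.C (b j) : (ResField x)⟦X⟧) • v i = _
    simp only [smul_smul, ← map_mul, ← Algebra.smul_def]
    rw [← sum_smul, ← map_sum, b.sum_repr]
  refine ⟨N, e, ⟨finite_of_lattice hΛ' habs, Λ', ⟨hΛ', fun _ _ => mem_top, habs, ?_⟩,
    fun f hf => ?_⟩, hpair, isOpenIso_of_fourierPair e hΛ' habs hmem h.isOpenSubgroup_iff⟩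
  · intro m hm
    obtain ⟨m, rfl⟩ := e.surjective m
    have hm0 : m ∈ h.fil 0 := (hmem 0 m).1 (by rw [adicFil_zero]; exact hm)
    have h2 := (hmem 0 _).2 ((h.fil 0).smul_mem ((diskAt x).toRingHom X) hm0)
    rw [adicFil_zero] at h2
    rw [show delZ N (e m) = σ • e ((diskAt x).toRingHom X • m) from hpair.del m]
    exact (units_smul_mem_iff σ).2 h2
  · obtain ⟨j, hj⟩ := h.adic_le_fil 1
    refine ⟨j, fun m hm => ?_⟩
    obtain ⟨m, rfl⟩ := e.surjective m
    have hm0 : m ∈ h.fil 0 := (hmem 0 m).1 (by rw [adicFil_zero]; exact hm)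
    refine (adicFil_eq_shift (Λ := Λ') 1).1 ?_
    rw [show calc' N (f ^ j) (e m) = e ((diskAt x).toRingHom ((f ^ j).comp ((-σ) • X : k[X])) • m)
      from hpair.action _ m]
    refine (hmem 1 _).2 ?_
    have h4 := mem_signedPoint.1 hf
    rw [← Ideal.Quotient.eq_zero_iff_mem, ← constantCoeff_diskAt, ← PowerSeries.X_dvd_iff] at h4
    obtain ⟨b, hb⟩ := h4
    rw [pow_comp, map_pow, hb, mul_pow, mul_smul]
    exact hj _ (Λ.smul_mem _ hm0)

end Disk

end Infinity

/-! ### The operator `θ = t ∂` -/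

section Theta

variable {L : Type u} [Field L]

instance instModuleConstants (N : DMod L⸨X⸩) : Module L N.carrier :=
  Module.compHom N (PowerSeries.C : L →+* L⟦X⟧)

lemma const_smul (N : DMod L⸨X⸩) (c : L) (m : N) :
    c • m = (PowerSeries.C c : L⟦X⟧) • m := rfl

instance instIsScalarTowerConstants (N : DMod L⸨X⸩) : IsScalarTower L L⟦X⟧ N.carrier :=
  ⟨fun c a m => by rw [const_smul, smul_smul, PowerSeries.smul_eq_C_mul]⟩

lemma tpow_smul_const_smul (N : DMod L⸨X⸩) (n : ℤ) (c : L) (m : N) :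
    tpow L n • c • m = c • tpow L n • m := tpow_smul_comm n _ m

lemma powerSeries_deriv_C (c : L) : (PowerSeries.C c : L⟦X⟧)′ = 0 := PowerSeries.derivative_C

lemma del_laurent_smul (N : DMod L⸨X⸩) (a : L⟦X⟧) (m : N) :
    N.del (a • m) = (a′) • m + a • N.del m := by
  have := N.leibniz (algebraMap L⟦X⟧ L⸨X⸩ a) m
  rwa [algebraMap_deriv, algebraMap_smul, algebraMap_smul, algebraMap_smul] at this

/-- The operator `θ` as a linear map over the constants. -/
def thetaLin (N : DMod L⸨X⸩) : Module.End L N where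
  toFun m := tpow L 1 • N.del m
  map_add' a b := by rw [map_add, smul_add]
  map_smul' c m := by
    rw [const_smul, del_laurent_smul, powerSeries_deriv_C, zero_smul, zero_add,
      tpow_smul_comm]
    rfl

variable (N : DMod L⸨X⸩)

lemma thetaLin_apply (m : N) : thetaLin N m = tpow L 1 • N.del m := rfl

lemma del_eq_theta (m : N) : N.del m = tpow L (-1) • thetaLin N m := by
  rw [thetaLin_apply, tpow_neg_smul_smul]

/-- The operator `θ` as an additive map. -/
abbrev thetaAdd : N →+ N.carrier := (thetaLin N).toAddMonoidHom

lemma theta_isDer : IsDer (1 : L⟦X⟧) (thetaAdd N) := fun a m => by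
  change tpow L 1 • N.del (a • m) = _ + a • tpow L 1 • N.del m
  rw [N.leibniz, smul_add, mul_one, smul_smul, smul_comm (tpow L 1) a]
  congr 3
  have := coe_X_pow (L := L) 1
  rw [pow_one] at this
  rw [this]
  rfl

variable {N}

lemma theta_tpow (n : ℤ) (m : N) :
    thetaLin N (tpow L n • m) = tpow L n • (thetaLin N m + (n : L) • m) := by
  refine ((theta_isDer N).tpow n m).trans ?_
  rw [const_smul, map_intCast, zsmul_one]
  rfl

lemma map_theta {N' : DMod L⸨X⸩} (f : N ⟶ N') (m : N) :
    f.toLin (thetaLin N m) = thetaLin N' (f.toLin m) := by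
  rw [thetaLin_apply, thetaLin_apply, ← f.comm, map_smul]

lemma finite_quotient_adic {Λ : Submodule L⟦X⟧ N} (hΛ : Λ.FG) {B : Submodule L N}
    {n : ℕ} (hB : ∀ m ∈ adicFil Λ n, m ∈ B) :
    Module.Finite L ((Λ.restrictScalars L) ⧸ B.submoduleOf (Λ.restrictScalars L)) := by
  obtain ⟨ι, _, v, hv, hvs⟩ := exists_span_mod_adic hΛ n
  refine Module.Finite.of_surjective (Fintype.linearCombination L (fun i =>
    (B.submoduleOf (Λ.restrictScalars L)).mkQ ⟨v i, hv i⟩)) fun q => ?_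
  obtain ⟨⟨m, hm⟩, rfl⟩ := Submodule.mkQ_surjective _ q
  obtain ⟨c, hc⟩ := hvs m hm
  refine ⟨c, ?_⟩
  rw [Fintype.linearCombination_apply]
  simp only [← map_smul]
  rw [← map_sum]
  refine Eq.symm ((Submodule.Quotient.eq _).2 ?_)
  change ((⟨m, hm⟩ - ∑ i, c i • ⟨v i, hv i⟩ : Λ.restrictScalars L) : N) ∈ B
  refine hB _ ?_
  convert hc using 1
  rw [AddSubgroupClass.coe_sub, AddSubmonoidClass.coe_finsetSum]
  rfl

/-- On a `θ`-stable lattice, `θ` is bijective on all but finitely many graded pieces. -/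
lemma exists_graded_bijective [CharZero L] {F : Submodule L⸨X⸩ N}
    {Λ : Submodule L⟦X⟧ N} (h : IsStableLattice (thetaAdd N) F Λ) :
    ∃ a₀ : ℕ, ∀ a : ℤ, (a₀ : ℤ) ≤ |a| →
      (∀ m ∈ shift a Λ, ∃ y ∈ shift a Λ, m - thetaLin N y ∈ shift (a + 1) Λ) ∧
      ∀ m ∈ shift a Λ, thetaLin N m ∈ shift (a + 1) Λ → m ∈ shift (a + 1) Λ := by
  let B : Submodule L N.carrier := (shift 1 Λ).restrictScalars L
  have hBst : ∀ m ∈ B, thetaLin N m ∈ B := (h.shift (theta_isDer N) 1).stable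
  let V := Λ.restrictScalars L
  have hfin : Module.Finite L (V ⧸ B.submoduleOf V) :=
    finite_quotient_adic h.fg (n := 1) fun m hm => (adicFil_eq_shift 1).1 hm
  let T : Module.End L V := (thetaLin N).restrict h.stable
  let G : Module.End L (V ⧸ B.submoduleOf V) := (B.submoduleOf V).mapQ _ T fun m hm => hBst _ hm
  have hfinite : {a : ℤ | Module.End.HasEigenvalue G (-(a : L))}.Finite :=
    Set.Finite.preimage (f := fun a : ℤ => -(a : L))
      (fun a _ b _ hab => Int.cast_injective (neg_injective hab)) (Module.End.finite_hasEigenvalue G)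
  obtain ⟨c, hc⟩ := (hfinite.image Int.natAbs).bddAbove
  refine ⟨c + 1, fun a ha => ?_⟩
  have hne : ¬ Module.End.HasEigenvalue G (-(a : L)) := fun hcon => by
    have := hc ⟨a, hcon, rfl⟩
    rw [Int.abs_eq_natAbs] at ha
    omega
  have hinj : Injective (G + algebraMap L (Module.End L (V ⧸ B.submoduleOf V)) (a : L)) := by
    rw [injective_iff_map_eq_zero]
    intro q hq
    by_contra hq0
    refine hne (Module.End.hasEigenvalue_of_hasEigenvector (x := q)
      ⟨Module.End.mem_eigenspace_iff.2 ?_, hq0⟩)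
    have : G q + (a : L) • q = 0 := hq
    rw [neg_smul]
    exact eq_neg_of_add_eq_zero_left this
  have hsurj := LinearMap.surjective_of_injective hinj
  have hsh : ∀ m : N, tpow L (-(a + 1)) • m = tpow L (-1) • tpow L (-a) • m := fun m => by
    rw [tpow_smul_smul]; congr 2; ring
  have hneg : ∀ m : N, tpow L (-a) • thetaLin N m
      = thetaLin N (tpow L (-a) • m) + (a : L) • tpow L (-a) • m := fun m => by
    rw [theta_tpow, smul_add, tpow_smul_const_smul]
    push_cast
    rw [neg_smul, neg_add_cancel_right]
  constructor
  · intro m hm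
    obtain ⟨q, hq⟩ := hsurj (Submodule.Quotient.mk (⟨_, mem_shift.1 hm⟩ : V))
    obtain ⟨y, rfl⟩ := Submodule.Quotient.mk_surjective _ q
    have h1 : tpow L (-a) • m - (thetaLin N y.1 + (a : L) • y.1) ∈ B :=
      (Submodule.Quotient.eq (B.submoduleOf V)).1 hq.symm
    refine ⟨tpow L a • y.1, tpow_smul_mem_shift y.2, ?_⟩
    rw [mem_shift, hsh, ← mem_shift (n := 1), smul_sub, hneg, tpow_neg_smul_smul]
    exact h1
  · intro m hm hm'
    have h0 := mem_shift.1 hm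
    rw [mem_shift, hsh, ← mem_shift (n := 1), hneg] at hm'
    rw [mem_shift, hsh, ← mem_shift (n := 1)]
    have h1 : (Submodule.Quotient.mk (⟨_, h0⟩ : V) : V ⧸ B.submoduleOf V) = 0 := by
      refine hinj (Eq.trans ?_ (map_zero _).symm)
      exact (Submodule.Quotient.mk_eq_zero (B.submoduleOf V)).2 hm'
    exact (Submodule.Quotient.mk_eq_zero (B.submoduleOf V)).1 h1

lemma graded_descend {Λ : Submodule L⟦X⟧ N} {a : ℤ}
    (h : ∀ b : ℤ, b < a → ∀ m ∈ shift b Λ, thetaLin N m ∈ shift (b + 1) Λ → m ∈ shift (b + 1) Λ)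
    {m : N} (hm : thetaLin N m ∈ shift a Λ) {b : ℤ} (hb : m ∈ shift b Λ) :
    m ∈ shift a Λ := by
  rcases le_or_gt a b with hab | hab
  · exact shift_le_of_le hab hb
  · obtain ⟨n, hn⟩ := Int.le.dest hab.le
    induction n generalizing b with
    | zero => exact absurd hn (by push_cast; omega)
    | succ n ih =>
      have h1 := h b hab m hb (shift_le_of_le (by omega) hm)
      rcases lt_or_ge (b + 1) a with h2 | h2
      · exact ih h1 h2 (by push_cast at hn; omega)
      · exact shift_le_of_le h2 h1

/-- A module over the punctured disk is the direct sum of a part on which `θ` is expansive and a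
part with a `θ`-stable lattice. -/
lemma exists_theta_splitting [CharZero L] (hN : HolK L N) :
    ∃ (E F : Submodule L⸨X⸩ N) (ΛE ΛF : Submodule L⟦X⟧ N) (a₀ : ℕ),
      IsCompl E F ∧ IsExpansive (thetaAdd N) E ΛE ∧ IsStableLattice (thetaAdd N) F ΛF ∧
      ∀ a : ℤ, (a₀ : ℤ) ≤ |a| →
      (∀ m ∈ shift a ΛF, ∃ y ∈ shift a ΛF, m - thetaLin N y ∈ shift (a + 1) ΛF) ∧
      ∀ m ∈ shift a ΛF, thetaLin N m ∈ shift (a + 1) ΛF → m ∈ shift (a + 1) ΛF := by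
  have : Module.Finite L⸨X⸩ N.carrier := hN
  have hD := theta_isDer N
  obtain ⟨E, F, Λ, ΛF, hsup, -, hΛ, hE, hF⟩ := exists_expansive_sup_stable hD
  obtain ⟨i, hexp⟩ := exists_isExpansive hD hΛ (IsNoetherian.noetherian E)
    (fun m => (hE m).trans mem_chainSup)
  obtain ⟨a₀, ha₀⟩ := exists_graded_bijective hF
  refine ⟨E, F, _, ΛF, a₀, ⟨Submodule.disjoint_def.2 fun m hmE hmF => ?_,
    codisjoint_iff.2 hsup⟩, hexp, hF, ha₀⟩
  obtain ⟨e, he⟩ := hF.absorbs.exists_mem_shift hmF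
  have hsh := hF.shift hD (-e)
  obtain ⟨n, hn⟩ := hexp.absorbs.exists_le_shift
    (Λ' := shift (-e) ΛF ⊓ E.restrictScalars L⟦X⟧)
    (Submodule.FG.of_le hsh.fg inf_le_left) fun m hm => hm.2
  refine hexp.eq_zero_of_bounded hD hmE n fun i => hn _ ⟨?_, ?_⟩
  · exact (show Set.MapsTo (thetaAdd N) (shift (-e) ΛF) (shift (-e) ΛF) from hsh.stable).iterate i he
  · exact (show Set.MapsTo (thetaAdd N) E E from hexp.stable).iterate i hmE

lemma expansive_shift_surj {E : Submodule L⸨X⸩ N} {Λ : Submodule L⟦X⟧ N}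
    (h : IsExpansive (thetaAdd N) E Λ) {a : ℤ} {m : N} (hm : m ∈ shift a Λ) :
    ∃ y ∈ shift a Λ, thetaLin N y = m := by
  obtain ⟨y, hy, hy'⟩ := h.surj (a • 1) _ (h.le _ (mem_shift.1 hm))
  refine ⟨tpow L a • y, tpow_smul_mem_shift (h.mem _ y hy (by rw [hy']; exact mem_shift.1 hm)), ?_⟩
  have := (theta_isDer N).tpow a y
  exact this.trans ((congrArg _ hy').trans (tpow_smul_neg_smul a m))

lemma stable_shift_surj {F : Submodule L⸨X⸩ N} {Λ : Submodule L⟦X⟧ N}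
    (h : IsStableLattice (thetaAdd N) F Λ) {a : ℤ}
    (ha : ∀ b : ℤ, a ≤ b → ∀ m ∈ shift b Λ, ∃ y ∈ shift b Λ, m - thetaLin N y ∈ shift (b + 1) Λ)
    {m : N} (hm : m ∈ shift a Λ) : ∃ y ∈ shift a Λ, thetaLin N y = m := by
  have hfg := shift_fg h.fg a
  have hmem : ∀ (n : ℕ) m, m ∈ adicFil (shift a Λ) n ↔ m ∈ shift (a + n) Λ := fun n m => by
    rw [mem_adicFil_iff_shift, mem_shift, mem_shift, tpow_smul_smul, neg_add]
  obtain ⟨y, hy, hy'⟩ := surj_of_approx (adicFil_complete hfg) (adicFil_separated hfg) (thetaAdd N)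
    (fun n y hy => (hmem n _).2 ((h.shift (theta_isDer N) (a + n)).stable _ ((hmem n y).1 hy)))
    (fun n m hm => by
      obtain ⟨y, hy, hy'⟩ := ha (a + n) (by omega) m ((hmem n m).1 hm)
      refine ⟨y, (hmem n y).2 hy, (hmem (n + 1) _).2 ?_⟩
      push_cast
      rwa [← add_assoc]) m ((hmem 0 m).2 (by simpa using hm))
  exact ⟨y, by simpa using (hmem 0 y).1 hy, hy'⟩

lemma mem_shift_sup {Λ Λ' : Submodule L⟦X⟧ N} {a : ℤ} {m : N} :
    m ∈ shift a (Λ ⊔ Λ') ↔ ∃ e ∈ shift a Λ, ∃ f ∈ shift a Λ', m = e + f := by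
  rw [mem_shift, mem_sup]
  constructor
  · rintro ⟨e, he, f, hf, h⟩
    refine ⟨_, tpow_smul_mem_shift he, _, tpow_smul_mem_shift hf, ?_⟩
    rw [← smul_add, h, tpow_smul_neg_smul]
  · rintro ⟨e, he, f, hf, rfl⟩
    exact ⟨_, mem_shift.1 he, _, mem_shift.1 hf, by rw [smul_add]⟩

/-- Near zero, `θ` maps the multiples of a suitable lattice onto themselves; far from zero it is
surjective on the graded pieces. -/
theorem exists_theta_lattice [CharZero L] (hN : HolK L N) :
    ∃ (Λ : Submodule L⟦X⟧ N) (a₀ : ℕ), Λ.FG ∧ Absorbs Λ (⊤ : Submodule L⸨X⸩ N) ∧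
      (∀ a : ℤ, (a₀ : ℤ) ≤ a → ∀ m ∈ shift a Λ, ∃ y ∈ shift a Λ, thetaLin N y = m) ∧
      ∀ a : ℤ, a ≤ -(a₀ : ℤ) → ∀ m ∈ shift a Λ, ∃ y ∈ shift a Λ,
        m - thetaLin N y ∈ shift (a + 1) Λ := by
  obtain ⟨E, F, ΛE, ΛF, a₀, hEF, hE, hF, ha₀⟩ := exists_theta_splitting hN
  refine ⟨ΛE ⊔ ΛF, a₀, hE.fg.sup hF.fg, fun m _ => ?_, fun a ha m hm => ?_, fun a ha m hm => ?_⟩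
  · obtain ⟨e, he, f, hf, rfl⟩ := mem_sup.1
      (show m ∈ E ⊔ F by rw [codisjoint_iff.1 hEF.2]; exact mem_top)
    obtain ⟨i, hi⟩ := hE.absorbs e he
    obtain ⟨j, hj⟩ := hF.absorbs f hf
    refine ⟨max i j, ?_⟩
    rw [smul_add]
    exact add_mem (mem_sup_left (pow_smul_mem_of_le (le_max_left _ _) hi))
      (mem_sup_right (pow_smul_mem_of_le (le_max_right _ _) hj))
  · obtain ⟨e, he, f, hf, rfl⟩ := mem_shift_sup.1 hm
    obtain ⟨y, hy, rfl⟩ := expansive_shift_surj hE he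
    obtain ⟨z, hz, rfl⟩ := stable_shift_surj hF
      (fun b hb => (ha₀ b (by rw [abs_of_nonneg (by omega)]; omega)).1) hf
    exact ⟨y + z, mem_shift_sup.2 ⟨y, hy, z, hz, rfl⟩, map_add _ _ _⟩
  · obtain ⟨e, he, f, hf, rfl⟩ := mem_shift_sup.1 hm
    obtain ⟨y, hy, rfl⟩ := expansive_shift_surj hE he
    obtain ⟨z, hz, h⟩ := (ha₀ a (by rw [abs_of_nonpos (by omega)]; omega)).1 f hf
    refine ⟨y + z, mem_shift_sup.2 ⟨y, hy, z, hz, rfl⟩, mem_shift_sup.2 ⟨0, zero_mem _, _, h, ?_⟩⟩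
    rw [map_add]
    abel

/-- Let `T` be bijective on `A` and modulo `B ≥ A`, with `B / A` finite dimensional. Then the kernels
and the ranges of the powers of `T` stabilize, and the kernels are finite dimensional. -/
lemma exists_fitting {V : Type*} [AddCommGroup V] [Module L V] (T : Module.End L V)
    {A B : Submodule L V} (hA : ∀ m ∈ A, T m ∈ A) (hB : ∀ m ∈ B, T m ∈ B)
    (hQ : Module.Finite L (B ⧸ A.submoduleOf B)) (hAsurj : ∀ m ∈ A, ∃ y ∈ A, T y = m)
    (hAinj : ∀ m ∈ A, T m = 0 → m = 0) (hBmem : ∀ m, T m ∈ B → m ∈ B)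
    (hBsurj : ∀ m, ∃ y, m - T y ∈ B) :
    ∃ n : ℕ, ker (T ^ (n + 1)) ≤ ker (T ^ n) ∧
      range (T ^ n) ≤ range (T ^ (n + 1)) ∧
      Module.Finite L (ker (T ^ n)) := by
  let Q := B ⧸ A.submoduleOf B
  let G : Module.End L Q := (A.submoduleOf B).mapQ _ (T.restrict hB) fun m hm => hA _ hm
  have hBn : ∀ n, ∀ m ∈ B, (T ^ n) m ∈ B := fun n m hm => by
    rw [Module.End.pow_apply]
    exact (show Set.MapsTo T B B from hB).iterate n hm
  have hGn : ∀ (n : ℕ) (m : V) (hm : m ∈ B), (G ^ n) (Submodule.Quotient.mk ⟨m, hm⟩)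
      = (Submodule.Quotient.mk ⟨(T ^ n) m, hBn n m hm⟩ : Q) := fun n => by
    induction n with
    | zero => exact fun m hm => rfl
    | succ n ih =>
      intro m hm
      rw [pow_succ]
      exact ih _ (hB m hm)
  obtain ⟨n₁, hn₁⟩ := IsArtinian.monotone_stabilizes G.iterateRange
  obtain ⟨n₂, hn₂⟩ := monotone_stabilizes_iff_noetherian.2 (inferInstance : IsNoetherian L Q)
    G.iterateKer
  let n := max n₁ n₂
  have hGker : ker (G ^ (n + 1)) ≤ ker (G ^ n) :=
    ((hn₂ (n + 1) (by omega)).symm.trans (hn₂ n (by omega))).le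
  have hGrange : range (G ^ n) ≤ range (G ^ (n + 1)) :=
    (((hn₁ n (by omega)).symm.trans (hn₁ (n + 1) (by omega))).ge :
      G.iterateRange (n + 1) ≤ G.iterateRange n)
  have hkerB : ∀ n m, (T ^ n) m = 0 → m ∈ B := fun n => by
    induction n with
    | zero => exact fun m h0 => (show m = 0 from h0) ▸ zero_mem _
    | succ n ih => exact fun m h0 => hBmem m (ih _ (by rwa [pow_succ] at h0))
  have hAn : ∀ n, ∀ m ∈ A, (T ^ n) m = 0 → m = 0 := fun n => by
    induction n with
    | zero => exact fun m hm h0 => h0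
    | succ n ih => exact fun m hm h0 => hAinj m hm (ih _ (hA m hm) (by rwa [pow_succ] at h0))
  have hAsurjn : ∀ n, ∀ m ∈ A, ∃ y, (T ^ n) y = m := fun n => by
    induction n with
    | zero => exact fun m hm => ⟨m, rfl⟩
    | succ n ih =>
      intro m hm
      obtain ⟨y, hy, rfl⟩ := hAsurj m hm
      obtain ⟨z, rfl⟩ := ih y hy
      exact ⟨z, by rw [pow_succ']; rfl⟩
  refine ⟨n, fun m hm => ?_, ?_, ?_⟩
  · have hm0 : (T ^ (n + 1)) m = 0 := hm
    have hmB := hkerB _ m hm0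
    have h1 : (Submodule.Quotient.mk ⟨m, hmB⟩ : Q) ∈ ker (G ^ (n + 1)) := by
      rw [mem_ker, hGn]
      exact (Submodule.Quotient.mk_eq_zero _).2 (show (T ^ (n + 1)) m ∈ A from hm0 ▸ zero_mem _)
    have h2 := hGker h1
    rw [mem_ker, hGn] at h2
    rw [pow_succ'] at hm0
    exact hAinj _ ((Submodule.Quotient.mk_eq_zero (A.submoduleOf B)).1 h2) hm0
  · rintro _ ⟨m, rfl⟩
    obtain ⟨y, hyB⟩ := hBsurj m
    obtain ⟨q, hq⟩ := hGrange ⟨_, hGn n _ hyB⟩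
    obtain ⟨⟨b, hb⟩, rfl⟩ := Submodule.Quotient.mk_surjective _ q
    rw [hGn] at hq
    obtain ⟨z, hz⟩ := hAsurjn (n + 1) _ ((Submodule.Quotient.eq (A.submoduleOf B)).1 hq)
    refine ⟨b - z + y, ?_⟩
    rw [map_add, map_sub, hz]
    change _ - ((T ^ (n + 1)) b - (T ^ n) (m - T y)) + (T ^ n) (T y) = _
    rw [map_sub]
    abel
  · refine Module.Finite.of_injective ((A.submoduleOf B).mkQ ∘ₗ Submodule.inclusion
      fun m hm => hkerB n m hm) ((injective_iff_map_eq_zero _).2 fun m hm => ?_)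
    exact Subtype.ext (hAn n m.1 ((Submodule.Quotient.mk_eq_zero (A.submoduleOf B)).1 hm) m.2)

/-- The space is the direct sum of the kernel and of the range of `θ ^ n` for large `n`, and the
kernel is finite dimensional over the constants. -/
theorem exists_theta_fitting [CharZero L] (hN : HolK L N) :
    ∃ n : ℕ, ker (thetaLin N ^ (n + 1)) ≤ ker (thetaLin N ^ n) ∧
      range (thetaLin N ^ n) ≤ range (thetaLin N ^ (n + 1)) ∧
      Module.Finite L (ker (thetaLin N ^ n)) := by
  obtain ⟨E, F, ΛE, ΛF, a₀, hEF, hE, hF, ha₀⟩ := exists_theta_splitting hN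
  have hD := theta_isDer N
  have hsum (m : N) : ∃ e ∈ E, ∃ f ∈ F, e + f = m :=
    mem_sup.1 (codisjoint_iff.1 hEF.2 ▸ mem_top)
  have hle : ∀ {c : ℤ} {y}, y ∈ shift c ΛF → y ∈ F := fun {c y} hy => (hF.shift hD c).le y hy
  refine exists_fitting (thetaLin N) (A := (shift a₀ ΛF).restrictScalars L)
    (B := (shift (-a₀) ΛF).restrictScalars L) (hF.shift hD a₀).stable (hF.shift hD (-a₀)).stable
    (finite_quotient_adic (hF.shift hD (-a₀)).fg (n := 2 * a₀) fun m hm => ?_)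
    (fun m => stable_shift_surj hF fun b hb => (ha₀ b (by rw [abs_of_nonneg (by omega)]; omega)).1)
    (fun m hm h0 => eq_zero_of_mem_shift hF.fg fun n => ?_) (fun m hm => ?_) fun m => ?_
  · rw [mem_adicFil_iff_shift, mem_shift, tpow_smul_smul] at hm
    refine mem_shift.2 ?_
    convert hm using 3
    push_cast
    ring
  · have : ∀ n : ℕ, m ∈ shift ((a₀ : ℤ) + n) ΛF := fun n => by
      induction n with
      | zero => simpa using show m ∈ shift a₀ ΛF from hm
      | succ n ih =>
        have := (ha₀ ((a₀ : ℤ) + n) (by rw [abs_of_nonneg (by omega)]; omega)).2 m ih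
          (by rw [h0]; exact zero_mem _)
        push_cast
        rwa [← add_assoc]
    exact shift_le_of_le (by omega) (this n)
  · obtain ⟨e, he, f, hf, rfl⟩ := hsum m
    have h1 : thetaLin N e ∈ F := by
      have := sub_mem (hle hm) (hF.space_stable hD f hf)
      rwa [map_add, LinearMap.toAddMonoidHom_coe, add_sub_cancel_right] at this
    rw [hE.inj 0 e he (by
      rw [addScalar_zero]; exact Submodule.disjoint_def.1 hEF.1 _ (hE.stable e he) h1),
      zero_add] at hm ⊢
    obtain ⟨c, hc⟩ := hF.absorbs.exists_mem_shift hf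
    exact graded_descend (fun b hb => (ha₀ b (by rw [abs_of_nonpos (by omega)]; omega)).2) hm hc
  · have key : ∀ n : ℕ, ∀ m ∈ shift (-(a₀ : ℤ) - n) ΛF,
        ∃ y, m - thetaLin N y ∈ shift (-a₀) ΛF := by
      intro n
      induction n with
      | zero => exact fun m hm => ⟨0, by simpa using hm⟩
      | succ n ih =>
        intro m hm
        obtain ⟨y, hy, h1⟩ := (ha₀ _ (by rw [abs_of_nonpos (by omega)]; omega)).1 m hm
        obtain ⟨z, h2⟩ := ih _ (shift_le_of_le (by push_cast; omega) h1)
        exact ⟨y + z, by rwa [map_add, ← sub_sub]⟩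
    obtain ⟨e, he, f, hf, rfl⟩ := hsum m
    obtain ⟨y, -, hy⟩ := hE.surj 0 e he
    rw [addScalar_zero] at hy
    obtain ⟨c, hc⟩ := hF.absorbs.exists_mem_shift hf
    obtain ⟨z, hz⟩ := key c f (shift_le_of_le (by omega) hc)
    refine ⟨y + z, ?_⟩
    rw [map_add, show thetaLin N y = e from hy, add_sub_add_left_eq_sub]
    exact hz

end Theta

/-! ### Construction of local Fourier transforms at finite points -/

section Finite

variable {L : Type u} [Field L]

lemma delZ_eq_theta (N : DMod L⸨X⸩) (m : N) :
    delZ N m = -(tpow L 1 • thetaLin N m) := by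
  rw [delZ_apply, thetaLin_apply, tpow_smul_smul, ← neg_smul]
  congr 1
  change _ = -(single 2 1 : L⸨X⸩)
  rw [← HahnSeries.single_neg]

/-- The operator `d/dz` maps small lattices onto the multiples by `X`. -/
lemma exists_delZ_surj [CharZero L] {N : DMod L⸨X⸩} (hN : HolK L N)
    {Λ : Submodule L⟦X⟧ N} (hΛ : Λ.FG) (habs : Absorbs Λ ⊤) (n : ℕ) :
    ∃ j, ∀ m ∈ adicFil Λ j, ∃ y ∈ Λ, (delZ N)^[n] y = m := by
  obtain ⟨Λ₁, a₀, hΛ₁, habs₁, hsurj, -⟩ := exists_theta_lattice hN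
  obtain ⟨i, hi⟩ := habs.exists_le_shift hΛ₁ fun _ _ => mem_top
  obtain ⟨i₁, hi₁⟩ := habs₁.exists_le_shift hΛ fun _ _ => mem_top
  have key : ∀ n : ℕ, ∀ m ∈ shift ((a₀ : ℤ) + i + n) Λ₁,
      ∃ y ∈ shift ((a₀ : ℤ) + i) Λ₁, (delZ N)^[n] y = m := by
    intro n
    induction n with
    | zero => exact fun m hm => ⟨m, by simpa using hm, rfl⟩
    | succ n ih =>
      intro m hm
      obtain ⟨y, hy, h⟩ := hsurj ((a₀ : ℤ) + i + n) (by omega) (tpow L (-1) • m) (by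
        rw [mem_shift] at hm ⊢
        rw [tpow_smul_smul]
        convert hm using 3
        push_cast
        ring)
      obtain ⟨z, hz, h'⟩ := ih (-y) (neg_mem hy)
      refine ⟨z, hz, ?_⟩
      rw [iterate_succ_apply', h', map_neg, delZ_eq_theta, h, neg_neg, tpow_smul_neg_smul]
  refine ⟨i₁ + (a₀ + i + n), fun m hm => ?_⟩
  obtain ⟨m, hm₀, rfl⟩ := mem_adicFil.1 hm
  obtain ⟨y, hy, h⟩ := key n (ϖ L ^ (i₁ + (a₀ + i + n)) • m) (by
    rw [mem_shift, ← tpow_natCast_smul, tpow_smul_smul]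
    convert hi₁ m hm₀ using 1
    rw [← tpow_natCast_smul]
    congr 2
    push_cast
    ring)
  refine ⟨y, ?_, h⟩
  have h1 := hi _ (mem_shift.1 hy)
  rw [← tpow_natCast_smul, tpow_smul_smul] at h1
  have h2 := Λ.smul_mem (PowerSeries.X ^ a₀ : L⟦X⟧) h1
  rwa [← tpow_natCast_smul, tpow_smul_smul, show (a₀ : ℤ) + (i + -(a₀ + i)) = 0 by ring,
    show tpow L 0 = 1 from rfl, one_smul] at h2

end Finite

section Disk

variable {k : Type u} [Field k] [CharZero k] {x : ClosedPoint k}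

instance resField_charZero : CharZero (ResField x) :=
  charZero_of_injective_algebraMap (algebraMap k (ResField x)).injective

/-- The Fourier transform of a module of class `≤ 1, (x)`. -/
theorem exists_disk_partner (σ : ℤˣ) {N : DMod k⸨X⸩}
    (hN : IsOfType (some (signedPoint σ x)) N) :
    ∃ (Y : DMod (ResField x)⟦X⟧) (Λ : Submodule (ResField x)⟦X⟧ Y)
      (e : Y ≃+ N), IsDelLattice Y Λ ∧
      FourierPair σ ((diskAt x).pushforward.obj Y)
        ((puncturedDiskInfty k).pushforward.obj N) e ∧ IsOpenIso Y ((jStar k).obj N) e := by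
  obtain ⟨hfin, Λ, hst, hnil⟩ := hN
  have hD := delZ_isDer N
  have hcalc := calc_isCalculus N
  obtain ⟨P, e₀, h₀⟩ := exists_fourierPair (-σ) ((puncturedDiskInfty k).pushforward.obj N)
  change N ≃+ P at e₀
  obtain ⟨f, hf, b, hb, hfb⟩ := exists_uniformizer x
  have hact : ∀ (q : k[X]) (m : N),
      q • e₀ m = e₀ (calc' N (q.comp ((-σ) • X : k[X])) m) := h₀.smul_apply
  set f' : k[X] := f.comp ((-σ) • X : k[X]) with hf'
  obtain ⟨j, hj⟩ := hnil f' (mem_signedPoint.2 (by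
    rw [hf', comp_units_smul_X_comp, hf]; exact Ideal.mem_span_singleton_self f))
  have hpow : ∀ (c : ℤ) (n : ℕ), ∀ m ∈ shift c Λ, calc' N (f' ^ (j * n)) m ∈ shift (c + n) Λ :=
    fun c n m hm => pow_mul f' j n ▸ hcalc.pow_apply_mem hD hst.stable hj c n m hm
  let U : ℕ → AddSubgroup P.carrier := fun n =>
    (shift n Λ).toAddSubgroup.comap (e₀.symm : P →+ N)
  have hU : ∀ n m, e₀ m ∈ U n ↔ m ∈ shift n Λ := fun n m => by
    change e₀.symm (e₀ m) ∈ shift n Λ ↔ _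
    rw [e₀.symm_apply_apply]
  have hinv : ∀ (n : ℤ) m, (-σ) • tpow k (-1) • m ∈ shift n Λ ↔ m ∈ shift (n + 1) Λ := fun n m => by
    rw [units_smul_mem_iff, mem_shift, mem_shift, tpow_smul_smul, neg_add]
  have hUadic : ∀ n m, e₀ m ∈ U n ↔ m ∈ adicFil Λ n := fun n m =>
    (hU n m).trans (adicFil_eq_shift n).symm
  obtain ⟨Y, f₁, V, hf₁, hV⟩ := exists_disk_module x P U
    ((adicFil_complete hst.fg).of_equiv e₀ hUadic) (.of_equiv e₀ hUadic (adicFil_separated hst.fg))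
    (fun m n => by
      obtain ⟨m, rfl⟩ := e₀.surjective m
      obtain ⟨c, hc⟩ := hst.absorbs.exists_mem_shift (m := m) mem_top
      refine ⟨j * (n + c), fun p hp => ?_⟩
      rw [hf, Ideal.span_singleton_pow, Ideal.mem_span_singleton] at hp
      obtain ⟨q, rfl⟩ := hp
      rw [hact, hU, mul_comp, pow_comp, calculus_mul]
      have := hpow (-c) (n + c) _ ((hst.shift hD (-c)).calculus hcalc
        (q.comp ((-σ) • X : k[X])) hc)
      rwa [Nat.cast_add, add_comm, add_neg_cancel_right] at this)
    (fun p n m hm => by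
      obtain ⟨m, rfl⟩ := e₀.surjective m
      rw [hact, hU]
      exact (hst.shift hD n).calculus hcalc _ ((hU n m).1 hm))
    (fun n => ⟨n + 1, fun m hm => by
      obtain ⟨m, rfl⟩ := e₀.surjective m
      rw [h₀.del_infty, hU, hinv]
      exact_mod_cast (hU _ m).1 hm⟩)
  let e₁ : P ≃+ Y.carrier :=
    AddEquiv.ofBijective (f₁.toLin.toAddMonoidHom : P →+ Y) hf₁
  let E : N ≃+ Y.carrier := e₀.trans e₁
  have hpair : FourierPair (-σ) ((puncturedDiskInfty k).pushforward.obj N)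
      ((diskAt x).pushforward.obj Y) E := h₀.trans f₁ e₁ fun _ => rfl
  have hEV : ∀ n m, E m ∈ V n ↔ m ∈ shift n Λ := fun n m => (hV n _).trans (hU n m)
  have hEadic : ∀ n m, E m ∈ (V n).toAddSubgroup ↔ m ∈ adicFil Λ n := fun n m =>
    (hEV n m).trans (adicFil_eq_shift n).symm
  have hEdel : ∀ m, Y.del (E m) = E ((-σ) • tpow k (-1) • m) := fun m =>
    (disk_del Y (E m)).symm.trans (hpair.del_infty m)
  have hEC : ∀ (a : k) m, E ((PowerSeries.C a : k⟦X⟧) • m)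
      = (PowerSeries.C (algebraMap k (ResField x) a) : (ResField x)⟦X⟧) • E m := fun a m =>
    (congrArg E (infty_C_smul N a m)).symm.trans ((hpair.const a m).trans (disk_C_smul Y a (E m)))
  have hVdel : ∀ n m, Y.del m ∈ V n ↔ m ∈ V (n + 1) := fun n m => by
    obtain ⟨m, rfl⟩ := E.surjective m
    rw [hEdel, hEV, hEV, hinv, Nat.cast_succ]
  have hVpow : ∀ (n : ℕ) m, Y.del^[n] m ∈ V 0 ↔ m ∈ V n := fun n => by
    induction n with
    | zero => exact fun m => Iff.rfl
    | succ n ih => intro m; rw [iterate_succ_apply, ih, hVdel]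
  have hanti : ∀ m, Y.del m ∈ V 0 → m ∈ V 0 := fun m hm => by
    obtain ⟨m, rfl⟩ := E.surjective m
    rw [hVdel, hEV] at hm
    exact (hEV 0 m).2 (shift_le_of_le (by simp) hm)
  have hbij : Bijective Y.del := by
    rw [← Function.Bijective.of_comp_iff _ E.bijective,
      show Y.del ∘ E = E ∘ ((-σ) • ·) ∘ (tpow k (-1) • ·) from funext hEdel]
    exact E.bijective.comp ((MulAction.bijective (-σ)).comp (Function.bijective_iff_has_inverse.2
      ⟨(tpow k 1 • ·), tpow_smul_neg_smul 1, tpow_neg_smul_smul 1⟩))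
  -- powers of `X` differ from powers of the equation `f` of `x` by units
  have hXpow : ∀ (W : Submodule (ResField x)⟦X⟧ Y) (i : ℕ) m,
      ϖ (ResField x) ^ i • E m ∈ W ↔ E (calc' N (f' ^ i) m) ∈ W := fun W i m => by
    have h1 : (diskAt x).toRingHom (f ^ i) • E m = _ := hpair.smul_apply (f ^ i) m
    rw [map_pow, hfb, mul_pow, mul_comm, mul_smul, pow_comp] at h1
    obtain ⟨u, hu⟩ := hb.pow i
    rw [← hu] at h1
    exact (Submodule.smul_mem_iff_of_isUnit W u.isUnit).symm.trans (h1 ▸ Iff.rfl)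
  have hexh : ∀ m, ∃ i, ∃ y ∈ V 0, Y.del^[i] y = m := fun m => by
    obtain ⟨m, rfl⟩ := E.surjective m
    obtain ⟨c, hc⟩ := hst.absorbs.exists_mem_shift (m := m) mem_top
    refine ⟨c, ?_⟩
    induction c generalizing m with
    | zero => exact ⟨_, (hEV 0 m).2 (by simpa using hc), rfl⟩
    | succ c ih =>
      obtain ⟨m', hm'⟩ := hbij.2 (E m)
      obtain ⟨m', rfl⟩ := E.surjective m'
      rw [hEdel] at hm'
      obtain ⟨y, hy, h⟩ := ih m' (by
        rw [← E.injective hm', hinv] at hc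
        simpa using hc)
      exact ⟨y, hy, by rw [iterate_succ_apply', h, hEdel, hm']⟩
  have hsepV : Separated fun n => (V n).toAddSubgroup :=
    .of_equiv E hEadic (adicFil_separated hst.fg)
  -- generators of `V 0` modulo `V i`
  have hgen : ∀ i : ℕ, ∃ (ι : Type) (_ : Fintype ι) (v : ι → Y), (∀ i, v i ∈ V 0) ∧
      ∀ m ∈ V 0, ∃ c : ι → ResField x,
        m - ∑ i, (PowerSeries.C (c i) : (ResField x)⟦X⟧) • v i ∈ V i := fun i => by
    obtain ⟨ι, _, v, hv, hvs⟩ := exists_span_mod_adic hst.fg i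
    refine ⟨ι, inferInstance, fun i => E (v i), fun i => (hEV 0 _).2 (by simpa [mem_shift] using hv i),
      fun m hm => ?_⟩
    obtain ⟨m, rfl⟩ := E.surjective m
    obtain ⟨c, hc⟩ := hvs m (by simpa [mem_shift] using (hEV 0 m).1 hm)
    refine ⟨fun i => algebraMap k (ResField x) (c i), ?_⟩
    simpa [hEC] using (hEadic i _).2 hc
  -- over the residue field, `Y` is a module at infinity on which `X` acts as `d/dz`
  have hcontr : ∀ n, ∃ i : ℕ, ∀ m, Y.del^[i] m ∈ V 0 → m ∈ adicFil (V 0) n := by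
    let P' := (polyDisk (ResField x)).pushforward.obj Y
    have hP'del : P'.del = Y.del := AddMonoidHom.ext fun m => by
      change ((1⁻¹ : ((ResField x)⟦X⟧)ˣ) : (ResField x)⟦X⟧) • Y.del m = _
      rw [inv_one, Units.val_one, one_smul]
      rfl
    have hC : ∀ (a : ResField x) (m : P'), (C a • m : P')
        = (PowerSeries.C a : (ResField x)⟦X⟧) • (show Y from m) := fun a m =>
      congrArg (fun r : (ResField x)⟦X⟧ => r • (show Y from m)) (Polynomial.coe_C a)
    have hX : ∀ m : P', ((X : (ResField x)[X]) • m : P')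
        = ϖ (ResField x) • (show Y from m) := fun m =>
      congrArg (fun r : (ResField x)⟦X⟧ => r • (show Y from m)) Polynomial.coe_X
    obtain ⟨N', e', Λ', hpair', habs', hmem'⟩ := exists_fourier_laurent 1 P'
      (hP'del ▸ hbij) (fun n => (V n).toAddSubgroup) (hP'del ▸ fun n m => (hVdel n m).symm)
      (fun a m hm => hC a m ▸ (V 0).smul_mem _ hm) (hP'del ▸ hanti) (hP'del ▸ hexh)
      ((adicFil_complete hst.fg).of_equiv E hEadic) hsepV
      (fun n => ⟨n, fun m hm => hX m ▸ (V n).smul_mem _ hm⟩)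
    change Y ≃+ N' at e'
    have hΛ' : Λ'.FG := by
      obtain ⟨ι, _, v, hv, hvs⟩ := hgen 1
      refine fg_of_fourierPair hpair' hmem' hsepV (v := v) hv fun m hm => ?_
      obtain ⟨c, hc⟩ := hvs m hm
      refine ⟨c, ?_⟩
      rw [sum_congr rfl fun i _ => hC (c i) (v i)]
      exact hc
    have hdelZ : Function.Semiconj e' (ϖ (ResField x) • ·) (delZ N') := fun m => by
      have := hpair'.del m
      rw [one_smul] at this
      exact (this.trans (congrArg e' (hX m))).symm
    intro n
    obtain ⟨i, hi⟩ := exists_delZ_surj (finite_of_lattice hΛ' habs') hΛ' habs' n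
    refine ⟨i, fun m hm => ?_⟩
    obtain ⟨y, hy, h⟩ := hi (e' m) ((hmem' i m).2 ((hVpow i m).1 hm))
    obtain ⟨y, rfl⟩ := e'.surjective y
    rw [← hdelZ.iterate_right n y, smul_iterate] at h
    exact mem_adicFil.2 ⟨y, (hmem' 0 y).1 (by rwa [adicFil_zero]), e'.injective h⟩
  have hlat : IsDelLattice Y (V 0) :=
    { fg := by
        obtain ⟨i, hi⟩ := hcontr 1
        obtain ⟨ι, _, v, hv, hvs⟩ := hgen i
        refine fg_of_separated' (fun y hy => hsepV y fun n => ?_) hv fun m hm =>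
          (hvs m hm).imp fun c hc => hi _ ((hVpow i _).2 hc)
        obtain ⟨y, hy₀, rfl⟩ := mem_adicFil.1 (hy (j * n))
        obtain ⟨y, rfl⟩ := E.surjective y
        change _ ∈ V n
        rw [hXpow, hEV]
        simpa using hpow 0 n y (by simpa using (hEV 0 y).1 hy₀)
      bijective := hbij
      mem := hanti
      bound := ⟨j, fun m hm => by
        obtain ⟨m, rfl⟩ := E.surjective m
        rw [hEdel, hXpow, hEV]
        simpa using hpow (-1) 1 _ ((hinv (-1) m).2 (by simpa using (hEV 0 m).1 hm))⟩
      contr := hcontr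
      exhaust := hexh }
  refine ⟨Y, V 0, E.symm, hlat, neg_neg σ ▸ hpair.symm, ?_⟩
  refine isOpenIso_of_fourierPair E.symm hst.fg hst.absorbs
    (F := fun n => (hlat.fil n).toAddSubgroup) (fun n m => ?_) hlat.isOpenSubgroup_iff
  obtain ⟨m, rfl⟩ := E.surjective m
  rw [E.symm_apply_apply]
  exact ((hVpow n _).trans (hEadic n m)).symm

end Disk

/-! ### Making the derivation invertible -/

section Invert

variable {R : Type u} [CommRing R] [Differential R] {M : DMod R}

/-- The symbol `e_m = ∂⁻¹ m` in the module obtained from `M` by inverting `∂`. -/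
def invertSymb (M : DMod R) : M →+ (invertObj M).carrier :=
  (invertRel M).mkQ.toAddMonoidHom.comp (AddMonoidHom.mk' (fun m => (1 : R) ⊗ₜ[ℤ] m)
    fun _ _ => TensorProduct.tmul_add _ _ _)

lemma invertSymb_smul {c : R} (hc : c′ = 0) (m : M) :
    invertSymb M (c • m) = c • invertSymb M m := by
  have h : c ⊗ₜ[ℤ] m - (1 : R) ⊗ₜ[ℤ] (c • m) ∈ invertRel M :=
    subset_span (Or.inl ⟨c, m, hc, rfl⟩)
  refine ((Submodule.Quotient.eq _).2 ?_).symm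
  change c • ((1 : R) ⊗ₜ[ℤ] m) - _ ∈ _
  rwa [TensorProduct.smul_tmul', smul_eq_mul, mul_one]

lemma smul_invertSymb_del (a : R) (m : M) :
    a • invertSymb M (M.del m) = invertSymb M (M.del (a • m)) := by
  have h : a ⊗ₜ[ℤ] M.del m - (1 : R) ⊗ₜ[ℤ] M.del (a • m) ∈ invertRel M :=
    subset_span (Or.inr ⟨a, m, rfl⟩)
  refine (Submodule.Quotient.eq _).2 ?_
  change a • ((1 : R) ⊗ₜ[ℤ] M.del m) - _ ∈ _
  rwa [TensorProduct.smul_tmul', smul_eq_mul, mul_one]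

lemma del_invertSymb (m : M) :
    (invertObj M).del (invertSymb M m) = invertSymb M (M.del m) := by
  refine congrArg (invertRel M).mkQ (?_ : freeDel M ((1 : R) ⊗ₜ m) = (1 : R) ⊗ₜ M.del m)
  rw [freeDel_tmul, Derivation.map_one_eq_zero, TensorProduct.zero_tmul, zero_add]

/-- The canonical map `m ↦ ∂ e_m`. -/
def invertUnit (M : DMod R) : M ⟶ invertObj M where
  toLin :=
    { toFun := fun m => invertSymb M (M.del m)
      map_add' := fun a b => by rw [map_add, map_add]
      map_smul' := fun a m => (smul_invertSymb_del a m).symm }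
  comm m := (del_invertSymb _).symm

lemma invertUnit_apply (m : M) :
    (invertUnit M).toLin m = (invertObj M).del (invertSymb M m) := (del_invertSymb m).symm

lemma invert_induction {p : (invertObj M) → Prop}
    (h : ∀ (a : R) m, p (a • invertSymb M m)) (hadd : ∀ x y, p x → p y → p (x + y))
    (x : (invertObj M)) : p x := by
  obtain ⟨x, rfl⟩ := Submodule.Quotient.mk_surjective (invertRel M) x
  induction x using TensorProduct.induction_on with
  | zero =>
    have := h 0 0
    rwa [zero_smul] at this
  | tmul a m =>
    have := h a m
    change p ((invertRel M).mkQ (a • (1 : R) ⊗ₜ[ℤ] m)) at this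
    rwa [TensorProduct.smul_tmul', smul_eq_mul, mul_one] at this
  | add x y hx hy => exact hadd _ _ hx hy

lemma invert_hom_ext {Y : DMod R} {f g : invertObj M ⟶ Y}
    (h : ∀ m, f.toLin (invertSymb M m) = g.toLin (invertSymb M m)) : f = g :=
  DMod.hom_ext fun x => by
    refine invert_induction (p := fun x => f.toLin x = g.toLin x) (fun a m => ?_)
      (fun x y hx hy => ?_) x
    · rw [map_smul, map_smul, h]
    · rw [map_add, map_add, hx, hy]

lemma invert_map_symb {M' : DMod R} (f : M ⟶ M') (m : M) :
    ((invert R).map f).toLin (invertSymb M m) = invertSymb M' (f.toLin m) := rfl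

lemma invert_map_unit {M' : DMod R} (f : M ⟶ M') (m : M) :
    ((invert R).map f).toLin ((invertUnit M).toLin m) = (invertUnit M').toLin (f.toLin m) :=
  (invert_map_symb f _).trans (congrArg _ (f.comm m))

/-- The morphism out of the module with `∂` inverted that sends the symbols `e_m` to `φ m`. -/
def invertDesc {Y : DMod R} (φ : M →+ Y)
    (hc : ∀ (c : R) m, c′ = 0 → φ (c • m) = c • φ m)
    (ha : ∀ (a : R) m, a • φ (M.del m) = φ (M.del (a • m)))
    (hd : ∀ m, φ (M.del m) = Y.del (φ m)) : invertObj M ⟶ Y :=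
  let F : R ⊗[ℤ] M →ₗ[R] Y.carrier :=
    TensorProduct.AlgebraTensorModule.lift
      (LinearMap.toSpanSingleton R (M →ₗ[ℤ] Y) φ.toIntLinearMap)
  have hF : ∀ (a : R) m, F (a ⊗ₜ m) = a • φ m := fun _ _ => rfl
  { toLin := (invertRel M).liftQ F (span_le.2 (by
      rintro x (⟨c, m, h, rfl⟩ | ⟨a, m, rfl⟩)
      · change F _ = 0
        rw [map_sub, hF, hF, hc c m h, one_smul, sub_self]
      · change F _ = 0
        rw [map_sub, hF, hF, ha, one_smul, sub_self]))
    comm := fun x => by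
      obtain ⟨x, rfl⟩ := Submodule.Quotient.mk_surjective (invertRel M) x
      change F (freeDel M x) = Y.del (F x)
      induction x using TensorProduct.induction_on with
      | zero => simp
      | tmul a m => rw [freeDel_tmul, map_add, hF, hF, hF, Y.leibniz, hd]
      | add x y hx hy => simp only [map_add, hx, hy] }

lemma invertDesc_symb {Y : DMod R} (φ : M →+ Y) (hc ha hd) (m : M) :
    (invertDesc (Y := Y) φ hc ha hd).toLin (invertSymb M m) = φ m := one_smul R (φ m)

/-- A morphism to a module with bijective `∂` factors through the module with `∂` inverted. -/
lemma exists_invert_lift {Y : DMod R} (hY : Bijective Y.del) (f : M ⟶ Y) :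
    ∃ g : invertObj M ⟶ Y, ∀ m, g.toLin ((invertUnit M).toLin m) = f.toLin m := by
  let D := AddEquiv.ofBijective Y.del hY
  have hD : ∀ y, Y.del (D.symm y) = y := D.apply_symm_apply
  have hφ : ∀ m, D.symm (f.toLin (M.del m)) = f.toLin m := fun m => by
    rw [f.comm]
    exact D.symm_apply_apply _
  refine ⟨invertDesc (D.symm.toAddMonoidHom.comp f.toLin.toAddMonoidHom) (fun c m h => ?_)
    (fun a m => ?_) (fun m => (hφ m).trans (hD _).symm), fun m =>
      (invertDesc_symb _ _ _ _ _).trans (hφ m)⟩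
  · refine hY.1 ?_
    change Y.del (D.symm (f.toLin (c • m))) = Y.del (c • D.symm (f.toLin m))
    rw [Y.leibniz, h, zero_smul, zero_add, hD, hD, map_smul]
  · exact (congrArg (a • ·) (hφ m)).trans ((map_smul _ _ _).symm.trans (hφ _).symm)

/-- Morphisms out of the module with `∂` inverted to a module with injective `∂` are determined
on the image of the original module. -/
lemma invert_hom_ext_unit {Y : DMod R} (hY : Injective Y.del) {f g : invertObj M ⟶ Y}
    (h : ∀ m, f.toLin ((invertUnit M).toLin m) = g.toLin ((invertUnit M).toLin m)) : f = g :=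
  invert_hom_ext fun m => hY (by
    rw [← f.comm, ← g.comm, ← invertUnit_apply, h])

end Invert

section Disk

variable {L : Type u} [Field L] [CharZero L]

/-- The antiderivative without constant term of a power series. -/
def primitive (L : Type u) [Field L] : L⟦X⟧ →+ L⟦X⟧ :=
  AddMonoidHom.mk' (fun a => PowerSeries.X * PowerSeries.mk fun n => a.coeff n / (n + 1 : L))
    fun a b => by
      rw [← mul_add]
      congr 1
      ext n
      simp [add_div]

lemma primitive_deriv (a : L⟦X⟧) : (primitive L a)′ = a := by
  ext n
  change PowerSeries.coeff n (PowerSeries.derivative L (PowerSeries.X * PowerSeries.mk fun n =>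
    PowerSeries.coeff n a / (n + 1 : L))) = _
  have : (n + 1 : L) ≠ 0 := by exact Nat.cast_add_one_ne_zero n
  rw [PowerSeries.coeff_derivative, PowerSeries.coeff_succ_X_mul, PowerSeries.coeff_mk]
  field_simp

lemma eq_C_of_deriv_eq_zero {c : L⟦X⟧} (hc : c′ = 0) : ∃ a, c = PowerSeries.C a := by
  refine ⟨c.coeff 0, ?_⟩
  ext n
  cases n with
  | zero => simp
  | succ n =>
    have h : PowerSeries.coeff n (PowerSeries.derivative L c) = 0 := by
      rw [show PowerSeries.derivative L c = 0 from hc, map_zero]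
    rw [PowerSeries.coeff_derivative] at h
    have h0 : (n + 1 : L) ≠ 0 := by exact Nat.cast_add_one_ne_zero n
    rw [(mul_eq_zero.1 h).resolve_right h0, PowerSeries.coeff_C, if_neg n.succ_ne_zero]

lemma eq_add_primitive (a : L⟦X⟧) : ∃ c, a = PowerSeries.C c + primitive L (a′) := by
  have h : (a - primitive L (a′))′ = 0 := by rw [map_sub, primitive_deriv, sub_self]
  obtain ⟨c, hc⟩ := eq_C_of_deriv_eq_zero h
  exact ⟨c, by rw [← hc, sub_add_cancel]⟩

lemma primitive_C_mul (c : L) (a : L⟦X⟧) :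
    primitive L (a * PowerSeries.C c) = primitive L a * PowerSeries.C c := by
  change ϖ L * _ = PowerSeries.X * _ * _
  rw [mul_assoc]
  congr 1
  ext n
  simp [mul_div_right_comm]

/-- In characteristic zero `∂` is bijective on the module with `∂` inverted; the inverse is
`a e_m ↦ b e_m - e_{b m}` for an antiderivative `b` of `a`. -/
theorem invert_bijective (M : DMod L⟦X⟧) : Bijective (invertObj M).del := by
  let e := invertSymb M
  let I₀ : L⟦X⟧ ⊗[ℤ] M →+ (invertObj M).carrier :=
    TensorProduct.liftAddHom
      (AddMonoidHom.mk' (fun a => AddMonoidHom.mk' (fun m =>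
        primitive L a • e m - e (primitive L a • m))
        (fun m m' => by simp only [map_add, smul_add]; abel))
        (fun a b => by
          ext m
          simp only [map_add, add_smul, AddMonoidHom.mk'_apply, AddMonoidHom.add_apply]
          abel))
      (fun r a m => by
        change primitive L (r • a) • e m - e (primitive L (r • a) • m)
          = primitive L a • e (r • m) - e (primitive L a • r • m)
        rw [map_zsmul, smul_assoc, smul_assoc, map_zsmul, map_zsmul, smul_comm (primitive L a) r,
          smul_comm (primitive L a) r m, map_zsmul])
  have hI₀ : ∀ a m, I₀ (a ⊗ₜ m) = primitive L a • e m - e (primitive L a • m) := fun _ _ => rfl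
  have key : ∀ (a : L⟦X⟧) m,
      primitive L a • e (M.del m) - e (primitive L a • M.del m) = e (a • m) := fun a m => by
    rw [smul_invertSymb_del, M.leibniz, primitive_deriv, map_add, add_sub_cancel_right]
  have hrel : ∀ x ∈ invertRel M, ∀ r : L⟦X⟧, I₀ (r • x) = 0 := fun x hx => by
    refine span_induction (p := fun x _ => ∀ r : L⟦X⟧, I₀ (r • x) = 0) ?_ ?_ ?_ ?_ hx
    · rintro x (⟨c, m, hc, rfl⟩ | ⟨a, m, rfl⟩) r
      · obtain ⟨c₀, rfl⟩ := eq_C_of_deriv_eq_zero hc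
        rw [smul_sub, TensorProduct.smul_tmul', TensorProduct.smul_tmul', map_sub, hI₀, hI₀,
          smul_eq_mul, smul_eq_mul, mul_one, primitive_C_mul, mul_smul, mul_smul,
          ← invertSymb_smul hc, sub_self]
      · rw [smul_sub, TensorProduct.smul_tmul', TensorProduct.smul_tmul', map_sub, hI₀, hI₀,
          key, key, smul_eq_mul, smul_eq_mul, mul_one, mul_smul, sub_self]
    · intro r; rw [smul_zero, map_zero]
    · intro x y _ _ hx hy r; rw [smul_add, map_add, hx, hy, add_zero]
    · intro a x _ h r; rw [smul_smul]; exact h _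
  constructor
  · refine (injective_iff_map_eq_zero _).2 fun y hy => ?_
    let I : (invertObj M) →+ (invertObj M).carrier :=
      QuotientAddGroup.lift (invertRel M).toAddSubgroup I₀ fun x hx => by
        have := hrel x hx 1
        rwa [one_smul] at this
    have hI : ∀ a m, I (a • e m) = primitive L a • e m - e (primitive L a • m) := fun a m => by
      refine (congrArg I₀ ?_ : I₀ (a • (1 : L⟦X⟧) ⊗ₜ m) = _).trans (hI₀ a m)
      rw [TensorProduct.smul_tmul', smul_eq_mul, mul_one]
    have hid : ∀ y, I ((invertObj M).del y) = y := fun y => by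
      refine invert_induction (p := fun y => I ((invertObj M).del y) = y) (fun a m => ?_)
        (fun x y hx hy => ?_) y
      · obtain ⟨c, hc⟩ := eq_add_primitive a
        have h1 : I (a • e (M.del m)) = e (a • m) := (hI _ _).trans (key a m)
        rw [(invertObj M).leibniz, del_invertSymb, map_add, hI]
        refine (congrArg (_ + ·) h1).trans ?_
        rw [eq_sub_of_add_eq' hc.symm, sub_smul, sub_smul, map_sub, invertSymb_smul
          (powerSeries_deriv_C c)]
        change a • e m - _ - (e (a • m) - _) + _ = _
        abel
      · rw [map_add, map_add, hx, hy]
    rw [← hid y, hy, map_zero]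
  · refine fun y => invert_induction (p := fun y => ∃ x, (invertObj M).del x = y)
      (fun a m => ⟨primitive L a • e m - e (primitive L a • m), ?_⟩) ?_ y
    · rw [map_sub, (invertObj M).leibniz, primitive_deriv, del_invertSymb, del_invertSymb,
        ← smul_invertSymb_del, add_sub_cancel_right]
    · rintro _ _ ⟨x, rfl⟩ ⟨y, rfl⟩
      exact ⟨x + y, map_add _ _ _⟩

end Disk

/-! ### Finiteness of the module with `∂` inverted -/

section Lattice

variable {L : Type u} [Field L] {Z : DMod L⟦X⟧} {Z₀ : Submodule L⟦X⟧ Z}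

lemma absorbs_punctureLin (habs : ∀ m, ∃ n : ℕ, ϖ L ^ n • m ∈ Z₀) :
    Absorbs (Z₀.map (punctureLin Z)) ⊤ := by
  intro m _
  have hm : m ∈ span L⸨X⸩ (Set.range ((puncture L).incl Z)) := by
    rw [(puncture L).span_incl]
    trivial
  refine span_induction (p := fun m _ => ∃ n : ℕ, ϖ L ^ n • m ∈
    Z₀.map (punctureLin Z)) ?_ ⟨0, by simp⟩ ?_ ?_ hm
  · rintro _ ⟨z, rfl⟩
    obtain ⟨n, hn⟩ := habs z
    exact ⟨n, _, hn, map_smul _ _ _⟩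
  · rintro x y _ _ ⟨a, ha⟩ ⟨b, hb⟩
    refine ⟨a + b, ?_⟩
    rw [smul_add]
    exact add_mem (pow_smul_mem_of_le (Nat.le_add_right a b) ha)
      (pow_smul_mem_of_le (Nat.le_add_left b a) hb)
  · rintro a x _ ⟨n, hn⟩
    obtain ⟨p, b, hb⟩ := exists_tpow_mul_mem a
    refine ⟨n + p, ?_⟩
    rw [pow_add, mul_smul, ← tpow_natCast_smul p, smul_smul, hb, algebraMap_smul, smul_comm]
    exact smul_mem _ _ hn

lemma holK_puncture (hZ₀ : Z₀.FG) (habs : ∀ m, ∃ n : ℕ, ϖ L ^ n • m ∈ Z₀) :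
    HolK L ((puncture L).pullback.obj Z) :=
  finite_of_lattice (hZ₀.map (punctureLin Z)) (absorbs_punctureLin habs)

/-- A bounded power of `X` kills the torsion of a finitely generated module. -/
lemma exists_pow_smul_eq_zero (hZ₀ : Z₀.FG) : ∃ k : ℕ, ∀ n ≥ k, ∀ m ∈ adicFil Z₀ n,
    (∃ j : ℕ, ϖ L ^ j • m = 0) → m = 0 := by
  have : IsNoetherian L⟦X⟧ Z₀ := isNoetherian_of_fg_of_noetherian _ hZ₀
  let T : ℕ →o Submodule L⟦X⟧ Z₀ :=
    ⟨fun j => ker (LinearMap.lsmul L⟦X⟧ Z₀ (PowerSeries.X ^ j)), fun i j hij m hm => by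
      rw [mem_ker, LinearMap.lsmul_apply] at *
      rw [← Nat.sub_add_cancel hij, pow_add, mul_smul, hm, smul_zero]⟩
  obtain ⟨k, hk⟩ := monotone_stabilizes_iff_noetherian.2 this T
  refine ⟨k, fun n hn m hm ⟨j, hj⟩ => ?_⟩
  obtain ⟨f, hf, rfl⟩ := mem_adicFil.1 hm
  have h1 : (⟨f, hf⟩ : Z₀) ∈ T (k + (j + n)) := by
    refine mem_ker.2 (Subtype.ext ?_)
    change ϖ L ^ (k + (j + n)) • f = 0
    rw [pow_add, mul_smul, pow_add _ j, mul_smul, hj, smul_zero]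
  rw [← hk _ (Nat.le_add_right _ _)] at h1
  have h2 : ϖ L ^ k • f = 0 := congrArg Subtype.val (mem_ker.1 h1)
  rw [← Nat.sub_add_cancel hn, pow_add, mul_smul, h2, smul_zero]

lemma DMod.isLeibniz {R : Type u} [CommRing R] [Differential R] (M : DMod R) :
    IsLeibniz R M.del := fun r => ⟨r′, M.leibniz r⟩



lemma pow_smul_del_mem_chain {c : ℕ}
    (hbd : ∀ m ∈ Z₀, ϖ L ^ c • Z.del m ∈ Z₀) (i : ℕ) : ∀ m ∈ chain L⟦X⟧ Z.del Z₀ i,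
    ϖ L ^ c • Z.del m ∈ chain L⟦X⟧ Z.del Z₀ i := by
  induction i with
  | zero => exact hbd
  | succ i ih =>
    intro m hm
    obtain ⟨a, ha, b, hb, rfl⟩ := (mem_chain_succ Z.isLeibniz).1 hm
    have h1 := apply_mem_chain (D := Z.del) (ih b hb)
    rw [Z.leibniz] at h1
    rw [map_add, smul_add]
    exact add_mem (chain_mono i.le_succ (ih a ha)) ((Submodule.add_mem_iff_right _
      (smul_mem _ _ (apply_mem_chain hb))).1 h1)

lemma exists_pow_smul_mem_of_chain {c : ℕ}
    (hbd : ∀ m ∈ Z₀, ϖ L ^ c • Z.del m ∈ Z₀) (i : ℕ) : ∃ n : ℕ, ∀ m ∈ chain L⟦X⟧ Z.del Z₀ i,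
    ϖ L ^ n • m ∈ Z₀ := by
  induction i with
  | zero => exact ⟨0, fun m hm => by rwa [pow_zero, one_smul]⟩
  | succ i ih =>
    obtain ⟨n, hn⟩ := ih
    refine ⟨n + c, fun m hm => ?_⟩
    obtain ⟨a, ha, b, hb, rfl⟩ := (mem_chain_succ Z.isLeibniz).1 hm
    rw [pow_add, mul_smul, smul_add]
    exact hn _ (add_mem (smul_mem _ _ ha) (pow_smul_del_mem_chain hbd i b hb))

variable [CharZero L]

lemma exists_pow_smul_mem {c : ℕ} (hbd : ∀ m ∈ Z₀, ϖ L ^ c • Z.del m ∈ Z₀)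
    (hexh : ∀ m, ∃ i, m ∈ chain L⟦X⟧ Z.del Z₀ i) (m : Z) :
    ∃ n : ℕ, ϖ L ^ n • m ∈ Z₀ := by
  obtain ⟨i, hi⟩ := hexh m
  obtain ⟨n, hn⟩ := exists_pow_smul_mem_of_chain hbd i
  exact ⟨n, hn m hi⟩

/-- Small elements of a lattice have antiderivatives: on `L((t)) ⊗ Z` this is surjectivity of
`t ∂` on small lattices, and small elements of a finitely generated module are not torsion. -/
lemma exists_adic_le_range_del (hZ₀ : Z₀.FG)
    (habs : ∀ m, ∃ n : ℕ, ϖ L ^ n • m ∈ Z₀) :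
    ∃ n, ∀ m ∈ adicFil Z₀ n, ∃ b, Z.del b = m := by
  obtain ⟨Λ', a₀, hΛ', habs', hsurj, -⟩ := exists_theta_lattice (holK_puncture hZ₀ habs)
  obtain ⟨p, hp⟩ := habs'.exists_le_shift (hZ₀.map (punctureLin Z)) fun _ _ => trivial
  obtain ⟨q, hq⟩ := (absorbs_punctureLin habs).exists_le_shift hΛ' fun _ _ => trivial
  obtain ⟨k, hk⟩ := exists_pow_smul_eq_zero (chain_fg hZ₀ Z.isLeibniz 1)
  refine ⟨p + (a₀ + q + (k + 1)), fun m hm => ?_⟩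
  obtain ⟨z, hz, rfl⟩ := mem_adicFil.1 hm
  have hιz : punctureLin Z (ϖ L ^ (p + (a₀ + q + (k + 1))) • z)
      = tpow L (a₀ + q + (k + 1)) • ϖ L ^ p • punctureLin Z z := by
    rw [map_smul, ← tpow_natCast_smul, ← tpow_natCast_smul, tpow_smul_smul]
    congr 2
    push_cast
    ring
  obtain ⟨y, hy, hθ⟩ := hsurj ((a₀ : ℤ) + q + (k + 2)) (by omega)
    (tpow L 1 • punctureLin Z (ϖ L ^ (p + (a₀ + q + (k + 1))) • z)) (by
      rw [mem_shift, hιz, tpow_smul_smul, tpow_smul_smul]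
      convert hp _ ⟨z, hz, rfl⟩ using 1
      rw [show -((a₀ : ℤ) + q + (k + 2)) + 1 + (a₀ + q + (k + 1)) = 0 by ring]
      exact one_smul _ _)
  obtain ⟨z', hz', hq'⟩ := hq _ (mem_shift.1 hy)
  have hyz : y = punctureLin Z (ϖ L ^ (a₀ + (k + 1) + 1) • z') := by
    rw [map_smul, hq', ← tpow_natCast_smul, ← tpow_natCast_smul, tpow_smul_smul, tpow_smul_smul,
      show ((a₀ + (k + 1) + 1 : ℕ) : ℤ) + q + -(a₀ + q + (k + 2)) = 0 by push_cast; ring]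
    exact (one_smul _ y).symm
  have hdel : ((puncture L).pullback.obj Z).del y = punctureLin Z (ϖ L ^ (p + (a₀ + q + (k + 1))) • z) := by
    rw [del_eq_theta, hθ, tpow_neg_smul_smul]
  refine ⟨_, (sub_eq_zero.1 (hk k le_rfl _ ?_ (punctureLin_eq_zero (?_ :
    punctureLin Z (_ - Z.del (ϖ L ^ (a₀ + (k + 1) + 1) • z')) = 0)))).symm⟩
  · obtain ⟨a, ha⟩ := powerSeries_dvd_deriv
      (dvd_refl (ϖ L ^ (a₀ + (k + 1) + 1)))
    have hC := le_chain (R := L⟦X⟧) (D := Z.del) (Λ := Z₀) 1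
    refine mem_adicFil.2 ⟨ϖ L ^ (p + a₀ + q + 1) • z -
      ((ϖ L ^ (a₀ + 1) * a) • z' +
        ϖ L ^ (a₀ + 2) • Z.del z'), ?_, ?_⟩
    · exact sub_mem (smul_mem _ _ (hC hz)) (add_mem (smul_mem _ _ (hC hz'))
        (smul_mem _ _ (apply_mem_chain (i := 0) hz')))
    · rw [Z.leibniz, ha, smul_sub, smul_add, smul_smul, smul_smul, smul_smul, ← mul_assoc,
        ← pow_add, ← pow_add, ← pow_add, show k + (p + a₀ + q + 1) = p + (a₀ + q + (k + 1)) by ring,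
        show k + (a₀ + 1) = a₀ + (k + 1) by ring, show k + (a₀ + 2) = a₀ + (k + 1) + 1 by ring]
  · rw [map_sub, ← del_punctureLin, ← hyz, hdel, sub_self]

lemma exists_le_adic {Y : Type*} [AddCommGroup Y] [Module L⟦X⟧ Y] {Λ : Submodule L⟦X⟧ Y}
    (hΛ : Λ.FG) {U : ℕ → Submodule L⟦X⟧ Y} (hU : Antitone U) (hUΛ : ∀ n, U n ≤ Λ)
    (hsep : ∀ y, (∀ n, y ∈ U n) → y = 0) (n : ℕ) : ∃ j, ∀ y ∈ U j, y ∈ adicFil Λ n := by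
  induction n with
  | zero => exact ⟨0, fun y hy => by rw [adicFil_zero]; exact hUΛ 0 hy⟩
  | succ n ih =>
    obtain ⟨j, hj⟩ := ih
    let Λ' : Submodule L⟦X⟧ Y := Λ.map (LinearMap.lsmul L⟦X⟧ Y (PowerSeries.X ^ n))
    obtain ⟨i, hi⟩ := exists_le_adic_of_separated (Λ := Λ') (hΛ.map _) (U := fun i => U i ⊓ Λ')
      (fun a b h => inf_le_inf_right _ (hU h)) (fun _ => inf_le_right)
      (fun y hy => hsep y fun n => (hy n).1)
    refine ⟨max i j, fun y hy => ?_⟩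
    obtain ⟨_, ⟨y', hy', rfl⟩, rfl⟩ := mem_adicFil.1 (hi y ⟨hU (le_max_left i j) hy,
      mem_adicFil.1 (hj y (hU (le_max_right i j) hy))⟩)
    exact mem_adicFil.2 ⟨y', hy', by rw [pow_one, pow_succ', mul_smul]; rfl⟩

lemma powerSeries_deriv_X_pow (n : ℕ) : (ϖ L ^ (n + 1))′
    = PowerSeries.C ((n : L) + 1) * PowerSeries.X ^ n := by
  induction n with
  | zero =>
    have : (ϖ L)′ = 1 := PowerSeries.derivative_X
    simp [this]
  | succ n ih =>
    rw [pow_succ', powerSeries_deriv_X_mul, ih]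
    push_cast
    simp only [map_add, map_one]
    ring

/-- A finitely generated module over `L[[t]]` on which `∂` is injective is zero: the Taylor series
`∑ (-t)ⁱ/i! ∂ⁱ m` is horizontal and congruent to `m` modulo `t`. -/
lemma eq_zero_of_fg_of_injective {Y : DMod L⟦X⟧} (hY : Injective Y.del)
    {E : Submodule L⟦X⟧ Y} (hE : E.FG) (hst : Y.Stable E) : ∀ m ∈ E, m = 0 := by
  have hmem : ∀ (i : ℕ), ∀ m ∈ E, Y.del^[i] m ∈ E := fun i => by
    induction i with
    | zero => exact fun m hm => hm
    | succ i ih => exact fun m hm => ih _ (hst m hm)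
  have hX : ∀ m ∈ E, ∃ y ∈ E, m = ϖ L • y := by
    intro m hm
    let c : ℕ → L⟦X⟧ := fun i => PowerSeries.C ((-1) ^ i / (i.factorial : L))
    let s : ℕ → Y.carrier := fun n => ∑ i ∈ Finset.range n,
      ϖ L ^ i • c i • Y.del^[i] m
    have hs : ∀ n, ϖ L ^ n • c n • Y.del^[n] m ∈ adicFil E n := fun n =>
      mem_adicFil.2 ⟨_, E.smul_mem _ (hmem n m hm), rfl⟩
    obtain ⟨l, hl⟩ := adicFil_complete hE s (fun n => by
      change ∑ i ∈ Finset.range (n + 1), _ - ∑ i ∈ Finset.range n, _ ∈ _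
      rw [sum_range_succ, add_sub_cancel_left]
      exact hs n)
    have hds : ∀ n, Y.del (s (n + 1)) = ϖ L ^ n • c n • Y.del^[n + 1] m := by
      intro n
      induction n with
      | zero => simp [s, c]
      | succ n ih =>
        have h1 : s (n + 1 + 1) = s (n + 1) +
            ϖ L ^ (n + 1) • c (n + 1) • Y.del^[n + 1] m :=
          sum_range_succ _ _
        have h2 : (c (n + 1))′ = 0 := powerSeries_deriv_C _
        have h3 := powerSeries_deriv_X_pow (L := L) n
        have h4 : PowerSeries.C ((n : L) + 1) * c (n + 1) = -c n := by
          change PowerSeries.C _ * PowerSeries.C _ = -PowerSeries.C _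
          rw [← map_mul, ← map_neg]
          congr 1
          have := Nat.cast_add_one_ne_zero (R := L) n
          have := Nat.cast_ne_zero (R := L).2 n.factorial_ne_zero
          rw [Nat.factorial_succ]
          push_cast
          field_simp
          ring
        rw [h1, map_add, ih, Y.leibniz, h3, Y.leibniz, h2, zero_smul, zero_add,
          ← iterate_succ_apply' Y.del, mul_comm, mul_smul, smul_smul _ (c (n + 1)), h4,
          neg_smul, smul_neg, add_neg_cancel_left]
    have hl0 : l = 0 := hY (by
      rw [map_zero]
      refine adicFil_separated hE _ fun n => ?_
      obtain ⟨y, hy, h⟩ := mem_adicFil.1 (hl (n + 1))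
      have h5 : Y.del l = Y.del (s (n + 1)) + Y.del (ϖ L ^ (n + 1) • y) := by
        rw [← map_add, h, add_sub_cancel]
      obtain ⟨a, ha⟩ := powerSeries_dvd_deriv (dvd_refl (ϖ L ^ (n + 1)))
      rw [h5, hds, Y.leibniz, ha, mul_smul, pow_succ, mul_smul, ← smul_add, ← smul_add]
      exact mem_adicFil.2 ⟨_, add_mem (E.smul_mem _ (hmem _ m hm)) (add_mem (E.smul_mem _ hy)
        (E.smul_mem _ (hst y hy))), rfl⟩)
    obtain ⟨y, hy, h⟩ := mem_adicFil.1 (hl 1)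
    refine ⟨-y, neg_mem hy, ?_⟩
    have h6 : s 1 = m := by simp [s, c]
    rw [hl0, h6, zero_sub, pow_one] at h
    rw [smul_neg, h, neg_neg]
  refine fun m hm => adicFil_separated hE m fun n => ?_
  induction n generalizing m with
  | zero => rw [adicFil_zero]; exact hm
  | succ n ih =>
    obtain ⟨y, hy, rfl⟩ := hX m hm
    have := pow_smul_mem_adicFil (i := 1) (ih y hy)
    rwa [pow_one, add_comm] at this

/-- If `Z` is generated over `D` by a lattice on which `∂` has a pole of bounded order, the module
with `∂` inverted has a lattice that `∂⁻¹` contracts. -/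
theorem exists_isDelLattice_invert (hZ₀ : Z₀.FG) {c : ℕ}
    (hbd : ∀ m ∈ Z₀, ϖ L ^ c • Z.del m ∈ Z₀)
    (hexh : ∀ m, ∃ i, m ∈ chain L⟦X⟧ Z.del Z₀ i) : ∃ Λ, IsDelLattice (invertObj Z) Λ := by
  have hbij := invert_bijective Z
  obtain ⟨n, hn⟩ := exists_adic_le_range_del hZ₀ (exists_pow_smul_mem hbd hexh)
  obtain ⟨ι, _, v, hv, hvs⟩ := exists_span_mod_adic hZ₀ n
  -- every element of `Z` is a combination of the `v i` up to a derivative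
  have hZ : ∀ i, ∀ m ∈ chain L⟦X⟧ Z.del Z₀ i, ∃ (a : ι → L) (b : Z),
      m = ∑ i, (PowerSeries.C (a i) : L⟦X⟧) • v i + Z.del b := fun i => by
    induction i with
    | zero =>
      intro m hm
      obtain ⟨a, ha⟩ := hvs m hm
      obtain ⟨b, hb⟩ := hn _ ha
      exact ⟨a, b, by rw [hb, add_sub_cancel]⟩
    | succ i ih =>
      intro m hm
      obtain ⟨x, hx, y, -, rfl⟩ := (mem_chain_succ Z.isLeibniz).1 hm
      obtain ⟨a, b, rfl⟩ := ih x hx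
      exact ⟨a, b + y, by rw [map_add, add_assoc]⟩
  let e := invertSymb Z
  let η := (invertUnit Z).toLin
  let Λ₀ : Submodule L⟦X⟧ (invertObj Z).carrier :=
    Z₀.map η ⊔ span L⟦X⟧ (Set.range fun i => e (v i))
  have hΛ₀ : Λ₀.FG := (hZ₀.map _).sup (fg_span (Set.finite_range _))
  have hη : ∀ i, ∀ m ∈ chain L⟦X⟧ Z.del Z₀ i,
      η m ∈ chain L⟦X⟧ (invertObj Z).del Λ₀ i := fun i => by
    induction i with
    | zero => exact fun m hm => mem_sup_left ⟨m, hm, rfl⟩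
    | succ i ih =>
      intro m hm
      obtain ⟨x, hx, y, hy, rfl⟩ := (mem_chain_succ Z.isLeibniz).1 hm
      refine (mem_chain_succ (invertObj Z).isLeibniz).2 ⟨_, ih x hx, _, ih y hy, ?_⟩
      rw [map_add]
      exact congrArg (_ + ·) ((invertUnit Z).comm y)
  have hall : ∀ y, ∃ i, y ∈ chain L⟦X⟧ (invertObj Z).del Λ₀ i := fun y => by
    refine invert_induction (p := fun y => ∃ i, y ∈ chain L⟦X⟧ (invertObj Z).del Λ₀ i)
      (fun r m => ?_) ?_ y
    · obtain ⟨i, hi⟩ := hexh m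
      obtain ⟨a, b, rfl⟩ := hZ i m hi
      obtain ⟨j, hj⟩ := hexh b
      refine ⟨j, smul_mem _ _ ?_⟩
      rw [map_add, map_sum]
      refine add_mem (sum_mem fun l _ => ?_) (hη j b hj)
      rw [invertSymb_smul (powerSeries_deriv_C _)]
      exact smul_mem _ _ (le_chain j
        (mem_sup_right (subset_span ⟨l, rfl⟩)))
    · rintro x y ⟨i, hi⟩ ⟨j, hj⟩
      exact ⟨max i j, add_mem (chain_mono (le_max_left i j) hi) (chain_mono (le_max_right i j) hj)⟩
  have hbd₀ : ∀ m ∈ Λ₀, ϖ L ^ c • (invertObj Z).del m ∈ Λ₀ := by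
    have h1 : ∀ m ∈ Z₀, ϖ L ^ c • (invertObj Z).del (η m) ∈ Λ₀ := fun m hm =>
      mem_sup_left ⟨_, hbd m hm, by
        rw [map_smul]
        exact congrArg (_ • ·) ((invertUnit Z).comm m)⟩
    intro m hm
    obtain ⟨x, ⟨z, hz, rfl⟩, y, hy, rfl⟩ := mem_sup.1 hm
    rw [map_add, smul_add]
    refine add_mem (h1 z hz) (span_induction (p := fun y _ =>
      ϖ L ^ c • (invertObj Z).del y ∈ Λ₀) ?_ ?_ ?_ ?_ hy)
    · rintro _ ⟨i, rfl⟩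
      rw [← invertUnit_apply]
      exact Λ₀.smul_mem _ (mem_sup_left ⟨_, hv i, rfl⟩)
    · rw [map_zero, smul_zero]; exact zero_mem _
    · intro x y _ _ hx hy
      rw [map_add, smul_add]; exact add_mem hx hy
    · intro a x hx h
      rw [(invertObj Z).leibniz, smul_add, smul_comm _ a]
      exact add_mem (Λ₀.smul_mem _ (Λ₀.smul_mem _ (mem_sup_right hx)))
        (Λ₀.smul_mem _ h)
  obtain ⟨i₁, hi₁⟩ := exists_chain_stable hΛ₀ (invertObj Z).isLeibniz
  have hstep : ∀ i ≥ i₁, ∀ m, (invertObj Z).del m ∈ chain L⟦X⟧ (invertObj Z).del Λ₀ (i + 1) →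
      m ∈ chain L⟦X⟧ (invertObj Z).del Λ₀ i := fun i hi m hm => by
    obtain ⟨j, hj⟩ := hall m
    exact hi₁ i hi j m hj hm
  set Λ := chain L⟦X⟧ (invertObj Z).del Λ₀ i₁ with hΛ_def
  have hmem : ∀ m, (invertObj Z).del m ∈ Λ → m ∈ Λ := fun m hm =>
    hstep i₁ le_rfl m (chain_mono i₁.le_succ hm)
  have hΛ : Λ.FG := chain_fg hΛ₀ (invertObj Z).isLeibniz i₁
  refine ⟨Λ, hΛ, hbij, hmem, ⟨c, pow_smul_del_mem_chain hbd₀ i₁⟩, ?_, fun m => ?_⟩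
  · refine exists_le_adic hΛ (U := delPreimage hmem) (antitone_nat_of_succ_le fun n m hm => ?_)
      (fun n => ?_) fun y hy => ?_
    · change (invertObj Z).del^[n + 1] m ∈ Λ at hm
      rw [iterate_succ_apply'] at hm
      exact hmem _ hm
    · induction n with
      | zero => exact fun m hm => hm
      | succ n ih => exact fun m hm => hmem _ (ih hm)
    · let E : Submodule L⟦X⟧ (invertObj Z).carrier := ⨅ n, delPreimage hmem n
      have hE : E ≤ Λ := iInf_le_of_le 0 fun m hm => hm
      refine eq_zero_of_fg_of_injective hbij.1 (E := E) ?_ (fun m hm => ?_) y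
        ((Submodule.mem_iInf _).2 hy)
      · have : IsNoetherian L⟦X⟧ Λ := isNoetherian_of_fg_of_noetherian _ hΛ
        exact Submodule.FG.of_le hΛ hE
      · exact (Submodule.mem_iInf _).2 fun n => (Submodule.mem_iInf _).1 hm (n + 1)
  · obtain ⟨j, hj⟩ := hall m
    have key : ∀ n m, m ∈ chain L⟦X⟧ (invertObj Z).del Λ₀ (i₁ + n) →
        ∃ y ∈ Λ, (invertObj Z).del^[n] y = m := fun n => by
      induction n with
      | zero => exact fun m hm => ⟨m, hm, rfl⟩
      | succ n ih =>
        intro m hm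
        obtain ⟨m', rfl⟩ := hbij.2 m
        obtain ⟨y, hy, rfl⟩ := ih m' (hstep _ (Nat.le_add_right _ _) m' hm)
        exact ⟨y, hy, iterate_succ_apply' _ _ _⟩
    obtain ⟨y, hy, h⟩ := key j m (chain_mono (Nat.le_add_left j i₁) hj)
    exact ⟨j, y, hy, h⟩

end Lattice

/-! ### Lifting through morphisms with torsion kernel and cokernel -/

section Lift

variable {L : Type u} [Field L] [CharZero L]

lemma jStar_del {N : DMod L⸨X⸩} (m : N) :
    (((jStar L).obj N).del m : N) = N.del m := one_smul L⸨X⸩ (N.del m)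

theorem exists_isDelLattice_jShriek {N : DMod L⸨X⸩} (hN : HolK L N) :
    ∃ Λ, IsDelLattice ((jShriek L).obj N) Λ := by
  obtain ⟨Λ, a₀, hΛ, habs, -, happ⟩ := exists_theta_lattice hN
  let Z₀ : Submodule L⟦X⟧ N.carrier := shift (-a₀) Λ
  have hZ₀ : Z₀.FG := shift_fg hΛ _
  let D : N →+ N.carrier := ((jStar L).obj N).del
  have hD : ∀ m, D m = N.del m := fun m => jStar_del m
  have hN' : IsLeibniz L⟦X⟧ D := ((jStar L).obj N).isLeibniz
  have key : ∀ b : ℕ, ∀ m ∈ shift (-(a₀ + b : ℤ)) Λ, m ∈ chain L⟦X⟧ D Z₀ b := fun b => by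
    induction b with
    | zero => exact fun m hm => by simpa [chain] using hm
    | succ b ih =>
      intro m hm
      obtain ⟨y, hy, h⟩ := happ (-(a₀ + b : ℤ)) (by omega) (tpow L 1 • m) (by
        rw [mem_shift] at hm ⊢
        rw [tpow_smul_smul]
        convert hm using 3
        push_cast
        ring)
      refine (mem_chain_succ hN').2 ⟨m - D y, ih _ ?_, y, ih y hy, (sub_add_cancel _ _).symm⟩
      rw [mem_shift] at h ⊢
      rw [hD, del_eq_theta, ← tpow_neg_smul_smul (L := L) 1 m, ← smul_sub, tpow_smul_smul]
      convert h using 3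
      ring
  have hexh : ∀ m, ∃ i, m ∈ chain L⟦X⟧ D Z₀ i := fun m => by
    obtain ⟨e, he⟩ := habs.exists_mem_shift (m := m) trivial
    exact ⟨e, key e m (shift_le_of_le (by omega) he)⟩
  have habs₀ : Absorbs Z₀ ⊤ := fun m _ => by
    obtain ⟨n, hn⟩ := habs m trivial
    refine ⟨n, shift_le_of_le (b := 0) (by omega) (mem_shift_zero.2 hn)⟩
  obtain ⟨c, hc⟩ := habs₀.exists_le_shift (chain_fg hZ₀ hN' 1) fun _ _ => trivial
  exact exists_isDelLattice_invert (Z := (jStar L).obj N) (Z₀ := Z₀) hZ₀ (c := c)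
    (fun m hm => hc _ (apply_mem_chain (D := D) (Λ := Z₀) (i := 0) hm)) hexh

variable {Y Y₁ Y₂ Q : DMod L⟦X⟧}

/-- A `D`-submodule with torsion quotient is everything. -/
lemma IsDelLattice.mem_of_torsion {Λ : Submodule L⟦X⟧ Y} (h : IsDelLattice Y Λ)
    {S : Submodule L⟦X⟧ Y} (hS : Y.Stable S)
    (ht : ∀ m, ∃ k : ℕ, ϖ L ^ k • m ∈ S) (m : Y) : m ∈ S := by
  obtain ⟨k, hk⟩ : ∃ k : ℕ, ∀ m ∈ Λ, ϖ L ^ k • m ∈ S := by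
    obtain ⟨G, rfl⟩ := h.fg
    choose b hb using ht
    refine ⟨G.sup b, fun m hm => ?_⟩
    refine span_induction (p := fun m _ => ϖ L ^ G.sup b • m ∈ S)
      (fun s hs => ?_) ?_ ?_ ?_ hm
    · rw [← Nat.sub_add_cancel (Finset.le_sup (f := b) hs), pow_add, mul_smul]
      exact S.smul_mem _ (hb s)
    · rw [smul_zero]; exact zero_mem _
    · intro x y _ _ hx hy
      rw [smul_add]; exact add_mem hx hy
    · intro a x _ hx
      rw [smul_comm]; exact S.smul_mem a hx
  have key : ∀ (k : ℕ) (u : ℕ → Y), (∀ i, Y.del (u (i + 1)) = u i) →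
      (∀ i, ϖ L ^ k • u i ∈ S) → u 0 ∈ S := fun k => by
    induction k with
    | zero => exact fun u _ h0 => by simpa using h0 0
    | succ k ih =>
      intro u hu hk
      rw [← hu 0]
      refine hS _ (ih (fun i => u (i + 1)) (fun i => hu _) fun i => ?_)
      have h3 := hS _ (hk (i + 1))
      rw [Y.leibniz, hu, powerSeries_deriv_X_pow, mul_smul] at h3
      have h4 := S.smul_mem (PowerSeries.C ((k : L) + 1)⁻¹)
        ((Submodule.add_mem_iff_left _ (hk i)).1 h3)
      rwa [smul_smul, ← map_mul, inv_mul_cancel₀ (Nat.cast_add_one_ne_zero k), map_one,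
        one_smul] at h4
  obtain ⟨i, y, hy, rfl⟩ := h.exhaust m
  let D := AddEquiv.ofBijective Y.del h.bijective
  have hDu : ∀ m, Y.del (D.symm m) = m := D.apply_symm_apply
  have hD : ∀ j, D.symm^[j] y ∈ Λ := fun j => by
    induction j with
    | zero => exact hy
    | succ j ih =>
      rw [iterate_succ_apply']
      exact h.mem _ (by rwa [hDu])
  have h0 : y ∈ S := key k (fun j => D.symm^[j] y) (fun j => by
    simp only [iterate_succ_apply']
    exact hDu _) fun j => hk _ (hD j)
  clear hy hD
  induction i with
  | zero => exact h0
  | succ i ih =>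
    rw [iterate_succ_apply']
    exact hS _ ih

/-- The product of two `D_R`-modules. -/
def DMod.prod {R : Type u} [CommRing R] [Differential R] (M N : DMod R) : DMod R where
  carrier := M × N
  del := M.del.prodMap N.del
  leibniz r m := Prod.ext (M.leibniz r m.1) (N.leibniz r m.2)

lemma smul_del_of_torsion {t : Y} (n : ℕ) (ht : ϖ L ^ n • t = 0)
    (h : ϖ L • Y.del t = 0) : t = 0 := by
  induction n with
  | zero => simpa using ht
  | succ n ih =>
    refine ih ?_
    have h1 := congrArg Y.del ht
    rw [Y.leibniz, map_zero, powerSeries_deriv_X_pow, pow_succ, mul_smul _ _ (Y.del t), h,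
      smul_zero, add_zero, mul_smul] at h1
    have h2 := congrArg ((PowerSeries.C ((n : L) + 1)⁻¹ : L⟦X⟧) • ·) h1
    simp only [smul_zero] at h2
    rwa [smul_smul, ← map_mul, inv_mul_cancel₀ (Nat.cast_add_one_ne_zero n), map_one,
      one_smul] at h2

/-- Torsion elements are derivatives up to elements killed by `X`. -/
lemma exists_sub_del_of_torsion {T : Submodule L⟦X⟧ Y} (hT : Y.Stable T) (n : ℕ) :
    ∀ t ∈ T, ϖ L ^ n • t = 0 →
      ∃ t' ∈ T, ϖ L • (t - Y.del t') = 0 := by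
  induction n with
  | zero => exact fun t _ h => ⟨0, zero_mem _, by simp_all⟩
  | succ n ih =>
    rcases n with _ | n
    · exact fun t _ h => ⟨0, zero_mem _, by simpa using h⟩
    intro t ht h
    let c : L⟦X⟧ := PowerSeries.C ((n : L) + 1)⁻¹
    have hc : c * PowerSeries.C ((n : L) + 1) = 1 := by
      rw [← map_mul, inv_mul_cancel₀ (Nat.cast_add_one_ne_zero n), map_one]
    let x := c • ϖ L • t
    have hx : x ∈ T := T.smul_mem _ (T.smul_mem _ ht)
    have hdx : Y.del x = c • Y.del (ϖ L • t) := by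
      rw [Y.leibniz, powerSeries_deriv_C, zero_smul, zero_add]
    obtain ⟨y, hy, h'⟩ := ih (t + Y.del x) (add_mem ht (hT _ hx)) (by
      have h1 := congrArg Y.del (show ϖ L ^ (n + 1) • PowerSeries.X • t = 0 by
        rw [smul_smul, ← pow_succ, h])
      rw [map_zero, Y.leibniz, powerSeries_deriv_X_pow, mul_smul, smul_smul _ PowerSeries.X t,
        ← pow_succ] at h1
      have h2 := congrArg (c • ·) h1
      simp only [smul_add, smul_zero, smul_smul c, hc, one_smul] at h2
      rw [smul_add, hdx, smul_comm _ c, smul_smul c, h2])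
    refine ⟨y - x, sub_mem hy hx, ?_⟩
    rw [map_sub, ← h']
    congr 1
    abel

lemma exists_pow_smul_del_iterate {t : Y} (h : ϖ L • t = 0) (j : ℕ) :
    ∃ c : L, c ≠ 0 ∧ ϖ L ^ j • Y.del^[j] t = (PowerSeries.C c : L⟦X⟧) • t := by
  induction j with
  | zero => exact ⟨1, one_ne_zero, by simp⟩
  | succ j ih =>
    obtain ⟨c, hc, hj⟩ := ih
    refine ⟨-((j : L) + 1) * c, mul_ne_zero (neg_ne_zero.2 (Nat.cast_add_one_ne_zero j)) hc, ?_⟩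
    have h1 : ϖ L ^ (j + 1) • Y.del^[j] t = 0 := by
      rw [pow_succ', mul_smul, hj, smul_comm, h, smul_zero]
    have h2 := congrArg Y.del h1
    rw [map_zero, Y.leibniz, powerSeries_deriv_X_pow, mul_smul, hj, smul_smul, ← map_mul] at h2
    rw [iterate_succ_apply', eq_neg_of_add_eq_zero_right h2, ← neg_smul, ← map_neg,
      neg_mul]

/-- A surjection with torsion kernel onto a module with a lattice contracted by `∂⁻¹` splits: the
elements all of whose multiples by powers of `X` are derivatives form a complement to the kernel. -/
theorem IsDelLattice.exists_section {Λ : Submodule L⟦X⟧ Y} (h : IsDelLattice Y Λ)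
    {P : DMod L⟦X⟧} (π : P ⟶ Y) (hsurj : Surjective π.toLin)
    (hker : ∀ p, π.toLin p = 0 → ∃ n : ℕ, ϖ L ^ n • p = 0) :
    ∃ s : Y ⟶ P, ∀ m, π.toLin (s.toLin m) = m := by
  let T : Submodule L⟦X⟧ P.carrier := ker π.toLin
  have hT : P.Stable T := fun t ht => by
    rw [mem_ker] at *
    rw [π.comm, ht, map_zero]
  let A : P → ℕ → Prop := fun p i => ∃ q, P.del q = ϖ L ^ i • p
  have huniq : ∀ (k : ℕ), ∀ t, ϖ L ^ k • t = 0 →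
      (∀ i, A t i) → π.toLin t = 0 → t = 0 := by
    intro k
    induction k with
    | zero => exact fun t h _ _ => by simpa using h
    | succ k ih =>
      refine fun t hk hA ht => ih t ?_ hA ht
      obtain ⟨q, hq⟩ := hA k
      have h1 : π.toLin q = 0 := h.bijective.1 (by
        rw [← π.comm, hq, map_smul, ht, smul_zero, map_zero])
      obtain ⟨n, hn⟩ := hker q h1
      rw [← hq, smul_del_of_torsion n hn (by rw [hq, smul_smul, ← pow_succ', hk]), map_zero]
  have hev : ∀ p, ∃ j₀, ∀ j ≥ j₀, ∀ b : L⟦X⟧, A (b • p) j := by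
    intro p
    obtain ⟨S, hS⟩ := h.fg
    choose l hl using hsurj
    let F₀ : Submodule L⟦X⟧ P.carrier := span L⟦X⟧ (insert p (l '' (S : Set Y)))
    have hF₀ : F₀.FG := fg_span ((S.finite_toSet.image _).insert _)
    have hlift : Λ ≤ F₀.map π.toLin := by
      rw [← hS]
      exact span_le.2 fun s hs => ⟨l s, subset_span (Or.inr ⟨s, hs, rfl⟩), hl s⟩
    obtain ⟨k, hk⟩ := exists_pow_smul_eq_zero (chain_fg hF₀ P.isLeibniz 1)
    obtain ⟨J, hJ⟩ := h.contr (k + 1)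
    obtain ⟨j', hj'⟩ := h.adic_le_fil J
    obtain ⟨b, hb⟩ := h.absorbs (π.toLin p)
    refine ⟨j' + b + k, fun j hj a => ?_⟩
    obtain ⟨x, hx⟩ := h.bijective.2 (ϖ L ^ j • a • π.toLin p)
    obtain ⟨u, hu, hux⟩ := mem_adicFil.1 (hJ x (h.fil_antitone J.le_succ (h.mem_fil.2 (by
      rw [iterate_succ_apply, hx, ← h.mem_fil, smul_comm _ a,
        ← Nat.sub_add_cancel (show j' + b ≤ j by omega), pow_add, mul_smul, pow_add, mul_smul]
      exact smul_mem _ _ (smul_mem _ _ (hj' _ hb))))))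
    obtain ⟨v, hv, rfl⟩ := hlift hu
    have hpF : p ∈ F₀ := subset_span (Or.inl rfl)
    refine ⟨ϖ L ^ (k + 1) • v, (sub_eq_zero.1 (hk k le_rfl _ ?_
      (hker _ ?_))).symm⟩
    · rw [P.leibniz, powerSeries_deriv_X_pow, mul_comm, mul_smul, pow_succ, mul_smul,
        ← smul_add, ← Nat.sub_add_cancel (show k ≤ j by omega), add_comm, pow_add, mul_smul,
        ← smul_sub]
      exact mem_adicFil.2 ⟨_, sub_mem (smul_mem _ _ (smul_mem _ a (le_chain 1 hpF)))
        (add_mem (smul_mem _ _ (le_chain 1 hv))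
          (smul_mem _ _ (apply_mem_chain (i := 0) hv))), rfl⟩
    · rw [map_sub, π.comm, map_smul, map_smul, map_smul, hux, hx, sub_self]
  have hexist : ∀ j p, (∀ i ≥ j, A p i) → ∃ t ∈ T, ∀ i, A (p + t) i := by
    intro j
    induction j with
    | zero => exact fun p hA => ⟨0, zero_mem _, fun i => by
        rw [add_zero]
        exact hA i i.zero_le⟩
    | succ j ih =>
      intro p hA
      obtain ⟨x, hx⟩ := h.bijective.2 (ϖ L ^ j • π.toLin p)
      obtain ⟨v, rfl⟩ := hsurj x
      have h1 : ϖ L ^ j • p - P.del v ∈ T := by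
        rw [mem_ker, map_sub, map_smul, π.comm, hx, sub_self]
      obtain ⟨n, hn⟩ := hker _ h1
      obtain ⟨t', ht', h0⟩ := exists_sub_del_of_torsion hT n _ h1 hn
      set t₀ := ϖ L ^ j • p - P.del v - P.del t' with ht₀
      obtain ⟨c, hc, hcj⟩ := exists_pow_smul_del_iterate h0 j
      have ht₀T : ∀ i, P.del^[i] t₀ ∈ T := fun i => by
        induction i with
        | zero => exact sub_mem h1 (hT _ ht')
        | succ i ih' =>
          rw [iterate_succ_apply']
          exact hT _ ih'
      -- the correction that makes the `j`-th multiple a derivative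
      let t : P.carrier := -((PowerSeries.C c⁻¹ : L⟦X⟧) • P.del^[j] t₀)
      have htj : ϖ L ^ j • t = -t₀ := by
        rw [smul_neg, smul_comm, hcj, smul_smul, ← map_mul, inv_mul_cancel₀ hc, map_one, one_smul]
      obtain ⟨t'', ht'', hfin⟩ := ih (p + t) fun i hi => by
        rcases hi.eq_or_lt with rfl | hi
        · refine ⟨v + t', ?_⟩
          rw [map_add, smul_add, htj, ht₀]
          abel
        · obtain ⟨q, hq⟩ := hA i hi
          refine ⟨q, hq.trans ?_⟩
          rw [smul_add, ← Nat.sub_add_cancel hi, pow_add _ _ (j + 1), mul_smul _ _ t, pow_succ',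
            mul_smul _ _ t, htj, smul_neg, h0, neg_zero, smul_zero, add_zero, ← pow_succ',
            ← pow_add]
      refine ⟨t + t'', add_mem (neg_mem (T.smul_mem _ (ht₀T j))) ht'', fun i => ?_⟩
      rw [← add_assoc]
      exact hfin i
  have hsec : ∀ m, ∃ p, π.toLin p = m ∧ ∀ i, A p i := fun m => by
    obtain ⟨p, rfl⟩ := hsurj m
    obtain ⟨j₀, hj₀⟩ := hev p
    obtain ⟨t, ht, hA⟩ := hexist j₀ p fun i hi => by
      have := hj₀ i hi 1
      rwa [one_smul] at this
    exact ⟨p + t, by rw [map_add, mem_ker.1 ht, add_zero], hA⟩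
  choose s hs hsA using hsec
  have hs_eq : ∀ p, (∀ i, A p i) → s (π.toLin p) = p := fun p hA => by
    refine sub_eq_zero.1 ?_
    have h0 : π.toLin (s (π.toLin p) - p) = 0 := by rw [map_sub, hs, sub_self]
    obtain ⟨k, hk⟩ := hker _ h0
    refine huniq k _ hk (fun i => ?_) h0
    obtain ⟨q, e⟩ := hsA (π.toLin p) i
    obtain ⟨q', e'⟩ := hA i
    exact ⟨q - q', by rw [map_sub, e, e', smul_sub]⟩
  have hA_smul : ∀ (a : L⟦X⟧) p, (∀ i, A p i) → ∀ i, A (a • p) i := by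
    intro a p hA i
    obtain ⟨j₀, hj₀⟩ := hev p
    obtain ⟨c, b, rfl⟩ := exists_trunc a j₀
    obtain ⟨q', hq'⟩ := hj₀ (i + j₀) (Nat.le_add_left _ _) b
    choose q hq using hA
    refine ⟨∑ l, (PowerSeries.C (c l) : L⟦X⟧) • q (i + l) + q', ?_⟩
    rw [map_add, map_sum, hq', add_smul, smul_add, sum_smul, smul_sum, pow_add,
      mul_smul, mul_smul]
    congr 1
    refine sum_congr rfl fun l _ => ?_
    rw [P.leibniz, powerSeries_deriv_C, zero_smul, zero_add, hq, smul_smul, smul_smul, pow_add]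
    congr 1
    ring
  refine ⟨⟨⟨⟨s, fun m m' => ?_⟩, fun a m => ?_⟩, fun m => ?_⟩, hs⟩
  · conv_lhs => rw [← hs m, ← hs m', ← map_add]
    refine hs_eq _ fun i => ?_
    obtain ⟨q, e⟩ := hsA m i
    obtain ⟨q', e'⟩ := hsA m' i
    exact ⟨q + q', by rw [map_add, e, e', smul_add]⟩
  · conv_lhs => rw [← hs m, ← map_smul]
    exact hs_eq _ (hA_smul a _ (hsA m))
  · change s (Y.del m) = P.del (s m)
    conv_lhs => rw [← hs m, ← π.comm]
    refine hs_eq _ fun i => ?_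
    rcases i with _ | i
    · exact ⟨s m, by rw [pow_zero, one_smul]⟩
    · obtain ⟨q, e⟩ := hsA m i
      refine ⟨ϖ L ^ (i + 1) • s m - (PowerSeries.C ((i : L) + 1) : L⟦X⟧) • q, ?_⟩
      rw [map_sub, P.leibniz, P.leibniz, e, powerSeries_deriv_C, zero_smul, zero_add,
        powerSeries_deriv_X_pow, mul_smul, add_sub_cancel_left]

/-- Morphisms from a module with a lattice contracted by `∂⁻¹` are determined modulo torsion. -/
lemma IsDelLattice.hom_ext {Λ : Submodule L⟦X⟧ Y₁} (h : IsDelLattice Y₁ Λ)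
    (ε : Y₂ ⟶ Q) (hker : ∀ y, ε.toLin y = 0 → ∃ n : ℕ, ϖ L ^ n • y = 0)
    {s s' : Y₁ ⟶ Y₂} (hs : s ≫ ε = s' ≫ ε) : s = s' := by
  refine DMod.hom_ext fun m => sub_eq_zero.1 ?_
  have hst : Y₁.Stable (ker (s.toLin - s'.toLin)) := fun m hm => by
    rw [mem_ker, LinearMap.sub_apply] at *
    rw [s.comm, s'.comm, ← map_sub, hm, map_zero]
  refine mem_ker.1 (h.mem_of_torsion hst (fun m => ?_) m)
  obtain ⟨n, hn⟩ := hker (s.toLin m - s'.toLin m) (by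
    rw [map_sub, sub_eq_zero]
    exact congrArg (fun f => DMod.Hom.toLin f m) hs)
  exact ⟨n, by rw [mem_ker, map_smul]; exact hn⟩

/-- A morphism from a module with a lattice contracted by `∂⁻¹` lifts through a morphism with
torsion kernel and cokernel. -/
theorem IsDelLattice.exists_lift {Λ : Submodule L⟦X⟧ Y₁} (h : IsDelLattice Y₁ Λ)
    (ε : Y₂ ⟶ Q) (hker : ∀ y, ε.toLin y = 0 → ∃ n : ℕ, ϖ L ^ n • y = 0)
    (hcok : ∀ q, ∃ (n : ℕ) (y : Y₂), ε.toLin y = ϖ L ^ n • q)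
    (g : Y₁ ⟶ Q) : ∃ s : Y₁ ⟶ Y₂, s ≫ ε = g := by
  -- the fibre product of `Y₁` and `Y₂` over `Q`
  let G : Submodule L⟦X⟧ (Y₁.prod Y₂).carrier :=
    ker (g.toLin.comp (LinearMap.fst _ _ _) - ε.toLin.comp (LinearMap.snd _ _ _))
  have hG : ∀ p : Y₁ × Y₂, p ∈ G ↔ g.toLin p.1 = ε.toLin p.2 :=
    fun p => sub_eq_zero
  have hGdel : (Y₁.prod Y₂).Stable G := fun p hp => (hG _).2 (by
    change g.toLin (Y₁.del p.1) = ε.toLin (Y₂.del p.2)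
    rw [g.comm, ε.comm, (hG p).1 hp])
  let P := (Y₁.prod Y₂).sub G hGdel
  let π : P ⟶ Y₁ := ⟨(LinearMap.fst _ _ _).comp G.subtype, fun _ => rfl⟩
  let ρ : P ⟶ Y₂ := ⟨(LinearMap.snd _ _ _).comp G.subtype, fun _ => rfl⟩
  have hsurj : Surjective π.toLin := fun m => by
    obtain ⟨y, hy⟩ := h.mem_of_torsion (S := (range ε.toLin).comap g.toLin) (by
      rintro m ⟨y, hy⟩
      exact ⟨Y₂.del y, by rw [ε.comm, hy, g.comm]⟩) (fun m => by
      obtain ⟨n, y, hy⟩ := hcok (g.toLin m)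
      exact ⟨n, y, by rw [hy, map_smul]⟩) m
    exact ⟨⟨(m, y), (hG _).2 hy.symm⟩, rfl⟩
  obtain ⟨s, hs⟩ := h.exists_section π hsurj fun p hp => by
    have hp1 : p.1.1 = 0 := hp
    obtain ⟨n, hn⟩ := hker p.1.2 (by rw [← (hG p.1).1 p.2, hp1, map_zero])
    exact ⟨n, Subtype.ext (Prod.ext ((congrArg (_ • ·) hp1).trans (smul_zero _)) hn)⟩
  refine ⟨s ≫ ρ, DMod.hom_ext fun m => ?_⟩
  exact ((hG _).1 (s.toLin m).2).symm.trans (congrArg g.toLin (hs m))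

end Lift

/-! ### The morphism from the `!`-extension to the `*`-extension -/

section Variation

variable {L : Type u} [Field L] {N N' : DMod L⸨X⸩}

/-- A splitting of the operator `θ`: the projection `π` onto its generalized kernel `V`, the
inverse `R` of `θ` on the complement of `V`, a basis `v` of `V`, and the `L((t))`-linear forms `P j`
whose coefficients of index `i` are the coordinates of `π (t⁻ⁱ m)`. -/
structure ThetaSplit (N : DMod L⸨X⸩) where
  π : N →ₗ[L] N
  R : N →ₗ[L] N
  n : ℕ
  d : ℕ
  v : Fin d → N
  P : Fin d → N →ₗ[L⸨X⸩] L⸨X⸩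
  π_v : ∀ j, π (v j) = v j
  θ_π : ∀ m, thetaLin N (π m) = π (thetaLin N m)
  θ_R : ∀ m, thetaLin N (R m) = m - π m
  R_θ : ∀ m, R (thetaLin N m) = m - π m
  R_π : ∀ m, R (π m) = 0
  π_R : ∀ m, π (R m) = 0
  nil : ∀ m, (thetaLin N ^ n) (π m) = 0
  P_v : ∀ j l, P j (v l) = if j = l then 1 else 0
  π_eq : ∀ m, π m = ∑ j, (P j m).coeff 0 • v j

lemma exists_projection {V : Type*} [AddCommGroup V] [Module L V] (T : Module.End L V) (n : ℕ)
    (hk : ker (T ^ (n + 1)) ≤ ker (T ^ n))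
    (hr : range (T ^ n) ≤ range (T ^ (n + 1))) :
    ∃ π R : V →ₗ[L] V, range π ≤ ker (T ^ n) ∧ (∀ m, π (π m) = π m) ∧
      (∀ m, T (π m) = π (T m)) ∧ (∀ m, T (R m) = m - π m) ∧ (∀ m, R (T m) = m - π m) ∧
      (∀ m, R (π m) = 0) ∧ (∀ m, π (R m) = 0) ∧ ∀ m, π ((T ^ n) m) = 0 := by
  have hkj : ∀ j m, (T ^ (n + j)) m = 0 → (T ^ n) m = 0 := fun j => by
    induction j with
    | zero => exact fun m h => h
    | succ j ih =>
      intro m h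
      rw [← add_assoc, pow_succ] at h
      refine hk (?_ : (T ^ (n + 1)) m = 0)
      rw [pow_succ]
      exact ih _ h
  have hrj : ∀ j m, ∃ y, (T ^ (n + j)) y = (T ^ n) m := fun j => by
    induction j with
    | zero => exact fun m => ⟨m, rfl⟩
    | succ j ih =>
      intro m
      obtain ⟨y, hy⟩ := hr ⟨m, rfl⟩
      obtain ⟨z, hz⟩ := ih y
      exact ⟨z, by rw [← add_assoc, pow_succ', Module.End.mul_apply, hz, ← hy, pow_succ']; rfl⟩
  let A := ker (T ^ n)
  let B := range (T ^ n)
  have hAB : IsCompl A B := by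
    refine ⟨Submodule.disjoint_def.2 ?_, codisjoint_iff.2 (eq_top_iff.2 fun m _ => ?_)⟩
    · rintro _ ha ⟨y, rfl⟩
      exact hkj n y (by rw [pow_add]; exact ha)
    · obtain ⟨y, hy⟩ := hrj n m
      refine mem_sup.2 ⟨m - (T ^ n) y, ?_, _, ⟨y, rfl⟩, sub_add_cancel _ _⟩
      change (T ^ n) _ = 0
      rw [map_sub, ← hy, pow_add, Module.End.mul_apply, sub_self]
  have hTn : ∀ m, T ((T ^ n) m) = (T ^ n) (T m) := fun m => by
    rw [← Module.End.mul_apply, ← Module.End.mul_apply, ← pow_succ, ← pow_succ']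
  have hTB : ∀ b ∈ B, T b ∈ B := by
    rintro _ ⟨y, rfl⟩
    exact ⟨T y, (hTn y).symm⟩
  have hTA : ∀ a ∈ A, T a ∈ A := fun a ha => by
    change (T ^ n) _ = 0
    rw [← hTn, show (T ^ n) a = 0 from ha, map_zero]
  let Te : B ≃ₗ[L] B := LinearEquiv.ofBijective (T.restrict hTB) <| by
    refine ⟨(injective_iff_map_eq_zero _).2 ?_, ?_⟩
    · rintro ⟨_, y, rfl⟩ h
      have h' : T ((T ^ n) y) = 0 := congrArg Subtype.val h
      exact Subtype.ext (hkj 1 y (by rw [pow_succ']; exact h'))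
    · rintro ⟨_, y, rfl⟩
      obtain ⟨z, hz⟩ := hrj 1 y
      have h : T ((T ^ n) z) = (T ^ n) y := by rw [← hz, pow_succ']; rfl
      exact ⟨⟨_, z, rfl⟩, Subtype.ext h⟩
  have hTe : ∀ b, T (Te.symm b : V) = b := fun b => congrArg Subtype.val (Te.apply_symm_apply b)
  let p := A.projectionOnto B hAB
  let q := B.projectionOnto A hAB.symm
  have hpA : ∀ a ∈ A, (p a : V) = a := fun a ha =>
    congrArg Subtype.val (Submodule.projectionOnto_apply_left hAB ⟨a, ha⟩)
  have hpB : ∀ b ∈ B, p b = 0 := fun b hb => Submodule.projectionOnto_apply_right hAB ⟨b, hb⟩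
  have hqA : ∀ a ∈ A, q a = 0 := fun a ha => Submodule.projectionOnto_apply_right hAB.symm ⟨a, ha⟩
  have hqB : ∀ b (hb : b ∈ B), q b = ⟨b, hb⟩ := fun b hb =>
    Submodule.projectionOnto_apply_left hAB.symm ⟨b, hb⟩
  have hpq : ∀ m, (q m : V) = m - p m := fun m => by
    obtain ⟨a, ha, b, hb, rfl⟩ := mem_sup.1
      (show m ∈ A ⊔ B by rw [codisjoint_iff.1 hAB.2]; trivial)
    rw [map_add, map_add, hqA a ha, hqB b hb, hpB b hb, zero_add, add_zero, hpA a ha]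
    simp
  have hpT : ∀ m, T (p m) = p (T m) := fun m => by
    have h : T m = T (p m) + T (q m) := by rw [hpq, map_sub, add_sub_cancel]
    rw [h, map_add, hpB _ (hTB _ (q m).2), add_zero, hpA _ (hTA _ (p m).2)]
  refine ⟨A.subtype ∘ₗ p, B.subtype ∘ₗ Te.symm.toLinearMap ∘ₗ q, ?_, fun m => hpA _ (p m).2, hpT,
    fun m => (hTe _).trans (hpq m), fun m => ?_, fun m => ?_, fun m => ?_, fun m => ?_⟩
  · rintro _ ⟨m, rfl⟩
    exact (p m).2
  · have h : q (T m) = Te (q m) := Subtype.ext (by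
      change _ = T (q m)
      rw [hpq, hpq, map_sub, hpT])
    change (Te.symm (q (T m)) : V) = _
    rw [h, LinearEquiv.symm_apply_apply]
    exact hpq m
  · change (Te.symm (q (p m)) : V) = 0
    rw [hqA _ (p m).2, map_zero]
    rfl
  · exact congrArg Subtype.val (hpB _ (Te.symm (q m)).2)
  · exact congrArg Subtype.val (hpB _ ⟨_, rfl⟩)

/-- A linear form `c` over the constants that vanishes on small elements is the constant
coefficient of a linear form over `L((t))`. -/
lemma exists_linear_form (c : N →ₗ[L] L)
    (hc : ∀ m, ∃ i₀ : ℤ, ∀ b : L⟦X⟧, ∀ i ≥ i₀, c (tpow L i • b • m) = 0) :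
    ∃ P : N →ₗ[L⸨X⸩] L⸨X⸩, ∀ m i, (P m).coeff i = c (tpow L (-i) • m) := by
  choose i₀ hi₀ using hc
  let P : N → L⸨X⸩ := fun m => HahnSeries.ofSuppBddBelow (fun i => c (tpow L (-i) • m))
    ⟨-i₀ m, fun i hi => by
      by_contra h
      refine hi ?_
      have := hi₀ m 1 (-i) (by omega)
      rwa [one_smul] at this⟩
  have hP : ∀ m i, (P m).coeff i = c (tpow L (-i) • m) := fun m i => rfl
  have hone : ∀ (e : ℤ) (a : L⸨X⸩), (tpow L e * a).coeff 0 = a.coeff (-e) := fun e a => by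
    rw [tpow, HahnSeries.coeff_single_mul, one_mul, zero_sub]
  have hC : ∀ (r : L) (a : L⸨X⸩),
      (algebraMap L⟦X⟧ L⸨X⸩ (PowerSeries.C r) * a).coeff 0 = r * a.coeff 0 := fun r a => by
    have : algebraMap L⟦X⟧ L⸨X⸩ (PowerSeries.C r) = single 0 r :=
      HahnSeries.ofPowerSeries_C r
    rw [this, HahnSeries.coeff_single_mul, sub_zero]
  have hvan : ∀ (b : L⟦X⟧) (x : L⸨X⸩), (∀ j < 0, x.coeff (1 + j) = 0) →
      (algebraMap L⟦X⟧ L⸨X⸩ b * x).coeff 0 = 0 := fun b x hx => by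
    rw [HahnSeries.coeff_mul]
    refine Finset.sum_eq_zero fun ij hij => ?_
    simp only [Finset.mem_antidiagonal] at hij
    obtain ⟨h1, -, h3⟩ := hij
    by_cases h : ij.1 < 0
    · have : (algebraMap L⟦X⟧ L⸨X⸩ b).coeff ij.1 = 0 := by
        have := PowerSeries.coeff_coe b ij.1
        rw [if_pos h] at this
        exact this
      rw [this, zero_mul]
    · rw [show ij.2 = 1 + (ij.2 - 1) by ring, hx _ (by omega), mul_zero]
  have key : ∀ (a : L⸨X⸩) m, c (a • m) = (a * P m).coeff 0 := fun a m => by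
    obtain ⟨e, b, hb⟩ := exists_tpow_mul_mem a
    have ha : a = tpow L (-e) * algebraMap L⟦X⟧ L⸨X⸩ b := by
      rw [← hb, ← mul_assoc, tpow_mul]
      simp [tpow]
    obtain ⟨r, b', h⟩ := exists_trunc b (Int.toNat (i₀ m + e))
    have e1 : a = ∑ i, algebraMap L⟦X⟧ L⸨X⸩ (PowerSeries.C (r i)) * tpow L (i - e)
        + algebraMap L⟦X⟧ L⸨X⸩ b' * tpow L (Int.toNat (i₀ m + e) - e) := by
      rw [ha, h, map_add, map_sum, mul_add, Finset.mul_sum]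
      congr 1
      · refine sum_congr rfl fun i _ => ?_
        rw [map_mul, coe_X_pow, mul_left_comm, tpow_mul, neg_add_eq_sub]
      · rw [map_mul, coe_X_pow, mul_comm _ (algebraMap _ _ b'), mul_left_comm, tpow_mul,
          neg_add_eq_sub]
    rw [e1, add_smul, add_mul, HahnSeries.coeff_add, map_add, sum_smul, Finset.sum_mul,
      map_sum, HahnSeries.coeff_sum]
    congr 1
    · refine sum_congr rfl fun i _ => ?_
      rw [mul_assoc, hC, hone, hP, mul_smul, neg_neg, algebraMap_smul, ← const_smul, map_smul,
        smul_eq_mul]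
    · rw [mul_assoc, hvan, mul_comm, mul_smul, algebraMap_smul]
      · exact hi₀ m b' _ (by omega)
      · intro j hj
        have := hP (tpow L (Int.toNat (i₀ m + e) - e) • m) 0
        rw [tpow, HahnSeries.coeff_single_mul, one_mul, hP]
        have := hi₀ m 1 (-(1 + j - (↑(Int.toNat (i₀ m + e)) - e))) (by omega)
        rwa [one_smul] at this
  refine ⟨⟨⟨P, fun x y => ?_⟩, fun a x => ?_⟩, hP⟩
  · ext i
    rw [HahnSeries.coeff_add, hP, hP, hP, smul_add, map_add]
  · ext i
    change _ = (a * P x).coeff i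
    rw [hP, ← mul_smul, key, mul_assoc, hone, neg_neg]

theorem exists_thetaSplit [CharZero L] (hN : HolK L N) : Nonempty (ThetaSplit N) := by
  obtain ⟨n, hk, hr, hfin⟩ := exists_theta_fitting hN
  obtain ⟨π, R, hπ, hππ, hTπ, hTR, hRT, hRπ, hπR, hmin⟩ := exists_projection (thetaLin N) n hk hr
  have hnil : ∀ m, (thetaLin N ^ n) (π m) = 0 := fun m => hπ ⟨m, rfl⟩
  have : Module.Finite L (range π) :=
    Module.Finite.of_injective (Submodule.inclusion hπ) (Submodule.inclusion_injective _)
  obtain ⟨Λ, a₀, hΛ, habs, happ, -⟩ := exists_theta_lattice hN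
  have hsmall : ∀ a : ℤ, (a₀ : ℤ) ≤ a → ∀ m ∈ shift a Λ, π m = 0 := fun a ha m hm => by
    have h : ∀ j : ℕ, ∃ y ∈ shift a Λ, (thetaLin N ^ j) y = m := fun j => by
      induction j with
      | zero => exact ⟨m, hm, rfl⟩
      | succ j ih =>
        obtain ⟨y, hy, h⟩ := ih
        obtain ⟨z, hz, rfl⟩ := happ a ha y hy
        exact ⟨z, hz, by rw [pow_succ]; exact h⟩
    obtain ⟨y, -, rfl⟩ := h n
    exact hmin y
  let B := Module.finBasis L (range π)
  let c : Fin _ → N →ₗ[L] L := fun j => B.coord j ∘ₗ π.rangeRestrict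
  have hc0 : ∀ j m, π m = 0 → c j m = 0 := fun j m h => by
    have h' : π.rangeRestrict m = 0 := Subtype.ext h
    exact (congrArg (B.coord j) h').trans (map_zero _)
  choose P hP using fun j => exists_linear_form (c j) fun m => by
    obtain ⟨e, he⟩ := habs m trivial
    refine ⟨a₀ + e, fun b i hi => hc0 j _ (hsmall (i - e) (by omega) _ ?_)⟩
    rw [tpow_smul_comm]
    refine smul_mem _ b (mem_shift.2 ?_)
    rw [tpow_smul_smul, neg_sub, sub_add_cancel, tpow_natCast_smul]
    exact he
  have hπv : ∀ j, π (B j : N) = B j := fun j => by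
    obtain ⟨m, hm⟩ := (B j).2
    rw [← hm, hππ]
  have hθi : ∀ (i : ℤ) (x : N), tpow L i • thetaLin N x
      = thetaLin N (tpow L i • x) - (i : L) • tpow L i • x := fun i x => by
    rw [theta_tpow, smul_add, tpow_smul_const_smul, add_sub_cancel_right]
  -- the generalized kernels of `θ` and of `θ - i` meet in zero for `i ≠ 0`
  have hdisj : ∀ (i : ℤ), i ≠ 0 → ∀ p y, (thetaLin N ^ p) y = 0 → π (tpow L i • y) = 0 := by
    intro i hi p
    induction p with
    | zero =>
      intro y hy
      rw [show y = 0 from hy, smul_zero, map_zero]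
    | succ p ih =>
      intro y hy
      rw [pow_succ] at hy
      have h1 := ih _ hy
      rw [hθi, map_sub, ← hTπ, π.map_smul, sub_eq_zero] at h1
      have h2 : ∀ q, (thetaLin N ^ q) (π (tpow L i • y)) = (i : L) ^ q • π (tpow L i • y) :=
        fun q => by
        induction q with
        | zero => simp
        | succ q ih => rw [pow_succ, Module.End.mul_apply, h1, map_smul, ih, smul_smul, pow_succ']
      have h3 := h2 n
      rw [hnil] at h3
      exact (smul_eq_zero.1 h3.symm).resolve_left (pow_ne_zero _ (Int.cast_ne_zero.2 hi))
  refine ⟨⟨π, R, n, _, fun j => B j, P, hπv, hTπ, hTR, hRT, hRπ, hπR, hnil, fun j l => ?_,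
    fun m => ?_⟩⟩
  · ext i
    rw [hP]
    by_cases hi : i = 0
    · subst hi
      rw [neg_zero, tpow_zero_smul]
      have : c j (B l) = B.coord j (B l) := congrArg (B.coord j) (Subtype.ext (hπv l))
      rw [this, Module.Basis.coord_apply, B.repr_self, Finsupp.single_apply]
      by_cases h : l = j
      · simp [h]
      · simp [h, Ne.symm h]
    · rw [hc0 j _ (hdisj _ (neg_ne_zero.2 hi) n _ (by rw [← hπv]; exact hnil _))]
      split_ifs <;> simp [HahnSeries.coeff_one, hi]
  · have h1 := congrArg Subtype.val (B.sum_repr (π.rangeRestrict m))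
    refine h1.symm.trans ?_
    rw [AddSubmonoidClass.coe_finsetSum]
    refine sum_congr rfl fun j _ => ?_
    rw [hP, neg_zero, tpow_zero_smul]
    rfl

end Variation

namespace ThetaSplit

variable {L : Type u} [Field L] {N N' : DMod L⸨X⸩} (S : ThetaSplit N) (S' : ThetaSplit N')

lemma theta_smul (a : L⸨X⸩) (m : N) :
    thetaLin N (a • m) = (tpow L 1 * a′) • m + a • thetaLin N m := by
  rw [thetaLin_apply, N.leibniz, smul_add, smul_smul, smul_comm (tpow L 1) a]
  rfl

lemma const_smul_eq_single (c : L) (m : N) :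
    c • m = (single 0 c : L⸨X⸩) • m := by
  rw [const_smul, ← algebraMap_smul L⸨X⸩]
  exact congrArg (· • m) (HahnSeries.ofPowerSeries_C c)

lemma π_π (m : N) : S.π (S.π m) = S.π m := by
  rw [S.π_eq m, map_sum]
  simp only [map_smul, S.π_v]

lemma coeff_P (m : N) (i : ℤ) :
    S.π (tpow L i • m) = ∑ j, (S.P j m).coeff (-i) • S.v j := by
  rw [S.π_eq]
  simp only [map_smul, smul_eq_mul, tpow, HahnSeries.coeff_single_mul, one_mul, zero_sub]

/-- The natural complement of the `L((t))`-span of the generalized kernel of `θ`. -/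
def IsRegular (m : N) : Prop := ∀ i : ℤ, S.π (tpow L i • m) = 0

lemma isRegular_iff {m : N} : S.IsRegular m ↔ ∀ j, S.P j m = 0 := by
  refine ⟨fun h l => ?_, fun h i => ?_⟩
  · ext i
    have h1 := congrArg (S.P l) (h (-i))
    rw [S.coeff_P, map_sum, map_zero, neg_neg] at h1
    simp only [const_smul_eq_single, map_smul, S.P_v, smul_eq_mul, mul_ite, mul_one, mul_zero,
      Finset.sum_ite_eq, Finset.mem_univ, if_true] at h1
    simpa using congrArg (HahnSeries.coeff · 0) h1
  · rw [S.coeff_P]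
    simp [h]

lemma IsRegular.theta {m : N} (h : S.IsRegular m) : S.IsRegular (thetaLin N m) := by
  intro i
  have h1 : tpow L i • thetaLin N m = thetaLin N (tpow L i • m) - (i : L) • tpow L i • m := by
    rw [theta_tpow, smul_add, tpow_smul_const_smul, add_sub_cancel_right]
  rw [h1, map_sub, ← S.θ_π, S.π.map_smul, h i, map_zero, smul_zero, sub_zero]

lemma sub_regular (m : N) : S.IsRegular (m - ∑ j, S.P j m • S.v j) :=
  S.isRegular_iff.2 fun l => by simp [S.P_v]

lemma eq_of_nil (p : ℕ) : ∀ y, (thetaLin N ^ p) y = 0 → S.π y = y := by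
  induction p with
  | zero =>
    intro y hy
    rw [show y = 0 from hy, map_zero]
  | succ p ih =>
    intro y hy
    rw [pow_succ] at hy
    have h1 := S.R_θ y
    rw [← ih _ hy, S.R_π] at h1
    exact (sub_eq_zero.1 h1.symm).symm

lemma pow_θ_π (p : ℕ) (m : N) :
    (thetaLin N ^ p) (S.π m) = S.π ((thetaLin N ^ p) m) := by
  induction p with
  | zero => rfl
  | succ p ih => rw [pow_succ', Module.End.mul_apply, ih, S.θ_π, Module.End.mul_apply]

lemma map_pow_theta (f : N ⟶ N') (p : ℕ) (m : N) :
    f.toLin ((thetaLin N ^ p) m) = (thetaLin N' ^ p) (f.toLin m) := by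
  induction p with
  | zero => rfl
  | succ p ih => rw [pow_succ', Module.End.mul_apply, map_theta, ih, pow_succ',
      Module.End.mul_apply]

include S S' in
lemma map_π (f : N ⟶ N') (m : N) : f.toLin (S.π m) = S'.π (f.toLin m) := by
  have h1 : S'.π (f.toLin (S.π m)) = f.toLin (S.π m) := S'.eq_of_nil S.n _ (by
    rw [← map_pow_theta, S.nil, map_zero])
  have h2 : ∀ k : ℕ, ∃ y, S.π y = 0 ∧ (thetaLin N ^ k) y = m - S.π m := fun k => by
    induction k with
    | zero => exact ⟨m - S.π m, by rw [map_sub, S.π_π, sub_self], rfl⟩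
    | succ k ih =>
      obtain ⟨y, hy, h⟩ := ih
      refine ⟨S.R y, S.π_R y, ?_⟩
      rw [pow_succ, Module.End.mul_apply, S.θ_R, hy, sub_zero, h]
  obtain ⟨y, -, hy⟩ := h2 S'.n
  have h3 : S'.π (f.toLin (m - S.π m)) = 0 := by
    rw [← hy, map_pow_theta, ← S'.pow_θ_π, S'.nil]
  rw [map_sub, map_sub, h1, sub_eq_zero] at h3
  exact h3.symm

lemma map_R (f : N ⟶ N') (m : N) : f.toLin (S.R m) = S'.R (f.toLin m) := by
  have h1 := S'.R_θ (f.toLin (S.R m))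
  rw [← map_theta, S.θ_R, map_sub, ← S.map_π S' f (S.R m), S.π_R, map_zero, sub_zero, map_sub,
    S.map_π S' f, S'.R_π, sub_zero] at h1
  exact h1.symm

/-- `θ` extended linearly from the generalized kernel of `θ`, the identity on the complement. -/
def ψLin : N →ₗ[L⸨X⸩] N.carrier :=
  LinearMap.id - ∑ j, (S.P j).smulRight (S.v j - thetaLin N (S.v j))

lemma ψ_apply (m : N) :
    S.ψLin m = m - ∑ j, S.P j m • (S.v j - thetaLin N (S.v j)) := by
  simp [ψLin]

lemma ψ_regular {m : N} (h : S.IsRegular m) : S.ψLin m = m := by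
  simp [S.ψ_apply, S.isRegular_iff.1 h]

lemma ψ_π (m : N) : S.ψLin (S.π m) = thetaLin N (S.π m) := by
  have h : ∀ l, S.ψLin (S.v l) = thetaLin N (S.v l) := fun l => by simp [S.ψ_apply, S.P_v]
  rw [S.π_eq, map_sum, map_sum]
  refine sum_congr rfl fun j _ => ?_
  rw [(thetaLin N).map_smul, const_smul_eq_single, const_smul_eq_single, map_smul, h]

/-- Every element is a sum of a regular element and of multiples of the basis of the generalized
kernel. -/
lemma induction {p : N → Prop} (hadd : ∀ x y, p x → p y → p (x + y))
    (hreg : ∀ m, S.IsRegular m → p m) (hv : ∀ (a : L⸨X⸩) j, p (a • S.v j)) (m : N) :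
    p m := by
  rw [← sub_add_cancel m (∑ j, S.P j m • S.v j)]
  refine hadd _ _ (hreg _ (S.sub_regular m)) (Finset.sum_induction _ p hadd (hreg 0 ?_)
    fun j _ => hv _ j)
  intro i
  rw [smul_zero, map_zero]

/-- `ψLin` as a morphism. -/
def ψ : N ⟶ N where
  toLin := S.ψLin
  comm m := by
    have h : S.ψLin (thetaLin N m) = thetaLin N (S.ψLin m) := by
      refine S.induction (p := fun m => S.ψLin (thetaLin N m) = thetaLin N (S.ψLin m)) (fun x y hx hy => ?_) (fun m hm => ?_) (fun a j => ?_) m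
      · simp only [map_add, hx, hy]
      · rw [S.ψ_regular hm, S.ψ_regular (IsRegular.theta S hm)]
      · have h1 : S.ψLin (S.v j) = thetaLin N (S.v j) := by rw [← S.π_v, S.ψ_π]
        have h2 : S.ψLin (thetaLin N (S.v j)) = thetaLin N (thetaLin N (S.v j)) := by
          rw [← S.π_v, S.θ_π, S.ψ_π]
        simp only [theta_smul, map_add, map_smul, h1, h2]
    rw [del_eq_theta, map_smul, h, ← del_eq_theta]

lemma map_ψ (f : N ⟶ N') (m : N) : f.toLin (S.ψLin m) = S'.ψLin (f.toLin m) := by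
  refine S.induction (p := fun m => f.toLin (S.ψLin m) = S'.ψLin (f.toLin m)) (fun x y hx hy => ?_) (fun m hm => ?_) (fun a j => ?_) m
  · simp only [map_add, hx, hy]
  · rw [S.ψ_regular hm, S'.ψ_regular fun i => ?_]
    rw [← map_smul, ← S.map_π S', hm i, map_zero]
  · simp only [map_smul]
    rw [← S.π_v, S.ψ_π, S.map_π S', S'.ψ_π, ← S.map_π S', map_theta]

/-- The map `m ↦ π (t m) + ψ (R (t m))`, which is `ψ ∂⁻¹` where `∂` is invertible. -/
def φ : N →+ N.carrier :=
  (S.π.toAddMonoidHom + S.ψLin.toAddMonoidHom.comp S.R.toAddMonoidHom).comp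
    (DistribSMul.toAddMonoidHom N (tpow L 1))

lemma φ_apply (m : N) :
    S.φ m = S.π (tpow L 1 • m) + S.ψLin (S.R (tpow L 1 • m)) := rfl

lemma φ_del (m : N) : S.φ (N.del m) = S.ψLin m := by
  rw [φ_apply, ← thetaLin_apply, ← S.θ_π, S.R_θ, map_sub, S.ψ_π, add_sub_cancel]

lemma del_φ (m : N) : N.del (S.φ m) = S.ψLin m := by
  have h : ∀ m, S.ψLin (thetaLin N m) = thetaLin N (S.ψLin m) := fun m => by
    rw [thetaLin_apply, map_smul]
    exact congrArg (tpow L 1 • ·) (S.ψ.comm m)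
  rw [φ_apply, del_eq_theta, map_add, ← S.ψ_π, ← h, S.θ_R, ← map_add, add_sub_cancel, map_smul,
    tpow_neg_smul_smul]

lemma φ_const_smul (c : L) (m : N) : S.φ (c • m) = c • S.φ m := by
  have h : ∀ m : N, S.ψLin (c • m) = c • S.ψLin m := fun m => by
    rw [const_smul_eq_single, const_smul_eq_single, map_smul]
  rw [φ_apply, φ_apply, tpow_smul_const_smul, S.π.map_smul, S.R.map_smul, h, smul_add]

lemma map_φ (f : N ⟶ N') (m : N) : f.toLin (S.φ m) = S'.φ (f.toLin m) := by
  rw [φ_apply, φ_apply, map_add, S.map_π S', S.map_ψ S', S.map_R S', map_smul]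

variable [CharZero L]

/-- The morphism from the `!`-extension to the `*`-extension. -/
def ε : (jShriek L).obj N ⟶ (jStar L).obj N :=
  have hd : ∀ m, S.φ (((jStar L).obj N).del m) = S.ψLin m := fun m =>
    (congrArg S.φ (jStar_del m)).trans (S.φ_del m)
  invertDesc (M := (jStar L).obj N) (Y := (jStar L).obj N) S.φ (fun c m hc => by
      obtain ⟨c, rfl⟩ := eq_C_of_deriv_eq_zero hc
      exact S.φ_const_smul c m)
    (fun a m => by
      refine (congrArg (a • ·) (hd m)).trans (Eq.trans ?_ (hd (a • m)).symm)
      exact (S.ψLin.map_smul (algebraMap L⟦X⟧ L⸨X⸩ a) m).symm)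
    (fun m => (hd m).trans ((jStar_del _).trans (S.del_φ m)).symm)

/-- The symbol `∂⁻¹ m`. -/
abbrev symb (N : DMod L⸨X⸩) : N →+ ((jShriek L).obj N).carrier :=
  invertSymb ((jStar L).obj N)

/-- The canonical map to the `!`-extension. -/
abbrev unit (N : DMod L⸨X⸩) : (jStar L).obj N ⟶ (jShriek L).obj N :=
  invertUnit ((jStar L).obj N)

lemma ε_symb (m : N) : S.ε.toLin (symb N m) = S.φ m := by
  unfold ε
  exact invertDesc_symb ..

lemma unit_eq (m : N) : (unit N).toLin m = symb N (N.del m) :=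
  (invertUnit_apply _).trans ((del_invertSymb _).trans (congrArg (symb N) (jStar_del m)))

lemma ε_unit (m : N) : S.ε.toLin ((unit N).toLin m) = S.ψLin m := by
  rw [unit_eq, ε_symb, φ_del]

lemma ε_naturality (f : N ⟶ N') : (jShriek L).map f ≫ S'.ε = S.ε ≫ (jStar L).map f := by
  refine invert_hom_ext (M := (jStar L).obj N) fun m => ?_
  have h := (congrArg S'.ε.toLin (invert_map_symb ((jStar L).map f) m)).trans
    (S'.ε_symb (f.toLin m))
  exact h.trans ((S.map_φ S' f m).symm.trans (congrArg f.toLin (S.ε_symb m)).symm)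

lemma ε_v (j : Fin S.d) : S.ε.toLin (symb N (tpow L (-1) • S.v j)) = S.v j := by
  rw [ε_symb, φ_apply, tpow_smul_neg_smul, S.π_v, ← S.π_v j, S.R_π, map_zero, add_zero, S.π_v]

lemma exists_pow_smul_basis (a : L⸨X⸩) (m : N) :
    ∃ (k : ℕ) (b : L⟦X⟧), ϖ L ^ k • a • m = b • m := by
  obtain ⟨n, b, hb⟩ := exists_tpow_mul_mem a
  exact ⟨n, b, by rw [← tpow_natCast_smul, smul_smul, hb, algebraMap_smul]⟩

lemma torsion_add {Y : Type*} [AddCommGroup Y] [Module L⟦X⟧ Y] {T : Submodule L⟦X⟧ Y} {x y : Y}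
    (hx : ∃ k : ℕ, ϖ L ^ k • x ∈ T)
    (hy : ∃ k : ℕ, ϖ L ^ k • y ∈ T) :
    ∃ k : ℕ, ϖ L ^ k • (x + y) ∈ T := by
  obtain ⟨a, ha⟩ := hx
  obtain ⟨b, hb⟩ := hy
  refine ⟨a + b, ?_⟩
  rw [smul_add, add_comm a, pow_add, mul_smul, ← pow_add, add_comm b, pow_add, mul_smul _ _ y]
  exact add_mem (T.smul_mem _ ha) (T.smul_mem _ hb)

lemma ε_cokernel (q : N) :
    ∃ (n : ℕ) (y : ((jShriek L).obj N)),
      S.ε.toLin y = (ϖ L ^ n • q : N) := by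
  let T : Submodule L⟦X⟧ N.carrier := range (show
    ((jShriek L).obj N) →ₗ[L⟦X⟧] N from S.ε.toLin)
  change ∃ n : ℕ, ϖ L ^ n • q ∈ T
  refine S.induction (p := fun q => ∃ n : ℕ, ϖ L ^ n • q ∈ T)
    (fun x y => torsion_add) (fun m hm => ⟨0, (unit N).toLin m, ?_⟩) (fun a j => ?_) q
  · rw [pow_zero, one_smul]
    exact (S.ε_unit m).trans (S.ψ_regular hm)
  · obtain ⟨k, b, h⟩ := exists_pow_smul_basis a (S.v j)
    refine ⟨k, ?_⟩
    rw [h]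
    exact T.smul_mem b ⟨_, S.ε_v j⟩

/-- The regular elements, as a submodule. -/
def regular : Submodule L⟦X⟧ N.carrier :=
  (⨅ j, ker (S.P j)).restrictScalars L⟦X⟧

lemma mem_regular {m : N} : m ∈ S.regular ↔ ∀ j, S.P j m = 0 := by
  simp [regular]

lemma ε_kernel (y : ((jShriek L).obj N)) (hy : S.ε.toLin y = 0) :
    ∃ n : ℕ, ϖ L ^ n • y = 0 := by
  let e : Fin S.d → ((jShriek L).obj N).carrier := fun j => symb N (tpow L (-1) • S.v j)
  let T : Submodule L⟦X⟧ ((jShriek L).obj N).carrier :=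
    span L⟦X⟧ (Set.range e) ⊔ S.regular.map (show
      N →ₗ[L⟦X⟧] ((jShriek L).obj N) from (unit N).toLin)
  have hsymb : ∀ m, symb N (tpow L (-1) • S.π m) ∈ T := fun m => by
    rw [S.π_eq, smul_sum, map_sum]
    refine sum_mem fun j _ => ?_
    rw [tpow_smul_const_smul]
    have h := invertSymb_smul (M := (jStar L).obj N) (powerSeries_deriv_C ((S.P j m).coeff 0))
      (tpow L (-1) • S.v j)
    refine h.symm ▸ T.smul_mem _ (mem_sup_left (subset_span ⟨j, rfl⟩))
  have hunit : ∀ m : N, ∃ k : ℕ, ϖ L ^ k • (unit N).toLin m ∈ T := by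
    refine S.induction
      (p := fun m => ∃ k : ℕ, ϖ L ^ k • (unit N).toLin m ∈ T)
      (fun x y hx hy => ?_) (fun m hm => ⟨0, ?_⟩) fun a j => ?_
    · have h : (unit N).toLin (x + y) = (unit N).toLin x + (unit N).toLin y := map_add _ _ _
      rw [h]
      exact torsion_add hx hy
    · rw [pow_zero, one_smul]
      exact mem_sup_right ⟨m, S.mem_regular.2 (S.isRegular_iff.1 hm), rfl⟩
    · obtain ⟨k, b, h⟩ := exists_pow_smul_basis a (S.v j)
      have h1 := ((unit N).toLin.map_smul (PowerSeries.X ^ k) (a • S.v j)).symm.trans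
        ((congrArg (unit N).toLin h).trans ((unit N).toLin.map_smul b (S.v j)))
      refine ⟨k, h1 ▸ T.smul_mem b ?_⟩
      rw [unit_eq, del_eq_theta, ← S.π_v, S.θ_π]
      exact hsymb _
  obtain ⟨k, hk⟩ : ∃ k : ℕ, ϖ L ^ k • y ∈ T := by
    refine invert_induction (M := (jStar L).obj N)
      (p := fun y => ∃ k : ℕ, ϖ L ^ k • y ∈ T)
      (fun a m => ?_) (fun x y => torsion_add) y
    have h : ∀ m : N,
        m = tpow L (-1) • S.π (tpow L 1 • m) + N.del (S.R (tpow L 1 • m)) := fun m => by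
      rw [del_eq_theta, ← smul_add, S.θ_R, add_sub_cancel, tpow_neg_smul_smul]
    obtain ⟨k, hk⟩ : ∃ k : ℕ, ϖ L ^ k • symb N m ∈ T := by
      rw [h m, map_add]
      refine torsion_add ⟨0, ?_⟩ ?_
      · rw [pow_zero, one_smul]; exact hsymb _
      · rw [← unit_eq]; exact hunit _
    refine ⟨k, ?_⟩
    rw [smul_comm]
    exact T.smul_mem a hk
  refine ⟨k, ?_⟩
  have h0 : S.ε.toLin (ϖ L ^ k • y) = 0 := by rw [map_smul, hy, smul_zero]
  generalize ϖ L ^ k • y = z at hk h0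
  obtain ⟨x, hx, _, ⟨m, hm, rfl⟩, rfl⟩ := mem_sup.1 hk
  obtain ⟨α, rfl⟩ := (Submodule.mem_span_range_iff_exists_fun _).1 hx
  have h1 : (∑ j, α j • S.v j) + m = 0 := by
    refine Eq.trans ?_ h0
    rw [map_add, map_sum]
    refine congrArg₂ (· + ·) (sum_congr rfl fun j _ => ?_) ?_
    · exact ((S.ε.toLin.map_smul (α j) (e j)).trans (congrArg (α j • ·) (S.ε_v j))).symm
    · exact ((S.ε_unit m).trans (S.ψ_regular (S.isRegular_iff.2 (S.mem_regular.1 hm)))).symm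
  have hα : ∀ l, α l = 0 := fun l => by
    have h2 := congrArg (S.P l) h1
    simp only [← algebraMap_smul L⸨X⸩ (α _), map_add, map_sum, map_smul, S.P_v, smul_eq_mul,
      mul_ite, mul_one, mul_zero, Finset.sum_ite_eq, Finset.mem_univ, if_true, map_zero,
      S.mem_regular.1 hm l, add_zero] at h2
    exact (map_eq_zero_iff _ (IsFractionRing.injective L⟦X⟧ L⸨X⸩)).1 h2
  simp only [hα, zero_smul, Finset.sum_const_zero, zero_add] at h1 ⊢
  subst h1
  exact map_zero (unit N).toLin

end ThetaSplit

/-! ### Holonomic modules with bijective `∂` are `!`-extensions -/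

section Extension

variable {L : Type u} [Field L] {Y Y' : DMod L⟦X⟧} {N N' : DMod L⸨X⸩}

/-- The kernel and the cokernel of `ε` are torsion. -/
structure IsTorsionIso (ε : Y ⟶ (jStar L).obj N) : Prop where
  ker : ∀ y, ε.toLin y = 0 → ∃ n : ℕ, ϖ L ^ n • y = 0
  coker : ∀ q : ((jStar L).obj N), ∃ (n : ℕ) (y : Y),
    ε.toLin y = ϖ L ^ n • q

/-- An isomorphism from a bijective morphism. -/
def DMod.isoOfBijective {R : Type u} [CommRing R] [Differential R] {M M' : DMod R} (f : M ⟶ M')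
    (hf : Bijective f.toLin) : M ≅ M' where
  hom := f
  inv := ⟨(LinearEquiv.ofBijective f.toLin hf).symm, fun m => hf.1 (by
    have h : ∀ m, f.toLin ((LinearEquiv.ofBijective f.toLin hf).symm m) = m :=
      (LinearEquiv.ofBijective f.toLin hf).apply_symm_apply
    refine (h _).trans ?_
    rw [f.comm]
    exact congrArg _ (h m).symm)⟩
  hom_inv_id := DMod.hom_ext (LinearEquiv.ofBijective f.toLin hf).symm_apply_apply
  inv_hom_id := DMod.hom_ext (LinearEquiv.ofBijective f.toLin hf).apply_symm_apply

lemma eq_zero_of_pow_smul {n : ℕ} {m : N} (h : ϖ L ^ n • m = 0) :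
    m = 0 := by
  rw [← tpow_neg_smul_smul (L := L) (n : ℤ) m, tpow_natCast_smul, h, smul_zero]

lemma IsTorsionIso.bijective_lift {ε : Y ⟶ (jStar L).obj N} (h : IsTorsionIso ε) :
    Bijective ((puncture L).lift ε).toLin := by
  have hl : ∀ y, ((puncture L).lift ε).toLin (punctureLin Y y) = ε.toLin y :=
    (puncture L).lift_incl ε
  have hs : ∀ (n : ℕ) x, ((puncture L).lift ε).toLin (ϖ L ^ n • x)
      = ϖ L ^ n • ((puncture L).lift ε).toLin x := fun n x => by
    rw [← tpow_natCast_smul, map_smul, tpow_natCast_smul]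
  refine ⟨(injective_iff_map_eq_zero _).2 fun x hx => ?_, fun q => ?_⟩
  · obtain ⟨n, y, hy⟩ := exists_pow_smul_punctureLin x
    obtain ⟨m, hm⟩ := h.ker y ((hl y).symm.trans (by rw [hy, hs, hx]; exact smul_zero (_ : L⟦X⟧)))
    refine eq_zero_of_pow_smul (n := m + n) ?_
    rw [pow_add, mul_smul, ← hy, ← map_smul, hm, map_zero]
  · obtain ⟨n, y, hy⟩ := h.coker q
    refine ⟨tpow L (-n) • punctureLin Y y, ?_⟩
    rw [map_smul]
    refine (congrArg (tpow L (-n) • ·) ((hl y).trans hy)).trans ?_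
    change tpow L (-n) • ϖ L ^ n • (q : N) = q
    rw [← tpow_natCast_smul, tpow_neg_smul_smul]

lemma IsTorsionIso.exists_hom {ε : Y ⟶ (jStar L).obj N} (h : IsTorsionIso ε)
    (g : Y ⟶ (jStar L).obj N') : ∃ f : N ⟶ N', ε ≫ (jStar L).map f = g := by
  refine ⟨(DMod.isoOfBijective _ h.bijective_lift).inv ≫ (puncture L).lift g,
    DMod.hom_ext fun y => ?_⟩
  have h1 := congrArg (fun f => DMod.Hom.toLin f ((puncture L).incl Y y))
    (DMod.isoOfBijective _ h.bijective_lift).hom_inv_id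
  have h2 := congrArg ((DMod.isoOfBijective _ h.bijective_lift).inv ≫ (puncture L).lift g).toLin
    ((puncture L).lift_incl ε y)
  refine h2.symm.trans ((congrArg ((puncture L).lift g).toLin h1).trans ((puncture L).lift_incl g y))

lemma IsTorsionIso.hom_ext {ε : Y ⟶ (jStar L).obj N} (h : IsTorsionIso ε) {f g : N ⟶ N'}
    (hfg : ε ≫ (jStar L).map f = ε ≫ (jStar L).map g) : f = g := by
  refine DMod.hom_ext fun q => ?_
  obtain ⟨n, y, hy⟩ := h.coker q
  have h1 : f.toLin (ε.toLin y) = g.toLin (ε.toLin y) :=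
    congrArg (fun f => DMod.Hom.toLin f y) hfg
  have h2 : ε.toLin y = tpow L n • (q : N) := hy.trans (tpow_natCast_smul n q).symm
  have h3 := (congrArg f.toLin h2).symm.trans (h1.trans (congrArg g.toLin h2))
  rw [map_smul, map_smul] at h3
  simpa only [tpow_neg_smul_smul] using congrArg (tpow L (-n) • ·) h3


/-- The morphism from `Y` to the `*`-extension of its restriction to the punctured disk. -/
def toStar (Y : DMod L⟦X⟧) : Y ⟶ (jStar L).obj ((puncture L).pullback.obj Y) := (puncture L).unit Y

lemma isTorsionIso_toStar (Y : DMod L⟦X⟧) : IsTorsionIso (toStar Y) :=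
  ⟨fun _ hy => punctureLin_eq_zero hy, exists_pow_smul_punctureLin⟩

variable [CharZero L]

/-- The morphism `j_! N → j_* N` of a holonomic module. -/
def shriekToStar (hN : HolK L N) : (jShriek L).obj N ⟶ (jStar L).obj N :=
  (exists_thetaSplit hN).some.ε

lemma isTorsionIso_shriekToStar (hN : HolK L N) : IsTorsionIso (shriekToStar hN) :=
  ⟨(exists_thetaSplit hN).some.ε_kernel, (exists_thetaSplit hN).some.ε_cokernel⟩

lemma shriekToStar_naturality (hN : HolK L N) (hN' : HolK L N') (f : N ⟶ N') :
    (jShriek L).map f ≫ shriekToStar hN' = shriekToStar hN ≫ (jStar L).map f :=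
  (exists_thetaSplit hN).some.ε_naturality _ f

theorem jShriek_bijective (hN : HolK L N) (hN' : HolK L N') :
    Bijective fun f : N ⟶ N' => (jShriek L).map f := by
  refine ⟨fun f g hfg => (isTorsionIso_shriekToStar hN).hom_ext ?_, fun h => ?_⟩
  · rw [← shriekToStar_naturality hN hN', ← shriekToStar_naturality hN hN']
    exact congrArg (· ≫ shriekToStar hN') hfg
  · obtain ⟨f, hf⟩ := (isTorsionIso_shriekToStar hN).exists_hom (h ≫ shriekToStar hN')
    obtain ⟨Λ, hΛ⟩ := exists_isDelLattice_jShriek hN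
    exact ⟨f, hΛ.hom_ext _ (isTorsionIso_shriekToStar hN').ker
      ((shriekToStar_naturality hN hN' f).trans hf)⟩

variable {Λ : Submodule L⟦X⟧ Y} {Λ' : Submodule L⟦X⟧ Y'}

lemma IsDelLattice.holK (h : IsDelLattice Y Λ) : HolK L ((puncture L).pullback.obj Y) :=
  holK_puncture h.fg h.absorbs

theorem IsDelLattice.exists_iso (h : IsDelLattice Y Λ) :
    ∃ κ : Y ≅ (jShriek L).obj ((puncture L).pullback.obj Y),
      κ.hom ≫ shriekToStar h.holK = toStar Y := by
  have hε := isTorsionIso_shriekToStar h.holK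
  have hu := isTorsionIso_toStar Y
  obtain ⟨Λ', h'⟩ := exists_isDelLattice_jShriek h.holK
  obtain ⟨s, hs⟩ := h.exists_lift _ hε.ker hε.coker (toStar Y)
  obtain ⟨s', hs'⟩ := h'.exists_lift (toStar Y) hu.ker hu.coker (shriekToStar h.holK)
  exact ⟨⟨s, s', h.hom_ext _ hu.ker (by rw [Category.assoc, hs', hs, Category.id_comp]),
    h'.hom_ext _ hε.ker (by rw [Category.assoc, hs, hs', Category.id_comp])⟩, hs⟩

/-- The isomorphism of a holonomic module with bijective `∂` with the `!`-extension of its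
restriction to the punctured disk. -/
def IsDelLattice.iso (h : IsDelLattice Y Λ) :
    Y ≅ (jShriek L).obj ((puncture L).pullback.obj Y) := h.exists_iso.choose

lemma IsDelLattice.iso_naturality (h : IsDelLattice Y Λ) (h' : IsDelLattice Y' Λ') (g : Y ⟶ Y') :
    g ≫ h'.iso.hom = h.iso.hom ≫ (jShriek L).map ((puncture L).pullback.map g) := by
  refine h.hom_ext _ (isTorsionIso_shriekToStar h'.holK).ker ?_
  have e1 : h.iso.hom ≫ shriekToStar h.holK = _ := h.exists_iso.choose_spec
  have e2 : h'.iso.hom ≫ shriekToStar h'.holK = _ := h'.exists_iso.choose_spec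
  rw [Category.assoc, Category.assoc, shriekToStar_naturality h.holK, e2, ← Category.assoc, e1]
  rfl

end Extension

/-! ### Relative adjunctions -/

section Relative

universe v₁ v₂ v₃ v₄ u₁ u₂ u₃ u₄

variable {C : Type u₁} [Category.{v₁} C] {D : Type u₂} [Category.{v₂} D] {W : Type u₃}
  [Category.{v₃} W] {D' : Type u₄} [Category.{v₄} D']

/-- `Λ` is left adjoint to `R` relative to `A`: every `A c` has a universal arrow to `R (Λ c)`. -/
structure RelAdj (A : C ⥤ W) (R : D ⥤ W) (Λ : C ⥤ D) where
  /-- the universal arrow -/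
  u : A ⟶ Λ ⋙ R
  univ : ∀ c d, Bijective fun g : Λ.obj c ⟶ d => u.app c ≫ R.map g

namespace RelAdj

variable {A : C ⥤ W} {R : D ⥤ W} {Λ Λ' : C ⥤ D}

/-- The morphism between two relative left adjoints. -/
lemma exists_hom (a : RelAdj A R Λ) (b : RelAdj A R Λ') :
    ∃ t : Λ ⟶ Λ', ∀ c, a.u.app c ≫ R.map (t.app c) = b.u.app c := by
  choose t ht using fun c => (a.univ c (Λ'.obj c)).2 (b.u.app c)
  refine ⟨⟨t, fun c c' f => (a.univ c _).1 ?_⟩, ht⟩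
  have h1 := a.u.naturality f
  have h2 := b.u.naturality f
  have h3 := ht c
  have h4 := ht c'
  dsimp only [Functor.comp_map] at h1 h2 h3 h4 ⊢
  rw [R.map_comp, R.map_comp, ← Category.assoc, ← Category.assoc, h3, ← h1, Category.assoc, h4, h2]

/-- Relative left adjoints are unique. -/
theorem nonempty_iso (a : RelAdj A R Λ) (b : RelAdj A R Λ') : Nonempty (Λ ≅ Λ') := by
  obtain ⟨s, hs⟩ := a.exists_hom b
  obtain ⟨t, ht⟩ := b.exists_hom a
  refine ⟨⟨s, t, ?_, ?_⟩⟩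
  · ext c
    refine (a.univ c _).1 ?_
    dsimp only
    rw [NatTrans.comp_app, R.map_comp, ← Category.assoc, hs, ht]
    simp
  · ext c
    refine (b.univ c _).1 ?_
    dsimp only
    rw [NatTrans.comp_app, R.map_comp, ← Category.assoc, ht, hs]
    simp

/-- Restriction along a functor. -/
def whisker (a : RelAdj A R Λ) (G : D' ⥤ C) : RelAdj (G ⋙ A) R (G ⋙ Λ) where
  u := Functor.whiskerLeft G a.u
  univ c d := a.univ (G.obj c) d

/-- Transport along a fully faithful functor `F` and an isomorphism `R ⋙ F ≅ E ⋙ R'`, where `E`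
is an equivalence. -/
def transport {W' : Type*} [Category W'] (a : RelAdj A R Λ) (F : W ⥤ W')
    (hF : ∀ X Y : W, Bijective fun f : X ⟶ Y => F.map f) (E : D ≌ D') {R' : D' ⥤ W'}
    (i : R ⋙ F ≅ E.functor ⋙ R') : RelAdj (A ⋙ F) R' (Λ ⋙ E.functor) where
  u := Functor.whiskerRight a.u F ≫ Functor.whiskerLeft Λ i.hom
  univ c d := by
    let p : E.functor.obj (E.inverse.obj d) ≅ d := E.counitIso.app d
    have key : ∀ g : Λ.obj c ⟶ E.inverse.obj d,
        (F.map (a.u.app c) ≫ i.hom.app (Λ.obj c)) ≫ R'.map (E.functor.map g ≫ p.hom)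
          = F.map (a.u.app c ≫ R.map g) ≫ i.hom.app _ ≫ R'.map p.hom := fun g => by
      have h := i.hom.naturality g
      dsimp only [Functor.comp_map] at h
      rw [R'.map_comp, F.map_comp, Category.assoc, Category.assoc, ← reassoc_of% h]
    have hp : ∀ h : E.functor.obj (Λ.obj c) ⟶ d, ∃ g : Λ.obj c ⟶ E.inverse.obj d,
        E.functor.map g ≫ p.hom = h := fun h => by
      obtain ⟨g, hg⟩ := E.functor.map_surjective (h ≫ p.inv)
      exact ⟨g, by rw [hg, Category.assoc, p.inv_hom_id, Category.comp_id]⟩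
    refine ⟨fun h h' hh => ?_, fun l => ?_⟩
    · obtain ⟨g, rfl⟩ := hp h
      obtain ⟨g', rfl⟩ := hp h'
      have h1 := ((key g).symm.trans hh).trans (key g')
      rw [cancel_mono] at h1
      rw [(a.univ c _).1 ((hF _ _).1 h1)]
    · obtain ⟨x, hx⟩ := (hF _ _).2 (l ≫ R'.map p.inv ≫ i.inv.app _)
      obtain ⟨g, rfl⟩ := (a.univ c _).2 x
      refine ⟨_, (key g).trans ?_⟩
      dsimp only at hx
      rw [hx, Category.assoc, Category.assoc, Iso.inv_hom_id_app_assoc, ← R'.map_comp,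
        p.inv_hom_id, R'.map_id, Category.comp_id]

end RelAdj

end Relative

/-! ### Continuous morphisms -/

section Continuous

variable {L : Type u} [Field L] {Y Y' : DMod L⟦X⟧}

lemma isOpenSubgroup_comap (f : Y ⟶ Y') {U : AddSubgroup Y'} (hU : IsOpenSubgroup Y' U) :
    IsOpenSubgroup Y (U.comap f.toLin.toAddMonoidHom) := fun N hN => by
  obtain ⟨n, hn⟩ := hU _ (hN.map f.toLin)
  exact ⟨n, fun m hm => by
    rw [AddSubgroup.mem_comap]
    exact (f.toLin.map_smul _ m).symm ▸ hn _ ⟨m, hm, rfl⟩⟩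

/-- A continuous map that commutes with a dense set of scalars is linear. -/
lemma map_smul_of_continuous (T : Y →+ Y')
    (hT : ∀ U, IsOpenSubgroup Y' U → IsOpenSubgroup Y (U.comap T))
    (hsep : ∀ y, (∀ U, IsOpenSubgroup Y' U → y ∈ U) → y = 0) {S : Set L⟦X⟧}
    (hS : ∀ (a : L⟦X⟧) (n : ℕ), ∃ s ∈ S, ϖ L ^ n ∣ a - s)
    (h : ∀ s ∈ S, ∀ m, T (s • m) = s • T m) (a : L⟦X⟧) (m : Y) : T (a • m) = a • T m := by
  refine sub_eq_zero.1 (hsep _ fun U hU => ?_)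
  obtain ⟨n₁, h₁⟩ := hT U hU (span _ {m}) (Submodule.fg_span_singleton m)
  obtain ⟨n₂, h₂⟩ := hU (span _ {T m}) (Submodule.fg_span_singleton _)
  obtain ⟨s, hs, b, hb⟩ := hS a (n₁ + n₂)
  rw [sub_eq_iff_eq_add.1 hb, add_smul, add_smul, map_add, h s hs, add_sub_add_right_eq_sub]
  refine sub_mem ?_ ?_
  · rw [pow_add, mul_assoc, mul_smul]
    exact h₁ _ (smul_mem _ _ (Submodule.mem_span_singleton_self m))
  · rw [add_comm, pow_add, mul_assoc, mul_smul]
    exact h₂ _ (smul_mem _ _ (Submodule.mem_span_singleton_self _))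

variable {k : Type u} [Field k] [CharZero k]

lemma exists_hom_disk {x : ClosedPoint k} {Y Y' : DMod (ResField x)⟦X⟧}
    {Λ : Submodule (ResField x)⟦X⟧ Y'} (hΛ : IsDelLattice Y' Λ)
    (g : (diskAt x).pushforward.obj Y ⟶ (diskAt x).pushforward.obj Y')
    (hg : ∀ U : AddSubgroup Y', IsOpenSubgroup Y' U →
      IsOpenSubgroup Y (U.comap (show Y →+ Y' from g.toLin.toAddMonoidHom))) :
    ∃ f : Y ⟶ Y', (diskAt x).pushforward.map f = g := by
  let T : Y →+ Y'.carrier := g.toLin.toAddMonoidHom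
  have hT := map_smul_of_continuous T hg
    (fun y hy => hΛ.fil_separated y fun n => hy _ (hΛ.isOpenSubgroup_fil n))
    (S := Set.range (diskAt x).toRingHom)
    (fun a n => by
      obtain ⟨p, hp⟩ := diskAt_dense x a n
      exact ⟨_, ⟨p, rfl⟩, hp⟩)
    (by
      rintro _ ⟨p, rfl⟩ m
      exact g.toLin.map_smul p m)
  refine ⟨⟨{ T with map_smul' := hT }, fun m => ?_⟩, DMod.hom_ext fun m => rfl⟩
  exact ((congrArg T (disk_del Y m)).symm.trans (g.comm m)).trans (disk_del Y' (T m))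

lemma separated_jStar {N : DMod k⸨X⸩} (hN : HolK k N) (y : N)
    (hy : ∀ U, IsOpenSubgroup ((jStar k).obj N) U → y ∈ U) : y = 0 := by
  have : Module.Finite k⸨X⸩ N.carrier := hN
  obtain ⟨Λ, hΛ, -, habs⟩ := exists_lattice (⊤ : Submodule k⸨X⸩ N) Module.Finite.fg_top
  exact adicFil_separated hΛ y fun n => hy _ ((isOpenSubgroup_jStar hΛ habs
    (fun n => ⟨n, le_rfl⟩) (fun n => ⟨n, le_rfl⟩) _).2 ⟨n, le_rfl⟩)

lemma exists_hom_infty {N N' : DMod k⸨X⸩} (hN' : HolK k N')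
    (g : (puncturedDiskInfty k).pushforward.obj N ⟶ (puncturedDiskInfty k).pushforward.obj N')
    (hg : ∀ U : AddSubgroup N', IsOpenSubgroup ((jStar k).obj N') U →
      IsOpenSubgroup ((jStar k).obj N)
        (U.comap (show N →+ N' from g.toLin.toAddMonoidHom))) :
    ∃ f : N ⟶ N', (puncturedDiskInfty k).pushforward.map f = g := by
  let T : N →+ N'.carrier := g.toLin.toAddMonoidHom
  have hX' : ∀ m, T (tpow k (-1) • m) = tpow k (-1) • T m := fun m =>
    (congrArg T (infty_X_smul N m)).symm.trans ((g.toLin.map_smul X m).trans (infty_X_smul N' (T m)))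
  have hC : ∀ (a : k) m, T ((PowerSeries.C a : k⟦X⟧) • m) = (PowerSeries.C a : k⟦X⟧) • T m :=
    fun a m => (congrArg T (infty_C_smul N a m)).symm.trans
      ((g.toLin.map_smul (C a) m).trans (infty_C_smul N' a (T m)))
  have hX : ∀ m, T (tpow k 1 • m) = tpow k 1 • T m := fun m => by
    conv_rhs => rw [← tpow_neg_smul_smul (L := k) 1 m, hX', tpow_smul_neg_smul]
  have hXn : ∀ (n : ℕ) m, T (ϖ k ^ n • m) = ϖ k ^ n • T m :=
    fun n => by
    induction n with
    | zero => simp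
    | succ n ih =>
      intro m
      rw [pow_succ, mul_smul, ih, ← tpow_one_smul, hX, mul_smul, tpow_one_smul]
  have hT := map_smul_of_continuous (Y := (jStar k).obj N) (Y' := (jStar k).obj N') T hg
    (separated_jStar hN') (S := {s | ∀ m : N, T (s • m) = s • T m})
    (fun a n => by
      obtain ⟨c, b, h⟩ := exists_trunc a n
      refine ⟨_, fun m => ?_, b, sub_eq_iff_eq_add'.2 h⟩
      rw [sum_smul, sum_smul, map_sum]
      refine sum_congr rfl fun i _ => ?_
      rw [mul_smul, hC, hXn, mul_smul])
    (fun s hs => hs)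
  have hneg : ∀ (n : ℕ) m, T (tpow k (-n) • m) = tpow k (-n) • T m := fun n m => by
    conv_rhs => rw [← tpow_smul_neg_smul (L := k) (n : ℤ) m, tpow_natCast_smul, hXn,
      ← tpow_natCast_smul, tpow_neg_smul_smul]
  have hK : ∀ (a : k⸨X⸩) (m : N), T (a • m) = a • T m := fun a m => by
    obtain ⟨n, b, hb⟩ := exists_tpow_mul_mem a
    have e : a = tpow k (-n) * algebraMap k⟦X⟧ k⸨X⸩ b := by
      rw [← hb, ← mul_assoc, tpow_mul, neg_add_cancel]
      exact (one_mul a).symm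
    rw [e, mul_smul, mul_smul, hneg, algebraMap_smul, algebraMap_smul]
    exact congrArg _ (hT b m)
  refine ⟨⟨{ T with map_smul' := hK }, fun m => ?_⟩, DMod.hom_ext fun m => rfl⟩
  let j : k⸨X⸩ := (((jacInfty k)⁻¹ : (k⸨X⸩)ˣ) : k⸨X⸩)
  have h1 : T (j • N.del m) = j • N'.del (T m) := g.comm m
  rw [hK] at h1
  have h2 := congrArg (((jacInfty k : (k⸨X⸩)ˣ) : k⸨X⸩) • ·) h1
  simp only [j, smul_smul, Units.mul_inv, one_smul] at h2
  exact h2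

/-- The Fourier transform is fully faithful. -/
lemma fourier_bijective (P Q : DMod k[X]) :
    Bijective fun f : P ⟶ Q => (fourier k).map f := by
  refine ⟨fun f g h => DMod.hom_ext fun m => congrArg
    (fun f : (fourier k).obj P ⟶ (fourier k).obj Q => f.toLin m) h, fun g => ?_⟩
  let T : P →+ Q.carrier := g.toLin.toAddMonoidHom
  have hd : ∀ m, T (P.del m) = Q.del (T m) := fun m => by
    have h : T (fourierAction P X m) = fourierAction Q X (T m) := g.toLin.map_smul X m
    rw [fourierAction_X, fourierAction_X, map_neg] at h
    exact neg_injective h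
  have hs : ∀ (p : k[X]) m, T (p • m) = p • T m := fun p => by
    induction p using Polynomial.induction_on with
    | C a =>
      intro m
      have h : T (fourierAction P (C a) m) = fourierAction Q (C a) (T m) :=
        g.toLin.map_smul (C a) m
      rwa [fourierAction_C, fourierAction_C] at h
    | add p q hp hq => intro m; rw [add_smul, add_smul, map_add, hp, hq]
    | monomial n a ih =>
      intro m
      rw [pow_succ, ← mul_assoc]
      generalize C a * X ^ n = q at ih
      rw [mul_smul, ih, mul_smul]
      exact congrArg (q • ·) (g.comm m)
  exact ⟨⟨{ T with map_smul' := hs }, hd⟩, DMod.hom_ext fun m => rfl⟩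

end Continuous

/-! ### Equivalences from comparisons of topological modules -/

section Transport

variable {k : Type u} [Field k]

universe v₁ v₂ u₁ u₂

variable {C : Type u₁} [Category.{v₁} C] {D : Type u₂} [Category.{v₂} D]

/-- Open subgroups on the values of a faithful functor to `D`-modules on the line, such that the
continuous morphisms are those in the image of the functor. -/
structure Opens (A : C ⥤ DMod k[X]) where
  /-- the open subgroups -/
  opens : ∀ c, Set (AddSubgroup (A.obj c))
  faithful : ∀ {c c' : C} {f g : c ⟶ c'}, A.map f = A.map g → f = g
  cont : ∀ {c c' : C} (f : c ⟶ c'), ∀ U ∈ opens c',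
    U.comap (A.map f).toLin.toAddMonoidHom ∈ opens c
  full : ∀ {c c' : C} (f : A.obj c ⟶ A.obj c'),
    (∀ U ∈ opens c', U.comap f.toLin.toAddMonoidHom ∈ opens c) → ∃ g, A.map g = f

/-- The isomorphism identifies the open subgroups. -/
def Opens.IsHomeo {A : C ⥤ DMod k[X]} {B : D ⥤ DMod k[X]} (a : Opens A) (b : Opens B) {c : C}
    {d : D} (i : A.obj c ≅ B.obj d) : Prop :=
  (∀ U ∈ b.opens d, U.comap i.hom.toLin.toAddMonoidHom ∈ a.opens c) ∧
    ∀ U ∈ a.opens c, U.comap i.inv.toLin.toAddMonoidHom ∈ b.opens d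

/-- The Fourier transform does not change the open subgroups. -/
def Opens.fourier [CharZero k] {A : C ⥤ DMod k[X]} (a : Opens A) :
    Opens (A ⋙ LocalFourier.fourier k) where
  opens := a.opens
  faithful h := a.faithful ((fourier_bijective _ _).1 h)
  cont := a.cont
  full f hf := by
    obtain ⟨g, rfl⟩ := (fourier_bijective _ _).2 f
    obtain ⟨g, rfl⟩ := a.full g hf
    exact ⟨g, rfl⟩

theorem Opens.exists_equivalence {A : C ⥤ DMod k[X]} {B : D ⥤ DMod k[X]} (a : Opens A)
    (b : Opens B) (h1 : ∀ c, ∃ (d : D) (i : A.obj c ≅ B.obj d), a.IsHomeo b i)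
    (h2 : ∀ d, ∃ (c : C) (i : A.obj c ≅ B.obj d), a.IsHomeo b i) :
    ∃ (E : C ≌ D) (i : A ≅ E.functor ⋙ B), ∀ c, a.IsHomeo b (i.app c) := by
  have lift : ∀ {c c' d d'} {i : A.obj c ≅ B.obj d} {i' : A.obj c' ≅ B.obj d'},
      a.IsHomeo b i → a.IsHomeo b i' → ∀ f : c ⟶ c',
        ∃ g : d ⟶ d', B.map g = i.inv ≫ A.map f ≫ i'.hom := fun hi hi' f =>
    b.full _ fun U hU => hi.2 _ (a.cont f _ (hi'.1 U hU))
  have lift' : ∀ {c c' d d'} {i : A.obj c ≅ B.obj d} {i' : A.obj c' ≅ B.obj d'},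
      a.IsHomeo b i → a.IsHomeo b i' → ∀ g : d ⟶ d',
        ∃ f : c ⟶ c', A.map f = i.hom ≫ B.map g ≫ i'.inv := fun hi hi' g =>
    a.full _ fun U hU => hi.1 _ (b.cont g _ (hi'.2 U hU))
  choose F i hi using h1
  choose m hm using fun {c c'} (f : c ⟶ c') => lift (hi c) (hi c') f
  let Φ : C ⥤ D :=
    { obj := F
      map := m
      map_id := fun c => b.faithful (by rw [hm]; simp)
      map_comp := fun f g => b.faithful (by rw [B.map_comp, hm, hm, hm]; simp) }
  have : Φ.Faithful := ⟨fun {c c'} f g hfg => a.faithful (by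
    have h := congrArg B.map (show m f = m g from hfg)
    rw [hm, hm, cancel_epi, cancel_mono] at h
    exact h)⟩
  have : Φ.Full := ⟨fun {c c'} g => by
    obtain ⟨f, hf⟩ := lift' (hi c) (hi c') g
    exact ⟨f, b.faithful (by change B.map (m f) = _; rw [hm, hf]; simp)⟩⟩
  have : Φ.EssSurj := ⟨fun d => by
    obtain ⟨c, j, hj⟩ := h2 d
    obtain ⟨g, hg⟩ := lift (hi c) hj (𝟙 c)
    obtain ⟨g', hg'⟩ := lift hj (hi c) (𝟙 c)
    exact ⟨c, ⟨⟨g, g', b.faithful (by rw [B.map_comp, hg, hg']; simp),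
      b.faithful (by rw [B.map_comp, hg, hg']; simp)⟩⟩⟩⟩
  have : Φ.IsEquivalence := {}
  exact ⟨Φ.asEquivalence, NatIso.ofComponents i fun {c c'} f => by
    change A.map f ≫ (i c').hom = (i c).hom ≫ B.map (m f)
    rw [hm]
    simp, fun c => hi c⟩

end Transport

/-! ### Existence of the local Fourier transforms -/

section Existence

variable {k : Type u} [Field k] [CharZero k] {x : ClosedPoint k}

/-- The open subgroups of `j_{x*} j_! N`. -/
def opensDisk (x : ClosedPoint k) :
    Opens ((HolK (ResField x)).ι ⋙ jShriek (ResField x) ⋙ (diskAt x).pushforward) where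
  opens N := {U : AddSubgroup ((jShriek (ResField x)).obj N.obj) |
    IsOpenSubgroup ((jShriek (ResField x)).obj N.obj) U}
  faithful {N N' f g} h := by
    refine (HolK (ResField x)).ι.map_injective ((jShriek_bijective N.2 N'.2).1 (DMod.hom_ext fun m =>
      congrArg (fun f : (diskAt x).pushforward.obj ((jShriek _).obj N.obj) ⟶
        (diskAt x).pushforward.obj ((jShriek _).obj N'.obj) => f.toLin m) h))
  cont f _ hU := isOpenSubgroup_comap ((jShriek (ResField x)).map f.hom) hU
  full {N N'} f hf := by
    obtain ⟨Λ, hΛ⟩ := exists_isDelLattice_jShriek N'.2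
    obtain ⟨g, rfl⟩ := exists_hom_disk hΛ f hf
    obtain ⟨g, rfl⟩ := (jShriek_bijective N.2 N'.2).2 g
    exact ⟨⟨g⟩, rfl⟩

/-- The open subgroups of `j_{∞*} N`. -/
def opensInfty {P : ObjectProperty (DMod k⸨X⸩)} (hP : ∀ N, P N → HolK k N) :
    Opens (P.ι ⋙ (puncturedDiskInfty k).pushforward) where
  opens N := {U : AddSubgroup N.obj | IsOpenSubgroup ((jStar k).obj N.obj) U}
  faithful {N N' f g} h := P.ι.map_injective (DMod.hom_ext fun m =>
      congrArg (fun f : (puncturedDiskInfty k).pushforward.obj N.obj ⟶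
        (puncturedDiskInfty k).pushforward.obj N'.obj => f.toLin m) h)
  cont f _ hU := isOpenSubgroup_comap ((jStar k).map f.hom) hU
  full {N N'} f hf := by
    obtain ⟨g, rfl⟩ := exists_hom_infty (hP _ N'.2) f hf
    exact ⟨⟨g⟩, rfl⟩

lemma isAdicHomeomorph_of_open {L L' : Type u} [Field L] [Field L'] {M : DMod L⟦X⟧}
    {M' : DMod L'⟦X⟧} (e : M ≃+ M')
    (h : ∀ U, IsOpenSubgroup M' U → IsOpenSubgroup M (U.comap (e : M →+ M')))
    (h' : ∀ U, IsOpenSubgroup M U →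
      IsOpenSubgroup M' (U.comap (e.symm : M' →+ M))) :
    IsAdicHomeomorph M M' e := by
  refine IsOpenIso.isAdicHomeomorph fun U => ⟨fun hU => ?_, h U⟩
  convert h' _ hU
  ext m
  simp

/-- The bijection underlying an isomorphism. -/
def isoAddEquiv {R : Type u} [CommRing R] [Differential R] {M M' : DMod R} (i : M ≅ M') :
    M ≃+ M' where
  toFun := i.hom.toLin
  invFun := i.inv.toLin
  left_inv m := congrArg (fun f : M ⟶ M => f.toLin m) i.hom_inv_id
  right_inv m := congrArg (fun f : M' ⟶ M' => f.toLin m) i.inv_hom_id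
  map_add' := map_add _

theorem nonempty_finInf (x : ClosedPoint k) : Nonempty (LocalFourierFinInf x) := by
  obtain ⟨E, i, hi⟩ := (opensDisk x).fourier.exists_equivalence
    (opensInfty (P := SlopeLE (negPoint x)) fun _ h => h.1) (fun N => by
      obtain ⟨Λ, hΛ⟩ := exists_isDelLattice_jShriek N.2
      obtain ⟨P, e, hP, hF, ho⟩ := exists_infinity_partner 1 hΛ
      exact ⟨⟨P, slopeLE_iff.2 hP⟩, hF.iso, fun U => (ho U).2, fun U => (ho.symm U).2⟩) fun P => by
      obtain ⟨Y, Λ, e, hΛ, hF, ho⟩ := exists_disk_partner 1 (slopeLE_iff.1 P.2)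
      let κ := hΛ.iso
      exact ⟨⟨_, hΛ.holK⟩, (fourier k).mapIso ((diskAt x).pushforward.mapIso κ.symm) ≪≫ hF.iso,
        fun U hU => isOpenSubgroup_comap κ.inv ((ho U).2 hU),
        fun U hU => (ho.symm _).2 (isOpenSubgroup_comap κ.hom hU)⟩
  exact ⟨⟨E, i, fun N => isAdicHomeomorph_of_open (M := ((jShriek (ResField x)).obj N.obj))
    (M' := ((jStar k).obj (E.functor.obj N).obj)) (isoAddEquiv (i.app N)) (hi N).1 (hi N).2⟩⟩

theorem nonempty_infFin (x : ClosedPoint k) : Nonempty (LocalFourierInfFin x) := by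
  have hx : signedPoint (-1) x = x := if_neg (by decide)
  obtain ⟨E, i, hi⟩ := (opensInfty (P := SlopeLE x) fun _ h => h.1).fourier.exists_equivalence
    (opensDisk x) (fun P => by
      obtain ⟨Y, Λ, e, hΛ, hF, ho⟩ := exists_disk_partner (x := x) (-1) (slopeLE_iff.1 (by rw [hx]; exact P.2))
      let κ := hΛ.iso
      exact ⟨⟨_, hΛ.holK⟩, hF.symm.iso ≪≫ (diskAt x).pushforward.mapIso κ,
        fun U hU => (ho.symm _).2 (isOpenSubgroup_comap κ.hom hU),
        fun U hU => isOpenSubgroup_comap κ.inv ((ho U).2 hU)⟩) fun N => by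
      obtain ⟨Λ, hΛ⟩ := exists_isDelLattice_jShriek N.2
      obtain ⟨P, e, hP, hF, ho⟩ := exists_infinity_partner (-1) hΛ
      rw [hx] at hP
      exact ⟨⟨P, slopeLE_iff.2 hP⟩, hF.symm.iso, fun U => (ho.symm U).2, fun U => (ho U).2⟩
  exact ⟨⟨E, i, fun N => isAdicHomeomorph_of_open (M := ((jStar k).obj N.obj))
    (M' := ((jShriek (ResField x)).obj (E.functor.obj N).obj)) (isoAddEquiv (i.app N)) (hi N).1 (hi N).2⟩⟩

theorem nonempty_infInf (k : Type u) [Field k] [CharZero k] : Nonempty (LocalFourierInfInf k) := by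
  let o := opensInfty (k := k) (P := SlopeGT k) fun _ h => h.1
  obtain ⟨E, i, hi⟩ := o.fourier.exists_equivalence o (fun N => by
      obtain ⟨P, e, hP, hF, ho⟩ := exists_irregular_partner 1 (slopeGT_iff.1 N.2)
      exact ⟨⟨P, slopeGT_iff.2 hP⟩, hF.iso, fun U => (ho U).2, fun U => (ho.symm U).2⟩) fun N => by
      obtain ⟨P, e, hP, hF, ho⟩ := exists_irregular_partner (-1) (slopeGT_iff.1 N.2)
      exact ⟨⟨P, slopeGT_iff.2 hP⟩, hF.symm.iso, fun U => (ho.symm U).2, fun U => (ho U).2⟩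
  refine ⟨⟨E, i, fun N => ?_⟩⟩
  let e : N.obj ≃+ (E.functor.obj N).obj.carrier := isoAddEquiv (R := k[X]) (i.app N)
  exact isAdicHomeomorph_of_open (M := ((jStar k).obj N.obj))
    (M' := ((jStar k).obj (E.functor.obj N).obj)) e (hi N).1 (hi N).2

end Existence

/-! ### Finite generic rank -/

section Saturation

variable {R : Type u} [CommRing R] [IsDomain R] {M : Type u} [AddCommGroup M] [Module R M]

/-- The elements with a nonzero multiple in `S`. -/
def saturation (S : Submodule R M) : Submodule R M where
  carrier := {y | ∃ q : R, q ≠ 0 ∧ q • y ∈ S}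
  zero_mem' := ⟨1, one_ne_zero, by simp⟩
  add_mem' := by
    rintro x y ⟨p, hp, hx⟩ ⟨q, hq, hy⟩
    refine ⟨p * q, mul_ne_zero hp hq, ?_⟩
    rw [smul_add, mul_comm, mul_smul, mul_comm, mul_smul]
    exact add_mem (S.smul_mem _ hx) (S.smul_mem _ hy)
  smul_mem' := by
    rintro a y ⟨q, hq, hy⟩
    exact ⟨q, hq, by rw [smul_comm]; exact S.smul_mem a hy⟩

lemma mem_saturation {S : Submodule R M} {y : M} : y ∈ saturation S ↔ ∃ q : R, q ≠ 0 ∧ q • y ∈ S :=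
  Iff.rfl

lemma le_saturation (S : Submodule R M) : S ≤ saturation S := fun y hy =>
  ⟨1, one_ne_zero, by rwa [one_smul]⟩

lemma saturation_mono {S T : Submodule R M} (h : S ≤ T) : saturation S ≤ saturation T :=
  fun _ ⟨q, hq, hy⟩ => ⟨q, hq, h hy⟩

lemma mem_saturation_of_smul {S : Submodule R M} {q : R} (hq : q ≠ 0) {y : M}
    (h : q • y ∈ saturation S) : y ∈ saturation S := by
  obtain ⟨p, hp, h⟩ := h
  exact ⟨p * q, mul_ne_zero hp hq, by rwa [mul_smul]⟩

/-- Modules of finite generic rank have finite dimensional inverse images on fields. -/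
lemma finite_tensor {K : Type u} [Field K] [Algebra R K]
    (hK : Injective (algebraMap R K)) {S : Submodule R M} (hS : S.FG)
    (h : ∀ m, m ∈ saturation S) : Module.Finite K (K ⊗[R] M) := by
  obtain ⟨G, rfl⟩ := hS
  let f := TensorProduct.mk R K M 1
  let W := span K (f '' G)
  have hle : span R (G : Set M) ≤ (W.restrictScalars R).comap f :=
    span_le.2 fun g hg => subset_span ⟨g, hg, rfl⟩
  have h1 : ∀ m, f m ∈ W := fun m => by
    obtain ⟨q, hq, hm⟩ := h m
    have h2 : f (q • m) ∈ W := hle hm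
    rw [map_smul, ← algebraMap_smul K] at h2
    exact (Submodule.smul_mem_iff _ (by rwa [Ne, map_eq_zero_iff _ hK])).1 h2
  have htop : W = ⊤ := eq_top_iff.2 fun x _ => by
    induction x using TensorProduct.induction_on with
    | zero => exact zero_mem _
    | tmul s m =>
      rw [← mul_one s, ← smul_eq_mul, ← TensorProduct.smul_tmul']
      exact smul_mem _ _ (h1 m)
    | add x y hx hy => exact add_mem (hx trivial) (hy trivial)
  exact ⟨htop ▸ fg_span (G.finite_toSet.image f)⟩

lemma tmul_eq_zero {m : M} (h : (1 : FractionRing R) ⊗ₜ[R] m = 0) : ∃ q : R, q ≠ 0 ∧ q • m = 0 := by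
  obtain ⟨⟨q, hq⟩, h'⟩ := (IsLocalizedModule.eq_zero_iff (nonZeroDivisors R)
    (TensorProduct.mk R (FractionRing R) M 1)).1 h
  exact ⟨q, nonZeroDivisors.ne_zero hq, h'⟩

lemma exists_fg_saturation (h : Module.Finite (FractionRing R) (FractionRing R ⊗[R] M)) :
    ∃ S : Submodule R M, S.FG ∧ ∀ m, m ∈ saturation S := by
  classical
  let K := FractionRing R
  let f := TensorProduct.mk R K M 1
  have htop : span K (Set.range f) = ⊤ := eq_top_iff.2 fun x _ => by
    induction x using TensorProduct.induction_on with
    | zero => exact zero_mem _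
    | tmul s m =>
      rw [← mul_one s, ← smul_eq_mul, ← TensorProduct.smul_tmul']
      exact smul_mem _ _ (subset_span ⟨m, rfl⟩)
    | add x y hx hy => exact add_mem (hx trivial) (hy trivial)
  obtain ⟨s, hs, hs'⟩ := (Submodule.fg_span_iff_fg_span_finset_subset _).1 (htop ▸ h.1)
  rw [← Set.image_univ] at hs
  obtain ⟨G, -, rfl⟩ := Finset.subset_set_image_iff.1 hs
  refine ⟨span R G, ⟨G, rfl⟩, fun m => ?_⟩
  have hm : f m ∈ span K (G.image f : Set (K ⊗[R] M)) := by
    rw [← hs', htop]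
    trivial
  obtain ⟨q, hq, s, hs, h1⟩ : ∃ q : R, q ≠ 0 ∧ ∃ s ∈ span R (G : Set M),
      q • f m = f s := by
    refine span_induction (p := fun x _ => ∃ q : R, q ≠ 0 ∧
      ∃ s ∈ span R (G : Set M), q • x = f s) (fun x hx => ?_) ?_ ?_ ?_ hm
    · obtain ⟨g, hg, rfl⟩ := Finset.mem_image.1 hx
      exact ⟨1, one_ne_zero, g, subset_span hg, one_smul _ _⟩
    · exact ⟨1, one_ne_zero, 0, zero_mem _, by simp⟩
    · rintro x y _ _ ⟨p, hp, a, ha, hx⟩ ⟨q, hq, b, hb, hy⟩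
      refine ⟨p * q, mul_ne_zero hp hq, q • a + p • b,
        add_mem (smul_mem _ _ ha) (smul_mem _ _ hb), ?_⟩
      rw [smul_add, map_add, map_smul, map_smul, ← hx, ← hy, smul_smul, smul_smul, mul_comm q]
    · rintro c x _ ⟨q, hq, s, hs, hx⟩
      obtain ⟨a, b, hb, rfl⟩ := IsFractionRing.div_surjective (A := R) c
      refine ⟨b * q, mul_ne_zero (nonZeroDivisors.ne_zero hb) hq, a • s,
        smul_mem _ _ hs, ?_⟩
      have hb' : algebraMap R K b ≠ 0 :=
        IsFractionRing.to_map_ne_zero_of_mem_nonZeroDivisors hb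
      rw [map_smul, ← hx, mul_smul, smul_comm q, ← algebraMap_smul K b, ← algebraMap_smul K a,
        smul_smul, mul_div_cancel₀ _ hb']
  obtain ⟨p, hp, h2⟩ := tmul_eq_zero (R := R) (m := q • m - s) (by
    rw [TensorProduct.tmul_sub, TensorProduct.tmul_smul]
    exact sub_eq_zero.2 h1)
  refine ⟨p * q, mul_ne_zero hp hq, ?_⟩
  rw [smul_sub, sub_eq_zero] at h2
  rw [mul_smul, h2]
  exact smul_mem _ _ hs

/-- In a module of finite generic rank sufficiently many elements are dependent. -/
lemma exists_relation (h : Module.Finite (FractionRing R) (FractionRing R ⊗[R] M)) (v : ℕ → M) :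
    ∃ (n : ℕ) (a : Fin n → R), (∃ i, a i ≠ 0) ∧ ∑ i, a i • v i = 0 := by
  let n := Module.finrank (FractionRing R) (FractionRing R ⊗[R] M) + 1
  have hdep : ¬ LinearIndependent R fun i : Fin n => (1 : FractionRing R) ⊗ₜ[R] v i := fun hli => by
    have h1 := ((LinearIndependent.iff_fractionRing R (FractionRing R)).1 hli).fintype_card_le_finrank
    simp [n] at h1
  obtain ⟨a, ha, i, hi⟩ := Fintype.not_linearIndependent_iff.1 hdep
  simp only [← TensorProduct.tmul_smul, ← TensorProduct.tmul_sum] at ha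
  obtain ⟨q, hq, h'⟩ := tmul_eq_zero ha
  refine ⟨n, fun i => q * a i, ⟨i, mul_ne_zero hq hi⟩, ?_⟩
  simpa only [mul_smul, ← smul_sum] using h'

end Saturation

section Line

variable {k : Type u} [Field k] {M : DMod k[X]}

lemma saturation_stable {S : Submodule k[X] M} (h : ∀ s ∈ S, M.del s ∈ saturation S) :
    M.Stable (saturation S) := by
  rintro y ⟨q, hq, hy⟩
  refine mem_saturation_of_smul (mul_ne_zero hq hq) ?_
  have h1 := (saturation S).smul_mem q (h _ hy)
  rw [M.leibniz, smul_add, smul_comm q] at h1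
  rw [mul_smul]
  exact (Submodule.add_mem_iff_right _ ((saturation S).smul_mem _ (le_saturation _ hy))).1 h1

lemma del_mem_saturation {ι : Type*} {G : Set ι} {S : ι → Submodule k[X] M}
    (h : ∀ i ∈ G, ∀ s ∈ S i, M.del s ∈ saturation (S i)) :
    ∀ s ∈ ⨆ i ∈ G, S i, M.del s ∈ saturation (⨆ i ∈ G, S i) := by
  let T := ⨆ i ∈ G, S i
  let U : Submodule k[X] M.carrier :=
    { carrier := {s | s ∈ saturation T ∧ M.del s ∈ saturation T}
      zero_mem' := ⟨zero_mem _, by rw [map_zero]; exact zero_mem _⟩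
      add_mem' := fun ha hb => ⟨add_mem ha.1 hb.1, by rw [map_add]; exact add_mem ha.2 hb.2⟩
      smul_mem' := fun p m hm => ⟨smul_mem _ p hm.1, by
        rw [M.leibniz]
        exact add_mem (smul_mem _ _ hm.1) (smul_mem _ p hm.2)⟩ }
  have hU : T ≤ U := iSup₂_le fun i hi s hs =>
    have hle : S i ≤ T := le_iSup₂_of_le i hi le_rfl
    ⟨le_saturation _ (hle hs), saturation_mono hle (h i hi s hs)⟩
  exact fun s hs => (hU hs).2

/-- A nontrivial relation between the `∂ʲ (b_j m)` bounds the generic rank of the submodule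
generated by `m`. -/
lemma exists_fg_of_relation {m : M} (D : ℕ) (b : ℕ → k[X]) (hb : ∃ j < D, b j ≠ 0)
    (h : ∑ j ∈ Finset.range D, M.del^[j] (b j • m) = 0) :
    ∃ S : Submodule k[X] M, S.FG ∧ (∀ s ∈ S, M.del s ∈ saturation S) ∧
      m ∈ saturation S := by
  induction D with
  | zero => simp at hb
  | succ D ih =>
    rw [sum_range_succ] at h
    by_cases hD : b D = 0
    · obtain ⟨j, hj, hj0⟩ := hb
      refine ih ⟨j, lt_of_le_of_ne (Nat.lt_succ_iff.1 hj) fun e => hj0 (e ▸ hD), hj0⟩ ?_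
      rwa [hD, zero_smul, iterate_map_zero, add_zero] at h
    let Λ := span k[X] {m}
    have hm : m ∈ Λ := Submodule.mem_span_singleton_self m
    have hΛ : Λ.FG := Submodule.fg_span_singleton m
    have hL : IsLeibniz k[X] M.del := M.isLeibniz
    rcases D with _ | p
    · refine ⟨⊥, Submodule.fg_bot, by simp [le_saturation _ (zero_mem _)], b 0, hD, ?_⟩
      simpa using h
    have hmem : ∀ j ≤ p, ∀ y ∈ Λ, M.del^[j] y ∈ chain k[X] M.del Λ p := fun j hj y hy => by
      refine chain_mono hj ?_
      clear hj
      induction j with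
      | zero => exact hy
      | succ j ih => rw [iterate_succ_apply']; exact apply_mem_chain ih
    have htop : M.del^[p + 1] m ∈ saturation (chain k[X] M.del Λ p) := by
      refine ⟨b (p + 1), hD, ?_⟩
      have h1 := iterate_smul_sub_mem hL (b (p + 1)) hm p
      rw [← Submodule.sub_mem_iff_left _ (show M.del^[p + 1] (b (p + 1) • m) ∈ _ from ?_)]
      · have := neg_mem h1
        rwa [neg_sub] at this
      · rw [← neg_eq_of_add_eq_zero_right h]
        exact neg_mem (sum_mem fun j hj => hmem j (by simpa [Nat.lt_succ_iff] using hj) _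
          (Λ.smul_mem _ hm))
    refine ⟨chain k[X] M.del Λ p, chain_fg hΛ hL p, fun s hs => ?_,
      le_saturation _ (le_chain p hm)⟩
    obtain ⟨a, ha, c, hc, h1⟩ := mem_chain_succ_iterate hL (apply_mem_chain hs)
    obtain ⟨r, rfl⟩ := Submodule.mem_span_singleton.1 hc
    rw [h1, ← sub_add_cancel (M.del^[p + 1] (r • m)) (r • M.del^[p + 1] m)]
    exact add_mem (le_saturation _ ha) (add_mem
      (le_saturation _ (iterate_smul_sub_mem hL r hm p)) (smul_mem _ r htop))

/-- A relation between the `∂ⁱ m` is a relation of the opposite order for the Fourier transform. -/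
lemma exists_fourier_relation {m : M} {n : ℕ} {a : Fin n → k[X]} (ha : ∃ i, a i ≠ 0)
    (h : ∑ i, a i • M.del^[i] m = 0) :
    ∃ (D : ℕ) (b : ℕ → k[X]), (∃ j < D, b j ≠ 0) ∧
      ∑ j ∈ Finset.range D, (fourierObj M).del^[j] (fourierAction M (b j) m) = 0 := by
  let D := (Finset.univ.sup fun i => (a i).natDegree) + 1
  have hlt : ∀ i, (a i).natDegree < D := fun i =>
    Nat.lt_succ_of_le (Finset.le_sup (f := fun i => (a i).natDegree) (Finset.mem_univ i))
  have hpow : ∀ (j : ℕ) (y : M), (fourierObj M).del^[j] y = (X : k[X]) ^ j • y := fun j => by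
    induction j with
    | zero => exact fun y => (one_smul k[X] y).symm
    | succ j ih =>
      intro y
      have h : (X : k[X]) • (X : k[X]) ^ j • y = (X : k[X]) ^ (j + 1) • y := by
        rw [smul_smul, ← pow_succ']
      exact (iterate_succ_apply' _ _ _).trans ((congrArg (fourierObj M).del (ih y)).trans h)
  have hact : ∀ (i : ℕ) (y : M), fourierAction M ((-X) ^ i) y = M.del^[i] y := fun i => by
    induction i with
    | zero => intro y; rw [pow_zero, map_one]; rfl
    | succ i ih =>
      intro y
      rw [pow_succ, fourierAction_mul, map_neg, ih, iterate_succ_apply]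
      exact congrArg _ (by
        change -(fourierAction M X y) = _
        rw [fourierAction_X, neg_neg])
  refine ⟨D, fun j => ∑ i, C ((a i).coeff j) * (-X) ^ (i : ℕ), ?_, ?_⟩
  · obtain ⟨i, hi⟩ := ha
    refine ⟨_, hlt i, fun h0 => hi (leadingCoeff_eq_zero.1 ?_)⟩
    have h1 := congrArg (fun p => p.coeff i) h0
    have e : ∀ c : k, ∀ l : ℕ, C c * (-X) ^ l = C (c * (-1) ^ l) * X ^ l := fun c l => by
      rw [neg_pow]
      simp [mul_assoc]
    simp only [e, finsetSum_coeff, coeff_C_mul_X_pow, coeff_zero, Fin.val_inj,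
      Finset.sum_ite_eq, Finset.mem_univ, if_true] at h1
    simpa using h1
  · have hsum : ∀ j, fourierAction M (∑ i, C ((a i).coeff j) * (-X) ^ (i : ℕ)) m
        = ∑ i, C ((a i).coeff j) • M.del^[i] m := fun j => by
      refine (map_sum ((AddMonoidHom.eval m).comp (fourierAction M).toAddMonoidHom :
        k[X] →+ M) _ _).trans (sum_congr rfl fun i _ => ?_)
      exact (fourierAction_mul M _ _ m).trans (by rw [hact, fourierAction_C])
    refine (sum_congr rfl fun j _ => (hpow j _).trans (congrArg _ (hsum j))).trans ?_
    have h' : ∑ j ∈ Finset.range D, (X : k[X]) ^ j • ∑ i, C ((a i).coeff j) • M.del^[i] m = 0 := by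
      simp only [smul_sum]
      rw [Finset.sum_comm, ← h]
      refine sum_congr rfl fun i _ => ?_
      conv_rhs => rw [(a i).as_sum_range_C_mul_X_pow' (hlt i), sum_smul]
      exact sum_congr rfl fun j _ => by rw [smul_smul, mul_comm]
    exact h'

/-- A `D_R`-module generated by finitely many elements has finite generic rank if the iterated
derivatives of each of its elements do. -/
lemma finite_of_generates {Q : DMod k[X]} {G : Finset Q}
    (hG : ∀ N : Submodule k[X] Q, Q.Stable N → (∀ s ∈ G, s ∈ N) → N = ⊤)
    (h : ∀ m : Q, ∃ S : Submodule k[X] Q, S.FG ∧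
      (∀ s ∈ S, Q.del s ∈ saturation S) ∧ m ∈ saturation S) :
    Module.Finite (FractionRing k[X]) (FractionRing k[X] ⊗[k[X]] Q) := by
  choose S hS hdel hmem using h
  let T : Submodule k[X] Q.carrier := ⨆ g ∈ G, S g
  have hle : ∀ g ∈ G, S g ≤ T := fun g hg => le_iSup₂_of_le g hg le_rfl
  have htop : saturation T = ⊤ := hG _ (saturation_stable <|
    del_mem_saturation fun g hg s hs => hdel g s hs) fun g hg =>
    saturation_mono (hle g hg) (hmem g)
  exact finite_tensor (IsFractionRing.injective k[X] (FractionRing k[X]))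
    (Submodule.fg_biSup G S fun g _ => hS g) fun m => htop ▸ trivial

theorem holA1_fourier (hM : HolA1 k M) : HolA1 k ((fourier k).obj M) := by
  obtain ⟨⟨G, hG⟩, hfin⟩ := hM
  have hG' : ∀ N : Submodule k[X] ((fourier k).obj M), ((fourier k).obj M).Stable N →
      (∀ s ∈ G, (s : M) ∈ N) → N = ⊤ := fun N hN hs => by
    have hX : ∀ m : M, m ∈ N → (X : k[X]) • m ∈ N := hN
    have hC : ∀ (a : k) (m : M), m ∈ N → (C a : k[X]) • m ∈ N := fun a m hm => by
      rw [← fourierAction_C]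
      exact N.smul_mem (C a) hm
    let N' : Submodule k[X] M.carrier :=
      { N.toAddSubmonoid with
        smul_mem' := fun p => by
          induction p using Polynomial.induction_on with
          | C a => exact fun hm => hC a _ hm
          | add p q hp hq =>
            intro m hm
            rw [add_smul]
            exact N.add_mem (hp hm) (hq hm)
          | monomial n a ih =>
            intro m hm
            rw [pow_succ, ← mul_assoc, mul_smul]
            exact ih (hX m hm) }
    have h : N' = ⊤ := hG N' (fun m hm => by
      have h1 : fourierAction M X m ∈ N := N.smul_mem X hm
      rw [fourierAction_X] at h1
      exact (congrArg (fun y : M => (show ((fourier k).obj M) from y) ∈ N)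
        (neg_neg (M.del m))).mp (N.neg_mem h1)) hs
    exact eq_top_iff.2 fun m _ => (h ▸ trivial : (show M from m) ∈ N')
  refine ⟨⟨G, hG'⟩, finite_of_generates hG' fun m => ?_⟩
  obtain ⟨n, a, ha, h⟩ := exists_relation hfin fun i => M.del^[i] m
  obtain ⟨D, b, hb, h'⟩ := exists_fourier_relation ha h
  exact exists_fg_of_relation D b hb h'

end Line

/-! ### Nearby and vanishing cycles of holonomic modules -/

section Cycles

lemma exists_smul_mem_of_fg {R : Type u} [CommRing R] [IsDomain R] {M : Type u} [AddCommGroup M]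
    [Module R M] {S T : Submodule R M} (hT : T.FG) (h : ∀ m, m ∈ saturation S) :
    ∃ q : R, q ≠ 0 ∧ ∀ m ∈ T, q • m ∈ S := by
  refine Submodule.fg_induction (motive := fun T _ => ∃ q : R, q ≠ 0 ∧ ∀ m ∈ T, q • m ∈ S)
    (fun x => ?_) ?_ T hT
  · obtain ⟨q, hq, hx⟩ := h x
    refine ⟨q, hq, fun m hm => ?_⟩
    obtain ⟨a, rfl⟩ := Submodule.mem_span_singleton.1 hm
    rw [smul_comm]
    exact S.smul_mem a hx
  · rintro T T' - - ⟨p, hp, hT⟩ ⟨q, hq, hT'⟩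
    refine ⟨p * q, mul_ne_zero hp hq, fun m hm => ?_⟩
    obtain ⟨a, ha, b, hb, rfl⟩ := mem_sup.1 hm
    rw [smul_add, mul_smul, smul_comm, mul_smul]
    exact add_mem (S.smul_mem _ (hT a ha)) (S.smul_mem _ (hT' b hb))

variable {k : Type u} [Field k] [CharZero k] {M : DMod k[X]}

/-- The kernel is stable under derivation, so it contains no nonzero element of least degree. -/
lemma DiffMap.injective {S : Type u} [CommRing S] [Differential S] [Nontrivial S]
    (φ : DiffMap k[X] S) : Injective φ.toRingHom := by
  refine (injective_iff_map_eq_zero _).2 fun f => ?_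
  induction hn : f.natDegree using Nat.strong_induction_on generalizing f with
  | _ n ih =>
    intro hf
    have h0 : f.natDegree = 0 := by
      by_contra h0
      have h1 : φ.toRingHom (derivative f) = 0 := by
        have h := φ.deriv_map f
        rw [hf, map_zero] at h
        exact (Units.mul_right_eq_zero _).1 h.symm
      exact h0 (derivative_eq_zero.1
        (ih _ (hn ▸ natDegree_derivative_lt h0) _ rfl h1))
    rw [eq_C_of_natDegree_eq_zero h0] at hf ⊢
    rw [(map_eq_zero (φ.toRingHom.comp C)).1 hf, C_0]

lemma holK_nearby (hM : HolA1 k M) : HolK k ((puncturedDiskInfty k).pullback.obj M) := by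
  obtain ⟨S, hS, h⟩ := exists_fg_saturation hM.2
  let _ : Algebra k[X] k⸨X⸩ := (puncturedDiskInfty k).toRingHom.toAlgebra
  exact finite_tensor (puncturedDiskInfty k).injective hS h

lemma mem_of_forall_mem_chain {R : Type*} [CommRing R] {Y : Type*} [AddCommGroup Y] [Module R Y]
    {D : Y →+ Y} {Λ : Submodule R Y} {m : Y} (h : m ∈ ⨆ i, chain R D Λ i) :
    ∃ i, m ∈ chain R D Λ i :=
  (Submodule.mem_iSup_of_directed _ chain_mono.directed_le).1 h

variable {x : ClosedPoint k}

lemma del_incl_disk (m : M) : ((diskAt x).pullback.obj M).del ((diskAt x).incl M m)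
    = (diskAt x).incl M (M.del m) :=
  ((diskAt x).del_incl m).trans (one_smul _ _)

lemma incl_mem_chain {M₀ : Submodule k[X] M}
    {Z₀ : Submodule (ResField x)⟦X⟧ ((diskAt x).pullback.obj M)}
    (h : ∀ m ∈ M₀, (diskAt x).incl M m ∈ Z₀) (i : ℕ) : ∀ m ∈ chain k[X] M.del M₀ i,
      (diskAt x).incl M m ∈ chain _ ((diskAt x).pullback.obj M).del Z₀ i := by
  induction i with
  | zero => exact h
  | succ i ih =>
    intro m hm
    obtain ⟨a, ha, b, hb, rfl⟩ := (mem_chain_succ M.isLeibniz).1 hm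
    exact (mem_chain_succ (DMod.isLeibniz _)).2 ⟨_, ih a ha, _, ih b hb, by
      rw [map_add, del_incl_disk]⟩

/-- A holonomic module is generated under `∂` by a finitely generated `k[z]`-submodule `M₀` with
`q ∂ M₀ ⊆ M₀` for some `q ≠ 0`; over the disk at `x`, `q` is a unit times a power of `t`. -/
theorem exists_isDelLattice_vanishing (hM : HolA1 k M) (x : ClosedPoint k) :
    ∃ Λ, IsDelLattice (invertObj ((diskAt x).pullback.obj M)) Λ := by
  classical
  obtain ⟨S, hS, hsat⟩ := exists_fg_saturation hM.2
  obtain ⟨G, hG⟩ := hM.1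
  let Z := (diskAt x).pullback.obj M
  let ι := (diskAt x).incl M
  obtain ⟨G₁, hG₁⟩ : ∃ G₁ : Finset M,
      span k[X] G₁ = S ⊔ span k[X] G := hS.sup ⟨G, rfl⟩
  let M₀ := span k[X] (G₁ : Set M)
  have hM₀ : ∀ m, m ∈ saturation M₀ := fun m =>
    saturation_mono (le_sup_left.trans hG₁.ge) (hsat m)
  obtain ⟨q, hq, hdel⟩ := exists_smul_mem_of_fg (chain_fg (Λ := M₀) ⟨G₁, rfl⟩ M.isLeibniz 1) hM₀
  have hch : ∀ m, ∃ i, m ∈ chain k[X] M.del M₀ i := fun m => mem_of_forall_mem_chain (by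
    rw [hG (⨆ i, chain k[X] M.del M₀ i) (fun m hm => by
      obtain ⟨i, hi⟩ := mem_of_forall_mem_chain hm
      exact mem_iSup_of_mem _ (apply_mem_chain hi)) fun s hs =>
      mem_iSup_of_mem 0 ((le_sup_right.trans hG₁.ge) (subset_span hs))]
    trivial)
  let Z₀ := span (ResField x)⟦X⟧ (ι '' G₁)
  have hZ₀ : ∀ m ∈ M₀, ι m ∈ Z₀ := fun m hm => by
    refine span_induction (p := fun m _ => ι m ∈ Z₀)
      (fun g hg => subset_span ⟨g, hg, rfl⟩) ?_ (fun a b _ _ ha hb => ?_)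
      (fun r a _ ha => ?_) hm
    · rw [map_zero]; exact zero_mem _
    · rw [map_add]; exact add_mem ha hb
    · exact ((diskAt x).incl_smul r a).symm ▸ smul_mem _ _ ha
  have hφ : (diskAt x).toRingHom q ≠ 0 := fun h => hq ((diskAt x).injective (by rw [h, map_zero]))
  obtain ⟨c, w, hw⟩ : ∃ (c : ℕ) (w : (ResField x)⟦X⟧),
      w * (diskAt x).toRingHom q = PowerSeries.X ^ c := by
    obtain ⟨c, w, hw⟩ := IsDiscreteValuationRing.associated_pow_irreducible hφ
      (PowerSeries.X_irreducible (R := ResField x))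
    exact ⟨c, w, by rw [mul_comm]; exact hw⟩
  have hbd : ∀ m ∈ Z₀, ϖ (ResField x) ^ c • Z.del m ∈ Z₀ := fun m hm => by
    refine span_induction
      (p := fun m _ => ϖ (ResField x) ^ c • Z.del m ∈ Z₀)
      ?_ ?_ (fun a b _ _ ha hb => ?_) (fun r a h ha => ?_) hm
    · rintro _ ⟨g, hg, rfl⟩
      rw [del_incl_disk, ← hw, mul_smul, ← (diskAt x).incl_smul]
      exact smul_mem _ _ (hZ₀ _ (hdel _ (apply_mem_chain (i := 0)
        (subset_span hg))))
    · rw [map_zero, smul_zero]; exact zero_mem _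
    · rw [map_add, smul_add]; exact add_mem ha hb
    · rw [Z.leibniz, smul_add, smul_comm _ r]
      exact add_mem (smul_mem _ _ (smul_mem _ _ h)) (smul_mem _ _ ha)
  refine exists_isDelLattice_invert (Z := Z) ⟨G₁.image ι, by rw [Finset.coe_image]⟩ hbd fun m =>
    mem_of_forall_mem_chain ?_
  have htop : span (ResField x)⟦X⟧ (Set.range ι)
      ≤ ⨆ i, chain (ResField x)⟦X⟧ Z.del Z₀ i := span_le.2 fun y ⟨m, hm⟩ => by
    obtain ⟨i, hi⟩ := hch m
    exact hm ▸ mem_iSup_of_mem i (incl_mem_chain hZ₀ i m hi)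
  exact htop ((diskAt x).span_incl (M := M) ▸ trivial)

theorem wellDefined (k : Type u) [Field k] [CharZero k] : WellDefined k where
  fourier M := holA1_fourier M.2
  nearby M := holK_nearby M.2
  vanishing x M := (exists_isDelLattice_vanishing M.2 x).choose_spec.holK
  component o N := by
    rw [piece_eq]
    exact part_isOfType N.2 o

end Cycles

/-! ### Components, nearby cycles and vanishing cycles as adjoints -/

section Adjoints

/-- Relative adjunctions compose. -/
def RelAdj.comp {C D E W : Type*} [Category C] [Category D] [Category E] [Category W]
    {A : C ⥤ W} {R : D ⥤ W} {Λ : C ⥤ D} {R' : E ⥤ D} {Λ' : C ⥤ E} (a : RelAdj A R Λ)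
    (b : RelAdj Λ R' Λ') : RelAdj A (R' ⋙ R) Λ' where
  u := a.u ≫ Functor.whiskerRight b.u R
  univ c e := by
    have h : ∀ g : Λ'.obj c ⟶ e, (a.u ≫ Functor.whiskerRight b.u R).app c ≫ (R' ⋙ R).map g
        = a.u.app c ≫ R.map (b.u.app c ≫ R'.map g) := fun g => by simp
    rw [funext h]
    exact (a.univ c _).comp (b.univ c e)

/-- The inverse image is left adjoint to the direct image. -/
def DiffMap.relAdj {R S : Type u} [CommRing R] [Differential R] [CommRing S] [Differential S]
    {C : Type*} [Category C] (φ : DiffMap R S) (A : C ⥤ DMod R) :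
    RelAdj A φ.pushforward (A ⋙ φ.pullback) where
  u := { app := fun c => φ.unit (A.obj c), naturality := fun _ _ _ => rfl }
  univ c Y := ⟨fun _ _ h => φ.pullback_hom_ext fun m => DFunLike.congr_fun
      (congrArg (fun f : A.obj c ⟶ φ.pushforward.obj Y => f.toLin) h) m,
    fun f => ⟨φ.lift f, DMod.hom_ext (φ.lift_incl f)⟩⟩

section DirectSum

variable {R : Type u} [CommRing R] [Differential R] {ι : Type*} {N : ι → DMod R} {M : DMod R}
  {f : ∀ i, N i ⟶ M}

open Classical in
lemma DMod.IsDirectSum.hom_ext (h : DMod.IsDirectSum N M f) {Y : DMod R} {g g' : M ⟶ Y}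
    (hg : ∀ i, f i ≫ g = f i ≫ g') : g = g' := by
  refine DMod.hom_ext fun m => ?_
  obtain ⟨m, rfl⟩ := h.2 m
  refine LinearMap.congr_fun (f := g.toLin ∘ₗ DirectSum.toModule R ι M _)
    (g := g'.toLin ∘ₗ DirectSum.toModule R ι M _)
    (DirectSum.linearMap_ext R fun i => LinearMap.ext fun y => ?_) m
  simp only [LinearMap.comp_apply, DirectSum.toModule_lof]
  exact DFunLike.congr_fun (congrArg (fun f : N i ⟶ Y => f.toLin) (hg i)) y

open Classical in
lemma DMod.IsDirectSum.exists_desc (h : DMod.IsDirectSum N M f) {Y : DMod R}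
    (g : ∀ i, N i ⟶ Y) : ∃ d : M ⟶ Y, ∀ i, f i ≫ d = g i := by
  let e := LinearEquiv.ofBijective _ h
  let l := DirectSum.toModule R ι Y (fun i => (g i).toLin) ∘ₗ e.symm.toLinearMap
  have hl : ∀ i m, l ((f i).toLin m) = (g i).toLin m := fun i m => by
    have h1 : e (DirectSum.lof R ι (fun i => (N i)) i m) = (f i).toLin m :=
      DirectSum.toModule_lof R (φ := fun i => (f i).toLin) i m
    rw [← h1]
    change DirectSum.toModule R ι Y _ (e.symm (e _)) = _
    rw [e.symm_apply_apply, DirectSum.toModule_lof]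
  refine ⟨⟨l, fun m => ?_⟩, fun i => DMod.hom_ext (hl i)⟩
  obtain ⟨m, rfl⟩ := h.2 m
  induction m using DirectSum.induction_on with
  | zero => simp only [map_zero]
  | of i m =>
    have h1 : DirectSum.toModule R ι M (fun i => (f i).toLin)
        (DirectSum.of (fun i => (N i)) i m) = (f i).toLin m :=
      DirectSum.toModule_lof R (φ := fun i => (f i).toLin) i m
    rw [h1, ← (f i).comm, hl, hl, (g i).comm]
  | add x y hx hy => simp only [map_add, hx, hy]

end DirectSum

lemma DMod.partInc_naturality {R : Type u} [CommRing R] [Differential R]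
    (P : ObjectProperty (DMod R)) {N N' : DMod R} (g : N ⟶ N') :
    (DMod.part P).map g ≫ DMod.partInc P N' = DMod.partInc P N ≫ g := rfl

variable {k : Type u} [Field k] [CharZero k]

lemma isDirectSum_piece {N : DMod k⸨X⸩} (hN : HolK k N) :
    DMod.IsDirectSum (fun o => (DMod.part (piece k o)).obj N) N
      (fun o => DMod.partInc (piece k o) N) := by
  rw [show piece k = IsOfType from funext piece_eq]
  exact isDirectSum_part hN

lemma piece_hom_eq {o o' : Option (ClosedPoint k)} (ho : o ≠ o') {N N' : DMod k⸨X⸩}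
    (hN : piece k o N) (hN' : piece k o' N') (f g : N ⟶ N') : f = g := by
  rw [piece_eq] at hN hN'
  exact DMod.hom_ext fun m => (hN.map_eq_zero hN' ho f m).trans (hN.map_eq_zero hN' ho g m).symm

lemma exists_proj {N : DMod k⸨X⸩} (hN : HolK k N) (o : Option (ClosedPoint k)) :
    ∃ p : N ⟶ (DMod.part (piece k o)).obj N, DMod.partInc (piece k o) N ≫ p = 𝟙 _ := by
  classical
  obtain ⟨p, hp⟩ := (isDirectSum_piece hN).exists_desc (Y := (DMod.part (piece k o)).obj N)
    fun o' => if h : o' = o then eqToHom (by rw [h]) else ⟨0, fun m => by simp⟩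
  exact ⟨p, (hp o).trans (by simp)⟩

variable (h : WellDefined k)

/-- The component of `N` in a class, as a full subcategory valued functor. -/
abbrev WellDefined.comp (o : Option (ClosedPoint k)) :
    (HolK k).FullSubcategory ⥤ (piece k o).FullSubcategory :=
  (piece k o).lift ((HolK k).ι ⋙ DMod.part (piece k o)) (h.component o)

/-- The projections to the components make these reflections, since there are no nonzero
morphisms between modules in different classes. -/
def compAdj (o : Option (ClosedPoint k)) : RelAdj (HolK k).ι (piece k o).ι (h.comp o) := by
  choose p hp using fun N : (HolK k).FullSubcategory => exists_proj N.2 o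
  exact
  { u := { app := p
           naturality := fun N N' g => (isDirectSum_piece N.2).hom_ext fun o' => by
             rcases eq_or_ne o' o with rfl | ho
             · change DMod.partInc _ _ ≫ g.hom ≫ p N' =
                 DMod.partInc _ _ ≫ p N ≫ (DMod.part _).map g.hom
               rw [← Category.assoc, ← DMod.partInc_naturality, Category.assoc, hp,
                 ← Category.assoc, hp]
               simp
             · exact piece_hom_eq ho (h.component o' N) (h.component o N') _ _ }
    univ := fun N Q => by
      refine ⟨fun f g hfg => ObjectProperty.hom_ext _ ?_, fun g =>
        ⟨ObjectProperty.homMk (DMod.partInc _ _ ≫ g), ?_⟩⟩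
      · have h1 := congrArg (DMod.partInc (piece k o) N.obj ≫ ·) hfg
        change DMod.partInc _ _ ≫ p N ≫ f.hom = DMod.partInc _ _ ≫ p N ≫ g.hom at h1
        rwa [← Category.assoc, ← Category.assoc, hp, Category.id_comp, Category.id_comp] at h1
      · refine (isDirectSum_piece N.2).hom_ext fun o' => ?_
        rcases eq_or_ne o' o with rfl | ho
        · change DMod.partInc _ _ ≫ p N ≫ DMod.partInc _ _ ≫ g = DMod.partInc _ _ ≫ g
          rw [← Category.assoc, hp]
          exact Category.id_comp _
        · exact piece_hom_eq ho (h.component o' N) Q.2 _ _ }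

/-- Nearby cycles of a class are left adjoint to `j_{∞*}` on that class. -/
def nearbyAdj (o : Option (ClosedPoint k)) : RelAdj (HolA1 k).ι
    ((piece k o).ι ⋙ (puncturedDiskInfty k).pushforward) (h.PsiInfty ⋙ h.comp o) :=
  ((puncturedDiskInfty k).relAdj (HolA1 k).ι).comp ((compAdj h o).whisker h.PsiInfty)

/-- Vanishing cycles are left adjoint to `j_{x*} j_!`: a morphism from a module on the disk to
`j_! N` extends to the module with inverted `∂`, which is `j_!` of its restriction to the punctured
disk, and `j_!` is fully faithful. -/
def vanishingAdj (x : ClosedPoint k) : RelAdj (HolA1 k).ι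
    ((HolK (ResField x)).ι ⋙ jShriek (ResField x) ⋙ (diskAt x).pushforward) (h.Phi x) := by
  choose Λ hΛ using fun M : (HolA1 k).FullSubcategory => exists_isDelLattice_vanishing M.2 x
  exact ((diskAt x).relAdj (HolA1 k).ι).comp (R' := (HolK (ResField x)).ι ⋙ jShriek (ResField x))
    { u :=
      { app := fun M => invertUnit _ ≫ (hΛ M).iso.hom
        naturality := fun M M' f => by
          let g := (diskAt x).pullback.map f.hom
          let g' : invertObj _ ⟶ invertObj _ := (invert _).map g
          have h1 : g ≫ invertUnit _ = invertUnit _ ≫ g' :=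
            DMod.hom_ext fun m => (invert_map_unit g m).symm
          have h2 := (hΛ M).iso_naturality (hΛ M') g'
          change g ≫ invertUnit _ ≫ (hΛ M').iso.hom = (invertUnit _ ≫ (hΛ M).iso.hom) ≫ _
          rw [← Category.assoc, h1, Category.assoc, h2]
          rfl }
      univ := fun M N => by
        have h1 : Bijective fun f : (h.Phi x).obj M ⟶ N => (jShriek _).map f.hom :=
          (jShriek_bijective ((h.Phi x).obj M).2 N.2).comp
            ⟨fun _ _ => ObjectProperty.hom_ext _, fun f => ⟨ObjectProperty.homMk f, rfl⟩⟩
        have hdel := invert_bijective ((jStar (ResField x)).obj N.obj)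
        have h2 : Bijective
            fun f : invertObj ((diskAt x).pullback.obj M.obj) ⟶ (jShriek _).obj N.obj =>
              invertUnit _ ≫ f := by
          refine ⟨fun f g hfg => invert_hom_ext_unit hdel.1 fun m => ?_, fun f => ?_⟩
          · exact DFunLike.congr_fun
              (congrArg (fun f : _ ⟶ (jShriek _).obj N.obj => f.toLin) hfg) m
          · obtain ⟨g, hg⟩ := exists_invert_lift (Y := (jShriek _).obj N.obj) hdel f
            exact ⟨g, DMod.hom_ext hg⟩
        have h3 : Bijective
            fun f : (jShriek _).obj ((h.Phi x).obj M).obj ⟶ (jShriek _).obj N.obj =>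
              (hΛ M).iso.hom ≫ f :=
          ⟨fun f g hfg => (cancel_epi (hΛ M).iso.hom).1 hfg, fun f =>
            ⟨(hΛ M).iso.inv ≫ f, by simp⟩⟩
        exact h2.comp (h3.comp h1) }

end Adjoints

/-! ### Stationary phase -/

section Phase

variable {k : Type u} [Field k] [CharZero k] (h : WellDefined k)

lemma negPoint_negPoint (x : ClosedPoint k) : negPoint (negPoint x) = x := by
  refine MaximalSpectrum.ext (Ideal.ext fun f => ?_)
  change algEquivAevalNegX (algEquivAevalNegX f) ∈ x.asIdeal ↔ _
  rw [show algEquivAevalNegX (algEquivAevalNegX f) = f from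
    algEquivAevalNegX.symm_apply_apply f]

/-- Vanishing cycles of the Fourier transform and components of nearby cycles: both sides are left
adjoint to the same functor, relative to the Fourier transform. -/
lemma nonempty_vanishing_iso {x : ClosedPoint k} (Fix : LocalFourierInfFin x) :
    Nonempty (h.Four ⋙ h.Phi x ≅ h.PsiInfty ⋙ h.lePart x ⋙ Fix.equiv.functor) :=
  ((vanishingAdj h x).whisker h.Four).nonempty_iso
    ((nearbyAdj h (some x)).transport (fourier k) fourier_bijective Fix.equiv Fix.iso)

lemma nonempty_lePart_iso {x : ClosedPoint k} (Fxi : LocalFourierFinInf x) :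
    Nonempty (h.Four ⋙ h.PsiInfty ⋙ h.lePart (negPoint x) ≅ h.Phi x ⋙ Fxi.equiv.functor) :=
  ((nearbyAdj h (some (negPoint x))).whisker h.Four).nonempty_iso
    ((vanishingAdj h x).transport (fourier k) fourier_bijective Fxi.equiv Fxi.iso)

lemma nonempty_gtPart_iso (Fii : LocalFourierInfInf k) :
    Nonempty (h.Four ⋙ h.PsiInfty ⋙ h.gtPart ≅ h.PsiInfty ⋙ h.gtPart ⋙ Fii.equiv.functor) :=
  ((nearbyAdj h none).whisker h.Four).nonempty_iso
    ((nearbyAdj h none).transport (fourier k) fourier_bijective Fii.equiv Fii.iso)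

/-- The decomposition into components, reindexed and with isomorphic summands. -/
lemma isDirectSum_piece_of_iso {N : DMod k⸨X⸩} (hN : HolK k N)
    (σ : Equiv.Perm (Option (ClosedPoint k))) {N' : Option (ClosedPoint k) → DMod k⸨X⸩}
    (e : ∀ o, N' o ≅ (DMod.part (piece k (σ o))).obj N) :
    DMod.IsDirectSum N' N fun o => (e o).hom ≫ DMod.partInc _ N := by
  have : Module.Finite k⸨X⸩ N.carrier := hN
  have hinv : ∀ o m, (e o).hom.toLin ((e o).inv.toLin m) = m := fun o m =>
    DFunLike.congr_fun (congrArg (fun f : (DMod.part (piece k (σ o))).obj N ⟶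
      (DMod.part (piece k (σ o))).obj N => f.toLin) (e o).inv_hom_id) m
  have hinv' : ∀ o m, (e o).inv.toLin ((e o).hom.toLin m) = m := fun o m =>
    DFunLike.congr_fun (congrArg (fun f : N' o ⟶ N' o => f.toLin) (e o).hom_inv_id) m
  have hr : ∀ o, range ((e o).hom ≫ DMod.partInc (piece k (σ o)) N).toLin
      = maxPiece (delZ N) (calc' N) (σ o) := fun o => by
    rw [← partSub_isOfType hN, ← piece_eq]
    refine le_antisymm ?_ fun m hm => ⟨(e o).inv.toLin ⟨m, hm⟩, congrArg Subtype.val (hinv o _)⟩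
    rintro _ ⟨m, rfl⟩
    exact ((e o).hom.toLin m).2
  refine isDirectSum_of_iSupIndep _
    (fun o => Subtype.val_injective.comp (Function.LeftInverse.injective (hinv' o))) ?_ ?_
  · simp only [hr]
    exact (iSupIndep_maxPiece (delZ_isDer N) (calc_isCalculus N)).comp σ.injective
  · simp only [hr]
    rw [σ.surjective.iSup_comp]
    exact iSup_maxPiece (delZ_isDer N) (calc_isCalculus N)

theorem exists_isDirectSum_phaseTerm (Fxi : ∀ x : ClosedPoint k, LocalFourierFinInf x)
    (Fii : LocalFourierInfInf k) :
    ∃ τ : ∀ o : Option (ClosedPoint k),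
        h.phaseTerm Fxi Fii o ⟶ h.Four ⋙ h.PsiInfty ⋙ (HolK k).ι,
      ∀ M : (HolA1 k).FullSubcategory,
        DMod.IsDirectSum (fun o => (h.phaseTerm Fxi Fii o).obj M)
          ((h.Four ⋙ h.PsiInfty).obj M).obj (fun o => (τ o).app M) := by
  let σ : Equiv.Perm (Option (ClosedPoint k)) :=
    Equiv.optionCongr (Function.Involutive.toPerm _ negPoint_negPoint)
  have e : ∀ o, Nonempty (h.phaseTerm Fxi Fii o ≅
      (h.Four ⋙ h.PsiInfty ⋙ (HolK k).ι) ⋙ DMod.part (piece k (σ o)))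
    | none => (nonempty_gtPart_iso h Fii).map fun i => by
        let j := Functor.isoWhiskerRight i.symm (SlopeGT k).ι
        exact j
    | some x => (nonempty_lePart_iso h (Fxi x)).map fun i => by
        let j := Functor.isoWhiskerRight i.symm (SlopeLE (negPoint x)).ι
        exact j
  exact ⟨fun o => (e o).some.hom ≫ { app := fun M => DMod.partInc _ _ }, fun M =>
    isDirectSum_piece_of_iso ((h.Four ⋙ h.PsiInfty).obj M).2 σ fun o => (e o).some.app M⟩

end Phase

end LocalFourier

end

theorem mainTheorem2 (k : Type u) [Field k] [CharZero k] :
    ∃ h : WellDefined k,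
      -- every holonomic module over `K_∞` is the direct sum of its components
      (∀ N : (HolK k).FullSubcategory,
        DMod.IsDirectSum (fun o => (DMod.part (piece k o)).obj N.obj) N.obj
          (fun o => DMod.partInc (piece k o) N.obj)) ∧
      -- the local Fourier transforms exist
      (∀ x : ClosedPoint k, Nonempty (LocalFourierFinInf x)) ∧
      (∀ x : ClosedPoint k, Nonempty (LocalFourierInfFin x)) ∧
      Nonempty (LocalFourierInfInf k) ∧
      -- and for any choice of them
      ∀ (Fxi : ∀ x : ClosedPoint k, LocalFourierFinInf x)
        (Fix : ∀ x : ClosedPoint k, LocalFourierInfFin x) (Fii : LocalFourierInfInf k),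
        (∀ x : ClosedPoint k,
          Nonempty (h.Four ⋙ h.Phi x ≅ h.PsiInfty ⋙ h.lePart x ⋙ (Fix x).equiv.functor)) ∧
        (∀ x : ClosedPoint k,
          Nonempty (h.Four ⋙ h.PsiInfty ⋙ h.lePart (negPoint x) ≅
            h.Phi x ⋙ (Fxi x).equiv.functor)) ∧
        Nonempty (h.Four ⋙ h.PsiInfty ⋙ h.gtPart ≅
          h.PsiInfty ⋙ h.gtPart ⋙ Fii.equiv.functor) ∧
        ∃ τ : ∀ o : Option (ClosedPoint k),
            h.phaseTerm Fxi Fii o ⟶ h.Four ⋙ h.PsiInfty ⋙ (HolK k).ι,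
          ∀ M : (HolA1 k).FullSubcategory,
            DMod.IsDirectSum (fun o => (h.phaseTerm Fxi Fii o).obj M)
              ((h.Four ⋙ h.PsiInfty).obj M).obj (fun o => (τ o).app M) := by
  exact ⟨wellDefined k, fun N => isDirectSum_piece N.2, nonempty_finInf, nonempty_infFin,
    nonempty_infInf k, fun Fxi Fix Fii => ⟨fun x => nonempty_vanishing_iso _ (Fix x),
      fun x => nonempty_lePart_iso _ (Fxi x), nonempty_gtPart_iso _ Fii,
      exists_isDirectSum_phaseTerm _ Fxi Fii⟩⟩
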